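/- Write $x=(x_1,x_2,x_3)\in\mathbb R^3$, $r=\sqrt{x_1^2+x_2^2}$, $r\,\partial_r=x_1\partial_1+x_2\partial_2$, $B_R=\{|x|<R\}$, $P(R)=B_R\times(-R^2,0]$. Let $\frac53<p\le 2$, $\beta>0$ and $K\in\mathbb R$. There are constants $c_0>0$ and $C>0$, depending only on $p,\beta,K$, such that the following holds. Let $b\in L^2(P(1);\mathbb R^3)$ be divergence-free (in the sense of distributions) and suppose that $$E_R(b):=\operatorname*{ess\,sup}_{-R^2\le t\le 0}\Big\{\frac1{R^{3-p}}\int_{B_R}|b(x,t)|^p\,dx\Big\}^{1/p}\le K\Big(\ln\big|\ln\tfrac R3\big|\Big)^{\frac{3p-5}{77p-120}(1-\beta)}\qquad\text{for all }R\in(0,1].$$ Let $\Gamma$ be a weak solution in $P(1)$ of $$\partial_t\Gamma+b\cdot\nabla\Gamma-\Delta\Gamma+\frac2r\,\partial_r\Gamma=0,\qquad \Gamma|_{r=0}=0,$$ that is: $\Gamma\in L^\infty_tL^2_x\cap L^2_tH^1_x(P(1))$; $$\iint_{P(1)}\Big(-\Gamma\,\partial_t\psi+(b\cdot\nabla\Gamma)\,\psi+\nabla\Gamma\cdot\nabla\psi+\frac2r\,\partial_r\Gamma\,\psi\Big)\,dx\,dt=0$$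 for all $\psi\in C_c^\infty\big((B_1\setminus\{r=0\})\times(-1,0)\big)$; and $\Gamma$ vanishes on the axis in the sense that $\rho^{-2}\iint_{P(R)\cap\{r<\rho\}}|\Gamma|\,dx\,dt\to0$ as $\rho\to0^+$, for every $R\in(0,1)$. Then $\Gamma$ is continuous at $(0,0)$ with value $0$ there (after modification on a null set), and it decays logarithmically at the origin: with $\varrho(x,t)=\max\{|x|,\sqrt{-t}\}$, $$|\Gamma(x,t)|\le C\,\|\Gamma\|_{L^2(P(1))}\,\Big|\ln\frac{\varrho(x,t)}3\Big|^{-c_0}\qquad\text{for a.e. }(x,t)\in P(\tfrac12),$$ and, if $|\Gamma|\le M$ a.e. in $P(1)$, $$|\Gamma(x,t)|\le C\,M\,\Big|\ln\frac{\varrho(x,t)}3\Big|^{-c_0}\qquad\text{for a.e. }(x,t)\in P(1).$$ -/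

import Mathlib

open MeasureTheory Set Filter Topology Metric
open scoped ENNReal NNReal ContDiff

namespace AxisDrift

/-- Points `x = (x₁, x₂, x₃)` of `ℝ³` with the Euclidean norm; the `x₃`-axis is the symmetry axis. -/
abbrev E : Type := EuclideanSpace ℝ (Fin 3)

/-- Space-time points `(x, t)`. -/
abbrev ST : Type := E × ℝ

/-- Distance `r` of `x` to the symmetry axis. -/
noncomputable def axisDist (x : E) : ℝ := Real.sqrt (x 0 ^ 2 + x 1 ^ 2)

/-- The parabolic cylinder `P(R) = B_R × (-R², 0]`. -/
def cyl (R : ℝ) : Set ST := ball (0 : E) R ×ˢ Ioc (-R ^ 2) 0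

/-- Lebesgue measure on `P(R)`. -/
noncomputable def cylVol (R : ℝ) : Measure ST := volume.restrict (cyl R)

/-- The interior `B₁ × (-1, 0)` of `P(1)`. -/
def openCyl : Set ST := ball (0 : E) 1 ×ˢ Ioo (-1 : ℝ) 0

/-- The interior of `P(1)` with the symmetry axis removed. -/
def openCylOffAxis : Set ST := {z | z ∈ openCyl ∧ 0 < axisDist z.1}

/-- Smooth functions with compact support in `U`. -/
structure IsTest (U : Set ST) (ψ : ST → ℝ) : Prop where
  smooth : ContDiff ℝ ∞ ψ
  compact : HasCompactSupport ψ
  supp : tsupport ψ ⊆ U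

/-- Classical spatial partial derivative `∂ψ/∂xᵢ`. -/
noncomputable def dx (i : Fin 3) (ψ : ST → ℝ) (z : ST) : ℝ :=
  fderiv ℝ ψ z (EuclideanSpace.single i 1, 0)

/-- Classical time derivative `∂ψ/∂t`. -/
noncomputable def dt (ψ : ST → ℝ) (z : ST) : ℝ :=
  fderiv ℝ ψ z (0, 1)

/-- `G` is the weak spatial gradient of `Γ` in `P(1)`. -/
def IsWeakGrad (Γ : ST → ℝ) (G : ST → E) : Prop :=
  ∀ ψ : ST → ℝ, IsTest openCyl ψ → ∀ i : Fin 3,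
    ∫ z in cyl 1, Γ z * dx i ψ z = -∫ z in cyl 1, G z i * ψ z

/-- `b` is a divergence-free drift of finite energy in `P(1)`:
`b ∈ L²(P(1); ℝ³)` and `div b = 0` in the sense of distributions. -/
structure IsDivFreeDrift (b : ST → E) : Prop where
  memLp : MemLp b 2 (cylVol 1)
  div_free : ∀ ψ : ST → ℝ, IsTest openCyl ψ →
    ∫ z in cyl 1, ∑ i : Fin 3, b z i * dx i ψ z = 0

/-- `Γ` vanishes on the axis `r = 0` in the sense of averages over thin tubes:
`ρ⁻² ∫_{P(R) ∩ {r < ρ}} |Γ| dx dt → 0` as `ρ → 0⁺`, for every `R < 1`. It holds if `Γ` is continuous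
and zero on the axis, and also if `Γ = r v_θ` with `v_θ / r` integrable on `P(1)`. -/
def VanishesOnAxis (Γ : ST → ℝ) : Prop :=
  ∀ R : ℝ, 0 < R → R < 1 →
    Tendsto (fun ρ : ℝ => (ρ ^ 2)⁻¹ * ∫ z in cyl R ∩ {z | axisDist z.1 < ρ}, |Γ z|)
      (𝓝[>] 0) (𝓝 0)

/-- `Γ` is a weak solution in `P(1)` of `∂ₜΓ + b · ∇Γ - ΔΓ + (2 / r) ∂ᵣΓ = 0` with `Γ = 0` on the
axis: `Γ` lies in `L^∞_t L²_x ∩ L²_t H¹_x`, vanishes on the axis, and satisfies the equation against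
all test functions supported off the axis (where the coefficient `2 / r` is smooth).
Here `(2 / r) ∂ᵣΓ = (2 / r²) (x₁ ∂₁Γ + x₂ ∂₂Γ)`. -/
def IsWeakSolution (b : ST → E) (Γ : ST → ℝ) : Prop :=
  MemLp Γ 2 (cylVol 1) ∧
  (∃ A : ℝ≥0, ∀ᵐ t ∂(volume.restrict (Ioc (-1 : ℝ) 0)),
    ∫⁻ x in ball (0 : E) 1, ‖Γ (x, t)‖ₑ ^ 2 ≤ A) ∧
  VanishesOnAxis Γ ∧
  ∃ G : ST → E, MemLp G 2 (cylVol 1) ∧ IsWeakGrad Γ G ∧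
    ∀ ψ : ST → ℝ, IsTest openCylOffAxis ψ →
      ∫ z in cyl 1,
        (-(Γ z * dt ψ z)
          + (∑ i : Fin 3, b z i * G z i) * ψ z
          + ∑ i : Fin 3, G z i * dx i ψ z
          + 2 / axisDist z.1 ^ 2 * (z.1 0 * G z 0 + z.1 1 * G z 1) * ψ z) = 0

/-- The scaled norm `E_R(b) = sup_{-R² ≤ t ≤ 0} (R^{-(3-p)} ∫_{B_R} |b(x,t)|^p dx)^{1/p}`, with values
in `[0, ∞]`; the supremum in time is the essential one, `b` being given almost everywhere. -/
noncomputable def scaledNorm (p : ℝ) (b : ST → E) (R : ℝ) : ℝ≥0∞ :=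
  essSup (fun t : ℝ =>
      (ENNReal.ofReal (1 / R ^ (3 - p)) * ∫⁻ x in ball (0 : E) R, ‖b (x, t)‖ₑ ^ p) ^ (1 / p))
    (volume.restrict (Icc (-R ^ 2) 0))

/-- Parabolic distance of `(x, t)`, `t ≤ 0`, to the origin: `(x, t) ∈ P(R)` iff it is `< R`, up to
the null set `t = -R²`. -/
noncomputable def parDist (z : ST) : ℝ := max ‖z.1‖ (Real.sqrt (-z.2))

end AxisDrift

/-!
A bound of the drift in `L^{5/3}(B_R)`, scale invariant up to a factor `e`, gives a decrease of the
maximum of `|Γ|` from `P(R)` to a smaller cylinder by a factor `1 - exp (-c e²⁹)`. By Hölder's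
inequality the hypothesis on `E_R(b)` allows `e ≤ A (1 + log (log (3 / R))) ^ (1 / 34)`
(`driftScale_of_scaledNorm_le`, `growth_le_sizeAt`), and `29 / 34 < 1` makes the decrease over all
scales add up.

*Energy identities.* The equation for `h(Γ)` follows by mollification. Off the axis the field
`(2 / r) e_r` is divergence-free, so that against a radial weight `σ(|x|²)` the term `(2 / r) ∂ᵣ`
becomes `-4 σ' h(Γ)`; a cutoff around the axis contributes nothing in the limit, because `Γ`
vanishes there (`Sol.renormalized`). The identity holds on almost every time slice, also if `h''` is
only a bounded limit of continuous functions (`Sol.energy_identity_lim`).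

*De Giorgi lemma.* For `h(s) = (|s| - k)₊²` the drift term is `∫ u² |b| |∇ψ|`, which Hölder's,
Sobolev's and Young's inequalities absorb into the diffusion (`Sol.caccioppoli`). The iteration
over levels shows that `(|Γ| - k)₊` small in `L²(P(R))`, relative to `κ² R⁵ e⁻²⁵`, gives
`|Γ| ≤ k + κ` in `P(R / 2)` (`Sol.deGiorgi`).

*Decrease of the maximum.* Suppose `|Γ| ≤ 1` in `P(R)`. The function
`F(s) = -log (1 - (1 - ε) s²)` satisfies `F'' ≥ (F')²`, so the diffusion dominates `|∇F(Γ)|²` and,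
by a weighted Poincaré inequality (`SliceH1.poincare`), the oscillation of `F(Γ)`; its mean does not
see the drift, because `div b = 0`. For a decreasing weight the term `-4 σ' F(Γ)` acts as a damping
of rate `ρ⁻²`. It makes the mean of `F(Γ)` at the scale `ρ ~ R / e` forget the initial value
`log (1 / ε)` (`Sol.logMass_le`). With `log (1 / ε)` a multiple of `e ^ 29`, the set
where `|Γ|` is close to `1` is small enough for the De Giorgi lemma, and `|Γ| ≤ 1 - √ε / 8` in a
cylinder of radius comparable to `R / e` (`Sol.decrease_of_le_one`).

*Iteration.* Let `L = log (3 / r)`. Between the scales `1` and `r` there are about `L / log e`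
steps, at least a multiple of `L ^ (3 / 4)`, and each of them gains at least a multiple of
`L ^ (-1 / 4)` because `e ^ 29` is at most a multiple of `(1 + log L) ^ (29 / 34)`. The product of
the gains is thus at most a negative power of `L` (`exists_decay_at_scale`).
-/

namespace AxisDrift

open ENNReal (ofReal)

/-! ### Convergence in `L²` -/

section L2
variable {α : Type*} [MeasurableSpace α] {μ : Measure α}

/-- Convergence of a sequence of real functions in `L²(μ)`. -/
def TendstoL2 (μ : Measure α) (f : ℕ → α → ℝ) (g : α → ℝ) : Prop :=
  Tendsto (fun n => eLpNorm (f n - g) 2 μ) atTop (𝓝 0)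

lemma eLpNorm_two_sq (f : α → ℝ) : eLpNorm f 2 μ ^ 2 = ∫⁻ x, ‖f x‖ₑ ^ 2 ∂μ := by
  rw [eLpNorm_eq_lintegral_rpow_enorm_toReal (by norm_num) (by norm_num)]
  rw [← ENNReal.rpow_natCast, ← ENNReal.rpow_mul]
  simp

lemma TendstoL2.add {f f' : ℕ → α → ℝ} {g g' : α → ℝ} (hf : TendstoL2 μ f g)
    (hf' : TendstoL2 μ f' g') (mf : ∀ n, MemLp (f n) 2 μ) (mg : MemLp g 2 μ)
    (mf' : ∀ n, MemLp (f' n) 2 μ) (mg' : MemLp g' 2 μ) :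
    TendstoL2 μ (fun n => f n + f' n) (g + g') := by
  have h := Filter.Tendsto.add hf hf'
  simp only [add_zero] at h
  refine tendsto_of_tendsto_of_tendsto_of_le_of_le tendsto_const_nhds h (fun _ => zero_le) ?_
  intro n
  have : f n + f' n - (g + g') = (f n - g) + (f' n - g') := by ring
  simp only [this]
  exact eLpNorm_add_le ((mf n).sub mg).1 ((mf' n).sub mg').1 (by norm_num)

lemma enorm_integral_mul_le (f g : α → ℝ) (mf : MemLp f 2 μ) (mg : MemLp g 2 μ) :
    ‖∫ x, f x * g x ∂μ‖ₑ ≤ eLpNorm f 2 μ * eLpNorm g 2 μ := by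
  refine (enorm_integral_le_lintegral_enorm _).trans ?_
  have := eLpNorm_smul_le_mul_eLpNorm (p := 2) (q := 2) (r := 1) mg.1 mf.1
  rw [eLpNorm_one_eq_lintegral_enorm] at this
  simpa using this

lemma TendstoL2.integral_mul {f f' : ℕ → α → ℝ} {g g' : α → ℝ} (hf : TendstoL2 μ f g)
    (hf' : TendstoL2 μ f' g') (mf : ∀ n, MemLp (f n) 2 μ) (mg : MemLp g 2 μ)
    (mf' : ∀ n, MemLp (f' n) 2 μ) (mg' : MemLp g' 2 μ) :
    Tendsto (fun n => ∫ x, f n x * f' n x ∂μ) atTop (𝓝 (∫ x, g x * g' x ∂μ)) := by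
  rw [tendsto_iff_edist_tendsto_0]
  have key : ∀ n, edist (∫ x, f n x * f' n x ∂μ) (∫ x, g x * g' x ∂μ) ≤
      eLpNorm (f n - g) 2 μ * (eLpNorm (f' n - g') 2 μ + eLpNorm g' 2 μ)
      + eLpNorm g 2 μ * eLpNorm (f' n - g') 2 μ := by
    intro n
    have i1 : Integrable (fun x => f n x * f' n x) μ := (mf n).integrable_mul (mf' n)
    have i2 : Integrable (fun x => g x * g' x) μ := mg.integrable_mul mg'
    have i3 : Integrable (fun x => (f n - g) x * f' n x) μ := ((mf n).sub mg).integrable_mul (mf' n)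
    have i4 : Integrable (fun x => g x * (f' n - g') x) μ := mg.integrable_mul ((mf' n).sub mg')
    rw [edist_eq_enorm_sub, ← integral_sub i1 i2]
    have e : (fun x => f n x * f' n x - g x * g' x)
        = fun x => (f n - g) x * f' n x + g x * (f' n - g') x := by
      ext x; simp; ring
    rw [e, integral_add i3 i4]
    refine (enorm_add_le _ _).trans (add_le_add ?_ (enorm_integral_mul_le _ _ mg ((mf' n).sub mg')))
    refine (enorm_integral_mul_le _ _ ((mf n).sub mg) (mf' n)).trans ?_
    gcongr
    have : f' n = (f' n - g') + g' := by ring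
    conv_lhs => rw [this]
    exact eLpNorm_add_le ((mf' n).sub mg').1 mg'.1 (by norm_num)
  have hlim : Tendsto (fun n => eLpNorm (f n - g) 2 μ * (eLpNorm (f' n - g') 2 μ + eLpNorm g' 2 μ)
      + eLpNorm g 2 μ * eLpNorm (f' n - g') 2 μ) atTop (𝓝 (0 * (0 + eLpNorm g' 2 μ)
        + eLpNorm g 2 μ * 0)) := by
    refine Tendsto.add (ENNReal.Tendsto.mul hf (Or.inr ?_) (Filter.Tendsto.add hf' tendsto_const_nhds)
      (Or.inr (by simp))) (ENNReal.Tendsto.const_mul hf' (Or.inr mg.2.ne))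
    simpa using mg'.2.ne
  simp only [zero_mul, mul_zero, add_zero] at hlim
  exact tendsto_of_tendsto_of_tendsto_of_le_of_le tendsto_const_nhds hlim (fun _ => zero_le) key

lemma TendstoL2.const {g : α → ℝ} : TendstoL2 μ (fun _ => g) g := by
  simp [TendstoL2]

/-- Multiplication by a bounded sequence that converges almost everywhere preserves convergence
in `L²`. -/
lemma TendstoL2.bdd_mul {a : ℕ → α → ℝ} {a' : α → ℝ} {f : ℕ → α → ℝ} {g : α → ℝ} {C : ℝ}
    (hf : TendstoL2 μ f g) (mf : ∀ n, MemLp (f n) 2 μ) (mg : MemLp g 2 μ)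
    (ma : ∀ n, AEStronglyMeasurable (a n) μ) (ma' : AEStronglyMeasurable a' μ)
    (hb : ∀ n x, |a n x| ≤ C) (hb' : ∀ x, |a' x| ≤ C)
    (ha : ∀ᵐ x ∂μ, Tendsto (fun n => a n x) atTop (𝓝 (a' x))) :
    TendstoL2 μ (fun n => a n * f n) (a' * g) := by
  -- `a n * f n - a' * g = a n * (f n - g) + (a n - a') * g`
  have h1 : Tendsto (fun n => ofReal C * eLpNorm (f n - g) 2 μ) atTop (𝓝 0) := by
    simpa using ENNReal.Tendsto.const_mul hf (Or.inr (ENNReal.ofReal_ne_top (r := C)))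
  have h2 : Tendsto (fun n => eLpNorm ((a n - a') * g) 2 μ) atTop (𝓝 0) := by
    have hsq : Tendsto (fun n => ∫⁻ x, ‖((a n - a') * g) x‖ₑ ^ 2 ∂μ) atTop
        (𝓝 (∫⁻ x, (0 : ℝ≥0∞) ∂μ)) := by
      refine tendsto_lintegral_of_dominated_convergence'
        (fun x => (ofReal (2 * C)) ^ 2 * ‖g x‖ₑ ^ 2) ?_ ?_ ?_ ?_
      · intro n
        exact ((((ma n).sub ma').mul mg.1).enorm.pow_const 2)
      · intro n
        refine ae_of_all _ fun x => ?_
        beta_reduce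
        rw [← mul_pow]
        gcongr
        simp only [Pi.mul_apply, enorm_mul, Pi.sub_apply]
        gcongr
        rw [Real.enorm_eq_ofReal_abs]
        apply ENNReal.ofReal_le_ofReal
        have := abs_sub (a n x) (a' x)
        linarith [hb n x, hb' x]
      · rw [lintegral_const_mul'']
        · rw [← eLpNorm_two_sq]
          exact ENNReal.mul_ne_top (ENNReal.pow_ne_top ENNReal.ofReal_ne_top)
            (ENNReal.pow_ne_top mg.2.ne)
        · exact mg.1.enorm.pow_const 2
      · filter_upwards [ha] with x hx
        have h0 : Tendsto (fun n => (a n x - a' x) * g x) atTop (𝓝 ((a' x - a' x) * g x)) :=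
          (hx.sub_const _).mul_const _
        have := ENNReal.Tendsto.pow (n := 2) h0.enorm
        simpa using this
    simp only [lintegral_zero, ← eLpNorm_two_sq] at hsq
    have := hsq.ennrpow_const (1 / 2)
    simp only [← ENNReal.rpow_natCast, ← ENNReal.rpow_mul] at this
    simpa using this
  have h3 := h1.add h2
  simp only [add_zero] at h3
  refine tendsto_of_tendsto_of_tendsto_of_le_of_le tendsto_const_nhds h3 (fun _ => zero_le) ?_
  intro n
  have e : a n * f n - a' * g = a n * (f n - g) + (a n - a') * g := by ring
  simp only [e]
  refine (eLpNorm_add_le ((ma n).mul ((mf n).sub mg).1)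
    (((ma n).sub ma').mul mg.1) (by norm_num)).trans (add_le_add ?_ le_rfl)
  refine eLpNorm_le_mul_eLpNorm_of_ae_le_mul (ae_of_all _ fun x => ?_) 2
  simp only [Pi.mul_apply, norm_mul]
  gcongr
  exact hb n x

lemma memLp_bdd_mul {a f : α → ℝ} {C : ℝ} (ma : AEStronglyMeasurable a μ) (hb : ∀ x, |a x| ≤ C)
    (mf : MemLp f 2 μ) : MemLp (a * f) 2 μ := by
  refine MemLp.of_le_mul (c := C) mf (ma.mul mf.1) (ae_of_all _ fun x => ?_)
  simp only [Pi.mul_apply, norm_mul]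
  gcongr
  exact hb x

lemma TendstoL2.comp_lipschitz {f : ℕ → α → ℝ} {g : α → ℝ} (hf : TendstoL2 μ f g) {h : ℝ → ℝ}
    {C : ℝ} (hh : ∀ s t, |h s - h t| ≤ C * |s - t|) :
    TendstoL2 μ (fun n x => h (f n x)) (fun x => h (g x)) := by
  have h1 : Tendsto (fun n => ofReal C * eLpNorm (f n - g) 2 μ) atTop (𝓝 0) := by
    simpa using ENNReal.Tendsto.const_mul hf (Or.inr (ENNReal.ofReal_ne_top (r := C)))
  refine tendsto_of_tendsto_of_tendsto_of_le_of_le tendsto_const_nhds h1 (fun _ => zero_le) ?_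
  intro n
  exact eLpNorm_le_mul_eLpNorm_of_ae_le_mul (ae_of_all _ fun x => hh _ _) 2

/-- A sequence converging in `L²` has a subsequence converging almost everywhere. -/
lemma TendstoL2.exists_subseq_ae {f : ℕ → α → ℝ} {g : α → ℝ} (hf : TendstoL2 μ f g)
    (mf : ∀ n, MemLp (f n) 2 μ) (mg : MemLp g 2 μ) :
    ∃ ns : ℕ → ℕ, StrictMono ns ∧ ∀ᵐ x ∂μ, Tendsto (fun n => f (ns n) x) atTop (𝓝 (g x)) :=
  (tendstoInMeasure_of_tendsto_eLpNorm (p := 2) (by norm_num) (fun n => (mf n).1) mg.1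
    hf).exists_seq_tendsto_ae

lemma TendstoL2.subseq {f : ℕ → α → ℝ} {g : α → ℝ} (hf : TendstoL2 μ f g)
    {ns : ℕ → ℕ} (hns : StrictMono ns) : TendstoL2 μ (fun n => f (ns n)) g :=
  Filter.Tendsto.comp (g := fun n => eLpNorm (f n - g) 2 μ) hf hns.tendsto_atTop

lemma lintegral_mul_sq_le {f g : α → ℝ≥0∞} (hf : AEMeasurable f μ) (hg : AEMeasurable g μ) :
    (∫⁻ x, f x * g x ∂μ) ^ 2 ≤ (∫⁻ x, f x ^ 2 ∂μ) * ∫⁻ x, g x ^ 2 ∂μ := by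
  have h := ENNReal.lintegral_mul_le_Lp_mul_Lq μ
    (Real.HolderConjugate.two_two) hf hg
  have h2 : (∫⁻ x, f x * g x ∂μ) ^ 2 ≤ ((∫⁻ a, f a ^ (2:ℝ) ∂μ) ^ (1 / (2:ℝ))
      * (∫⁻ a, g a ^ (2:ℝ) ∂μ) ^ (1 / (2:ℝ))) ^ 2 := pow_le_pow_left' h 2
  refine h2.trans (le_of_eq ?_)
  rw [mul_pow, ← ENNReal.rpow_natCast, ← ENNReal.rpow_natCast, ← ENNReal.rpow_mul,
    ← ENNReal.rpow_mul]
  simp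

end L2

/-! ### Mollification in space-time -/

instance : (volume : Measure ST).IsAddHaarMeasure :=
  inferInstanceAs ((volume : Measure E).prod (volume : Measure ℝ)).IsAddHaarMeasure

/-- A smooth even bump function on space-time supported in the ball of radius `1 / (n + 1)`. -/
noncomputable def bump (n : ℕ) : ContDiffBump (0 : ST) where
  rIn := 1 / (2 * (n + 1))
  rOut := 1 / (n + 1)
  rIn_pos := by positivity
  rIn_lt_rOut := by
    apply one_div_lt_one_div_of_lt
    · positivity
    · have : (0 : ℝ) < n + 1 := by positivity
      linarith

/-- The mollification kernel. -/
noncomputable def ker (n : ℕ) : ST → ℝ := (bump n).normed volume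

/-- Mollification of a function on space-time. -/
noncomputable def moll (n : ℕ) (v : ST → ℝ) : ST → ℝ :=
  MeasureTheory.convolution (ker n) v (ContinuousLinearMap.lsmul ℝ ℝ) volume

lemma ker_contDiff (n : ℕ) : ContDiff ℝ ∞ (ker n) := (bump n).contDiff_normed

lemma ker_continuous (n : ℕ) : Continuous (ker n) := (ker_contDiff n).continuous

lemma ker_compact (n : ℕ) : HasCompactSupport (ker n) := (bump n).hasCompactSupport_normed

lemma ker_nonneg (n : ℕ) (z : ST) : 0 ≤ ker n z := (bump n).nonneg_normed z

lemma ker_integral (n : ℕ) : ∫ z, ker n z = 1 := (bump n).integral_normed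

lemma ker_integrable (n : ℕ) : Integrable (ker n) :=
  (ker_continuous n).integrable_of_hasCompactSupport (ker_compact n)

lemma ker_lintegral (n : ℕ) : ∫⁻ z, ofReal (ker n z) = 1 := by
  rw [← ofReal_integral_eq_lintegral_ofReal (ker_integrable n)
    (ae_of_all _ (ker_nonneg n)), ker_integral]
  simp

lemma ker_eq_zero (n : ℕ) {z : ST} (hz : 1 / ((n : ℝ) + 1) ≤ ‖z‖) : ker n z = 0 := by
  have : z ∉ Function.support (ker n) := by
    rw [ker, (bump n).support_normed_eq]
    simp only [mem_ball, dist_zero_right, not_lt]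
    exact hz
  simpa using this

lemma ker_sub_comm (n : ℕ) (z w : ST) : ker n (z - w) = ker n (w - z) := by
  have := (bump n).normed_neg (μ := volume) (z - w)
  rw [neg_sub] at this
  exact this.symm

lemma moll_apply (n : ℕ) (v : ST → ℝ) (z : ST) : moll n v z = ∫ w, ker n w * v (z - w) := rfl

lemma moll_apply' (n : ℕ) (v : ST → ℝ) (z : ST) : moll n v z = ∫ w, ker n (z - w) * v w := by
  rw [moll, convolution_eq_swap]
  rfl

lemma moll_integrand_integrable (n : ℕ) {v : ST → ℝ} (hv : LocallyIntegrable v volume) (z : ST) :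
    Integrable (fun w => ker n w * v (z - w)) :=
  (ker_compact n).convolutionExists_left (ContinuousLinearMap.lsmul ℝ ℝ) (ker_continuous n) hv z

lemma moll_contDiff (n : ℕ) {v : ST → ℝ} (hv : LocallyIntegrable v volume) :
    ContDiff ℝ ∞ (moll n v) :=
  (ker_compact n).contDiff_convolution_left _ (ker_contDiff n) hv

lemma moll_compact (n : ℕ) {v : ST → ℝ} (hv : HasCompactSupport v) :
    HasCompactSupport (moll n v) :=
  HasCompactSupport.convolution _ (ker_compact n) hv

lemma moll_abs_le (n : ℕ) {v : ST → ℝ} {C : ℝ} (hC : ∀ z, |v z| ≤ C) (z : ST) :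
    |moll n v z| ≤ C := by
  rw [moll_apply, ← Real.norm_eq_abs]
  have h : ∀ w, ‖ker n w * v (z - w)‖ ≤ ker n w * C := by
    intro w
    rw [norm_mul, Real.norm_of_nonneg (ker_nonneg n w)]
    exact mul_le_mul_of_nonneg_left (hC _) (ker_nonneg n w)
  refine (norm_integral_le_of_norm_le ((ker_integrable n).mul_const C)
    (ae_of_all _ h)).trans ?_
  rw [integral_mul_const, ker_integral, one_mul]

lemma moll_sub (n : ℕ) {u v : ST → ℝ} (hu : LocallyIntegrable u volume)
    (hv : LocallyIntegrable v volume) : moll n (u - v) = moll n u - moll n v := by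
  ext z
  simp only [moll_apply, Pi.sub_apply, mul_sub]
  exact integral_sub (moll_integrand_integrable n hu z) (moll_integrand_integrable n hv z)

/-- The mollification only depends on values within distance `1 / (n + 1)`. -/
lemma moll_eq_zero (n : ℕ) {v : ST → ℝ} {z : ST}
    (hz : ∀ w, ‖z - w‖ < 1 / ((n : ℝ) + 1) → v w = 0) : moll n v z = 0 := by
  rw [moll_apply']
  refine integral_eq_zero_of_ae (ae_of_all _ fun w => ?_)
  by_cases h : ‖z - w‖ < 1 / ((n : ℝ) + 1)
  · simp [hz w h]
  · simp [ker_eq_zero n (not_lt.1 h)]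

lemma locInt_of_L2 {v : ST → ℝ} (hv : MemLp v 2 volume) : LocallyIntegrable v volume :=
  hv.locallyIntegrable (by norm_num)

/-- Mollification is a contraction of `L²`. -/
lemma moll_eLpNorm_le (n : ℕ) {v : ST → ℝ} (hv : MemLp v 2 volume) :
    eLpNorm (moll n v) 2 volume ≤ eLpNorm v 2 volume := by
  wlog hm : Measurable v generalizing v
  · obtain ⟨v', hv', hvv⟩ := hv.1.aemeasurable
    have e : moll n v = moll n v' := by
      ext z
      rw [moll_apply', moll_apply']
      refine integral_congr_ae ?_
      filter_upwards [hvv] with w hw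
      rw [hw]
    rw [e, eLpNorm_congr_ae hvv]
    exact this ((memLp_congr_ae hvv).1 hv) hv'
  have hk : Measurable (fun z => ofReal (ker n z)) :=
    (ker_continuous n).measurable.ennreal_ofReal
  have hm' : ∀ z, Measurable (fun w => v (z - w)) := fun z =>
    hm.comp (measurable_const.sub measurable_id)
  have h2 : eLpNorm (moll n v) 2 volume ^ 2 ≤ eLpNorm v 2 volume ^ 2 := by
    rw [eLpNorm_two_sq, eLpNorm_two_sq]
    have key : ∀ z, ‖moll n v z‖ₑ ^ 2 ≤ ∫⁻ w, ofReal (ker n w) * ‖v (z - w)‖ₑ ^ 2 := by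
      intro z
      have hz : ‖moll n v z‖ₑ ≤ ∫⁻ w, 1 * ‖v (z - w)‖ₑ
          ∂(volume.withDensity fun w => ofReal (ker n w)) := by
        rw [moll_apply]
        refine (enorm_integral_le_lintegral_enorm _).trans (le_of_eq ?_)
        rw [lintegral_withDensity_eq_lintegral_mul _ hk
          (hm' z |>.enorm.const_mul 1)]
        refine lintegral_congr fun w => ?_
        simp only [enorm_mul, Pi.mul_apply, one_mul]
        rw [Real.enorm_of_nonneg (ker_nonneg n w)]
      refine (pow_le_pow_left' hz 2).trans ?_
      refine (lintegral_mul_sq_le aemeasurable_const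
        (hm' z).enorm.aemeasurable).trans ?_
      simp only [one_pow, lintegral_const, one_mul]
      rw [withDensity_apply _ MeasurableSet.univ]
      simp only [Measure.restrict_univ]
      rw [ker_lintegral, one_mul, lintegral_withDensity_eq_lintegral_mul _ hk
        ((hm' z).enorm.pow_const 2)]
      rfl
    refine (lintegral_mono key).trans ?_
    rw [lintegral_lintegral_swap]
    · have : ∀ w : ST, ∫⁻ z, ofReal (ker n w) * ‖v (z - w)‖ₑ ^ 2
          = ofReal (ker n w) * ∫⁻ z, ‖v z‖ₑ ^ 2 := by
        intro w
        rw [lintegral_const_mul' _ _ ENNReal.ofReal_ne_top]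
        congr 1
        exact lintegral_sub_right_eq_self (fun z => ‖v z‖ₑ ^ 2) w
      simp only [this]
      rw [lintegral_mul_const _ hk, ker_lintegral, one_mul]
    · refine Measurable.aemeasurable ?_
      refine Measurable.mul (hk.comp measurable_snd) ?_
      exact (hm.comp (measurable_fst.sub measurable_snd)).enorm.pow_const 2
  exact (ENNReal.pow_le_pow_left_iff (by norm_num)).1 h2

lemma moll_memLp (n : ℕ) {v : ST → ℝ} (hv : MemLp v 2 volume) : MemLp (moll n v) 2 volume :=
  ⟨(moll_contDiff n (locInt_of_L2 hv)).continuous.aestronglyMeasurable,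
    (moll_eLpNorm_le n hv).trans_lt hv.2⟩

/-- Mollifications converge in `L²`. -/
lemma moll_tendsto {v : ST → ℝ} (hv : MemLp v 2 volume) :
    TendstoL2 volume (fun n => moll n v) v := by
  rw [TendstoL2, ENNReal.tendsto_atTop_zero]
  intro ε hε
  wlog hε1 : ε ≠ ⊤ generalizing ε
  · obtain ⟨N, hN⟩ := this 1 one_pos ENNReal.one_ne_top
    exact ⟨N, fun n hn => (hN n hn).trans (by simp at hε1; simp [hε1])⟩
  obtain ⟨g, gc, hg, gcont, gm⟩ := hv.exists_hasCompactSupport_eLpNorm_sub_le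
    (by norm_num) (ε := ε / 3) (by simpa using hε.ne')
  -- the continuous function is approximated uniformly, on a fixed compact set
  set K := cthickening 1 (tsupport g) with hK
  have Kc : IsCompact K := gc.isCompact.cthickening
  have hKfin : volume K ≠ ⊤ := Kc.measure_lt_top.ne
  obtain ⟨δ, δpos, hδ⟩ : ∃ δ : ℝ, 0 < δ ∧
      volume K ^ (1 / (2 : ℝ)) * ofReal δ ≤ ε / 3 := by
    have ht : Tendsto (fun δ : ℝ => volume K ^ (1 / (2 : ℝ)) * ofReal δ) (𝓝[>] 0)
        (𝓝 (volume K ^ (1 / (2 : ℝ)) * ofReal 0)) := by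
      refine ENNReal.Tendsto.const_mul ?_
        (Or.inr (ENNReal.rpow_ne_top_of_nonneg (by norm_num) hKfin))
      exact (ENNReal.continuous_ofReal.tendsto 0).mono_left nhdsWithin_le_nhds
    simp only [ENNReal.ofReal_zero, mul_zero] at ht
    have h3 : 0 < ε / 3 := ENNReal.div_pos hε.ne' (by norm_num)
    obtain ⟨δ, h1, h2⟩ := ((ht.eventually (gt_mem_nhds h3)).and self_mem_nhdsWithin).exists
    exact ⟨δ, h2, h1.le⟩
  obtain ⟨r, rpos, hr⟩ := Metric.uniformContinuous_iff.1
    (gc.uniformContinuous_of_continuous gcont) δ δpos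
  obtain ⟨N, hN⟩ := exists_nat_one_div_lt rpos
  refine ⟨N, fun n hn => ?_⟩
  have hnr : 1 / ((n : ℝ) + 1) < r := by
    refine lt_of_le_of_lt ?_ hN
    apply one_div_le_one_div_of_le (by positivity)
    have : (N : ℝ) ≤ n := by exact_mod_cast hn
    linarith
  have e : moll n v - v = moll n (v - g) + ((moll n g - g) + (g - v)) := by
    rw [moll_sub n (locInt_of_L2 hv) (locInt_of_L2 gm)]
    ring
  have h1 : eLpNorm (moll n (v - g)) 2 volume ≤ ε / 3 :=
    (moll_eLpNorm_le n (hv.sub gm)).trans hg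
  have h3 : eLpNorm (g - v) 2 volume ≤ ε / 3 := by rwa [eLpNorm_sub_comm]
  have h2 : eLpNorm (moll n g - g) 2 volume ≤ ε / 3 := by
    have hpt : ∀ z, ‖(moll n g - g) z‖ ≤ ‖K.indicator (fun _ => δ) z‖ := by
      intro z
      by_cases hz : z ∈ K
      · rw [indicator_of_mem hz, Real.norm_of_nonneg δpos.le]
        have := (bump n).dist_normed_convolution_le (μ := volume) (x₀ := z) (g := g) (ε := δ)
          gcont.aestronglyMeasurable (fun x hx => (hr (lt_trans hx hnr)).le)
        rw [dist_eq_norm] at this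
        exact this
      · rw [indicator_of_notMem hz, norm_zero]
        have hzs : ∀ w, ‖z - w‖ < 1 / ((n : ℝ) + 1) → g w = 0 := by
          intro w hw
          by_contra hgw
          apply hz
          have hw1 : w ∈ tsupport g := subset_tsupport g hgw
          refine mem_cthickening_of_dist_le z w 1 _ hw1 ?_
          rw [dist_eq_norm]
          refine hw.le.trans ?_
          rw [div_le_one (by positivity)]
          have : (0 : ℝ) ≤ n := by positivity
          linarith
        have hgz : g z = 0 := hzs z (by simp; positivity)
        simp [moll_eq_zero n hzs, hgz]
    refine (eLpNorm_mono hpt).trans ?_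
    rw [eLpNorm_indicator_const Kc.measurableSet (by norm_num) (by norm_num), mul_comm,
      Real.enorm_of_nonneg δpos.le]
    simpa using hδ
  rw [e]
  refine (eLpNorm_add_le (moll_memLp n (hv.sub gm)).1
    (((moll_memLp n gm).sub gm).add (gm.sub hv)).1 (by norm_num)).trans ?_
  calc _ ≤ ε / 3 + (ε / 3 + ε / 3) := by
        refine add_le_add h1 ((eLpNorm_add_le ((moll_memLp n gm).sub gm).1
          (gm.sub hv).1 (by norm_num)).trans (add_le_add h2 h3))
    _ = ε := by rw [← add_assoc, ENNReal.add_thirds]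

lemma TendstoL2.moll {f : ℕ → ST → ℝ} {g : ST → ℝ} (hf : TendstoL2 volume f g)
    (mf : ∀ n, MemLp (f n) 2 volume) (mg : MemLp g 2 volume) {ns : ℕ → ℕ} (hns : StrictMono ns) :
    TendstoL2 volume (fun n => AxisDrift.moll (ns n) (f n)) g := by
  have h := Filter.Tendsto.add hf ((moll_tendsto mg).subseq hns)
  simp only [add_zero] at h
  refine tendsto_of_tendsto_of_tendsto_of_le_of_le tendsto_const_nhds h (fun _ => zero_le) ?_
  intro n
  have : AxisDrift.moll (ns n) (f n) - g = AxisDrift.moll (ns n) (f n - g)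
      + (AxisDrift.moll (ns n) g - g) := by
    rw [moll_sub _ (locInt_of_L2 (mf n)) (locInt_of_L2 mg)]
    ring
  simp only [this]
  refine (eLpNorm_add_le (moll_memLp _ ((mf n).sub mg)).1
    ((moll_memLp _ mg).sub mg).1 (by norm_num)).trans ?_
  gcongr
  exact moll_eLpNorm_le _ ((mf n).sub mg)

/-- Mollification is symmetric. -/
lemma integral_moll_mul (n : ℕ) {u v : ST → ℝ} (hu : Integrable u) (hv : Integrable v) :
    ∫ z, moll n u z * v z = ∫ z, u z * moll n v z := by
  have hint : Integrable (Function.uncurry fun z w => ker n (z - w) * (v z * u w))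
      (volume.prod volume) := by
    obtain ⟨C, hC⟩ := (ker_compact n).exists_bound_of_continuous (ker_continuous n)
    refine Integrable.bdd_mul (c := C) (hv.mul_prod hu) ?_ ?_
    · exact ((ker_continuous n).comp (continuous_fst.sub continuous_snd)).aestronglyMeasurable
    · exact ae_of_all _ fun z => hC _
  calc ∫ z, moll n u z * v z = ∫ z, ∫ w, ker n (z - w) * (v z * u w) := by
        refine integral_congr_ae (ae_of_all _ fun z => ?_)
        simp only [moll_apply']
        rw [← integral_mul_const]
        refine integral_congr_ae (ae_of_all _ fun w => ?_)
        simp only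
        ring
    _ = ∫ w, ∫ z, ker n (z - w) * (v z * u w) := integral_integral_swap hint
    _ = ∫ z, u z * moll n v z := by
        refine integral_congr_ae (ae_of_all _ fun z => ?_)
        simp only [moll_apply']
        rw [← integral_const_mul]
        refine integral_congr_ae (ae_of_all _ fun w => ?_)
        simp only
        rw [ker_sub_comm]
        ring

lemma fderiv_moll (n : ℕ) {v : ST → ℝ} (hv : ContDiff ℝ 1 v) (hc : HasCompactSupport v) (z d : ST) :
    fderiv ℝ (moll n v) z d = moll n (fun w => fderiv ℝ v w d) z := by
  have hk : LocallyIntegrable (ker n) volume := (ker_continuous n).locallyIntegrable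
  have h := hc.hasFDerivAt_convolution_right (ContinuousLinearMap.lsmul ℝ ℝ) (μ := volume) hk hv z
  have h' : fderiv ℝ (moll n v) z = _ := h.fderiv
  rw [h', convolution_precompR_apply _ hk (hc.fderiv ℝ) (hv.continuous_fderiv one_ne_zero)]
  rfl

/-- Differentiating the kernel. -/
lemma fderiv_moll_ker (n : ℕ) {v : ST → ℝ} (hv : LocallyIntegrable v volume) (z d : ST) :
    fderiv ℝ (moll n v) z d = ∫ w, fderiv ℝ (ker n) (z - w) d * v w := by
  have hk : ContDiff ℝ 1 (ker n) := (ker_contDiff n).of_le (by simp)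
  have h := (ker_compact n).hasFDerivAt_convolution_left (ContinuousLinearMap.lsmul ℝ ℝ)
    (μ := volume) hk hv z
  have h' : fderiv ℝ (moll n v) z = _ := h.fderiv
  rw [h', convolution_eq_swap]
  rw [ContinuousLinearMap.integral_apply]
  · rfl
  · have := ((ker_compact n).fderiv ℝ).convolutionExists_left
      (ContinuousLinearMap.precompL ST (ContinuousLinearMap.lsmul ℝ ℝ : ℝ →L[ℝ] ℝ →L[ℝ] ℝ))
      (μ := volume) (hk.continuous_fderiv one_ne_zero) hv z
    exact this.integrable_swap

/-! ### Weak solutions and the chain rule -/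

/-- The data of a weak solution with its gradient, represented by measurable functions on all of
space-time that vanish outside `P(1)`. -/
structure Sol (b : ST → E) (Γ : ST → ℝ) (G : ST → E) : Prop where
  mb : Measurable b
  mΓ : Measurable Γ
  mG : Measurable G
  b2 : MemLp b 2 volume
  Γ2 : MemLp Γ 2 volume
  G2 : MemLp G 2 volume
  bz : ∀ z ∉ cyl 1, b z = 0
  Γz : ∀ z ∉ cyl 1, Γ z = 0
  Gz : ∀ z ∉ cyl 1, G z = 0
  div : ∀ ψ, IsTest openCyl ψ → ∫ z, ∑ i : Fin 3, b z i * dx i ψ z = 0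
  grad : ∀ ψ, IsTest openCyl ψ → ∀ i : Fin 3, ∫ z, Γ z * dx i ψ z = -∫ z, G z i * ψ z
  axis : VanishesOnAxis Γ
  eqn : ∀ ψ, IsTest openCylOffAxis ψ →
      ∫ z,
        (-(Γ z * dt ψ z)
          + (∑ i : Fin 3, b z i * G z i) * ψ z
          + ∑ i : Fin 3, G z i * dx i ψ z
          + 2 / axisDist z.1 ^ 2 * (z.1 0 * G z 0 + z.1 1 * G z 1) * ψ z) = 0

/-- Twice continuously differentiable functions `h` with bounded derivatives `h1 = h'`, `h2 = h''`,
normalized by `h 0 = h' 0 = 0`. -/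
structure C2B (h h1 h2 : ℝ → ℝ) (B : ℝ) : Prop where
  d1 : ∀ s, HasDerivAt h (h1 s) s
  d2 : ∀ s, HasDerivAt h1 (h2 s) s
  c2 : Continuous h2
  z0 : h 0 = 0
  z1 : h1 0 = 0
  b1 : ∀ s, |h1 s| ≤ B
  b2 : ∀ s, |h2 s| ≤ B

namespace C2B
variable {h h1 h2 : ℝ → ℝ} {B : ℝ}

lemma c1 (H : C2B h h1 h2 B) : Continuous h1 :=
  continuous_iff_continuousAt.2 fun s => (H.d2 s).continuousAt

lemma c0 (H : C2B h h1 h2 B) : Continuous h :=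
  continuous_iff_continuousAt.2 fun s => (H.d1 s).continuousAt

lemma contDiff (H : C2B h h1 h2 B) : ContDiff ℝ 1 h := by
  rw [contDiff_one_iff_deriv]
  refine ⟨fun s => (H.d1 s).differentiableAt, ?_⟩
  have : deriv h = h1 := funext fun s => (H.d1 s).deriv
  rw [this]; exact H.c1

lemma contDiff1 (H : C2B h h1 h2 B) : ContDiff ℝ 1 h1 := by
  rw [contDiff_one_iff_deriv]
  refine ⟨fun s => (H.d2 s).differentiableAt, ?_⟩
  have : deriv h1 = h2 := funext fun s => (H.d2 s).deriv
  rw [this]; exact H.c2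

lemma lip (H : C2B h h1 h2 B) (s t : ℝ) : |h s - h t| ≤ B * |s - t| :=
  Convex.norm_image_sub_le_of_norm_hasDerivWithin_le (s := univ)
    (fun x _ => (H.d1 x).hasDerivWithinAt) (fun x _ => H.b1 x) convex_univ (mem_univ t) (mem_univ s)

lemma lip1 (H : C2B h h1 h2 B) (s t : ℝ) : |h1 s - h1 t| ≤ B * |s - t| :=
  Convex.norm_image_sub_le_of_norm_hasDerivWithin_le (s := univ)
    (fun x _ => (H.d2 x).hasDerivWithinAt) (fun x _ => H.b2 x) convex_univ (mem_univ t) (mem_univ s)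

lemma abs_le (H : C2B h h1 h2 B) (s : ℝ) : |h s| ≤ B * |s| := by
  simpa [H.z0] using H.lip s 0

lemma abs_le1 (H : C2B h h1 h2 B) (s : ℝ) : |h1 s| ≤ B * |s| := by
  simpa [H.z1] using H.lip1 s 0

lemma nonneg (H : C2B h h1 h2 B) : 0 ≤ B := (abs_nonneg _).trans (H.b1 0)

end C2B

variable {b : ST → E} {Γ : ST → ℝ} {G : ST → E}

lemma memLp_apply {α : Type*} [MeasurableSpace α] {μ : Measure α} {F : α → E} {p : ℝ≥0∞}
    (hF : MemLp F p μ) (i : Fin 3) : MemLp (fun z => F z i) p μ := by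
  refine MemLp.of_le hF ?_ (ae_of_all _ fun z => PiLp.norm_apply_le (F z) i)
  exact ((EuclideanSpace.proj (𝕜 := ℝ) i).continuous).comp_aestronglyMeasurable hF.1

lemma measurable_coord {F : ST → E} (hF : Measurable F) (i : Fin 3) :
    Measurable (fun z => F z i) :=
  (EuclideanSpace.proj (𝕜 := ℝ) i).continuous.measurable.comp hF

lemma isOpen_openCyl : IsOpen openCyl := isOpen_ball.prod isOpen_Ioo

lemma continuous_axisDist : Continuous axisDist := by
  unfold axisDist
  fun_prop

lemma isOpen_openCylOffAxis : IsOpen openCylOffAxis :=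
  isOpen_openCyl.inter
    (isOpen_lt continuous_const (continuous_axisDist.comp continuous_fst))

lemma eventually_closedBall_subset {K U : Set ST} (hK : IsCompact K) (hU : IsOpen U) (h : K ⊆ U) :
    ∀ᶠ n : ℕ in atTop, ∀ z ∈ K, closedBall z (1 / ((n : ℝ) + 1)) ⊆ U := by
  obtain ⟨δ, δpos, hδ⟩ := hK.exists_cthickening_subset_open hU h
  obtain ⟨N, hN⟩ := exists_nat_one_div_lt δpos
  filter_upwards [eventually_ge_atTop N] with n hn z hz
  refine Subset.trans (fun w hw => ?_) hδ
  refine mem_cthickening_of_dist_le w z δ K hz (le_trans hw (le_trans ?_ hN.le))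
  apply one_div_le_one_div_of_le (by positivity)
  have : (N : ℝ) ≤ n := by exact_mod_cast hn
  linarith

lemma eventually_isTest_moll {K U : Set ST} (hK : IsCompact K) (hU : IsOpen U) (h : K ⊆ U) :
    ∀ᶠ n : ℕ in atTop, ∀ v : ST → ℝ, LocallyIntegrable v volume → (∀ z ∉ K, v z = 0) →
      IsTest U (moll n v) := by
  obtain ⟨δ, δpos, hδ⟩ := hK.exists_cthickening_subset_open hU h
  obtain ⟨N, hN⟩ := exists_nat_one_div_lt δpos
  filter_upwards [eventually_ge_atTop N] with n hn v hv hvK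
  have hnδ : 1 / ((n : ℝ) + 1) ≤ δ := by
    refine le_trans ?_ hN.le
    apply one_div_le_one_div_of_le (by positivity)
    have : (N : ℝ) ≤ n := by exact_mod_cast hn
    linarith
  have hs : tsupport (moll n v) ⊆ cthickening δ K := by
    refine closure_minimal ?_ isClosed_cthickening
    intro z hz
    by_contra hzK
    apply hz
    refine moll_eq_zero n fun w hw => ?_
    by_contra hvw
    have hwK : w ∈ K := by by_contra hw'; exact hvw (hvK w hw')
    exact hzK (mem_cthickening_of_dist_le z w δ K hwK
      (by rw [dist_eq_norm]; exact hw.le.trans hnδ))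
  exact ⟨moll_contDiff n hv, moll_compact n (HasCompactSupport.intro hK hvK), hs.trans hδ⟩

lemma IsTest.mono {U V : Set ST} {ψ : ST → ℝ} (h : IsTest U ψ) (hUV : U ⊆ V) : IsTest V ψ :=
  ⟨h.smooth, h.compact, h.supp.trans hUV⟩

lemma openCylOffAxis_subset : openCylOffAxis ⊆ openCyl := fun _ h => h.1

lemma IsTest.memLp {U : Set ST} {ψ : ST → ℝ} (h : IsTest U ψ) (p : ℝ≥0∞) : MemLp ψ p volume :=
  h.smooth.continuous.memLp_of_hasCompactSupport h.compact

lemma IsTest.bdd {U : Set ST} {ψ : ST → ℝ} (h : IsTest U ψ) : ∃ C, ∀ z, |ψ z| ≤ C :=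
  h.compact.exists_bound_of_continuous h.smooth.continuous

lemma IsTest.c1 {U : Set ST} {ψ : ST → ℝ} (h : IsTest U ψ) : ContDiff ℝ 1 ψ :=
  h.smooth.of_le (by simp)

lemma continuous_fderiv_apply {v : ST → ℝ} (hv : ContDiff ℝ 1 v) (d : ST) :
    Continuous fun z => fderiv ℝ v z d :=
  (hv.continuous_fderiv one_ne_zero).clm_apply continuous_const

lemma fderiv_apply_compact {v : ST → ℝ} (hc : HasCompactSupport v) (d : ST) :
    HasCompactSupport fun z => fderiv ℝ v z d := hc.fderiv_apply ℝ d

lemma fderiv_apply_memLp {v : ST → ℝ} (hv : ContDiff ℝ 1 v) (hc : HasCompactSupport v) (d : ST)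
    (p : ℝ≥0∞) : MemLp (fun z => fderiv ℝ v z d) p volume :=
  (continuous_fderiv_apply hv d).memLp_of_hasCompactSupport (fderiv_apply_compact hc d)

/-- Integration by parts for continuously differentiable functions, one of them compactly
supported. -/
lemma integral_mul_fderiv {u v : ST → ℝ} (hu : ContDiff ℝ 1 u) (hv : ContDiff ℝ 1 v)
    (hc : HasCompactSupport v) (d : ST) :
    ∫ z, u z * fderiv ℝ v z d = -∫ z, fderiv ℝ u z d * v z := by
  apply integral_mul_fderiv_eq_neg_fderiv_mul_of_integrable
  · exact ((continuous_fderiv_apply hu d).mul hv.continuous).integrable_of_hasCompactSupport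
      hc.mul_left
  · exact (hu.continuous.mul (continuous_fderiv_apply hv d)).integrable_of_hasCompactSupport
      (fderiv_apply_compact hc d).mul_left
  · exact (hu.continuous.mul hv.continuous).integrable_of_hasCompactSupport hc.mul_left
  · exact fun x _ => hu.differentiable one_ne_zero x
  · exact fun x _ => hv.differentiable one_ne_zero x

lemma moll_ae_tendsto {v : ST → ℝ} (hv : LocallyIntegrable v volume) :
    ∀ᵐ z, Tendsto (fun n => moll n v z) atTop (𝓝 (v z)) := by
  refine ContDiffBump.ae_convolution_tendsto_right_of_locallyIntegrable (φ := bump) (K := 2)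
    ?_ (Eventually.of_forall fun n => ?_) hv
  · exact tendsto_one_div_add_atTop_nhds_zero_nat
  · simp only [bump]
    rw [one_div, one_div, mul_inv]
    linarith

lemma volume_cyl_lt_top (R : ℝ) : volume (cyl R) < ⊤ := by
  have h : Bornology.IsBounded (cyl R) :=
    (isBounded_ball).prod (isBounded_Ioc _ _)
  exact h.measure_lt_top

/-- Square integrable functions that vanish outside the cylinder are integrable. -/
lemma integrable_of_zero {F : Type*} [NormedAddCommGroup F] {f : ST → F} (hf : MemLp f 2 volume)
    (hz : ∀ z ∉ cyl 1, f z = 0) : Integrable f := by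
  have h : MemLp f 2 (volume.restrict (cyl 1)) := hf.restrict _
  have : IsFiniteMeasure (volume.restrict (cyl 1)) :=
    ⟨by simpa using volume_cyl_lt_top 1⟩
  have h1 : IntegrableOn f (cyl 1) := h.integrable (by norm_num)
  exact h1.integrable_of_forall_notMem_eq_zero hz

namespace Sol

lemma Γint (S : Sol b Γ G) : Integrable Γ := integrable_of_zero S.Γ2 S.Γz

lemma Gi2 (S : Sol b Γ G) (i : Fin 3) : MemLp (fun z => G z i) 2 volume := memLp_apply S.G2 i

lemma bi2 (S : Sol b Γ G) (i : Fin 3) : MemLp (fun z => b z i) 2 volume := memLp_apply S.b2 i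

/-- The gradient of the mollified solution is the mollified weak gradient, away from the boundary
of the cylinder. -/
lemma dx_moll (S : Sol b Γ G) (n : ℕ) {z : ST} (hz : closedBall z (1 / ((n : ℝ) + 1)) ⊆ openCyl)
    (i : Fin 3) : dx i (moll n Γ) z = moll n (fun w => G w i) z := by
  have hd : ∀ w, HasFDerivAt (fun w : ST => ker n (z - w))
      (-(fderiv ℝ (ker n) (z - w))) w := by
    intro w
    have h1 : HasFDerivAt (ker n) (fderiv ℝ (ker n) (z - w)) (z - w) :=
      (((ker_contDiff n).differentiable (by simp)) (z - w)).hasFDerivAt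
    have h2 : HasFDerivAt (fun w : ST => z - w) (-(ContinuousLinearMap.id ℝ ST)) w := by
      simpa using (hasFDerivAt_id w).const_sub z
    exact (h1.comp w h2).congr_fderiv (by simp)
  have hts : tsupport (fun w : ST => ker n (z - w)) ⊆ closedBall z (1 / ((n : ℝ) + 1)) := by
    refine closure_minimal (fun w hw => ?_) isClosed_closedBall
    by_contra hw'
    apply hw
    refine ker_eq_zero n ?_
    rw [mem_closedBall, not_le, dist_comm, dist_eq_norm] at hw'
    exact hw'.le
  have hT : IsTest openCyl (fun w : ST => ker n (z - w)) := by
    refine ⟨(ker_contDiff n).comp (contDiff_const.sub contDiff_id), ?_, hts.trans hz⟩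
    exact (isCompact_closedBall z _).of_isClosed_subset isClosed_closure hts
  have h := S.grad _ hT i
  rw [dx, fderiv_moll_ker n (locInt_of_L2 S.Γ2)]
  rw [moll_apply']
  have e : ∀ w, Γ w * dx i (fun w : ST => ker n (z - w)) w
      = -(fderiv ℝ (ker n) (z - w) (EuclideanSpace.single i 1, 0) * Γ w) := by
    intro w
    rw [dx, (hd w).fderiv]
    simp only [neg_apply]
    ring
  simp only [e, integral_neg, neg_inj] at h
  rw [h]
  refine integral_congr_ae (ae_of_all _ fun w => ?_)
  simp only
  ring

variable {h h1 h2 : ℝ → ℝ} {B : ℝ}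

lemma moll_c1 (S : Sol b Γ G) (n : ℕ) : ContDiff ℝ 1 (moll n Γ) :=
  (moll_contDiff n (locInt_of_L2 S.Γ2)).of_le (by simp)

lemma hmoll_c1 (S : Sol b Γ G) (H : C2B h h1 h2 B) (n : ℕ) :
    ContDiff ℝ 1 (fun z => h (moll n Γ z)) := H.contDiff.comp (S.moll_c1 n)

lemma h1moll_c1 (S : Sol b Γ G) (H : C2B h h1 h2 B) (n : ℕ) :
    ContDiff ℝ 1 (fun z => h1 (moll n Γ z)) := H.contDiff1.comp (S.moll_c1 n)

lemma fderiv_hmoll (S : Sol b Γ G) (H : C2B h h1 h2 B) (n : ℕ) (z d : ST) :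
    fderiv ℝ (fun z => h (moll n Γ z)) z d = h1 (moll n Γ z) * fderiv ℝ (moll n Γ) z d := by
  have := (H.d1 (moll n Γ z)).comp_hasFDerivAt z
    ((S.moll_c1 n).differentiable one_ne_zero z).hasFDerivAt
  have h' : fderiv ℝ (fun z => h (moll n Γ z)) z = _ := this.fderiv
  rw [h']
  simp

lemma fderiv_mul_apply' {u v : ST → ℝ} (hu : ContDiff ℝ 1 u) (hv : ContDiff ℝ 1 v) (z d : ST) :
    fderiv ℝ (fun z => u z * v z) z d = fderiv ℝ u z d * v z + u z * fderiv ℝ v z d := by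
  rw [fderiv_fun_mul (hu.differentiable one_ne_zero z) (hv.differentiable one_ne_zero z)]
  simp
  ring

lemma moll_continuous (S : Sol b Γ G) (n : ℕ) : Continuous (moll n Γ) := (S.moll_c1 n).continuous

/-- `h(Γₙ)` converges to `h(Γ)` in `L²`, for the mollifications `Γₙ` of `Γ`. -/
lemma h_tendsto (S : Sol b Γ G) (H : C2B h h1 h2 B) :
    TendstoL2 volume (fun n z => h (moll n Γ z)) (fun z => h (Γ z)) :=
  (moll_tendsto S.Γ2).comp_lipschitz H.lip

lemma memLp_h (H : C2B h h1 h2 B) {v : ST → ℝ} (hv : MemLp v 2 volume) :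
    MemLp (fun z => h (v z)) 2 volume :=
  MemLp.of_le_mul (c := B) hv (H.c0.comp_aestronglyMeasurable hv.1)
    (ae_of_all _ fun z => H.abs_le (v z))

/-- `h'(Γₙ) ∂ᵢΓₙ` converges to `h'(Γ) ∂ᵢΓ` in `L²`; here `k` is any bounded continuous factor. -/
lemma kG_tendsto (S : Sol b Γ G) {k : ℝ → ℝ} {C : ℝ} (kc : Continuous k) (kb : ∀ s, |k s| ≤ C)
    (i : Fin 3) :
    TendstoL2 volume (fun n => (fun z => k (moll n Γ z)) * moll n (fun w => G w i))
      ((fun z => k (Γ z)) * (fun z => G z i)) := by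
  refine TendstoL2.bdd_mul (C := C) (moll_tendsto (S.Gi2 i)) (fun n => moll_memLp n (S.Gi2 i))
    (S.Gi2 i) (fun n => (kc.comp (S.moll_continuous n)).aestronglyMeasurable)
    (kc.measurable.comp S.mΓ).aestronglyMeasurable (fun n _ => kb _) (fun _ => kb _) ?_
  filter_upwards [moll_ae_tendsto (locInt_of_L2 S.Γ2)] with z hz
  exact (kc.tendsto _).comp hz

lemma kG_memLp (S : Sol b Γ G) {k : ℝ → ℝ} {C : ℝ} (kc : Continuous k) (kb : ∀ s, |k s| ≤ C)
    (i : Fin 3) : MemLp ((fun z => k (Γ z)) * (fun z => G z i)) 2 volume :=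
  memLp_bdd_mul (kc.measurable.comp S.mΓ).aestronglyMeasurable (fun _ => kb _) (S.Gi2 i)

lemma kG_memLp_moll (S : Sol b Γ G) {k : ℝ → ℝ} {C : ℝ} (kc : Continuous k) (kb : ∀ s, |k s| ≤ C)
    (i : Fin 3) (n : ℕ) :
    MemLp ((fun z => k (moll n Γ z)) * moll n (fun w => G w i)) 2 volume :=
  memLp_bdd_mul (kc.comp (S.moll_continuous n)).aestronglyMeasurable (fun _ => kb _)
    (moll_memLp n (S.Gi2 i))

/-- The weak chain rule `∂ᵢ h(Γ) = h'(Γ) ∂ᵢΓ`. -/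
lemma weak_chain (S : Sol b Γ G) (H : C2B h h1 h2 B) {ψ : ST → ℝ} (hψ : IsTest openCyl ψ)
    (i : Fin 3) :
    ∫ z, h (Γ z) * dx i ψ z = -∫ z, h1 (Γ z) * G z i * ψ z := by
  have hL : Tendsto (fun n => ∫ z, h (moll n Γ z) * dx i ψ z) atTop
      (𝓝 (∫ z, h (Γ z) * dx i ψ z)) :=
    (S.h_tendsto H).integral_mul TendstoL2.const (fun n => memLp_h H (moll_memLp n S.Γ2))
      (memLp_h H S.Γ2) (fun _ => fderiv_apply_memLp hψ.c1 hψ.compact _ 2)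
      (fderiv_apply_memLp hψ.c1 hψ.compact _ 2)
  have hR : Tendsto (fun n => ∫ z, ((fun z => h1 (moll n Γ z)) * moll n (fun w => G w i)) z * ψ z)
      atTop (𝓝 (∫ z, ((fun z => h1 (Γ z)) * (fun z => G z i)) z * ψ z)) :=
    (S.kG_tendsto H.c1 H.b1 i).integral_mul TendstoL2.const (S.kG_memLp_moll H.c1 H.b1 i)
      (S.kG_memLp H.c1 H.b1 i) (fun _ => hψ.memLp 2) (hψ.memLp 2)
  refine tendsto_nhds_unique (hL.congr' ?_) hR.neg
  filter_upwards [eventually_closedBall_subset hψ.compact isOpen_openCyl hψ.supp] with n hn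
  rw [show (fun z => h (moll n Γ z) * dx i ψ z) = fun z => h (moll n Γ z) *
    fderiv ℝ ψ z (EuclideanSpace.single i 1, 0) from rfl,
    integral_mul_fderiv (S.hmoll_c1 H n) hψ.c1 hψ.compact]
  congr 1
  refine integral_congr_ae (ae_of_all _ fun z => ?_)
  simp only [Pi.mul_apply]
  by_cases hz : z ∈ tsupport ψ
  · rw [S.fderiv_hmoll H, ← S.dx_moll n (hn z hz) i]
    rfl
  · rw [image_eq_zero_of_notMem_tsupport hz]; simp

/-- The gradient of `k(Γₙ) ψ` converges in `L²` (where `k` is `h` or `h'`). -/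
lemma grad_prod_tendsto (S : Sol b Γ G) {k k' : ℝ → ℝ} (kd : ∀ s, HasDerivAt k (k' s) s)
    (kc' : Continuous k') (kb' : ∀ s, |k' s| ≤ B) {ψ : ST → ℝ} (hψ : IsTest openCyl ψ)
    (i : Fin 3) :
    (∀ n, MemLp (dx i fun z => k (moll n Γ z) * ψ z) 2 volume) ∧
    MemLp (fun z => k' (Γ z) * G z i * ψ z + k (Γ z) * dx i ψ z) 2 volume ∧
    TendstoL2 volume (fun n => dx i fun z => k (moll n Γ z) * ψ z)
      (fun z => k' (Γ z) * G z i * ψ z + k (Γ z) * dx i ψ z) := by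
  have kc : Continuous k := continuous_iff_continuousAt.2 fun s => (kd s).continuousAt
  have kcd : ContDiff ℝ 1 k := by
    rw [contDiff_one_iff_deriv]
    refine ⟨fun s => (kd s).differentiableAt, ?_⟩
    have : deriv k = k' := funext fun s => (kd s).deriv
    rw [this]; exact kc'
  have hlip : ∀ s t, |k s - k t| ≤ B * |s - t| := fun s t =>
    Convex.norm_image_sub_le_of_norm_hasDerivWithin_le (s := univ)
      (fun x _ => (kd x).hasDerivWithinAt) (fun x _ => kb' x) convex_univ (mem_univ t) (mem_univ s)
  have uc : ∀ n, ContDiff ℝ 1 (fun z => k (moll n Γ z)) := fun n => kcd.comp (S.moll_c1 n)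
  have pc : ∀ n, ContDiff ℝ 1 (fun z => k (moll n Γ z) * ψ z) := fun n => (uc n).mul hψ.c1
  have pcs : ∀ n, HasCompactSupport (fun z => k (moll n Γ z) * ψ z) := fun n => hψ.compact.mul_left
  obtain ⟨C, hC⟩ := hψ.bdd
  have dψc : Continuous (dx i ψ) := continuous_fderiv_apply hψ.c1 _
  have dψk : HasCompactSupport (dx i ψ) := fderiv_apply_compact hψ.compact _
  obtain ⟨D, hD⟩ := dψk.exists_bound_of_continuous dψc
  -- the two limits
  have T1 : TendstoL2 volume (fun n => ψ * ((fun z => k' (moll n Γ z)) * moll n (fun w => G w i)))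
      (ψ * ((fun z => k' (Γ z)) * (fun z => G z i))) :=
    TendstoL2.bdd_mul (C := C) (S.kG_tendsto kc' kb' i) (S.kG_memLp_moll kc' kb' i)
      (S.kG_memLp kc' kb' i) (fun _ => hψ.smooth.continuous.aestronglyMeasurable)
      hψ.smooth.continuous.aestronglyMeasurable (fun _ => hC) hC
      (ae_of_all _ fun _ => tendsto_const_nhds)
  have M1 : ∀ n, MemLp (ψ * ((fun z => k' (moll n Γ z)) * moll n (fun w => G w i))) 2 volume :=
    fun n => memLp_bdd_mul hψ.smooth.continuous.aestronglyMeasurable hC (S.kG_memLp_moll kc' kb' i n)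
  have M1' : MemLp (ψ * ((fun z => k' (Γ z)) * (fun z => G z i))) 2 volume :=
    memLp_bdd_mul hψ.smooth.continuous.aestronglyMeasurable hC (S.kG_memLp kc' kb' i)
  -- `k(Γₙ) - k 0` is square integrable and Lipschitz in `Γₙ`
  have hlip0 : ∀ s t, |(fun s => k s - k 0) s - (fun s => k s - k 0) t| ≤ B * |s - t| := by
    intro s t
    simpa using hlip s t
  have m0 : ∀ v : ST → ℝ, MemLp v 2 volume → MemLp (fun z => k (v z) - k 0) 2 volume := by
    intro v hv
    refine MemLp.of_le_mul (c := B) hv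
      ((kc.comp_aestronglyMeasurable hv.1).sub aestronglyMeasurable_const)
      (ae_of_all _ fun z => ?_)
    simpa using hlip (v z) 0
  have Tk : TendstoL2 volume (fun n z => k (moll n Γ z) - k 0) (fun z => k (Γ z) - k 0) :=
    (moll_tendsto S.Γ2).comp_lipschitz (h := fun s => k s - k 0) hlip0
  have hD' : ∀ z, |dx i ψ z| ≤ D := hD
  have T2 : TendstoL2 volume (fun n => dx i ψ * (fun z => k (moll n Γ z) - k 0))
      (dx i ψ * (fun z => k (Γ z) - k 0)) :=
    TendstoL2.bdd_mul (C := D) Tk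
      (fun n => m0 _ (moll_memLp n S.Γ2)) (m0 _ S.Γ2) (fun _ => dψc.aestronglyMeasurable)
      dψc.aestronglyMeasurable (fun _ => hD') hD' (ae_of_all _ fun _ => tendsto_const_nhds)
  have M2 : ∀ n, MemLp (dx i ψ * (fun z => k (moll n Γ z) - k 0)) 2 volume :=
    fun n => memLp_bdd_mul dψc.aestronglyMeasurable hD' (m0 _ (moll_memLp n S.Γ2))
  have M2' : MemLp (dx i ψ * (fun z => k (Γ z) - k 0)) 2 volume :=
    memLp_bdd_mul dψc.aestronglyMeasurable hD' (m0 _ S.Γ2)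
  have M3 : MemLp (fun z => k 0 * dx i ψ z) 2 volume :=
    (dψc.memLp_of_hasCompactSupport dψk).const_mul _
  have T3 := ((T1.add T2 M1 M1' M2 M2').add (TendstoL2.const (g := fun z => k 0 * dx i ψ z))
    (fun n => (M1 n).add (M2 n)) (M1'.add M2') (fun _ => M3) M3)
  have elim : ψ * ((fun z => k' (Γ z)) * (fun z => G z i)) + dx i ψ * (fun z => k (Γ z) - k 0)
      + (fun z => k 0 * dx i ψ z)
      = fun z => k' (Γ z) * G z i * ψ z + k (Γ z) * dx i ψ z := by
    ext z; simp; ring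
  rw [elim] at T3
  refine ⟨fun n => fderiv_apply_memLp (pc n) (pcs n) _ 2, ?_, ?_⟩
  · rw [← elim]; exact (M1'.add M2').add M3
  · refine Filter.Tendsto.congr' ?_ T3
    filter_upwards [eventually_closedBall_subset hψ.compact isOpen_openCyl hψ.supp] with n hN
    congr 2
    ext z
    simp only [Pi.add_apply, Pi.mul_apply]
    symm
    rw [dx, fderiv_mul_apply' (uc n) hψ.c1]
    have hc := (kd (moll n Γ z)).comp_hasFDerivAt z
      ((S.moll_c1 n).differentiable one_ne_zero z).hasFDerivAt
    have hc' : fderiv ℝ (fun z => k (moll n Γ z)) z = _ := hc.fderiv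
    rw [hc']
    have e2 : fderiv ℝ ψ z (EuclideanSpace.single i 1, 0) = dx i ψ z := rfl
    rw [e2]
    by_cases hz : z ∈ tsupport ψ
    · rw [← S.dx_moll n (hN z hz) i]
      simp only [dx, smul_apply, smul_eq_mul]
      ring
    · rw [image_eq_zero_of_notMem_tsupport hz]; simp; ring

end Sol

/-! ### The equation off the axis -/
namespace Sol
variable {b : ST → E} {Γ : ST → ℝ} {G : ST → E} {h h1 h2 : ℝ → ℝ} {B : ℝ}

lemma dx_moll_fun (n : ℕ) {v : ST → ℝ} (hv : ContDiff ℝ 1 v) (hc : HasCompactSupport v)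
    (i : Fin 3) : dx i (moll n v) = moll n (dx i v) := by
  ext z
  exact fderiv_moll n hv hc z _

/-- The drift term in divergence form: `∫ b · ∇(h(Γ) ψ) = 0`. -/
lemma drift_parts (S : Sol b Γ G) (H : C2B h h1 h2 B) {ψ : ST → ℝ} (hψ : IsTest openCyl ψ) :
    ∑ i : Fin 3, ∫ z, b z i * (h1 (Γ z) * G z i * ψ z + h (Γ z) * dx i ψ z) = 0 := by
  have key := fun i => S.grad_prod_tendsto H.d1 H.c1 H.b1 hψ i
  have pc : ∀ n, ContDiff ℝ 1 (fun z => h (moll n Γ z) * ψ z) :=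
    fun n => (S.hmoll_c1 H n).mul hψ.c1
  have pcs : ∀ n, HasCompactSupport (fun z => h (moll n Γ z) * ψ z) := fun n => hψ.compact.mul_left
  have hlim : Tendsto (fun n => ∑ i : Fin 3, ∫ z, b z i *
      moll n (dx i fun z => h (moll n Γ z) * ψ z) z) atTop
      (𝓝 (∑ i : Fin 3, ∫ z, b z i * (h1 (Γ z) * G z i * ψ z + h (Γ z) * dx i ψ z))) := by
    refine tendsto_finsetSum _ fun i _ => ?_
    exact TendstoL2.const.integral_mul ((key i).2.2.moll (key i).1 (key i).2.1 strictMono_id)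
      (fun _ => S.bi2 i) (S.bi2 i) (fun n => moll_memLp n ((key i).1 n)) (key i).2.1
  refine tendsto_nhds_unique hlim (tendsto_const_nhds.congr' ?_)
  filter_upwards [eventually_isTest_moll hψ.compact isOpen_openCyl hψ.supp] with n hn
  have hT := hn (fun z => h (moll n Γ z) * ψ z) (pc n).continuous.locallyIntegrable
    (fun z hz => by rw [image_eq_zero_of_notMem_tsupport hz]; simp)
  have := S.div _ hT
  rw [integral_finsetSum] at this
  · rw [← this]
    refine Finset.sum_congr rfl fun i _ => ?_
    rw [dx_moll_fun n (pc n) (pcs n)]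
  · intro i _
    rw [dx_moll_fun n (pc n) (pcs n)]
    exact (S.bi2 i).integrable_mul (moll_memLp n ((key i).1 n))

/-- The first order terms `b · ∇Γ + (2 / r) ∂ᵣΓ` of the equation. -/
noncomputable def lowOrder (b G : ST → E) (z : ST) : ℝ :=
  (∑ i : Fin 3, b z i * G z i) + 2 / axisDist z.1 ^ 2 * (z.1 0 * G z 0 + z.1 1 * G z 1)

lemma measurable_axisDist : Measurable axisDist := continuous_axisDist.measurable

lemma bG_integrable (S : Sol b Γ G) : Integrable fun z => ∑ i : Fin 3, b z i * G z i :=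
  integrable_finsetSum _ fun i _ => (S.bi2 i).integrable_mul (S.Gi2 i)

/-- The first order terms are integrable on compact sets that do not meet the axis. -/
lemma lowOrder_integrableOn (S : Sol b Γ G) {K : Set ST} (hK : IsCompact K)
    (hK' : K ⊆ openCylOffAxis) : IntegrableOn (lowOrder b G) K := by
  have hc : ContinuousOn (fun z : ST => 2 / axisDist z.1 ^ 2) K := by
    refine ContinuousOn.div continuousOn_const
      ((continuous_axisDist.comp continuous_fst).pow 2).continuousOn ?_
    intro z hz
    exact pow_ne_zero _ (hK' hz).2.ne'
  have hGi : ∀ i, Integrable (fun z => G z i) := fun i =>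
    integrable_of_zero (S.Gi2 i) (fun z hz => by simp [S.Gz z hz])
  have hx : ∀ i : Fin 3, Continuous fun z : ST => z.1 i := fun i =>
    (EuclideanSpace.proj (𝕜 := ℝ) i).continuous.comp continuous_fst
  have h1 : IntegrableOn (fun z : ST => (2 / axisDist z.1 ^ 2 * z.1 0) * G z 0) K :=
    IntegrableOn.continuousOn_mul (hc.mul (hx 0).continuousOn) (hGi 0).integrableOn hK
  have h2 : IntegrableOn (fun z : ST => (2 / axisDist z.1 ^ 2 * z.1 1) * G z 1) K :=
    IntegrableOn.continuousOn_mul (hc.mul (hx 1).continuousOn) (hGi 1).integrableOn hK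
  have h3 := (S.bG_integrable.integrableOn (s := K)).add (h1.add h2)
  refine h3.congr_fun (fun z _ => ?_) hK.measurableSet
  simp only [lowOrder, Pi.add_apply]
  ring

/-- The renormalized equation for `h(Γ)`, tested off the axis. -/
lemma renormalized_offAxis (S : Sol b Γ G) (H : C2B h h1 h2 B) {ψ : ST → ℝ}
    (hψ : IsTest openCylOffAxis ψ) :
    -(∫ z, h (Γ z) * dt ψ z)
      + (∑ i : Fin 3, ∫ z, G z i * (h2 (Γ z) * G z i * ψ z + h1 (Γ z) * dx i ψ z))
      + ∫ z, lowOrder b G z * (h1 (Γ z) * ψ z) = 0 := by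
  have hψ' : IsTest openCyl ψ := hψ.mono openCylOffAxis_subset
  have key := fun i => S.grad_prod_tendsto H.d2 H.c2 H.b2 hψ' i
  set v : ℕ → ST → ℝ := fun n z => h1 (moll n Γ z) * ψ z with hv
  have pc : ∀ n, ContDiff ℝ 1 (v n) := fun n => (S.h1moll_c1 H n).mul hψ.c1
  have pcs : ∀ n, HasCompactSupport (v n) := fun n => hψ.compact.mul_left
  obtain ⟨C, hC⟩ := hψ.bdd
  have hB := H.nonneg
  have vb : ∀ n z, |v n z| ≤ B * C := by
    intro n z
    simp only [hv, abs_mul]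
    exact mul_le_mul (H.b1 _) (hC z) (abs_nonneg _) hB
  have vm : ∀ n, MemLp (v n) 2 volume := fun n =>
    (pc n).continuous.memLp_of_hasCompactSupport (pcs n)
  -- the limit of the mollified test functions
  have w2 : MemLp (fun z => h1 (Γ z) * ψ z) 2 volume :=
    memLp_bdd_mul (H.c1.measurable.comp S.mΓ).aestronglyMeasurable (fun _ => H.b1 _) (hψ.memLp 2)
  have vlim : TendstoL2 volume v (fun z => h1 (Γ z) * ψ z) := by
    have := TendstoL2.bdd_mul (C := B) (TendstoL2.const (g := ψ) (μ := volume))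
      (fun _ => hψ.memLp 2) (hψ.memLp 2)
      (fun n => (S.h1moll_c1 H n).continuous.aestronglyMeasurable)
      (H.c1.measurable.comp S.mΓ).aestronglyMeasurable (fun n _ => H.b1 _) (fun _ => H.b1 _) (by
        filter_upwards [moll_ae_tendsto (locInt_of_L2 S.Γ2)] with z hz
        exact (H.c1.tendsto _).comp hz)
    exact this
  have Vlim : TendstoL2 volume (fun n => moll n (v n)) (fun z => h1 (Γ z) * ψ z) :=
    vlim.moll vm w2 strictMono_id
  obtain ⟨ns, hns, hae⟩ := Vlim.exists_subseq_ae (fun n => moll_memLp n (vm n)) w2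
  -- a compact neighbourhood of the support that stays away from the axis
  obtain ⟨δ, δpos, hδ⟩ := hψ.compact.isCompact.exists_cthickening_subset_open
    isOpen_openCylOffAxis hψ.supp
  set K := cthickening δ (tsupport ψ) with hKdef
  have hK : IsCompact K := hψ.compact.isCompact.cthickening
  have hQ : IntegrableOn (lowOrder b G) K := S.lowOrder_integrableOn hK hδ
  have Vsupp : ∀ᶠ n : ℕ in atTop, ∀ z ∉ K, moll n (v n) z = 0 := by
    obtain ⟨N, hN⟩ := exists_nat_one_div_lt δpos
    filter_upwards [eventually_ge_atTop N] with n hn z hz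
    refine moll_eq_zero n fun w hw => ?_
    by_contra hvw
    have hwK : w ∈ tsupport ψ := by
      by_contra hw'
      exact hvw (by simp [hv, image_eq_zero_of_notMem_tsupport hw'])
    refine hz (mem_cthickening_of_dist_le z w δ _ hwK ?_)
    rw [dist_eq_norm]
    refine hw.le.trans (le_trans ?_ hN.le)
    apply one_div_le_one_div_of_le (by positivity)
    have : (N : ℝ) ≤ n := by exact_mod_cast hn
    linarith
  have subset_K : tsupport ψ ⊆ K := self_subset_cthickening _
  have L3 : Tendsto (fun n => ∫ z, lowOrder b G z * moll (ns n) (v (ns n)) z) atTop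
      (𝓝 (∫ z, lowOrder b G z * (h1 (Γ z) * ψ z))) := by
    have e1 : ∫ z, lowOrder b G z * (h1 (Γ z) * ψ z)
        = ∫ z in K, lowOrder b G z * (h1 (Γ z) * ψ z) := by
      symm
      refine setIntegral_eq_integral_of_forall_compl_eq_zero fun z hz => ?_
      rw [image_eq_zero_of_notMem_tsupport (fun h' => hz (subset_K h'))]; simp
    have e2 : ∀ᶠ n in atTop, ∫ z in K, lowOrder b G z * moll (ns n) (v (ns n)) z
        = ∫ z, lowOrder b G z * moll (ns n) (v (ns n)) z := by
      filter_upwards [hns.tendsto_atTop.eventually Vsupp] with n hn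
      refine setIntegral_eq_integral_of_forall_compl_eq_zero fun z hz => ?_
      rw [hn z hz, mul_zero]
    rw [e1]
    refine Filter.Tendsto.congr' e2 ?_
    refine tendsto_integral_of_dominated_convergence (fun z => |lowOrder b G z| * (B * C)) ?_ ?_ ?_ ?_
    · intro n
      exact (hQ.1).mul (moll_memLp _ (vm _)).1.restrict
    · exact (Integrable.abs hQ).mul_const _
    · intro n
      refine ae_of_all _ fun z => ?_
      rw [norm_mul, Real.norm_eq_abs, Real.norm_eq_abs]
      exact mul_le_mul_of_nonneg_left (moll_abs_le _ (vb _) z) (abs_nonneg _)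
    · filter_upwards [ae_restrict_of_ae hae] with z hz
      exact hz.const_mul _
  have L2' : Tendsto (fun n => ∑ i : Fin 3, ∫ z, G z i * moll n (dx i (v n)) z) atTop
      (𝓝 (∑ i : Fin 3, ∫ z, G z i * (h2 (Γ z) * G z i * ψ z + h1 (Γ z) * dx i ψ z))) := by
    refine tendsto_finsetSum _ fun i _ => ?_
    exact TendstoL2.const.integral_mul ((key i).2.2.moll (key i).1 (key i).2.1 strictMono_id)
      (fun _ => S.Gi2 i) (S.Gi2 i) (fun n => moll_memLp n ((key i).1 n)) (key i).2.1
  have L1 : Tendsto (fun n => -∫ z, h (moll n Γ z) * dt ψ z) atTop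
      (𝓝 (-∫ z, h (Γ z) * dt ψ z)) :=
    ((S.h_tendsto H).integral_mul TendstoL2.const (fun n => memLp_h H (moll_memLp n S.Γ2))
      (memLp_h H S.Γ2) (fun _ => fderiv_apply_memLp hψ.c1 hψ.compact _ 2)
      (fderiv_apply_memLp hψ.c1 hψ.compact _ 2)).neg
  refine tendsto_nhds_unique (((L1.comp hns.tendsto_atTop).add
    (L2'.comp hns.tendsto_atTop)).add L3) (tendsto_const_nhds.congr' ?_)
  have ev : ∀ᶠ n : ℕ in atTop, 0 = -(∫ z, h (moll n Γ z) * dt ψ z)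
      + (∑ i : Fin 3, ∫ z, G z i * moll n (dx i (v n)) z)
      + ∫ z, lowOrder b G z * moll n (v n) z := by
    filter_upwards [eventually_isTest_moll hψ.compact isOpen_openCylOffAxis hψ.supp, Vsupp]
      with n hn hsupp
    have hT := hn (v n) (pc n).continuous.locallyIntegrable
      (fun z hz => by simp [hv, image_eq_zero_of_notMem_tsupport hz])
    have heq := S.eqn _ hT
    -- the time derivative
    have et : ∫ z, Γ z * dt (moll n (v n)) z = ∫ z, h (moll n Γ z) * dt ψ z := by
      have f1 : ∀ z, dt (moll n (v n)) z = moll n (dt (v n)) z := fun z =>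
        fderiv_moll n (pc n) (pcs n) z _
      have dvi : Integrable (dt (v n)) :=
        (continuous_fderiv_apply (pc n) _).integrable_of_hasCompactSupport
          (fderiv_apply_compact (pcs n) _)
      simp only [f1]
      rw [← integral_moll_mul n S.Γint dvi]
      rw [show (fun z => moll n Γ z * dt (v n) z) = fun z => moll n Γ z * fderiv ℝ (v n) z (0, 1)
        from rfl, integral_mul_fderiv (S.moll_c1 n) (pc n) (pcs n)]
      rw [show (fun z => h (moll n Γ z) * dt ψ z) = fun z => h (moll n Γ z) * fderiv ℝ ψ z (0, 1)
        from rfl, integral_mul_fderiv (S.hmoll_c1 H n) hψ.c1 hψ.compact]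
      congr 1
      refine integral_congr_ae (ae_of_all _ fun z => ?_)
      simp only [hv]
      rw [S.fderiv_hmoll H]
      ring
    have i1 : Integrable fun z => Γ z * dt (moll n (v n)) z :=
      S.Γ2.integrable_mul (fderiv_apply_memLp hT.c1 hT.compact _ 2)
    have i2 : ∀ i, Integrable fun z => G z i * dx i (moll n (v n)) z := fun i =>
      (S.Gi2 i).integrable_mul (fderiv_apply_memLp hT.c1 hT.compact _ 2)
    have i3 : Integrable fun z => lowOrder b G z * moll n (v n) z := by
      have : IntegrableOn (fun z => lowOrder b G z * moll n (v n) z) K :=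
        IntegrableOn.mul_continuousOn hQ hT.smooth.continuous.continuousOn hK
      exact this.integrable_of_forall_notMem_eq_zero (fun z hz => by rw [hsupp z hz, mul_zero])
    have e : ∀ z, (-(Γ z * dt (moll n (v n)) z)
          + (∑ i : Fin 3, b z i * G z i) * moll n (v n) z
          + ∑ i : Fin 3, G z i * dx i (moll n (v n)) z
          + 2 / axisDist z.1 ^ 2 * (z.1 0 * G z 0 + z.1 1 * G z 1) * moll n (v n) z)
        = -(Γ z * dt (moll n (v n)) z) + (∑ i : Fin 3, G z i * dx i (moll n (v n)) z)
          + lowOrder b G z * moll n (v n) z := by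
      intro z; simp only [lowOrder]; ring
    simp only [e] at heq
    have i1' : Integrable fun z => -(Γ z * dt (moll n (v n)) z) := i1.neg
    have i2' : Integrable fun z => ∑ i : Fin 3, G z i * dx i (moll n (v n)) z :=
      integrable_finsetSum _ fun i _ => i2 i
    have i12 : Integrable fun z => -(Γ z * dt (moll n (v n)) z)
        + ∑ i : Fin 3, G z i * dx i (moll n (v n)) z := i1'.add i2'
    rw [integral_add i12 i3, integral_add i1' i2', integral_neg,
      integral_finsetSum _ fun i _ => i2 i, et] at heq
    rw [← heq]
    congr 2
    refine Finset.sum_congr rfl fun i _ => ?_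
    rw [dx_moll_fun n (pc n) (pcs n)]
  exact hns.tendsto_atTop.eventually ev

end Sol

/-! ### Test functions with rotational symmetry -/

/-- The square of the distance to the axis. -/
def r2 (x : E) : ℝ := x 0 ^ 2 + x 1 ^ 2

lemma r2_nonneg (x : E) : 0 ≤ r2 x := by unfold r2; positivity

lemma axisDist_sq (x : E) : axisDist x ^ 2 = r2 x := Real.sq_sqrt (r2_nonneg x)

lemma normSq_eq (x : E) : ‖x‖ ^ 2 = x 0 ^ 2 + x 1 ^ 2 + x 2 ^ 2 := by
  rw [EuclideanSpace.norm_sq_eq]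
  simp [Fin.sum_univ_three]

lemma abs_coord_le (x : E) (i : Fin 3) : |x i| ≤ ‖x‖ := PiLp.norm_apply_le x i

lemma hasFDerivAt_coord (i : Fin 3) (z : ST) :
    HasFDerivAt (fun z : ST => z.1 i)
      ((EuclideanSpace.proj (𝕜 := ℝ) i).comp (ContinuousLinearMap.fst ℝ E ℝ)) z :=
  ((EuclideanSpace.proj (𝕜 := ℝ) i).comp (ContinuousLinearMap.fst ℝ E ℝ)).hasFDerivAt

lemma contDiff_coord (i : Fin 3) : ContDiff ℝ ∞ fun z : ST => z.1 i :=
  ((EuclideanSpace.proj (𝕜 := ℝ) i).comp (ContinuousLinearMap.fst ℝ E ℝ)).contDiff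

lemma contDiff_normSq : ContDiff ℝ ∞ fun z : ST => ‖z.1‖ ^ 2 := contDiff_fst.norm_sq ℝ

lemma contDiff_r2 : ContDiff ℝ ∞ fun z : ST => r2 z.1 := by
  unfold r2
  exact ((contDiff_coord 0).pow 2).add ((contDiff_coord 1).pow 2)

/-- The indicator of the two directions orthogonal to the axis. -/
def perp (i : Fin 3) : ℝ := if i = 2 then 0 else 1

lemma fderiv_comp_real {f : ST → ℝ} {σ : ℝ → ℝ} (hf : ContDiff ℝ ∞ f) (hσ : ContDiff ℝ ∞ σ)
    (z d : ST) : fderiv ℝ (fun z => σ (f z)) z d = deriv σ (f z) * fderiv ℝ f z d := by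
  have h := ((hσ.differentiable (by simp)) (f z)).hasDerivAt.comp_hasFDerivAt z
    ((hf.differentiable (by simp)) z).hasFDerivAt
  have h' : fderiv ℝ (fun z => σ (f z)) z = _ := h.fderiv
  rw [h']
  simp

lemma dx_normSq (i : Fin 3) (z : ST) :
    fderiv ℝ (fun z : ST => ‖z.1‖ ^ 2) z (EuclideanSpace.single i 1, 0) = 2 * z.1 i := by
  have h0 := fun j => hasFDerivAt_coord j z
  have h := (((h0 0).pow 2).add ((h0 1).pow 2)).add ((h0 2).pow 2)
  have e : (fun z : ST => ‖z.1‖ ^ 2) = fun z : ST => z.1 0 ^ 2 + z.1 1 ^ 2 + z.1 2 ^ 2 := by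
    ext z; exact normSq_eq z.1
  have h' : fderiv ℝ (fun z : ST => z.1 0 ^ 2 + z.1 1 ^ 2 + z.1 2 ^ 2) z = _ := h.fderiv
  rw [e, h']
  fin_cases i <;> simp

lemma dx_r2 (i : Fin 3) (z : ST) :
    fderiv ℝ (fun z : ST => r2 z.1) z (EuclideanSpace.single i 1, 0) = perp i * (2 * z.1 i) := by
  have h0 := fun j => hasFDerivAt_coord j z
  have h := ((h0 0).pow 2).add ((h0 1).pow 2)
  have h' : fderiv ℝ (fun z : ST => r2 z.1) z = _ := h.fderiv
  rw [h']
  fin_cases i <;> simp [perp]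

lemma dt_normSq (z : ST) : fderiv ℝ (fun z : ST => ‖z.1‖ ^ 2) z (0, 1) = 0 := by
  have h0 := fun j => hasFDerivAt_coord j z
  have h := (((h0 0).pow 2).add ((h0 1).pow 2)).add ((h0 2).pow 2)
  have e : (fun z : ST => ‖z.1‖ ^ 2) = fun z : ST => z.1 0 ^ 2 + z.1 1 ^ 2 + z.1 2 ^ 2 := by
    ext z; exact normSq_eq z.1
  have h' : fderiv ℝ (fun z : ST => z.1 0 ^ 2 + z.1 1 ^ 2 + z.1 2 ^ 2) z = _ := h.fderiv
  rw [e, h']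
  simp

lemma dt_r2 (z : ST) : fderiv ℝ (fun z : ST => r2 z.1) z (0, 1) = 0 := by
  have h0 := fun j => hasFDerivAt_coord j z
  have h := ((h0 0).pow 2).add ((h0 1).pow 2)
  have h' : fderiv ℝ (fun z : ST => r2 z.1) z = _ := h.fderiv
  rw [h']
  simp

lemma fderiv_snd_apply (z d : ST) : fderiv ℝ (fun z : ST => z.2) z d = d.2 := by
  have h' : fderiv ℝ (fun z : ST => z.2) z = _ :=
    (ContinuousLinearMap.snd ℝ E ℝ).hasFDerivAt (x := z) |>.fderiv
  rw [h']; rfl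

/-- The product test function `σ(|x|²) η(t) χ(r²)`. -/
noncomputable def tens (σ η χ : ℝ → ℝ) (z : ST) : ℝ := σ (‖z.1‖ ^ 2) * η z.2 * χ (r2 z.1)

section tens
variable {σ η χ : ℝ → ℝ}

lemma tens_contDiff (hσ : ContDiff ℝ ∞ σ) (hη : ContDiff ℝ ∞ η) (hχ : ContDiff ℝ ∞ χ) :
    ContDiff ℝ ∞ (tens σ η χ) :=
  ((hσ.comp contDiff_normSq).mul (hη.comp contDiff_snd)).mul (hχ.comp contDiff_r2)

lemma fderiv_tens (hσ : ContDiff ℝ ∞ σ) (hη : ContDiff ℝ ∞ η) (hχ : ContDiff ℝ ∞ χ) (z d : ST) :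
    fderiv ℝ (tens σ η χ) z d =
      deriv σ (‖z.1‖ ^ 2) * fderiv ℝ (fun z : ST => ‖z.1‖ ^ 2) z d * η z.2 * χ (r2 z.1)
      + σ (‖z.1‖ ^ 2) * (deriv η z.2 * d.2) * χ (r2 z.1)
      + σ (‖z.1‖ ^ 2) * η z.2 * (deriv χ (r2 z.1) * fderiv ℝ (fun z : ST => r2 z.1) z d) := by
  have c1 : ∀ {f : ST → ℝ}, ContDiff ℝ ∞ f → ContDiff ℝ 1 f := fun h =>
    h.of_le (by simp)
  have hs := hσ.comp contDiff_normSq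
  have he := hη.comp (contDiff_snd (E := E) (F := ℝ) (𝕜 := ℝ) (n := ∞))
  have hc := hχ.comp contDiff_r2
  have e1 := Sol.fderiv_mul_apply' (c1 (hs.mul he)) (c1 hc) z d
  have e2 := Sol.fderiv_mul_apply' (c1 hs) (c1 he) z d
  have f1 := fderiv_comp_real contDiff_normSq hσ z d
  have f2 := fderiv_comp_real (contDiff_snd (E := E) (F := ℝ) (𝕜 := ℝ) (n := ∞)) hη z d
  have f3 := fderiv_comp_real contDiff_r2 hχ z d
  rw [fderiv_snd_apply] at f2
  simp only [Function.comp_def] at e1 e2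
  have e0 : tens σ η χ = fun z => σ (‖z.1‖ ^ 2) * η z.2 * χ (r2 z.1) := rfl
  rw [e0, e1, e2, f1, f2, f3]
  ring

lemma dx_tens (hσ : ContDiff ℝ ∞ σ) (hη : ContDiff ℝ ∞ η) (hχ : ContDiff ℝ ∞ χ) (z : ST)
    (i : Fin 3) : dx i (tens σ η χ) z = 2 * z.1 i * η z.2 *
      (deriv σ (‖z.1‖ ^ 2) * χ (r2 z.1) + perp i * σ (‖z.1‖ ^ 2) * deriv χ (r2 z.1)) := by
  rw [dx, fderiv_tens hσ hη hχ, dx_normSq, dx_r2]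
  ring

lemma dt_tens (hσ : ContDiff ℝ ∞ σ) (hη : ContDiff ℝ ∞ η) (hχ : ContDiff ℝ ∞ χ) (z : ST) :
    dt (tens σ η χ) z = σ (‖z.1‖ ^ 2) * deriv η z.2 * χ (r2 z.1) := by
  rw [dt, fderiv_tens hσ hη hχ, dt_normSq, dt_r2]
  ring

end tens

/-- A smooth bounded profile `σ` with `σ = 0` on `[a, ∞)` for some `0 < a < 1`, to be used as
`σ(|x|²)`; the constant `C` bounds `σ` and `σ'`. -/
structure Profile (σ : ℝ → ℝ) (a C : ℝ) : Prop where
  smooth : ContDiff ℝ ∞ σ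
  apos : 0 < a
  a1 : a < 1
  zero : ∀ s, a ≤ s → σ s = 0
  bd : ∀ s, |σ s| ≤ C
  bd' : ∀ s, |deriv σ s| ≤ C

namespace Profile
variable {σ : ℝ → ℝ} {a C : ℝ}

lemma deriv_continuous (P : Profile σ a C) : Continuous (deriv σ) :=
  P.smooth.continuous_deriv (by simp)

lemma deriv_zero (P : Profile σ a C) (s : ℝ) (hs : a ≤ s) : deriv σ s = 0 := by
  have hd : HasDerivAt σ (deriv σ s) s :=
    (P.smooth.differentiable (by simp) s).hasDerivAt
  have h1 : HasDerivWithinAt σ (deriv σ s) (Ici s) s := hd.hasDerivWithinAt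
  have h2 : HasDerivWithinAt σ 0 (Ici s) s := by
    refine (hasDerivWithinAt_const s (Ici s) (0 : ℝ)).congr ?_ ?_
    · intro x hx; exact P.zero x (hs.trans hx)
    · exact P.zero s hs
  exact (uniqueDiffWithinAt_Ici s).eq_deriv _ h1 h2

lemma coord_bd (P : Profile σ a C) (x : E) (i : Fin 3) : |x i * deriv σ (‖x‖ ^ 2)| ≤ C := by
  by_cases h : a ≤ ‖x‖ ^ 2
  · rw [P.deriv_zero _ h]; simp; exact (abs_nonneg _).trans (P.bd 0)
  · have hx : ‖x‖ ≤ 1 := by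
      have := P.a1
      have h0 := norm_nonneg x
      nlinarith
    rw [abs_mul]
    calc |x i| * |deriv σ (‖x‖ ^ 2)| ≤ 1 * C :=
          mul_le_mul ((abs_coord_le x i).trans hx) (P.bd' _) (abs_nonneg _) zero_le_one
      _ = C := one_mul C

end Profile

lemma isTest_of_zero {U : Set ST} {ψ : ST → ℝ} (hs : ContDiff ℝ ∞ ψ) {K : Set ST}
    (hK : IsCompact K) (hKU : K ⊆ U) (hz : ∀ z ∉ K, ψ z = 0) : IsTest U ψ := by
  have hsub : tsupport ψ ⊆ K :=
    closure_minimal (fun z hz' => by by_contra h; exact hz' (hz z h)) hK.isClosed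
  exact ⟨hs, hK.of_isClosed_subset isClosed_closure hsub, hsub.trans hKU⟩

lemma isTest_tens_openCyl {σ η χ : ℝ → ℝ} {a C t₀ t₁ : ℝ} (P : Profile σ a C)
    (hη : ContDiff ℝ ∞ η) (hχ : ContDiff ℝ ∞ χ) (h0 : -1 < t₀) (h1 : t₁ < 0)
    (hz : ∀ t ∉ Icc t₀ t₁, η t = 0) : IsTest openCyl (tens σ η χ) := by
  refine isTest_of_zero (tens_contDiff P.smooth hη hχ)
    (K := closedBall (0 : E) (Real.sqrt a) ×ˢ Icc t₀ t₁)
    ((isCompact_closedBall _ _).prod isCompact_Icc) ?_ ?_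
  · rintro ⟨x, t⟩ ⟨hx, ht⟩
    refine ⟨?_, lt_of_lt_of_le h0 ht.1, lt_of_le_of_lt ht.2 h1⟩
    simp only [mem_closedBall, dist_zero_right, mem_ball] at hx ⊢
    refine lt_of_le_of_lt hx ?_
    rw [Real.sqrt_lt' one_pos]
    simpa using P.a1
  · rintro ⟨x, t⟩ hxt
    unfold tens
    by_cases ht : t ∈ Icc t₀ t₁
    · have hx : x ∉ closedBall (0 : E) (Real.sqrt a) := fun hx => hxt ⟨hx, ht⟩
      simp only [mem_closedBall, dist_zero_right, not_le] at hx
      have : a ≤ ‖x‖ ^ 2 := by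
        have := Real.sq_sqrt P.apos.le
        have h0 := Real.sqrt_nonneg a
        nlinarith
      simp [P.zero _ this]
    · simp [hz t ht]

lemma isTest_tens_offAxis {σ η χ : ℝ → ℝ} {a C t₀ t₁ δ : ℝ} (P : Profile σ a C)
    (hη : ContDiff ℝ ∞ η) (hχ : ContDiff ℝ ∞ χ) (h0 : -1 < t₀) (h1 : t₁ < 0)
    (hz : ∀ t ∉ Icc t₀ t₁, η t = 0) (δpos : 0 < δ) (hχz : ∀ s ≤ δ, χ s = 0) :
    IsTest openCylOffAxis (tens σ η χ) := by
  have T := isTest_tens_openCyl P hη hχ h0 h1 hz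
  refine isTest_of_zero T.smooth (K := tsupport (tens σ η χ) ∩ {z | δ ≤ r2 z.1})
    (T.compact.isCompact.inter_right (isClosed_le continuous_const contDiff_r2.continuous)) ?_ ?_
  · rintro z ⟨hz1, hz2⟩
    refine ⟨T.supp hz1, ?_⟩
    exact Real.sqrt_pos.2 (lt_of_lt_of_le δpos hz2)
  · intro z hz'
    by_cases hz1 : z ∈ tsupport (tens σ η χ)
    · have : ¬ δ ≤ r2 z.1 := fun h => hz' ⟨hz1, h⟩
      simp [tens, hχz _ (not_le.1 this).le]
    · exact image_eq_zero_of_notMem_tsupport hz1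

namespace Sol
variable {b : ST → E} {Γ : ST → ℝ} {G : ST → E} {h h1 h2 : ℝ → ℝ} {B : ℝ}

/-- The inner product of a space-time vector field with the position `x`. -/
def dotx (F : ST → E) (z : ST) : ℝ := ∑ i : Fin 3, z.1 i * F z i

/-- The `(2 / r) ∂ᵣ` term, integrated by parts off the axis; note that `div (2 e_r / r) = 0`. -/
lemma axis_term_parts (S : Sol b Γ G) (H : C2B h h1 h2 B) {σ η χ : ℝ → ℝ} {a C t₀ t₁ δ : ℝ}
    (P : Profile σ a C) (hη : ContDiff ℝ ∞ η) (hχ : ContDiff ℝ ∞ χ) (h0 : -1 < t₀) (h1' : t₁ < 0)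
    (hz : ∀ t ∉ Icc t₀ t₁, η t = 0) (δpos : 0 < δ) (hχz : ∀ s ≤ δ, χ s = 0) :
    Integrable (fun z =>
      2 / axisDist z.1 ^ 2 * (z.1 0 * G z 0 + z.1 1 * G z 1) * (h1 (Γ z) * tens σ η χ z)) ∧
    ∫ z, 2 / axisDist z.1 ^ 2 * (z.1 0 * G z 0 + z.1 1 * G z 1) * (h1 (Γ z) * tens σ η χ z)
      = -∫ z, h (Γ z) * (4 * η z.2 * (deriv σ (‖z.1‖ ^ 2) * χ (r2 z.1)
        + σ (‖z.1‖ ^ 2) * deriv χ (r2 z.1))) := by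
  -- `k(s) = 2 χ(s) / s` is smooth
  set k : ℝ → ℝ := fun s => 2 * χ s / s with hk
  have kz : ∀ s ≤ δ, k s = 0 := fun s hs => by simp [hk, hχz s hs]
  have kd : ∀ s ≠ 0, HasDerivAt k (2 * deriv χ s / s - 2 * χ s / s ^ 2) s := by
    intro s hs
    have := (((hχ.differentiable (by simp)) s).hasDerivAt.const_mul 2).div (hasDerivAt_id s) hs
    refine this.congr_deriv ?_
    simp only [id]
    field_simp
  have kc : ContDiff ℝ ∞ k := by
    rw [contDiff_iff_contDiffAt]
    intro s
    by_cases hs : s < δ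
    · have : k =ᶠ[𝓝 s] fun _ => 0 := by
        filter_upwards [gt_mem_nhds hs] with u hu using kz u hu.le
      exact contDiffAt_const.congr_of_eventuallyEq this
    · have hs' : s ≠ 0 := by rintro rfl; exact hs δpos
      exact (contDiffAt_const.mul hχ.contDiffAt).div contDiffAt_id hs'
  have T := isTest_tens_offAxis P hη kc h0 h1' hz δpos kz
  have Tx : ∀ i : Fin 3, IsTest openCyl (fun z => z.1 i * tens σ η k z) := by
    intro i
    refine ⟨(contDiff_coord i).mul T.smooth, T.compact.mul_left, ?_⟩
    refine (closure_mono ?_).trans (T.supp.trans openCylOffAxis_subset)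
    intro z hz hz'
    exact hz (by simp [hz'])
  have w := fun i => S.weak_chain H (Tx i) i
  have dT : ∀ i : Fin 3, ∀ z : ST, dx i (fun z => z.1 i * tens σ η k z) z
      = tens σ η k z + z.1 i * dx i (tens σ η k) z := by
    intro i z
    rw [dx, fderiv_mul_apply' ((contDiff_coord i).of_le (by simp)) T.c1]
    rw [(hasFDerivAt_coord i z).fderiv]
    simp [dx]
  have ii : ∀ i : Fin 3, Integrable fun z => h (Γ z) * dx i (fun z => z.1 i * tens σ η k z) z :=
    fun i => (memLp_h H S.Γ2).integrable_mul (fderiv_apply_memLp (Tx i).c1 (Tx i).compact _ 2)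
  have jj : ∀ i : Fin 3, Integrable fun z => h1 (Γ z) * G z i * (z.1 i * tens σ η k z) :=
    fun i => (S.kG_memLp H.c1 H.b1 i).integrable_mul ((Tx i).memLp 2)
  have sum := congrArg₂ (· + ·) (w 0) (w 1)
  simp only at sum
  rw [← integral_add (ii 0) (ii 1), ← neg_add, ← integral_add (jj 0) (jj 1)] at sum
  have e1 : (fun z => 2 / axisDist z.1 ^ 2 * (z.1 0 * G z 0 + z.1 1 * G z 1) *
      (h1 (Γ z) * tens σ η χ z)) = fun z => h1 (Γ z) * G z 0 * (z.1 0 * tens σ η k z)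
      + h1 (Γ z) * G z 1 * (z.1 1 * tens σ η k z) := by
    ext z
    simp only [tens, hk, axisDist_sq]
    ring
  rw [e1]
  refine ⟨(jj 0).add (jj 1), ?_⟩
  rw [← neg_eq_iff_eq_neg.2 sum.symm.symm, neg_inj]
  refine integral_congr_ae (ae_of_all _ fun z => ?_)
  simp only [dT, dx_tens P.smooth hη kc]
  have p0 : perp 0 = 1 := by simp [perp]
  have p1 : perp 1 = 1 := by simp [perp]
  rw [p0, p1]
  by_cases hs : r2 z.1 < δ
  · have dk : deriv k (r2 z.1) = 0 := by
      have : k =ᶠ[𝓝 (r2 z.1)] fun _ => 0 := by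
        filter_upwards [gt_mem_nhds hs] with u hu using kz u hu.le
      rw [this.deriv_eq]; simp
    have dχ : deriv χ (r2 z.1) = 0 := by
      have : χ =ᶠ[𝓝 (r2 z.1)] fun _ => 0 := by
        filter_upwards [gt_mem_nhds hs] with u hu using hχz u hu.le
      rw [this.deriv_eq]; simp
    simp [tens, kz _ hs.le, hχz _ hs.le, dk, dχ]
  · have hs' : r2 z.1 ≠ 0 := by intro h; rw [h] at hs; exact hs δpos
    rw [(kd _ hs').deriv]
    simp only [tens, hk]
    have hr : r2 z.1 = z.1 0 ^ 2 + z.1 1 ^ 2 := rfl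
    have : z.1 0 ^ 2 = r2 z.1 - z.1 1 ^ 2 := by rw [hr]; ring
    field_simp
    ring_nf
    rw [this]
    ring

end Sol

/-! ### The equation across the axis -/

lemma volume_axis : volume {z : ST | axisDist z.1 = 0} = 0 := by
  set L : ST →ₗ[ℝ] ℝ :=
    ((EuclideanSpace.proj (𝕜 := ℝ) (0 : Fin 3)).comp (ContinuousLinearMap.fst ℝ E ℝ) :
      ST →L[ℝ] ℝ).toLinearMap with hL
  have hne : LinearMap.ker L ≠ ⊤ := by
    intro h
    have : (EuclideanSpace.single (0 : Fin 3) (1 : ℝ), (0 : ℝ)) ∈ LinearMap.ker L := by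
      rw [h]; trivial
    simp [hL] at this
  refine measure_mono_null ?_ (Measure.addHaar_submodule volume (LinearMap.ker L) hne)
  intro z hz
  have h0 : r2 z.1 = 0 := by rw [← axisDist_sq, show axisDist z.1 = 0 from hz]; norm_num
  have : z.1 0 = 0 := by
    unfold r2 at h0
    nlinarith [sq_nonneg (z.1 0), sq_nonneg (z.1 1)]
  simpa [hL] using this

lemma normSq_sum (v : E) : ‖v‖ ^ 2 = ∑ i : Fin 3, v i ^ 2 := by
  rw [normSq_eq, Fin.sum_univ_three]

lemma abs_perp_dot_le (x g : E) : |x 0 * g 0 + x 1 * g 1| ≤ 2 * (axisDist x * ‖g‖) := by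
  have hx : ∀ i : Fin 3, i = 0 ∨ i = 1 → |x i| ≤ axisDist x := by
    intro i hi
    unfold axisDist
    apply Real.abs_le_sqrt
    rcases hi with rfl | rfl <;> nlinarith [sq_nonneg (x 0), sq_nonneg (x 1)]
  have h0 := mul_le_mul (hx 0 (Or.inl rfl)) (abs_coord_le g 0) (abs_nonneg _) (Real.sqrt_nonneg _)
  have h1 := mul_le_mul (hx 1 (Or.inr rfl)) (abs_coord_le g 1) (abs_nonneg _) (Real.sqrt_nonneg _)
  calc _ ≤ |x 0 * g 0| + |x 1 * g 1| := abs_add_le _ _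
    _ = |x 0| * |g 0| + |x 1| * |g 1| := by rw [abs_mul, abs_mul]
    _ ≤ _ := by unfold axisDist at *; linarith

lemma smoothTransition_smooth : ContDiff ℝ ∞ Real.smoothTransition :=
  Real.smoothTransition.contDiff

lemma exists_smoothTransition_deriv_bound :
    ∃ D : ℝ, 0 ≤ D ∧ ∀ s, |deriv Real.smoothTransition s| ≤ D := by
  have hc : Continuous (deriv Real.smoothTransition) :=
    smoothTransition_smooth.continuous_deriv (by simp)
  have hz : ∀ s ∉ Icc (0 : ℝ) 1, deriv Real.smoothTransition s = 0 := by
    intro s hs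
    rw [mem_Icc, not_and_or, not_le, not_le] at hs
    rcases hs with hs | hs
    · have : Real.smoothTransition =ᶠ[𝓝 s] fun _ => 0 := by
        filter_upwards [gt_mem_nhds hs] with u hu using Real.smoothTransition.zero_of_nonpos hu.le
      rw [this.deriv_eq]; simp
    · have : Real.smoothTransition =ᶠ[𝓝 s] fun _ => 1 := by
        filter_upwards [lt_mem_nhds hs] with u hu using Real.smoothTransition.one_of_one_le hu.le
      rw [this.deriv_eq]; simp
  obtain ⟨D, hD⟩ := (isCompact_Icc (a := (0 : ℝ)) (b := 1)).exists_bound_of_continuousOn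
    hc.continuousOn
  refine ⟨max D 0, le_max_right _ _, fun s => ?_⟩
  by_cases hs : s ∈ Icc (0 : ℝ) 1
  · exact (hD s hs).trans (le_max_left _ _)
  · rw [hz s hs]; simp

lemma smoothTransition_deriv_zero {s : ℝ} (hs : s < 0 ∨ 1 < s) :
    deriv Real.smoothTransition s = 0 := by
  rcases hs with hs | hs
  · have : Real.smoothTransition =ᶠ[𝓝 s] fun _ => 0 := by
      filter_upwards [gt_mem_nhds hs] with u hu using Real.smoothTransition.zero_of_nonpos hu.le
    rw [this.deriv_eq]; simp
  · have : Real.smoothTransition =ᶠ[𝓝 s] fun _ => 1 := by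
      filter_upwards [lt_mem_nhds hs] with u hu using Real.smoothTransition.one_of_one_le hu.le
    rw [this.deriv_eq]; simp

/-- The profile in `r²` that removes the axis: it vanishes for `r ≤ 1 / n` and is `1` for
`r² ≥ 2 / n²`. -/
noncomputable def offAxisCut (n : ℕ) (s : ℝ) : ℝ := Real.smoothTransition ((n : ℝ) ^ 2 * s - 1)

lemma offAxisCut_contDiff (n : ℕ) : ContDiff ℝ ∞ (offAxisCut n) :=
  smoothTransition_smooth.comp
    ((contDiff_const.mul contDiff_id).sub contDiff_const)

lemma deriv_offAxisCut (n : ℕ) (s : ℝ) :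
    deriv (offAxisCut n) s = (n : ℝ) ^ 2 * deriv Real.smoothTransition ((n : ℝ) ^ 2 * s - 1) := by
  have h1 : HasDerivAt Real.smoothTransition
      (deriv Real.smoothTransition ((n : ℝ) ^ 2 * s - 1)) ((n : ℝ) ^ 2 * s - 1) :=
    (smoothTransition_smooth.differentiable (by simp) _).hasDerivAt
  have h2 : HasDerivAt (fun s : ℝ => (n : ℝ) ^ 2 * s - 1) ((n : ℝ) ^ 2) s := by
    simpa using ((hasDerivAt_id s).const_mul ((n : ℝ) ^ 2)).sub_const 1
  have h3 : HasDerivAt (offAxisCut n)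
      (deriv Real.smoothTransition ((n : ℝ) ^ 2 * s - 1) * (n : ℝ) ^ 2) s := h1.comp s h2
  rw [h3.deriv, mul_comm]

lemma abs_offAxisCut_le (n : ℕ) (s : ℝ) : |offAxisCut n s| ≤ 1 := by
  rw [offAxisCut, abs_of_nonneg (Real.smoothTransition.nonneg _)]
  exact Real.smoothTransition.le_one _

/-- The thin tube around the axis. -/
def tube (n : ℕ) : Set ST := {z | axisDist z.1 < 2 / (n : ℝ)}

lemma measurableSet_tube (n : ℕ) : MeasurableSet (tube n) :=
  measurableSet_lt (Sol.measurable_axisDist.comp measurable_fst) measurable_const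

lemma measurableSet_cyl (R : ℝ) : MeasurableSet (cyl R) :=
  measurableSet_ball.prod measurableSet_Ioc

namespace Sol
variable {b : ST → E} {Γ : ST → ℝ} {G : ST → E} {h h1 h2 : ℝ → ℝ} {B : ℝ}

lemma h_integrable (S : Sol b Γ G) (H : C2B h h1 h2 B) : Integrable fun z => h (Γ z) :=
  integrable_of_zero (memLp_h H S.Γ2) (fun z hz => by simp [S.Γz z hz, H.z0])

lemma normSq_integrable (S : Sol b Γ G) : Integrable fun z => ‖G z‖ ^ 2 := S.G2.integrable_norm_pow
  (by norm_num)

lemma Gi_integrable (S : Sol b Γ G) (i : Fin 3) : Integrable fun z => G z i :=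
  integrable_of_zero (S.Gi2 i) (fun z hz => by simp [S.Gz z hz])

lemma hb_integrable (S : Sol b Γ G) (H : C2B h h1 h2 B) (i : Fin 3) :
    Integrable fun z => h (Γ z) * b z i := (memLp_h H S.Γ2).integrable_mul (S.bi2 i)

section
variable {σ : ℝ → ℝ} {a C : ℝ}

lemma measurable_prof (P : Profile σ a C) : Measurable fun z : ST => σ (‖z.1‖ ^ 2) :=
  (P.smooth.continuous.comp contDiff_normSq.continuous).measurable

lemma measurable_prof' (P : Profile σ a C) : Measurable fun z : ST => deriv σ (‖z.1‖ ^ 2) :=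
  (P.deriv_continuous.comp contDiff_normSq.continuous).measurable

lemma measurable_xprof' (P : Profile σ a C) (i : Fin 3) :
    Measurable fun z : ST => z.1 i * deriv σ (‖z.1‖ ^ 2) :=
  ((contDiff_coord i).continuous.measurable).mul (measurable_prof' P)

lemma int_hσ (S : Sol b Γ G) (H : C2B h h1 h2 B) (P : Profile σ a C) :
    Integrable fun z => σ (‖z.1‖ ^ 2) * h (Γ z) :=
  (S.h_integrable H).bdd_mul (c := C) (measurable_prof P).aestronglyMeasurable
    (ae_of_all _ fun _ => P.bd _)

lemma int_hσ' (S : Sol b Γ G) (H : C2B h h1 h2 B) (P : Profile σ a C) :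
    Integrable fun z => deriv σ (‖z.1‖ ^ 2) * h (Γ z) :=
  (S.h_integrable H).bdd_mul (c := C) (measurable_prof' P).aestronglyMeasurable
    (ae_of_all _ fun _ => P.bd' _)

lemma int_energy (S : Sol b Γ G) (H : C2B h h1 h2 B) (P : Profile σ a C) :
    Integrable fun z => σ (‖z.1‖ ^ 2) * (h2 (Γ z) * ‖G z‖ ^ 2) :=
  ((S.normSq_integrable).bdd_mul (c := B) (H.c2.measurable.comp S.mΓ).aestronglyMeasurable
    (ae_of_all _ fun _ => H.b2 _)).bdd_mul (c := C)
    (measurable_prof P).aestronglyMeasurable (ae_of_all _ fun _ => P.bd _)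

lemma int_grad (S : Sol b Γ G) (H : C2B h h1 h2 B) (P : Profile σ a C) :
    Integrable fun z => h1 (Γ z) * (deriv σ (‖z.1‖ ^ 2) * dotx G z) := by
  have : ∀ i : Fin 3, Integrable fun z : ST =>
      h1 (Γ z) * ((z.1 i * deriv σ (‖z.1‖ ^ 2)) * G z i) := fun i =>
    (((S.Gi_integrable i).bdd_mul (c := C) (measurable_xprof' P i).aestronglyMeasurable
      (ae_of_all _ fun _ => P.coord_bd _ _))).bdd_mul (c := B)
      (H.c1.measurable.comp S.mΓ).aestronglyMeasurable (ae_of_all _ fun _ => H.b1 _)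
  refine (integrable_finsetSum Finset.univ fun i _ => this i).congr
    (ae_of_all _ fun z => ?_)
  simp only [dotx, Fin.sum_univ_three]
  ring

lemma int_drift (S : Sol b Γ G) (H : C2B h h1 h2 B) (P : Profile σ a C) :
    Integrable fun z => h (Γ z) * (deriv σ (‖z.1‖ ^ 2) * dotx b z) := by
  have : ∀ i : Fin 3, Integrable fun z : ST =>
      (z.1 i * deriv σ (‖z.1‖ ^ 2)) * (h (Γ z) * b z i) := fun i =>
    (S.hb_integrable H i).bdd_mul (c := C) (measurable_xprof' P i).aestronglyMeasurable
      (ae_of_all _ fun _ => P.coord_bd _ _)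
  refine (integrable_finsetSum Finset.univ fun i _ => this i).congr
    (ae_of_all _ fun z => ?_)
  simp only [dotx, Fin.sum_univ_three]
  ring

lemma int_bG (S : Sol b Γ G) (H : C2B h h1 h2 B) (P : Profile σ a C) :
    Integrable fun z => σ (‖z.1‖ ^ 2) * (h1 (Γ z) * ∑ i : Fin 3, b z i * G z i) :=
  (S.bG_integrable.bdd_mul (c := B) (H.c1.measurable.comp S.mΓ).aestronglyMeasurable
    (ae_of_all _ fun _ => H.b1 _)).bdd_mul (c := C)
    (measurable_prof P).aestronglyMeasurable (ae_of_all _ fun _ => P.bd _)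

end

/-- The spatial terms of the renormalized equation for `h(Γ)` tested with `σ(|x|²)`: the energy
density, the diffusion, the drift, and the term `(2 / r) ∂ᵣ`. -/
noncomputable def flux (b : ST → E) (Γ : ST → ℝ) (G : ST → E) (h h1 h2 σ : ℝ → ℝ) (z : ST) : ℝ :=
  σ (‖z.1‖ ^ 2) * (h2 (Γ z) * ‖G z‖ ^ 2)
    + 2 * (h1 (Γ z) * (deriv σ (‖z.1‖ ^ 2) * dotx G z))
    - 2 * (h (Γ z) * (deriv σ (‖z.1‖ ^ 2) * dotx b z))
    - 4 * (deriv σ (‖z.1‖ ^ 2) * h (Γ z))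

lemma flux_integrable (S : Sol b Γ G) (H : C2B h h1 h2 B) {σ : ℝ → ℝ} {a C : ℝ}
    (P : Profile σ a C) : Integrable (flux b Γ G h h1 h2 σ) :=
  (((S.int_energy H P).add ((S.int_grad H P).const_mul 2)).sub
    ((S.int_drift H P).const_mul 2)).sub ((S.int_hσ' H P).const_mul 4)

set_option maxHeartbeats 400000 in
/-- The renormalized equation across the axis: since `Γ` vanishes on the axis, no boundary term
appears there. -/
lemma renormalized (S : Sol b Γ G) (H : C2B h h1 h2 B) {σ η : ℝ → ℝ} {a C t₀ t₁ : ℝ}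
    (P : Profile σ a C) (hη : ContDiff ℝ ∞ η) (h0 : -1 < t₀) (h1' : t₁ < 0)
    (hz : ∀ t ∉ Icc t₀ t₁, η t = 0) :
    ∫ z, deriv η z.2 * (σ (‖z.1‖ ^ 2) * h (Γ z)) = ∫ z, η z.2 * flux b Γ G h h1 h2 σ z := by
  -- bounds for `η` and `η'`
  have ηc : HasCompactSupport η := HasCompactSupport.intro isCompact_Icc hz
  obtain ⟨Cη, hCη⟩ := ηc.exists_bound_of_continuous hη.continuous
  have η'cont : Continuous (deriv η) := hη.continuous_deriv (by simp)
  obtain ⟨Dη, hDη⟩ := (ηc.deriv).exists_bound_of_continuous η'cont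
  obtain ⟨D, D0, hD⟩ := exists_smoothTransition_deriv_bound
  have mη : AEStronglyMeasurable (fun z : ST => η z.2) volume :=
    (hη.continuous.comp continuous_snd).aestronglyMeasurable
  have mη' : AEStronglyMeasurable (fun z : ST => deriv η z.2) volume :=
    (η'cont.comp continuous_snd).aestronglyMeasurable
  have bη : ∀ {f : ST → ℝ}, Integrable f → Integrable fun z => η z.2 * f z := fun hf =>
    hf.bdd_mul (c := Cη) mη (ae_of_all _ fun _ => hCη _)
  have bη' : ∀ {f : ST → ℝ}, Integrable f → Integrable fun z => deriv η z.2 * f z := fun hf =>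
    hf.bdd_mul (c := Dη) mη' (ae_of_all _ fun _ => hDη _)
  -- the radius of a smaller cylinder that contains the support
  obtain ⟨R, R0, R1, hRa, hRt⟩ : ∃ R : ℝ, 0 < R ∧ R < 1 ∧ a ≤ R ^ 2 ∧ -R ^ 2 < t₀ := by
    set m := max a (-t₀) with hm
    have hm1 : m < 1 := max_lt P.a1 (by linarith)
    have hm0 : 0 < m := lt_of_lt_of_le P.apos (le_max_left _ _)
    refine ⟨Real.sqrt ((m + 1) / 2), Real.sqrt_pos.2 (by linarith), ?_, ?_, ?_⟩
    · rw [Real.sqrt_lt' one_pos]; linarith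
    · rw [Real.sq_sqrt (by linarith)]; linarith [le_max_left a (-t₀)]
    · rw [Real.sq_sqrt (by linarith)]; linarith [le_max_right a (-t₀)]
  -- the main part and the part supported near the axis
  set f : ST → ℝ := fun z => -(deriv η z.2 * (σ (‖z.1‖ ^ 2) * h (Γ z)))
    + η z.2 * (σ (‖z.1‖ ^ 2) * (h2 (Γ z) * ‖G z‖ ^ 2)
      + 2 * (h1 (Γ z) * (deriv σ (‖z.1‖ ^ 2) * dotx G z))
      + σ (‖z.1‖ ^ 2) * (h1 (Γ z) * ∑ i : Fin 3, b z i * G z i)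
      - 4 * (deriv σ (‖z.1‖ ^ 2) * h (Γ z))) with hf
  have fi : Integrable f :=
    (bη' (S.int_hσ H P)).neg.add (bη ((((S.int_energy H P).add ((S.int_grad H P).const_mul 2)).add
      (S.int_bG H P)).sub ((S.int_hσ' H P).const_mul 4)))
  set g : ST → ℝ := fun z => η z.2 * σ (‖z.1‖ ^ 2) *
    (2 * h1 (Γ z) * (z.1 0 * G z 0 + z.1 1 * G z 1) - 4 * h (Γ z)) with hg
  have main : ∀ n : ℕ, 0 < n → ∫ z, (f z * offAxisCut n (r2 z.1)
      + deriv (offAxisCut n) (r2 z.1) * g z) = 0 := by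
    intro n hn
    have n0 : (0 : ℝ) < n := by exact_mod_cast hn
    set χ := offAxisCut n with hχ
    have χs : ContDiff ℝ ∞ χ := offAxisCut_contDiff n
    have δpos : (0 : ℝ) < 1 / (n : ℝ) ^ 2 := by positivity
    have χz : ∀ s ≤ 1 / (n : ℝ) ^ 2, χ s = 0 := by
      intro s hs
      refine Real.smoothTransition.zero_of_nonpos ?_
      rw [le_div_iff₀ (by positivity)] at hs
      linarith
    have T := isTest_tens_offAxis P hη χs h0 h1' hz δpos χz
    obtain ⟨ai, ap⟩ := S.axis_term_parts H P hη χs h0 h1' hz δpos χz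
    have ren := S.renormalized_offAxis H T
    obtain ⟨CT, hCT⟩ := T.bdd
    have i1 : Integrable fun z => h (Γ z) * dt (tens σ η χ) z :=
      (memLp_h H S.Γ2).integrable_mul (fderiv_apply_memLp T.c1 T.compact _ 2)
    have i2 : ∀ i : Fin 3, Integrable fun z => G z i *
        (h2 (Γ z) * G z i * tens σ η χ z + h1 (Γ z) * dx i (tens σ η χ) z) := fun i =>
      (S.Gi2 i).integrable_mul
        (S.grad_prod_tendsto H.d2 H.c2 H.b2 (T.mono openCylOffAxis_subset) i).2.1
    have i3 : Integrable fun z => (∑ i : Fin 3, b z i * G z i) * (h1 (Γ z) * tens σ η χ z) := by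
      have := (S.bG_integrable.bdd_mul (c := B) (H.c1.measurable.comp S.mΓ).aestronglyMeasurable
        (ae_of_all _ fun _ => H.b1 _)).bdd_mul (c := CT)
        T.smooth.continuous.aestronglyMeasurable (ae_of_all _ fun _ => hCT _)
      refine this.congr (ae_of_all _ fun z => ?_)
      simp only [Function.comp]; ring
    have i4 : Integrable fun z => h (Γ z) * (4 * η z.2 * (deriv σ (‖z.1‖ ^ 2) * χ (r2 z.1)
        + σ (‖z.1‖ ^ 2) * deriv χ (r2 z.1))) := by
      refine MemLp.integrable_mul (p := 2) (q := 2) (memLp_h H S.Γ2)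
        (Continuous.memLp_of_hasCompactSupport ?_ ?_)
      · have c1 := P.deriv_continuous.comp contDiff_normSq.continuous
        have c2 := P.smooth.continuous.comp contDiff_normSq.continuous
        have c3 := χs.continuous.comp contDiff_r2.continuous
        have c4 := (χs.continuous_deriv (by simp)).comp contDiff_r2.continuous
        have c5 := hη.continuous.comp (continuous_snd (X := E) (Y := ℝ))
        exact (continuous_const.mul c5).mul ((c1.mul c3).add (c2.mul c4))
      · refine HasCompactSupport.intro
          (K := closedBall (0 : E) (Real.sqrt a) ×ˢ Icc t₀ t₁)
          ((isCompact_closedBall _ _).prod isCompact_Icc) ?_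
        rintro ⟨x, t⟩ hxt
        by_cases ht : t ∈ Icc t₀ t₁
        · have hx : x ∉ closedBall (0 : E) (Real.sqrt a) := fun hx => hxt ⟨hx, ht⟩
          simp only [mem_closedBall, dist_zero_right, not_le] at hx
          have : a ≤ ‖x‖ ^ 2 := by
            have := Real.sq_sqrt P.apos.le
            have h0 := Real.sqrt_nonneg a
            nlinarith
          simp [P.zero _ this, P.deriv_zero _ this]
        · simp [hz t ht]
    have e3 : ∫ z, lowOrder b G z * (h1 (Γ z) * tens σ η χ z)
        = (∫ z, (∑ i : Fin 3, b z i * G z i) * (h1 (Γ z) * tens σ η χ z))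
          - ∫ z, h (Γ z) * (4 * η z.2 * (deriv σ (‖z.1‖ ^ 2) * χ (r2 z.1)
        + σ (‖z.1‖ ^ 2) * deriv χ (r2 z.1))) := by
      rw [sub_eq_add_neg, ← ap, ← integral_add i3 ai]
      refine integral_congr_ae (ae_of_all _ fun z => ?_)
      simp only [lowOrder]; ring
    have i1' : Integrable fun z => -(h (Γ z) * dt (tens σ η χ) z) := i1.neg
    have i2' := integrable_finsetSum Finset.univ fun i _ => i2 i
    have i12 : Integrable fun z => -(h (Γ z) * dt (tens σ η χ) z) + ∑ i : Fin 3, G z i *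
        (h2 (Γ z) * G z i * tens σ η χ z + h1 (Γ z) * dx i (tens σ η χ) z) := i1'.add i2'
    have i34 : Integrable fun z => (∑ i : Fin 3, b z i * G z i) * (h1 (Γ z) * tens σ η χ z)
        - h (Γ z) * (4 * η z.2 * (deriv σ (‖z.1‖ ^ 2) * χ (r2 z.1)
        + σ (‖z.1‖ ^ 2) * deriv χ (r2 z.1))) := i3.sub i4
    rw [e3, ← integral_sub i3 i4, ← integral_neg, ← integral_finsetSum _ fun i _ => i2 i,
      ← integral_add i1' i2', ← integral_add i12 i34] at ren
    rw [← ren]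
    refine integral_congr_ae (ae_of_all _ fun z => ?_)
    simp only [hf, hg, dt_tens P.smooth hη χs, dx_tens P.smooth hη χs, normSq_sum (G z), dotx,
      Fin.sum_univ_three, tens]
    have p0 : perp 0 = 1 := by simp [perp]
    have p1 : perp 1 = 1 := by simp [perp]
    have p2 : perp 2 = 0 := by simp [perp]
    rw [p0, p1, p2]
    ring
  -- the part near the axis is small
  set Cσ := C with hCσ
  set M : ℝ := |Cη| * |C| * D * (8 * B + 4 * B) with hM
  have bad : ∀ n : ℕ, 0 < n → ∀ z, ‖deriv (offAxisCut n) (r2 z.1) * g z‖ ≤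
      M * ((tube n).indicator (fun z => ‖G z‖ ^ 2) z
        + (n : ℝ) ^ 2 * (cyl R ∩ tube n).indicator (fun z => |Γ z|) z) := by
    intro n hn z
    have n0 : (0 : ℝ) < n := by exact_mod_cast hn
    have hB := H.nonneg
    have M0 : 0 ≤ M := by positivity
    have rhs0 : 0 ≤ M * ((tube n).indicator (fun z => ‖G z‖ ^ 2) z
        + (n : ℝ) ^ 2 * (cyl R ∩ tube n).indicator
          (fun z => |Γ z|) z) := by
      refine mul_nonneg M0 (add_nonneg (indicator_nonneg (fun _ _ => by positivity) _)
        (mul_nonneg (by positivity) (indicator_nonneg (fun _ _ => by positivity) _)))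
    by_cases hs : (n : ℝ) ^ 2 * r2 z.1 - 1 < 0 ∨ 1 < (n : ℝ) ^ 2 * r2 z.1 - 1
    · rw [deriv_offAxisCut, smoothTransition_deriv_zero hs]
      simpa using rhs0
    push Not at hs
    have hr : axisDist z.1 < 2 / (n : ℝ) := by
      rw [axisDist, Real.sqrt_lt' (by positivity)]
      have : r2 z.1 ≤ 2 / (n : ℝ) ^ 2 := by
        rw [le_div_iff₀ (by positivity)]; linarith [hs.2]
      calc z.1 0 ^ 2 + z.1 1 ^ 2 ≤ 2 / (n : ℝ) ^ 2 := this
        _ < (2 / (n : ℝ)) ^ 2 := by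
          rw [div_pow]
          apply div_lt_div_of_pos_right _ (by positivity)
          norm_num
    by_cases hzR : z ∈ cyl R
    swap
    · -- outside the smaller cylinder the test function or `Γ` vanishes
      have : g z = 0 := by
        have hcase : a ≤ ‖z.1‖ ^ 2 ∨ z.2 ∉ Icc t₀ t₁ := by
          by_contra hcon
          push Not at hcon
          apply hzR
          refine ⟨?_, ?_, ?_⟩
          · simp only [mem_ball, dist_zero_right]
            have h0 := norm_nonneg z.1
            nlinarith [hcon.1]
          · exact hRt.trans_le hcon.2.1
          · exact hcon.2.2.trans h1'.le
        rcases hcase with hc | hc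
        · simp [hg, P.zero _ hc]
        · simp [hg, hz _ hc]
      rw [this]; simpa using rhs0
    rw [indicator_of_mem (show z ∈ tube n from hr), indicator_of_mem
      (show z ∈ cyl R ∩ tube n from ⟨hzR, hr⟩)]
    rw [deriv_offAxisCut, norm_mul, norm_mul]
    simp only [Real.norm_eq_abs, hg]
    have b1 : |(n : ℝ) ^ 2| * |deriv Real.smoothTransition ((n : ℝ) ^ 2 * r2 z.1 - 1)|
        ≤ (n : ℝ) ^ 2 * D := by
      rw [abs_of_nonneg (by positivity)]
      exact mul_le_mul_of_nonneg_left (hD _) (by positivity)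
    have b2 : |η z.2 * σ (‖z.1‖ ^ 2)| ≤ |Cη| * |C| := by
      rw [abs_mul]
      exact mul_le_mul ((hCη _).trans (le_abs_self _)) ((P.bd _).trans (le_abs_self _))
        (abs_nonneg _) (abs_nonneg _)
    -- Young's inequality with `|h'(Γ)|² ≤ B² |Γ|`
    have b3 : (n : ℝ) ^ 2 * |2 * h1 (Γ z) * (z.1 0 * G z 0 + z.1 1 * G z 1) - 4 * h (Γ z)| ≤
        (8 * B + 4 * B) * (‖G z‖ ^ 2 + (n : ℝ) ^ 2 * |Γ z|) := by
      have q1 := abs_perp_dot_le z.1 (G z)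
      have q2 : axisDist z.1 * ‖G z‖ ≤ 2 / n * ‖G z‖ :=
        mul_le_mul_of_nonneg_right hr.le (norm_nonneg _)
      have q3 : |h1 (Γ z)| ^ 2 ≤ B ^ 2 * |Γ z| := by
        have a1 := H.b1 (Γ z)
        have a2 := H.abs_le1 (Γ z)
        have a3 := abs_nonneg (h1 (Γ z))
        calc |h1 (Γ z)| ^ 2 = |h1 (Γ z)| * |h1 (Γ z)| := sq _
          _ ≤ B * (B * |Γ z|) := mul_le_mul a1 a2 a3 hB
          _ = _ := by ring
      have q4 := H.abs_le (Γ z)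
      have q5 : (n : ℝ) ^ 2 * |2 * h1 (Γ z) * (z.1 0 * G z 0 + z.1 1 * G z 1)| ≤
          8 * (n * |h1 (Γ z)|) * ‖G z‖ := by
        rw [abs_mul, abs_mul, abs_two]
        calc (n : ℝ) ^ 2 * (2 * |h1 (Γ z)| * |z.1 0 * G z 0 + z.1 1 * G z 1|)
            ≤ (n : ℝ) ^ 2 * (2 * |h1 (Γ z)| * (2 * (2 / n * ‖G z‖))) := by
              gcongr
              exact q1.trans (by linarith)
          _ = 8 * (n * |h1 (Γ z)|) * ‖G z‖ := by field_simp; ring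
      have q6 : 8 * (n * |h1 (Γ z)|) * ‖G z‖ ≤ 8 * B * (‖G z‖ ^ 2 + (n : ℝ) ^ 2 * |Γ z|) := by
        rcases hB.eq_or_lt with hB0 | hB0
        · have : |h1 (Γ z)| = 0 := le_antisymm (hB0 ▸ H.b1 _) (abs_nonneg _)
          rw [this, ← hB0]; simp
        · have y1 : 0 ≤ (n * |h1 (Γ z)| - B * ‖G z‖) ^ 2 := sq_nonneg _
          have y2 : (n : ℝ) ^ 2 * |h1 (Γ z)| ^ 2 ≤ (n : ℝ) ^ 2 * (B ^ 2 * |Γ z|) := by gcongr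
          have y4 : 0 ≤ n * |h1 (Γ z)| * ‖G z‖ := by positivity
          have y3 : B * (n * |h1 (Γ z)| * ‖G z‖)
              ≤ B * (B * (‖G z‖ ^ 2 + (n : ℝ) ^ 2 * |Γ z|)) := by
            have : 0 ≤ B ^ 2 * ‖G z‖ ^ 2 + (n : ℝ) ^ 2 * (B ^ 2 * |Γ z|) := by positivity
            nlinarith [mul_nonneg hB y4]
          have := le_of_mul_le_mul_left y3 hB0
          nlinarith
      have q7 : (n : ℝ) ^ 2 * |4 * h (Γ z)| ≤ 4 * B * (‖G z‖ ^ 2 + (n : ℝ) ^ 2 * |Γ z|) := by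
        rw [abs_mul, abs_of_pos (by norm_num : (0 : ℝ) < 4)]
        have : (n : ℝ) ^ 2 * |h (Γ z)| ≤ (n : ℝ) ^ 2 * (B * |Γ z|) := by gcongr
        have h0 : 0 ≤ B * ‖G z‖ ^ 2 := by positivity
        nlinarith
      have q8 := abs_sub (2 * h1 (Γ z) * (z.1 0 * G z 0 + z.1 1 * G z 1)) (4 * h (Γ z))
      calc _ ≤ (n : ℝ) ^ 2 * (|2 * h1 (Γ z) * (z.1 0 * G z 0 + z.1 1 * G z 1)|
              + |4 * h (Γ z)|) := by gcongr
        _ ≤ _ := by rw [mul_add]; linarith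
    calc |(n : ℝ) ^ 2| * |deriv Real.smoothTransition ((n : ℝ) ^ 2 * r2 z.1 - 1)| *
          |η z.2 * σ (‖z.1‖ ^ 2) * (2 * h1 (Γ z) * (z.1 0 * G z 0 + z.1 1 * G z 1) - 4 * h (Γ z))|
        ≤ ((n : ℝ) ^ 2 * D) * (|Cη| * |C| *
          |2 * h1 (Γ z) * (z.1 0 * G z 0 + z.1 1 * G z 1) - 4 * h (Γ z)|) := by
          rw [abs_mul (η z.2 * σ (‖z.1‖ ^ 2))]
          gcongr
      _ = (|Cη| * |C| * D) * ((n : ℝ) ^ 2 *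
          |2 * h1 (Γ z) * (z.1 0 * G z 0 + z.1 1 * G z 1) - 4 * h (Γ z)|) := by ring
      _ ≤ (|Cη| * |C| * D) * ((8 * B + 4 * B) * (‖G z‖ ^ 2 + (n : ℝ) ^ 2 * |Γ z|)) := by gcongr
      _ = _ := by rw [hM]; ring
  -- measurability of the part near the axis
  have gm : Measurable g := by
    have mG := fun i => measurable_coord S.mG i
    have mx := fun i : Fin 3 => (contDiff_coord i).continuous.measurable
    have m1 := H.c1.measurable.comp S.mΓ
    have m0 := H.c0.measurable.comp S.mΓ
    have mη1 := (hη.continuous.comp (continuous_snd (X := E) (Y := ℝ))).measurable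
    exact (mη1.mul (measurable_prof P)).mul (((m1.const_mul 2).mul
      (((mx 0).mul (mG 0)).add ((mx 1).mul (mG 1)))).sub (m0.const_mul 4))
  have badm : ∀ n : ℕ, Measurable fun z => deriv (offAxisCut n) (r2 z.1) * g z := fun n =>
    (((offAxisCut_contDiff n).continuous_deriv (by simp)).comp
      contDiff_r2.continuous).measurable.mul gm
  have iΓ : Integrable fun z => |Γ z| := S.Γint.abs
  have mset : ∀ n : ℕ, MeasurableSet (cyl R ∩ tube n) := fun n =>
    (measurableSet_cyl R).inter (measurableSet_tube n)
  have bound_int : ∀ n : ℕ, Integrable fun z => M * ((tube n).indicator (fun z => ‖G z‖ ^ 2) z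
        + (n : ℝ) ^ 2 * (cyl R ∩ tube n).indicator (fun z => |Γ z|) z) :=
    fun n => ((S.normSq_integrable.indicator (measurableSet_tube n)).add
      ((iΓ.indicator (mset n)).const_mul _)).const_mul _
  have badi : ∀ n : ℕ, 0 < n → Integrable fun z => deriv (offAxisCut n) (r2 z.1) * g z :=
    fun n hn => (bound_int n).mono' (badm n).aestronglyMeasurable (ae_of_all _ (bad n hn))
  have badlim : Tendsto (fun n : ℕ => ∫ z, deriv (offAxisCut n) (r2 z.1) * g z) atTop (𝓝 0) := by
    have l1 : Tendsto (fun n : ℕ => ∫ z, (tube n).indicator (fun z => ‖G z‖ ^ 2) z) atTop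
        (𝓝 (∫ _ : ST, (0 : ℝ))) := by
      refine tendsto_integral_of_dominated_convergence (fun z => ‖G z‖ ^ 2)
        (fun n => (S.normSq_integrable.indicator (measurableSet_tube n)).1)
        S.normSq_integrable (fun n => ae_of_all _ fun z => ?_) ?_
      · rw [Real.norm_eq_abs, abs_of_nonneg (indicator_nonneg (fun _ _ => by positivity) _)]
        exact indicator_le_self' (fun _ _ => by positivity) z
      · have hax : ∀ᵐ z : ST, axisDist z.1 ≠ 0 := by
          rw [ae_iff]; simpa using volume_axis
        filter_upwards [hax] with z hz
        have hpos : 0 < axisDist z.1 := lt_of_le_of_ne (Real.sqrt_nonneg _) hz.symm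
        obtain ⟨N, hN⟩ := exists_nat_gt (2 / axisDist z.1)
        refine tendsto_const_nhds.congr' ?_
        filter_upwards [eventually_ge_atTop N] with n hn
        rw [indicator_of_notMem]
        simp only [tube, mem_ofPred_eq, not_lt]
        have hnN : 2 / axisDist z.1 ≤ n := hN.le.trans (by exact_mod_cast hn)
        have n0 : (0 : ℝ) < n := lt_of_lt_of_le (by positivity) hnN
        rw [div_le_iff₀ n0]
        rw [div_le_iff₀ hpos] at hnN
        linarith
    have l2 : Tendsto (fun n : ℕ => (n : ℝ) ^ 2 *
        ∫ z, (cyl R ∩ tube n).indicator (fun z => |Γ z|) z) atTop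
        (𝓝 0) := by
      have hρ : Tendsto (fun n : ℕ => 2 / (n : ℝ)) atTop (𝓝[>] 0) := by
        refine tendsto_nhdsWithin_iff.2 ⟨tendsto_const_div_atTop_nhds_zero_nat 2, ?_⟩
        filter_upwards [eventually_gt_atTop 0] with n hn
        have : (0 : ℝ) < n := by exact_mod_cast hn
        simp only [mem_Ioi]; positivity
      have := ((S.axis R R0 R1).comp hρ).const_mul 4
      rw [mul_zero] at this
      refine this.congr fun n => ?_
      simp only [Function.comp]
      rw [integral_indicator (mset n), div_pow, inv_div, tube]
      ring
    have l3 := ((l1.add l2).const_mul M)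
    simp only [integral_zero, add_zero, mul_zero] at l3
    refine squeeze_zero_norm' ?_ l3
    filter_upwards [eventually_gt_atTop 0] with n hn
    refine (norm_integral_le_of_norm_le (bound_int n) (ae_of_all _ (bad n hn))).trans
      (le_of_eq ?_)
    rw [integral_const_mul, integral_add (S.normSq_integrable.indicator (measurableSet_tube n))
      ((iΓ.indicator (mset n)).const_mul _), integral_const_mul]
  -- the main part converges
  have mainlim : Tendsto (fun n : ℕ => ∫ z, f z * offAxisCut n (r2 z.1)) atTop (𝓝 (∫ z, f z)) := by
    refine tendsto_integral_of_dominated_convergence (fun z => |f z|) (fun n => ?_) fi.abs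
      (fun n => ae_of_all _ fun z => ?_) ?_
    · exact fi.1.mul ((offAxisCut_contDiff n).continuous.comp
        contDiff_r2.continuous).aestronglyMeasurable
    · rw [norm_mul, Real.norm_eq_abs, Real.norm_eq_abs]
      refine mul_le_of_le_one_right (abs_nonneg _) ?_
      exact abs_offAxisCut_le _ _
    · have hax : ∀ᵐ z : ST, axisDist z.1 ≠ 0 := by
        rw [ae_iff]; simpa using volume_axis
      filter_upwards [hax] with z hz
      have hpos : 0 < r2 z.1 := by
        rw [← axisDist_sq]; positivity
      obtain ⟨N, hN⟩ := exists_nat_gt (2 / r2 z.1)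
      refine tendsto_const_nhds.congr' ?_
      filter_upwards [eventually_ge_atTop N, eventually_ge_atTop 1] with n hn hn1
      have hnN : 2 / r2 z.1 ≤ n := hN.le.trans (by exact_mod_cast hn)
      have n1 : (1 : ℝ) ≤ n := by exact_mod_cast hn1
      rw [div_le_iff₀ hpos] at hnN
      have : offAxisCut n (r2 z.1) = 1 := by
        refine Real.smoothTransition.one_of_one_le ?_
        nlinarith
      rw [this, mul_one]
  have fint : ∀ n : ℕ, Integrable fun z => f z * offAxisCut n (r2 z.1) := by
    intro n
    exact fi.mul_bdd (c := 1)
      ((offAxisCut_contDiff n).continuous.comp contDiff_r2.continuous).aestronglyMeasurable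
      (ae_of_all _ fun z => abs_offAxisCut_le _ _)
  have f0 : ∫ z, f z = 0 := by
    have := mainlim.add badlim
    rw [add_zero] at this
    refine tendsto_nhds_unique this (tendsto_const_nhds.congr' ?_)
    filter_upwards [eventually_gt_atTop 0] with n hn
    rw [← integral_add (fint n) (badi n hn), main n hn]
  -- the drift in divergence form
  have T1 := isTest_tens_openCyl (χ := fun _ => 1) P hη contDiff_const h0 h1' hz
  have dp := S.drift_parts H T1
  have di : ∀ i : Fin 3, Integrable fun z => b z i * (h1 (Γ z) * G z i * tens σ η (fun _ => 1) z
      + h (Γ z) * dx i (tens σ η fun _ => 1) z) := fun i =>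
    (S.bi2 i).integrable_mul (S.grad_prod_tendsto H.d1 H.c1 H.b1 T1 i).2.1
  rw [← integral_finsetSum _ fun i _ => di i] at dp
  have dpi := integrable_finsetSum Finset.univ fun i _ => di i
  have i5 : Integrable fun z => η z.2 * flux b Γ G h h1 h2 σ z := bη (S.flux_integrable H P)
  have i6 : Integrable fun z => deriv η z.2 * (σ (‖z.1‖ ^ 2) * h (Γ z)) := bη' (S.int_hσ H P)
  have fin : ∫ z, (η z.2 * flux b Γ G h h1 h2 σ z - deriv η z.2 * (σ (‖z.1‖ ^ 2) * h (Γ z)))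
      = ∫ z, (f z - ∑ i : Fin 3, b z i * (h1 (Γ z) * G z i * tens σ η (fun _ => 1) z
      + h (Γ z) * dx i (tens σ η fun _ => 1) z)) := by
    refine integral_congr_ae (ae_of_all _ fun z => ?_)
    simp only [hf, flux, dx_tens P.smooth hη contDiff_const, dotx, Fin.sum_univ_three, tens,
      deriv_const]
    ring
  rw [integral_sub fi dpi, f0, dp, sub_zero, integral_sub i5 i6] at fin
  linarith

end Sol

/-! ### From the distributional equation in time to almost every time -/

lemma integrable_cont_mul {F : ℝ → ℝ} {η : ℝ → ℝ} (hη : Continuous η) (hF : Integrable F)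
    (hz : ∀ t ∉ Ioc (-1 : ℝ) 0, F t = 0) : Integrable fun t => η t * F t := by
  have h1 : IntegrableOn (fun t => η t * F t) (Icc (-1 : ℝ) 0) :=
    IntegrableOn.continuousOn_mul hη.continuousOn hF.integrableOn isCompact_Icc
  refine h1.integrable_of_forall_notMem_eq_zero fun t ht => ?_
  rw [hz t (fun h => ht (Ioc_subset_Icc_self h)), mul_zero]

/-- If `W' = -Q` in the sense of distributions on `(-1, 0)`, then `(η W)(t) = ∫_{s ≤ t} (η' W - η Q)`
for almost every `t`, for every smooth `η` vanishing near `-1`. -/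
lemma ae_eq_integral_of_distrib_deriv {W Q : ℝ → ℝ} (hW : Integrable W) (hQ : Integrable Q)
    (Wz : ∀ t ∉ Ioc (-1 : ℝ) 0, W t = 0) (Qz : ∀ t ∉ Ioc (-1 : ℝ) 0, Q t = 0)
    (H : ∀ (η : ℝ → ℝ) (t₀ t₁ : ℝ), ContDiff ℝ ∞ η → -1 < t₀ → t₁ < 0 →
      (∀ t ∉ Icc t₀ t₁, η t = 0) → ∫ t, deriv η t * W t = ∫ t, η t * Q t)
    {η : ℝ → ℝ} {t₀ : ℝ} (hη : ContDiff ℝ ∞ η) (ht₀ : -1 < t₀) (ηz : ∀ t ≤ t₀, η t = 0) :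
    ∀ᵐ t, t ∈ Ioo (-1 : ℝ) 0 →
      η t * W t = ∫ s in Iic t, (deriv η s * W s - η s * Q s) := by
  have η'c : Continuous (deriv η) := hη.continuous_deriv (by simp)
  set P : ℝ → ℝ := fun s => deriv η s * W s - η s * Q s with hP
  have Pi : Integrable P :=
    (integrable_cont_mul η'c hW Wz).sub (integrable_cont_mul hη.continuous hQ Qz)
  have Pz : ∀ t ∉ Ioc (-1 : ℝ) 0, P t = 0 := fun t ht => by simp [hP, Wz t ht, Qz t ht]
  have ηWi : Integrable fun t => η t * W t := integrable_cont_mul hη.continuous hW Wz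
  have hprim : Continuous fun t => ∫ s in Iic t, P s := by
    have : (fun t => ∫ s in Iic t, P s)
        = fun t => (∫ s in (0 : ℝ)..t, P s) + ∫ s in Iic 0, P s := by
      ext t
      rw [← intervalIntegral.integral_Iic_sub_Iic Pi.integrableOn Pi.integrableOn]
      ring
    rw [this]
    exact (intervalIntegral.continuous_primitive (fun _ _ => Pi.intervalIntegrable) 0).add
      continuous_const
  have key : ∀ᵐ t, t ∈ Ioo (-1 : ℝ) 0 → η t * W t - ∫ s in Iic t, P s = 0 := by
    refine isOpen_Ioo.ae_eq_zero_of_integral_contDiff_smul_eq_zero ?_ ?_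
    · exact (ηWi.locallyIntegrable.sub hprim.locallyIntegrable).locallyIntegrableOn _
    intro θ θs θc θsupp
    have θcont := θs.continuous
    -- the support of `θ` lies in `[s₀, s₁]` with `-1 < s₀`, `s₁ < 0`
    obtain ⟨s₁, hs₁, hθ₁⟩ : ∃ s₁ < (0 : ℝ), ∀ t, s₁ < t → θ t = 0 := by
      by_cases hne : (tsupport θ).Nonempty
      · obtain ⟨m, hm, hmax⟩ := θc.isCompact.exists_isMaxOn hne continuousOn_id
        refine ⟨m, (θsupp hm).2, fun t ht => ?_⟩
        by_contra h
        exact absurd (hmax (subset_tsupport _ h)) (not_le.2 ht)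
      · refine ⟨-1, by norm_num, fun t _ => ?_⟩
        by_contra h
        exact hne ⟨t, subset_tsupport _ h⟩
    have θi : Integrable θ := θcont.integrable_of_hasCompactSupport θc
    -- the primitive `Θ(s) = ∫_s^0 θ`
    set Θ : ℝ → ℝ := fun s => ∫ t in s..0, θ t with hΘ
    have Θd : ∀ s, HasDerivAt Θ (-θ s) s := fun s =>
      intervalIntegral.integral_hasDerivAt_left (θcont.intervalIntegrable _ _)
        (θcont.stronglyMeasurableAtFilter volume (𝓝 s)) θcont.continuousAt
    have Θs : ContDiff ℝ ∞ Θ := by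
      rw [contDiff_infty_iff_deriv]
      refine ⟨fun s => (Θd s).differentiableAt, ?_⟩
      have : deriv Θ = fun s => -θ s := funext fun s => (Θd s).deriv
      rw [this]
      exact θs.neg
    have Θz : ∀ s, s₁ < s → Θ s = 0 := by
      intro s hs
      simp only [hΘ]
      rw [intervalIntegral.integral_congr (g := fun _ => 0)]
      · simp
      · intro t ht
        refine hθ₁ t ?_
        rcases le_total s 0 with h | h
        · rw [uIcc_of_le h] at ht; exact hs.trans_le ht.1
        · rw [uIcc_of_ge h] at ht; exact hs₁.trans_le ht.1
    have tst := H (fun t => η t * Θ t) t₀ s₁ (hη.mul Θs) ht₀ hs₁ (by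
      intro t ht
      rw [mem_Icc, not_and_or, not_le, not_le] at ht
      rcases ht with ht | ht
      · rw [ηz t ht.le, zero_mul]
      · rw [Θz t ht, mul_zero])
    have d : ∀ t, deriv (fun t => η t * Θ t) t = deriv η t * Θ t - η t * θ t := by
      intro t
      have h1 : HasDerivAt η (deriv η t) t := (hη.differentiable (by simp) t).hasDerivAt
      have h3 : HasDerivAt (fun t => η t * Θ t) (deriv η t * Θ t + η t * -θ t) t := h1.mul (Θd t)
      rw [h3.deriv]; ring
    simp only [d] at tst
    have Θcont : Continuous Θ := Θs.continuous
    have i1 : Integrable fun t => Θ t * P t := integrable_cont_mul Θcont Pi Pz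
    have i2 : Integrable fun t => θ t * (η t * W t) :=
      integrable_cont_mul θcont ηWi (fun t ht => by simp [Wz t ht])
    have i3 : Integrable fun t => (deriv η t * Θ t - η t * θ t) * W t :=
      integrable_cont_mul ((η'c.mul Θcont).sub (hη.continuous.mul θcont)) hW Wz
    have i4 : Integrable fun t => η t * Θ t * Q t :=
      integrable_cont_mul (hη.continuous.mul Θcont) hQ Qz
    have e1 : ∫ t, θ t * (η t * W t) = ∫ t, Θ t * P t := by
      rw [← sub_eq_zero, ← integral_sub i2 i1]
      have : ∀ t, θ t * (η t * W t) - Θ t * P t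
          = -((deriv η t * Θ t - η t * θ t) * W t - η t * Θ t * Q t) := by
        intro t; simp only [hP]; ring
      simp only [this]
      rw [integral_neg, integral_sub i3 i4, tst]
      simp
    have e2 : ∫ t, θ t * ∫ s in Iic t, P s = ∫ t, Θ t * P t := by
      have hint : Integrable (Function.uncurry fun t s =>
          {p : ℝ × ℝ | p.2 ≤ p.1}.indicator (fun p => θ p.1 * P p.2) (t, s))
          (volume.prod volume) :=
        (θi.mul_prod Pi).indicator (measurableSet_le measurable_snd measurable_fst)
      calc ∫ t, θ t * ∫ s in Iic t, P s
          = ∫ t, ∫ s, {p : ℝ × ℝ | p.2 ≤ p.1}.indicator (fun p => θ p.1 * P p.2) (t, s) := by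
            refine integral_congr_ae (ae_of_all _ fun t => ?_)
            simp only
            rw [← integral_const_mul, ← integral_indicator measurableSet_Iic]
            rfl
        _ = ∫ s, ∫ t, {p : ℝ × ℝ | p.2 ≤ p.1}.indicator (fun p => θ p.1 * P p.2) (t, s) :=
            integral_integral_swap hint
        _ = ∫ t, Θ t * P t := by
            refine integral_congr_ae (ae_of_all _ fun s => ?_)
            simp only
            by_cases hs : s ∈ Ioc (-1 : ℝ) 0
            · have : ∀ t, {p : ℝ × ℝ | p.2 ≤ p.1}.indicator (fun p => θ p.1 * P p.2) (t, s)
                  = (Ioc s 0).indicator θ t * P s + ({s} : Set ℝ).indicator (fun _ => θ s * P s) t := by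
                intro t
                rcases lt_trichotomy t s with h | h | h
                · rw [indicator_of_notMem, indicator_of_notMem, indicator_of_notMem]
                  · simp
                  · simpa using h.ne
                  · simp [h.le]
                  · simpa using h
                · subst h; simp
                · have hne : t ≠ s := h.ne'
                  by_cases h0 : t ≤ 0
                  · rw [indicator_of_mem (by simpa using h.le),
                      indicator_of_mem (show t ∈ Ioc s 0 from ⟨h, h0⟩),
                      indicator_of_notMem (by simpa using hne)]
                    ring
                  · rw [indicator_of_mem (by simpa using h.le),
                      indicator_of_notMem (by simp [h0]), indicator_of_notMem (by simpa using hne)]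
                    simp [hθ₁ t (hs₁.trans (not_le.1 h0))]
              simp only [this]
              rw [integral_add]
              · rw [integral_mul_const, integral_indicator measurableSet_Ioc,
                  integral_indicator (measurableSet_singleton s)]
                simp [hΘ, intervalIntegral.integral_of_le hs.2]
              · exact (θi.indicator measurableSet_Ioc).mul_const _
              · rw [integrable_indicator_iff (measurableSet_singleton s)]
                exact integrableOn_singleton enorm_ne_top (by simp)
            · rw [Pz s hs, mul_zero]
              refine integral_eq_zero_of_ae (ae_of_all _ fun t => ?_)
              change ({p : ℝ × ℝ | p.2 ≤ p.1}.indicator (fun p => θ p.1 * P p.2) (t, s)) = 0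
              rw [indicator_apply]
              split_ifs
              · simp only [Pz s hs, mul_zero]
              · rfl
    simp only [smul_eq_mul, mul_sub]
    rw [integral_sub i2, e1, e2, sub_self]
    refine (θcont.mul hprim).integrable_of_hasCompactSupport θc.mul_right
  filter_upwards [key] with t ht htI
  have := ht htI
  linarith

/-! ### Slicing -/

lemma ae_slice {p : ST → Prop} (h : ∀ᵐ z : ST, p z) : ∀ᵐ t : ℝ, ∀ᵐ x : E, p (x, t) := by
  have h' : ∀ᵐ z ∂((volume : Measure E).prod (volume : Measure ℝ)), p z := h
  have := (Measure.measurePreserving_swap (μ := (volume : Measure ℝ))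
    (ν := (volume : Measure E))).quasiMeasurePreserving.ae h'
  exact Measure.ae_ae_of_ae_prod this

lemma integrable_slice {F : ST → ℝ} (hF : Integrable F) :
    ∀ᵐ t : ℝ, Integrable fun x : E => F (x, t) := hF.prod_left_ae

lemma integral_slice {F : ST → ℝ} (hF : Integrable F) : ∫ z, F z = ∫ t, ∫ x, F (x, t) :=
  integral_prod_symm F hF

lemma lintegral_slice {F : ST → ℝ≥0∞} (hF : Measurable F) :
    ∫⁻ z, F z = ∫⁻ t, ∫⁻ x, F (x, t) := lintegral_prod_symm F hF.aemeasurable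

lemma integral_slice_Iic {F : ST → ℝ} (hF : Integrable F) (T : ℝ) :
    ∫ z in {z : ST | z.2 ≤ T}, F z = ∫ t in Iic T, ∫ x, F (x, t) := by
  have hm : MeasurableSet {z : ST | z.2 ≤ T} := measurableSet_le measurable_snd measurable_const
  rw [← integral_indicator hm, integral_slice (hF.indicator hm), ← integral_indicator
    measurableSet_Iic]
  refine integral_congr_ae (ae_of_all _ fun t => ?_)
  by_cases ht : t ≤ T
  · simp [indicator, ht]
  · simp [indicator, ht]

namespace Sol
variable {b : ST → E} {Γ : ST → ℝ} {G : ST → E} {h h1 h2 : ℝ → ℝ} {B : ℝ}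

lemma zero_time {z : ST} (ht : z.2 ∉ Ioc (-1 : ℝ) 0) : z ∉ cyl 1 := fun hz => ht (by simpa using hz.2)

lemma bdd_mul_time {F : ST → ℝ} {η : ℝ → ℝ} (hη : Continuous η) (hF : Integrable F)
    (hz : ∀ z ∉ cyl 1, F z = 0) : Integrable fun z => η z.2 * F z := by
  obtain ⟨C, hC⟩ := (isCompact_Icc (a := (-1 : ℝ)) (b := 0)).exists_bound_of_continuousOn
    hη.continuousOn
  refine (hF.norm.const_mul C).mono' ((hη.comp continuous_snd).aestronglyMeasurable.mul hF.1)
    (ae_of_all _ fun z => ?_)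
  rw [norm_mul]
  by_cases ht : z.2 ∈ Ioc (-1 : ℝ) 0
  · exact mul_le_mul_of_nonneg_right (hC _ (Ioc_subset_Icc_self ht)) (norm_nonneg _)
  · rw [hz z (zero_time ht)]; simp

lemma flux_zero (S : Sol b Γ G) (z0 : h 0 = 0) (z1 : h1 0 = 0) {σ : ℝ → ℝ} {z : ST}
    (hz : z ∉ cyl 1) : flux b Γ G h h1 h2 σ z = 0 := by
  simp [flux, S.Γz z hz, S.Gz z hz, z0, z1]

/-- The energy identity for `h(Γ)` with the weight `σ(|x|²)` on almost every time slice. -/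
lemma energy_identity (S : Sol b Γ G) (H : C2B h h1 h2 B) {σ : ℝ → ℝ} {a C : ℝ}
    (P : Profile σ a C) {η : ℝ → ℝ} {t₀ : ℝ} (hη : ContDiff ℝ ∞ η) (ht₀ : -1 < t₀)
    (ηz : ∀ t ≤ t₀, η t = 0) :
    ∀ᵐ t, t ∈ Ioo (-1 : ℝ) 0 →
      η t * ∫ x, σ (‖x‖ ^ 2) * h (Γ (x, t)) =
        ∫ z in {z : ST | z.2 ≤ t}, (deriv η z.2 * (σ (‖z.1‖ ^ 2) * h (Γ z))
          - η z.2 * flux b Γ G h h1 h2 σ z) := by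
  have Wi := S.int_hσ H P
  have Qi := S.flux_integrable H P
  have Wz : ∀ z ∉ cyl 1, σ (‖z.1‖ ^ 2) * h (Γ z) = 0 := fun z hz => by simp [S.Γz z hz, H.z0]
  have Qz : ∀ z ∉ cyl 1, flux b Γ G h h1 h2 σ z = 0 := fun z hz => S.flux_zero H.z0 H.z1 hz
  have η'c : Continuous (deriv η) := hη.continuous_deriv (by simp)
  have key := ae_eq_integral_of_distrib_deriv (W := fun t => ∫ x, σ (‖x‖ ^ 2) * h (Γ (x, t)))
    (Q := fun t => ∫ x, flux b Γ G h h1 h2 σ (x, t)) Wi.integral_prod_right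
    Qi.integral_prod_right ?_ ?_ ?_ hη ht₀ ηz
  · have i1 := bdd_mul_time η'c Wi Wz
    have i2 := bdd_mul_time hη.continuous Qi Qz
    filter_upwards [key] with t ht htI
    have i12 : Integrable (fun z : ST => deriv η z.2 * (σ (‖z.1‖ ^ 2) * h (Γ z))
        - η z.2 * flux b Γ G h h1 h2 σ z) := i1.sub i2
    rw [ht htI, integral_slice_Iic i12]
    refine integral_congr_ae (ae_restrict_of_ae ?_)
    filter_upwards [integrable_slice i1, integrable_slice i2] with s hs1 hs2
    rw [integral_sub hs1 hs2, integral_const_mul, integral_const_mul]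
  · intro t ht
    refine integral_eq_zero_of_ae (ae_of_all _ fun x => ?_)
    exact Wz (x, t) (zero_time ht)
  · intro t ht
    refine integral_eq_zero_of_ae (ae_of_all _ fun x => ?_)
    exact Qz (x, t) (zero_time ht)
  · intro θ s₀ s₁ hθ h0 h1' hz
    have := S.renormalized H P hθ h0 h1' hz
    rw [integral_slice (bdd_mul_time (hθ.continuous_deriv (by simp)) Wi Wz),
      integral_slice (bdd_mul_time hθ.continuous Qi Qz)] at this
    simpa only [integral_const_mul] using this

end Sol

/-! ### Local Sobolev functions on time slices -/

/-- `u` has the weak gradient `g` in every ball of radius less than `1`, in the sense of local `L²`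
approximation by `C¹` functions. -/
structure SliceH1 (u : E → ℝ) (g : E → E) : Prop where
  mu : Measurable u
  mg : Measurable g
  u2 : MemLp u 2 volume
  g2 : MemLp g 2 volume
  approx : ∀ r < 1, ∀ δ > 0, ∃ v : E → ℝ, ContDiff ℝ 1 v ∧
    eLpNorm (v - u) 2 (volume.restrict (ball 0 r)) ≤ δ ∧
    ∀ i : Fin 3, eLpNorm ((fun x => fderiv ℝ v x (EuclideanSpace.single i 1)) - fun x => g x i) 2
      (volume.restrict (ball 0 r)) ≤ δ

lemma exists_subseq_ae_of_lintegral {α : Type*} [MeasurableSpace α] {μ : Measure α}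
    {f : ℕ → α → ℝ≥0∞} (hf : ∀ n, Measurable (f n))
    (h : Tendsto (fun n => ∫⁻ x, f n x ∂μ) atTop (𝓝 0)) :
    ∃ ns : ℕ → ℕ, StrictMono ns ∧ ∀ᵐ x ∂μ, Tendsto (fun n => f (ns n) x) atTop (𝓝 0) := by
  obtain ⟨ns, hns, hle⟩ := Filter.extraction_forall_of_eventually'
    (P := fun n k => ∫⁻ x, f k x ∂μ ≤ (2⁻¹ : ℝ≥0∞) ^ n) (fun n =>
      eventually_atTop.1 ((h.eventually_lt_const
        (u := (2⁻¹ : ℝ≥0∞) ^ n) (ENNReal.pow_pos (by simp) n)).mono fun k hk => hk.le))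
  refine ⟨ns, hns, ?_⟩
  have hs : ∫⁻ x, ∑' n, f (ns n) x ∂μ ≠ ⊤ := by
    rw [lintegral_tsum fun n => (hf _).aemeasurable]
    refine ne_top_of_le_ne_top ?_ (ENNReal.tsum_le_tsum hle)
    rw [ENNReal.tsum_geometric]
    simp
  filter_upwards [ae_lt_top (Measurable.tsum fun n => hf _) hs] with x hx
  exact ENNReal.tendsto_atTop_zero_of_tsum_ne_top hx.ne

lemma memLp_slice {F : Type*} [NormedAddCommGroup F] [MeasurableSpace F] [BorelSpace F]
    [SecondCountableTopology F] {f : ST → F} (mf : Measurable f) (hf : MemLp f 2 volume) :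
    ∀ᵐ t : ℝ, MemLp (fun x : E => f (x, t)) 2 volume := by
  have hi : Integrable (fun z => ‖f z‖ ^ 2) := hf.integrable_norm_pow (p := 2) (by norm_num)
  filter_upwards [integrable_slice hi] with t ht
  have m : AEStronglyMeasurable (fun x : E => f (x, t)) volume :=
    (mf.comp measurable_prodMk_right).aestronglyMeasurable
  exact (memLp_two_iff_integrable_sq_norm m).2 ht

namespace Sol
variable {b : ST → E} {Γ : ST → ℝ} {G : ST → E}

lemma moll_measurable (S : Sol b Γ G) (n : ℕ) : Measurable (moll n Γ) :=
  (S.moll_continuous n).measurable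

lemma fderiv_slice (S : Sol b Γ G) (n : ℕ) (x : E) (t : ℝ) (i : Fin 3) :
    fderiv ℝ (fun y : E => moll n Γ (y, t)) x (EuclideanSpace.single i 1)
      = dx i (moll n Γ) (x, t) := by
  have h1 : HasFDerivAt (fun y : E => (y, t)) (ContinuousLinearMap.inl ℝ E ℝ) x := by
    simpa using hasFDerivAt_prodMk_left x t
  have h2 := (((S.moll_c1 n).differentiable (by simp)) (x, t)).hasFDerivAt
  have h3 : HasFDerivAt (fun y : E => moll n Γ (y, t)) _ x := h2.comp x h1
  rw [h3.fderiv]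
  simp [dx]

/-- Almost every time slice of a solution is a local Sobolev function. -/
lemma sliceH1 (S : Sol b Γ G) :
    ∀ᵐ t : ℝ, t ∈ Ioo (-1 : ℝ) 0 → SliceH1 (fun x => Γ (x, t)) (fun x => G (x, t)) := by
  have mG := fun i => measurable_coord S.mG i
  have mmG : ∀ n i, Measurable (moll n fun w => G w i) := fun n i =>
    (moll_contDiff n (locInt_of_L2 (S.Gi2 i))).continuous.measurable
  set f : ℕ → ST → ℝ≥0∞ := fun n z => ‖moll n Γ z - Γ z‖ₑ ^ 2
    + ∑ i : Fin 3, ‖moll n (fun w => G w i) z - G z i‖ₑ ^ 2 with hf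
  have mf : ∀ n, Measurable (f n) := fun n =>
    (((S.moll_measurable n).sub S.mΓ).enorm.pow_const 2).add
      (Finset.measurable_sum _ fun i _ => ((mmG n i).sub (mG i)).enorm.pow_const 2)
  have hlim : Tendsto (fun n => ∫⁻ z, f n z) atTop (𝓝 0) := by
    have e : ∀ n, ∫⁻ z, f n z = eLpNorm (moll n Γ - Γ) 2 volume ^ 2
        + ∑ i : Fin 3, eLpNorm ((moll n fun w => G w i) - fun w => G w i) 2 volume ^ 2 := by
      intro n
      simp only [hf, eLpNorm_two_sq, Pi.sub_apply]
      have m0 : Measurable fun z => ‖moll n Γ z - Γ z‖ₑ ^ 2 :=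
        ((S.moll_measurable n).sub S.mΓ).enorm.pow_const 2
      have mi : ∀ i ∈ (Finset.univ : Finset (Fin 3)),
          Measurable fun z => ‖moll n (fun w => G w i) z - G z i‖ₑ ^ 2 :=
        fun i _ => ((mmG n i).sub (mG i)).enorm.pow_const 2
      rw [lintegral_add_left m0, lintegral_finsetSum _ mi]
    simp only [e]
    have h0 := ENNReal.Tendsto.pow (n := 2) (moll_tendsto S.Γ2)
    have hi := tendsto_finsetSum (Finset.univ : Finset (Fin 3)) fun i _ =>
      ENNReal.Tendsto.pow (n := 2) (moll_tendsto (S.Gi2 i))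
    simpa using h0.add hi
  have hlim' : Tendsto (fun n => ∫⁻ t : ℝ, ∫⁻ x : E, f n (x, t)) atTop (𝓝 0) := by
    simpa only [lintegral_slice (mf _)] using hlim
  obtain ⟨ns, hns, hae⟩ := exists_subseq_ae_of_lintegral
    (fun n => (mf n).lintegral_prod_left') hlim'
  filter_upwards [hae, memLp_slice S.mΓ S.Γ2, memLp_slice S.mG S.G2] with t ht hΓ hG htI
  refine ⟨S.mΓ.comp measurable_prodMk_right, S.mG.comp measurable_prodMk_right, hΓ, hG, ?_⟩
  intro r hr δ hδ
  have hK : IsCompact (closedBall (0 : E) r ×ˢ ({t} : Set ℝ)) :=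
    (isCompact_closedBall _ _).prod isCompact_singleton
  have hKs : closedBall (0 : E) r ×ˢ ({t} : Set ℝ) ⊆ openCyl :=
    prod_mono (closedBall_subset_ball hr) (singleton_subset_iff.2 htI)
  have e1 := hns.tendsto_atTop.eventually
    (eventually_closedBall_subset hK isOpen_openCyl hKs)
  have hδ' : (0 : ℝ≥0∞) < δ ^ 2 := ENNReal.pow_pos hδ 2
  obtain ⟨n, hn, hn'⟩ := (e1.and (ht.eventually_lt_const hδ')).exists
  have conv : ∀ {F : E → ℝ}, ∫⁻ x, ‖F x‖ₑ ^ 2 ≤ δ ^ 2 →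
      eLpNorm F 2 (volume.restrict (ball 0 r)) ≤ δ := by
    intro F hF
    have : eLpNorm F 2 (volume.restrict (ball 0 r)) ^ 2 ≤ δ ^ 2 := by
      rw [eLpNorm_two_sq]
      exact (setLIntegral_le_lintegral _ _).trans hF
    exact (ENNReal.pow_le_pow_left_iff (by norm_num)).1 this
  refine ⟨fun x => moll (ns n) Γ (x, t), (S.moll_c1 _).comp (contDiff_prodMk_left t), ?_, ?_⟩
  · refine conv (le_trans (lintegral_mono fun x => ?_) hn'.le)
    simp only [hf, Pi.sub_apply]
    exact le_self_add
  · intro i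
    have : eLpNorm ((fun x => fderiv ℝ (fun y : E => moll (ns n) Γ (y, t)) x
          (EuclideanSpace.single i 1)) - fun x => G (x, t) i) 2 (volume.restrict (ball 0 r))
        = eLpNorm (fun x => moll (ns n) (fun w => G w i) (x, t) - G (x, t) i) 2
          (volume.restrict (ball 0 r)) := by
      refine eLpNorm_congr_ae ?_
      filter_upwards [ae_restrict_mem measurableSet_ball] with x hx
      simp only [Pi.sub_apply]
      rw [S.fderiv_slice, S.dx_moll _ (hn (x, t) ⟨ball_subset_closedBall hx, rfl⟩)]
    rw [this]
    refine conv (le_trans (lintegral_mono fun x => ?_) hn'.le)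
    simp only [hf]
    refine le_trans ?_ le_add_self
    exact Finset.single_le_sum
      (f := fun i => ‖moll (ns n) (fun w => G w i) (x, t) - G (x, t) i‖ₑ ^ 2)
      (fun _ _ => zero_le) (Finset.mem_univ i)

end Sol

/-! ### The chain rule for Lipschitz functions -/

/-- The primitive of `k` vanishing at `0`. -/
noncomputable def prim (k : ℝ → ℝ) (s : ℝ) : ℝ := ∫ x in (0 : ℝ)..s, k x

/-- Pointwise limits of continuous functions bounded by `B`. -/
def BddLim (B : ℝ) (k : ℝ → ℝ) : Prop :=
  ∃ kn : ℕ → ℝ → ℝ, (∀ n, Continuous (kn n)) ∧ (∀ n s, |kn n s| ≤ B) ∧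
    ∀ s, Tendsto (fun n => kn n s) atTop (𝓝 (k s))

lemma bddLim_of_continuous {k : ℝ → ℝ} {B : ℝ} (kc : Continuous k) (kb : ∀ s, |k s| ≤ B) :
    BddLim B k := ⟨fun _ => k, fun _ => kc, fun _ => kb, fun _ => tendsto_const_nhds⟩

namespace BddLim
variable {k : ℝ → ℝ} {B : ℝ}

lemma measurable (h : BddLim B k) : Measurable k := by
  obtain ⟨kn, hc, -, ht⟩ := h
  exact measurable_of_tendsto_metrizable (fun n => (hc n).measurable) (tendsto_pi_nhds.2 ht)

lemma abs_le (h : BddLim B k) (s : ℝ) : |k s| ≤ B := by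
  obtain ⟨kn, -, hb, ht⟩ := h
  exact le_of_tendsto (ht s).abs (Eventually.of_forall fun n => hb n s)

lemma nonneg (h : BddLim B k) : 0 ≤ B := (abs_nonneg _).trans (h.abs_le 0)

lemma intervalIntegrable (h : BddLim B k) (a c : ℝ) : IntervalIntegrable k volume a c := by
  rw [intervalIntegrable_iff]
  refine Measure.integrableOn_of_bounded (M := B) (by simp) h.measurable.aestronglyMeasurable ?_
  exact ae_of_all _ h.abs_le

lemma prim_lip (h : BddLim B k) (s t : ℝ) : |prim k s - prim k t| ≤ B * |s - t| := by
  have := intervalIntegral.norm_integral_le_of_norm_le_const (f := k) (a := t) (b := s) (C := B)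
    fun x _ => h.abs_le x
  rw [← intervalIntegral.integral_interval_sub_left (h.intervalIntegrable 0 s)
    (h.intervalIntegrable 0 t)] at this
  exact this

lemma prim_continuous (h : BddLim B k) : Continuous (prim k) :=
  (LipschitzWith.of_dist_le_mul (K := ⟨B, h.nonneg⟩) fun s t => h.prim_lip s t).continuous

end BddLim

lemma prim_zero (k : ℝ → ℝ) : prim k 0 = 0 := by simp [prim]

lemma BddLim.abs_prim_le {k : ℝ → ℝ} {B : ℝ} (h : BddLim B k) (s : ℝ) : |prim k s| ≤ B * |s| := by
  simpa [prim_zero] using h.prim_lip s 0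

lemma prim_tendsto {kn : ℕ → ℝ → ℝ} {k : ℝ → ℝ} {B : ℝ} (hc : ∀ n, Measurable (kn n))
    (hb : ∀ n s, |kn n s| ≤ B) (ht : ∀ s, Tendsto (fun n => kn n s) atTop (𝓝 (k s))) (s : ℝ) :
    Tendsto (fun n => prim (kn n) s) atTop (𝓝 (prim k s)) := by
  refine intervalIntegral.tendsto_integral_filter_of_dominated_convergence (fun _ => B)
    (Eventually.of_forall fun n => (hc n).aestronglyMeasurable)
    (Eventually.of_forall fun n => Eventually.of_forall fun x _ => hb n x) (by simp)
    (ae_of_all _ fun x _ => ht x)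

lemma hasDerivAt_prim {k : ℝ → ℝ} (kc : Continuous k) (s : ℝ) : HasDerivAt (prim k) (k s) s :=
  intervalIntegral.integral_hasDerivAt_right (kc.intervalIntegrable _ _)
    (kc.stronglyMeasurableAtFilter volume (𝓝 s)) kc.continuousAt

lemma fderiv_eq_sum (L : E →L[ℝ] ℝ) (y : E) :
    L y = ∑ i : Fin 3, y i * L (EuclideanSpace.single i 1) := by
  have hy : y = ∑ i : Fin 3, y i • EuclideanSpace.single i (1 : ℝ) := by
    ext j; simp [Finset.sum_apply, Pi.single_apply]
  conv_lhs => rw [hy]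
  simp

lemma norm_le_sum_coord (L : E →L[ℝ] ℝ) :
    ‖L‖ ≤ ∑ i : Fin 3, |L (EuclideanSpace.single i 1)| := by
  refine L.opNorm_le_bound (Finset.sum_nonneg fun _ _ => abs_nonneg _) fun y => ?_
  rw [fderiv_eq_sum, Finset.sum_mul]
  refine (norm_sum_le _ _).trans (Finset.sum_le_sum fun i _ => ?_)
  rw [norm_mul, mul_comm]
  exact mul_le_mul_of_nonneg_left (abs_coord_le y i) (abs_nonneg _)

/-- The constant of the Gagliardo–Nirenberg–Sobolev inequality `‖u‖_6 ≤ C ‖∇u‖_2` in `ℝ³`. -/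
noncomputable def sobolevConst : ℝ≥0 :=
  MeasureTheory.SNormLESNormFDerivOfEqConst ℝ (volume : Measure E) 2

namespace SliceH1
variable {u : E → ℝ} {g : E → E}

lemma gi2 (H : SliceH1 u g) (i : Fin 3) : MemLp (fun x => g x i) 2 volume := memLp_apply H.g2 i

lemma memLp_of_continuous {f : E → ℝ} (hf : Continuous f) (r : ℝ) :
    MemLp f 2 (volume.restrict (ball (0 : E) r)) := by
  have : IsFiniteMeasure (volume.restrict (ball (0 : E) r)) := ⟨by
    simpa using measure_ball_lt_top (μ := (volume : Measure E)) (x := 0) (r := r)⟩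
  obtain ⟨C, hC⟩ := (isCompact_closedBall (0 : E) r).exists_bound_of_continuousOn hf.continuousOn
  refine MemLp.of_bound hf.aestronglyMeasurable C ?_
  filter_upwards [ae_restrict_mem measurableSet_ball] with x hx using hC x (ball_subset_closedBall hx)

lemma continuous_partial {v : E → ℝ} (hv : ContDiff ℝ 1 v) (y : E) :
    Continuous fun x => fderiv ℝ v x y :=
  (hv.continuous_fderiv (by simp)).clm_apply continuous_const

/-- An approximating sequence that also converges almost everywhere. -/
lemma exists_seq (H : SliceH1 u g) {r : ℝ} (hr : r < 1) : ∃ v : ℕ → E → ℝ,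
    (∀ n, ContDiff ℝ 1 (v n)) ∧ TendstoL2 (volume.restrict (ball 0 r)) v u ∧
    (∀ i : Fin 3, TendstoL2 (volume.restrict (ball 0 r))
      (fun n x => fderiv ℝ (v n) x (EuclideanSpace.single i 1)) fun x => g x i) ∧
    ∀ᵐ x ∂(volume.restrict (ball (0 : E) r)), Tendsto (fun n => v n x) atTop (𝓝 (u x)) := by
  choose v hv h1 h2 using fun n : ℕ => H.approx r hr (((n : ℝ≥0∞) + 1)⁻¹) (by simp)
  have lim : Tendsto (fun n : ℕ => ((n : ℝ≥0∞) + 1)⁻¹) atTop (𝓝 0) := by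
    have := ENNReal.tendsto_inv_nat_nhds_zero.comp (tendsto_add_atTop_nat 1)
    simpa [Function.comp_def] using this
  have t1 : TendstoL2 (volume.restrict (ball 0 r)) v u :=
    tendsto_of_tendsto_of_tendsto_of_le_of_le tendsto_const_nhds lim (fun _ => zero_le) h1
  have t2 : ∀ i : Fin 3, TendstoL2 (volume.restrict (ball 0 r))
      (fun n x => fderiv ℝ (v n) x (EuclideanSpace.single i 1)) fun x => g x i := fun i =>
    tendsto_of_tendsto_of_tendsto_of_le_of_le tendsto_const_nhds lim (fun _ => zero_le)
      fun n => h2 n i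
  obtain ⟨ns, hns, hae⟩ := t1.exists_subseq_ae (fun n => memLp_of_continuous (hv n).continuous r)
    (H.u2.restrict _)
  exact ⟨fun n => v (ns n), fun n => hv _, t1.subseq hns, fun i => (t2 i).subseq hns, hae⟩

lemma of_tendsto {uj : ℕ → E → ℝ} {gj : ℕ → E → E} (H : ∀ j, SliceH1 (uj j) (gj j))
    (mu : Measurable u) (mg : Measurable g) (u2 : MemLp u 2 volume) (g2 : MemLp g 2 volume)
    (hu : TendstoL2 volume uj u) (hg : ∀ i, TendstoL2 volume (fun j x => gj j x i) fun x => g x i) :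
    SliceH1 u g := by
  refine ⟨mu, mg, u2, g2, fun r hr δ hδ => ?_⟩
  have hδ2 : 0 < δ / 2 := ENNReal.half_pos hδ.ne'
  have e1 := hu.eventually_lt_const hδ2
  have e2 := eventually_all.2 fun i => (hg i).eventually_lt_const hδ2
  obtain ⟨j, h1, h2⟩ := (e1.and e2).exists
  obtain ⟨v, hv, v1, v2⟩ := (H j).approx r hr (δ / 2) hδ2
  refine ⟨v, hv, ?_, fun i => ?_⟩
  · have e : v - u = (v - uj j) + (uj j - u) := by ring
    rw [e]
    refine (eLpNorm_add_le (hv.continuous.aestronglyMeasurable.sub (H j).mu.aestronglyMeasurable)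
      ((H j).mu.sub mu).aestronglyMeasurable (by norm_num)).trans ?_
    rw [← ENNReal.add_halves δ]
    exact add_le_add v1 ((eLpNorm_mono_measure _ Measure.restrict_le_self).trans h1.le)
  · have e : ((fun x => fderiv ℝ v x (EuclideanSpace.single i 1)) - fun x => g x i)
        = ((fun x => fderiv ℝ v x (EuclideanSpace.single i 1)) - fun x => gj j x i)
          + ((fun x => gj j x i) - fun x => g x i) := by ring
    rw [e]
    refine (eLpNorm_add_le ((continuous_partial hv _).aestronglyMeasurable.sub
      (memLp_apply (H j).g2 i).1.restrict) ((memLp_apply (H j).g2 i).1.sub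
        (memLp_apply g2 i).1).restrict (by norm_num)).trans ?_
    rw [← ENNReal.add_halves δ]
    exact add_le_add (v2 i) ((eLpNorm_mono_measure _ Measure.restrict_le_self).trans (h2 i).le)

lemma memLp_prim (H : SliceH1 u g) {k : ℝ → ℝ} {B : ℝ} (hk : BddLim B k) :
    MemLp (fun x => prim k (u x)) 2 volume := by
  refine MemLp.of_le_mul (c := B) H.u2 (hk.prim_continuous.measurable.comp H.mu).aestronglyMeasurable
    (ae_of_all _ fun x => hk.abs_prim_le _)

lemma memLp_smul (H : SliceH1 u g) {k : ℝ → ℝ} {B : ℝ} (hk : BddLim B k) :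
    MemLp (fun x => k (u x) • g x) 2 volume := by
  refine MemLp.of_le_mul (c := B) H.g2
    ((hk.measurable.comp H.mu).smul H.mg).aestronglyMeasurable
    (ae_of_all _ fun x => ?_)
  rw [norm_smul]
  exact mul_le_mul_of_nonneg_right (hk.abs_le _) (norm_nonneg _)

lemma comp_of_continuous (H : SliceH1 u g) {k : ℝ → ℝ} {B : ℝ} (kc : Continuous k)
    (kb : ∀ s, |k s| ≤ B) : SliceH1 (fun x => prim k (u x)) (fun x => k (u x) • g x) := by
  have hk := bddLim_of_continuous kc kb
  refine ⟨hk.prim_continuous.measurable.comp H.mu, (kc.measurable.comp H.mu).smul H.mg,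
    H.memLp_prim hk, H.memLp_smul hk, fun r hr δ hδ => ?_⟩
  obtain ⟨v, hv, t1, t2, hae⟩ := H.exists_seq hr
  have T1 := t1.comp_lipschitz hk.prim_lip
  have T2 : ∀ i : Fin 3, TendstoL2 (volume.restrict (ball 0 r))
      ((fun n x => k (v n x)) * fun n x => fderiv ℝ (v n) x (EuclideanSpace.single i 1))
      ((fun x => k (u x)) * fun x => g x i) := fun i =>
    (t2 i).bdd_mul (C := B) (fun n => memLp_of_continuous (continuous_partial (hv n) _) r)
      ((H.gi2 i).restrict _) (fun n => (kc.comp (hv n).continuous).aestronglyMeasurable)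
      (kc.measurable.comp H.mu).aestronglyMeasurable (fun n x => kb _) (fun x => kb _)
      (hae.mono fun x hx => (kc.tendsto _).comp hx)
  have e2 := eventually_all.2 fun i => (T2 i).eventually_lt_const hδ
  obtain ⟨n, h1, h2⟩ := ((T1.eventually_lt_const hδ).and e2).exists
  have hKd : ContDiff ℝ 1 (prim k) := by
    rw [contDiff_one_iff_deriv]
    refine ⟨fun s => (hasDerivAt_prim kc s).differentiableAt, ?_⟩
    rw [show deriv (prim k) = k from funext fun s => (hasDerivAt_prim kc s).deriv]
    exact kc
  refine ⟨fun x => prim k (v n x), hKd.comp (hv n), h1.le, fun i => ?_⟩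
  refine le_trans (le_of_eq ?_) (h2 i).le
  congr 1
  ext x
  have hd : HasFDerivAt (fun x => prim k (v n x)) (k (v n x) • fderiv ℝ (v n) x) x :=
    (hasDerivAt_prim kc _).comp_hasFDerivAt x
      (((hv n).differentiable (by simp)) x).hasFDerivAt
  simp [hd.fderiv]

/-- The chain rule for the primitive of a bounded limit of continuous functions. -/
lemma comp (H : SliceH1 u g) {k : ℝ → ℝ} {B : ℝ} (hk : BddLim B k) :
    SliceH1 (fun x => prim k (u x)) (fun x => k (u x) • g x) := by
  have hk' := hk
  obtain ⟨kn, hc, hb, ht⟩ := hk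
  have hn : ∀ n, BddLim B (kn n) := fun n => bddLim_of_continuous (hc n) (hb n)
  refine of_tendsto (fun n => H.comp_of_continuous (hc n) (hb n))
    (hk'.prim_continuous.measurable.comp H.mu) ((hk'.measurable.comp H.mu).smul H.mg)
    (H.memLp_prim hk') (H.memLp_smul hk') ?_ fun i => ?_
  · -- `prim kn (u) = (prim kn (u) / u) u` with a bounded first factor
    have e : ∀ {k : ℝ → ℝ}, (fun x => prim k (u x)) = (fun x => prim k (u x) / u x) * u := by
      intro k
      ext x
      simp only [Pi.mul_apply]
      by_cases h0 : u x = 0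
      · simp [h0, prim_zero]
      · field_simp
    have bd : ∀ {k : ℝ → ℝ}, BddLim B k → ∀ x, |prim k (u x) / u x| ≤ B := by
      intro k hk x
      rw [abs_div]
      exact div_le_of_le_mul₀ (abs_nonneg _) hk.nonneg (hk.abs_prim_le _)
    have := TendstoL2.const (μ := (volume : Measure E)) (g := u) |>.bdd_mul (C := B)
      (a := fun n x => prim (kn n) (u x) / u x) (a' := fun x => prim k (u x) / u x)
      (fun _ => H.u2) H.u2
      (fun n => (((hn n).prim_continuous.measurable.comp H.mu).div H.mu).aestronglyMeasurable)
      ((hk'.prim_continuous.measurable.comp H.mu).div H.mu).aestronglyMeasurable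
      (fun n => bd (hn n)) (bd hk')
      (ae_of_all _ fun x => (prim_tendsto (fun n => (hc n).measurable) hb ht _).div_const _)
    rw [← e] at this
    refine this.congr fun n => ?_
    congr 2
    exact e.symm
  · have := TendstoL2.const (μ := (volume : Measure E)) (g := fun x => g x i) |>.bdd_mul (C := B)
      (a := fun n x => kn n (u x)) (a' := fun x => k (u x)) (fun _ => H.gi2 i) (H.gi2 i)
      (fun n => ((hc n).measurable.comp H.mu).aestronglyMeasurable)
      (hk'.measurable.comp H.mu).aestronglyMeasurable (fun n x => hb n _) (fun x => hk'.abs_le _)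
      (ae_of_all _ fun x => ht _)
    exact this

lemma sobolev_c1 {v : E → ℝ} (hv : ContDiff ℝ 1 v) (hc : HasCompactSupport v) :
    eLpNorm v 6 volume ≤ sobolevConst * eLpNorm (fderiv ℝ v) 2 volume := by
  have := eLpNorm_le_eLpNorm_fderiv_of_eq (volume : Measure E) hv hc (p := 2) (p' := 6)
    (by norm_num) (by simp) (by simp; norm_num)
  exact_mod_cast this

/-- The Sobolev inequality for `u ψ`, where `ψ` is a `C¹` cutoff function. -/
lemma sobolev (H : SliceH1 u g) {ψ : E → ℝ} (hψ : ContDiff ℝ 1 ψ) {r : ℝ} (hr : r < 1)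
    (ψz : ∀ x, r ≤ ‖x‖ → ψ x = 0) :
    eLpNorm (fun x => ψ x * u x) 6 volume ≤ sobolevConst *
      (∑ i : Fin 3, eLpNorm (fun x => ψ x * g x i) 2 volume
        + eLpNorm (fun x => ‖fderiv ℝ ψ x‖ * u x) 2 volume) := by
  obtain ⟨r', hr', hr'1⟩ := exists_between hr
  obtain ⟨v, hv, t1, t2, hae⟩ := H.exists_seq hr'1
  have ψc : HasCompactSupport ψ := HasCompactSupport.intro (isCompact_closedBall (0 : E) r)
    fun x hx => ψz x (by rw [mem_closedBall_zero_iff, not_le] at hx; exact hx.le)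
  have ψz' : ∀ x, r < ‖x‖ → fderiv ℝ ψ x = 0 := by
    intro x hx
    have : ψ =ᶠ[𝓝 x] fun _ => 0 :=
      (continuous_norm.continuousAt.eventually_const_lt hx).mono fun y hy => ψz y (le_of_lt hy)
    rw [this.fderiv_eq]; simp
  have ψ'c : Continuous fun x => ‖fderiv ℝ ψ x‖ := (hψ.continuous_fderiv (by simp)).norm
  obtain ⟨C, hC⟩ := ψc.exists_bound_of_continuous hψ.continuous
  obtain ⟨C', hC'⟩ := (ψc.fderiv (𝕜 := ℝ)).exists_bound_of_continuous
    (hψ.continuous_fderiv (by simp))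
  set μ := volume.restrict (ball (0 : E) r') with hμ
  -- all the functions below vanish outside the ball of radius `r'`
  have res : ∀ {f : E → ℝ} {p : ℝ≥0∞}, (∀ x, r < ‖x‖ → f x = 0) →
      eLpNorm f p μ = eLpNorm f p volume := by
    intro f p hf
    refine eLpNorm_restrict_eq_of_support_subset fun x hx => ?_
    rw [mem_ball_zero_iff]
    by_contra h
    exact hx (hf x (hr'.trans_le (not_lt.1 h)))
  have T2 : ∀ i : Fin 3, TendstoL2 μ
      (fun n => ψ * fun x => fderiv ℝ (v n) x (EuclideanSpace.single i 1))
      (ψ * fun x => g x i) := fun i =>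
    (t2 i).bdd_mul (C := C) (fun n => memLp_of_continuous (continuous_partial (hv n) _) r')
      ((H.gi2 i).restrict _) (fun _ => hψ.continuous.aestronglyMeasurable)
      hψ.continuous.aestronglyMeasurable (fun _ => hC) hC
      (ae_of_all _ fun x => tendsto_const_nhds)
  have T1 : TendstoL2 μ (fun n => (fun x => ‖fderiv ℝ ψ x‖) * v n)
      ((fun x => ‖fderiv ℝ ψ x‖) * u) :=
    t1.bdd_mul (C := C') (fun n => memLp_of_continuous (hv n).continuous r')
      (H.u2.restrict _) (fun _ => ψ'c.aestronglyMeasurable) ψ'c.aestronglyMeasurable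
      (fun _ x => by rw [abs_norm]; exact hC' x) (fun x => by rw [abs_norm]; exact hC' x)
      (ae_of_all _ fun x => tendsto_const_nhds)
  have up : ∀ {f : ℕ → E → ℝ} {f' : E → ℝ}, (∀ n, AEStronglyMeasurable (f n) μ) →
      AEStronglyMeasurable f' μ → ∀ n, eLpNorm (f n) 2 μ ≤ eLpNorm (f n - f') 2 μ + eLpNorm f' 2 μ := by
    intro f f' hf hf' n
    have e : f n = (f n - f') + f' := by ring
    conv_lhs => rw [e]
    exact eLpNorm_add_le ((hf n).sub hf') hf' (by norm_num)
  have m2 : ∀ i n, AEStronglyMeasurable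
      (ψ * fun x => fderiv ℝ (v n) x (EuclideanSpace.single i 1)) μ := fun i n =>
    (hψ.continuous.mul (continuous_partial (hv n) _)).aestronglyMeasurable
  have m2' : ∀ i, AEStronglyMeasurable (ψ * fun x => g x i) μ := fun i =>
    hψ.continuous.aestronglyMeasurable.mul ((H.gi2 i).1.restrict)
  have m1 : ∀ n, AEStronglyMeasurable ((fun x => ‖fderiv ℝ ψ x‖) * v n) μ := fun n =>
    (ψ'c.mul (hv n).continuous).aestronglyMeasurable
  have m1' : AEStronglyMeasurable ((fun x => ‖fderiv ℝ ψ x‖) * u) μ :=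
    ψ'c.aestronglyMeasurable.mul H.u2.1.restrict
  have bound : ∀ n, eLpNorm (fun x => ψ x * v n x) 6 μ ≤ sobolevConst *
      (∑ i : Fin 3, (eLpNorm ((ψ * fun x => fderiv ℝ (v n) x (EuclideanSpace.single i 1))
          - ψ * fun x => g x i) 2 μ + eLpNorm (ψ * fun x => g x i) 2 μ)
        + (eLpNorm ((fun x => ‖fderiv ℝ ψ x‖) * v n - (fun x => ‖fderiv ℝ ψ x‖) * u) 2 μ
          + eLpNorm ((fun x => ‖fderiv ℝ ψ x‖) * u) 2 μ)) := by
    intro n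
    rw [res fun x hx => by rw [ψz x hx.le, zero_mul]]
    refine (sobolev_c1 (hψ.mul (hv n)) ψc.mul_right).trans ?_
    gcongr
    have d : ∀ x, fderiv ℝ (fun x => ψ x * v n x) x = ψ x • fderiv ℝ (v n) x
        + v n x • fderiv ℝ ψ x := fun x =>
      fderiv_fun_mul ((hψ.differentiable (by simp)) x) (((hv n).differentiable (by simp)) x)
    have pw : ∀ x, ‖fderiv ℝ (fun x => ψ x * v n x) x‖ ≤
        (∑ i : Fin 3, fun x => |(ψ * fun x => fderiv ℝ (v n) x (EuclideanSpace.single i 1)) x|) x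
          + |((fun x => ‖fderiv ℝ ψ x‖) * v n) x| := by
      intro x
      rw [d]
      refine (norm_add_le _ _).trans (add_le_add ?_ ?_)
      · rw [norm_smul, Finset.sum_apply]
        simp only [Pi.mul_apply, abs_mul, ← Finset.mul_sum]
        exact mul_le_mul_of_nonneg_left (norm_le_sum_coord _) (norm_nonneg _)
      · rw [norm_smul, Pi.mul_apply, abs_mul, abs_norm, mul_comm]
        rfl
    have e0 : eLpNorm (fderiv ℝ (fun x => ψ x * v n x)) 2 volume
        = eLpNorm (fun x => ‖fderiv ℝ (fun x => ψ x * v n x) x‖) 2 μ := by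
      rw [res, eLpNorm_norm]
      intro x hx
      rw [d, ψz x hx.le, ψz' x hx]; simp
    rw [e0]
    refine (eLpNorm_mono_real (g := fun x =>
        (∑ i : Fin 3, fun x => |(ψ * fun x => fderiv ℝ (v n) x (EuclideanSpace.single i 1)) x|) x
          + |((fun x => ‖fderiv ℝ ψ x‖) * v n) x|) fun x => by rw [norm_norm]; exact pw x).trans ?_
    refine (eLpNorm_add_le (Finset.aestronglyMeasurable_sum _ fun i _ => (m2 i n).norm)
      (m1 n).norm (by norm_num)).trans (add_le_add ?_ ?_)
    · refine (eLpNorm_sum_le (fun i _ => (m2 i n).norm) (by norm_num)).trans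
        (Finset.sum_le_sum fun i _ => ?_)
      refine le_trans (le_of_eq (eLpNorm_norm _)) (up (m2 i) (m2' i) n)
    · exact le_trans (le_of_eq (eLpNorm_norm _)) (up m1 m1' n)
  have lim : Tendsto (fun n => (sobolevConst : ℝ≥0∞) *
      (∑ i : Fin 3, (eLpNorm ((ψ * fun x => fderiv ℝ (v n) x (EuclideanSpace.single i 1))
          - ψ * fun x => g x i) 2 μ + eLpNorm (ψ * fun x => g x i) 2 μ)
        + (eLpNorm ((fun x => ‖fderiv ℝ ψ x‖) * v n - (fun x => ‖fderiv ℝ ψ x‖) * u) 2 μ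
          + eLpNorm ((fun x => ‖fderiv ℝ ψ x‖) * u) 2 μ))) atTop
      (𝓝 (sobolevConst * (∑ i : Fin 3, (0 + eLpNorm (ψ * fun x => g x i) 2 μ)
        + (0 + eLpNorm ((fun x => ‖fderiv ℝ ψ x‖) * u) 2 μ)))) := by
    refine ENNReal.Tendsto.const_mul ?_ (Or.inr ENNReal.coe_ne_top)
    exact Filter.Tendsto.add (tendsto_finsetSum _ fun i _ =>
      Filter.Tendsto.add (T2 i) tendsto_const_nhds) (Filter.Tendsto.add T1 tendsto_const_nhds)
  have fin := Lp.eLpNorm_lim_le_liminf_eLpNorm (μ := μ) (p := 6) (f := fun n x => ψ x * v n x)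
    (fun n => (hψ.continuous.mul (hv n).continuous).aestronglyMeasurable) (fun x => ψ x * u x)
    (hae.mono fun x hx => hx.const_mul _)
  have fin2 := fin.trans (liminf_le_liminf (Eventually.of_forall bound))
  rw [lim.liminf_eq, res fun x hx => by rw [ψz x hx.le, zero_mul]] at fin2
  refine fin2.trans (le_of_eq ?_)
  simp only [zero_add]
  congr 2
  · refine Finset.sum_congr rfl fun i _ => res fun x hx => ?_
    rw [Pi.mul_apply, ψz x hx.le, zero_mul]
  · refine res fun x hx => ?_
    rw [Pi.mul_apply, ψz' x hx, norm_zero, zero_mul]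

/-- The Sobolev inequality for `u ψ` in squared form. -/
lemma sobolev_sq (H : SliceH1 u g) {ψ : E → ℝ} (hψ : ContDiff ℝ 1 ψ) {r : ℝ} (hr : r < 1)
    (ψz : ∀ x, r ≤ ‖x‖ → ψ x = 0) :
    eLpNorm (fun x => ψ x * u x) 6 volume ^ 2 ≤ 4 * sobolevConst ^ 2 *
      ((∫⁻ x, ‖ψ x‖ₑ ^ 2 * ‖g x‖ₑ ^ 2) + ∫⁻ x, ‖fderiv ℝ ψ x‖ₑ ^ 2 * ‖u x‖ₑ ^ 2) := by
  have h := pow_le_pow_left' (H.sobolev hψ hr ψz) 2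
  refine h.trans ?_
  rw [mul_pow, Fin.sum_univ_three]
  have two : ∀ a b : ℝ≥0∞, (a + b) ^ 2 ≤ 2 * (a ^ 2 + b ^ 2) := by
    intro a b
    have := ENNReal.rpow_add_le_mul_rpow_add_rpow a b (p := 2) (by norm_num)
    norm_num at this
    exact this
  have four : ∀ a b c d : ℝ≥0∞, (a + b + c + d) ^ 2 ≤ 4 * (a ^ 2 + b ^ 2 + c ^ 2 + d ^ 2) := by
    intro a b c d
    calc (a + b + c + d) ^ 2 = ((a + b) + (c + d)) ^ 2 := by rw [add_assoc (a + b)]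
      _ ≤ 2 * ((a + b) ^ 2 + (c + d) ^ 2) := two _ _
      _ ≤ 2 * (2 * (a ^ 2 + b ^ 2) + 2 * (c ^ 2 + d ^ 2)) := by gcongr <;> exact two _ _
      _ = 4 * (a ^ 2 + b ^ 2 + c ^ 2 + d ^ 2) := by ring
  refine (mul_le_mul_right (four _ _ _ _) _).trans (le_of_eq ?_)
  have ψm : Measurable ψ := hψ.continuous.measurable
  have gm : ∀ i : Fin 3, Measurable fun x => g x i := fun i =>
    (EuclideanSpace.proj (𝕜 := ℝ) i).continuous.measurable.comp H.mg
  have e : ∀ x, ‖ψ x‖ₑ ^ 2 * ‖g x‖ₑ ^ 2 = ‖ψ x * g x 0‖ₑ ^ 2 + ‖ψ x * g x 1‖ₑ ^ 2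
      + ‖ψ x * g x 2‖ₑ ^ 2 := by
    intro x
    have h1 : ‖g x‖ₑ ^ 2 = ‖g x 0‖ₑ ^ 2 + ‖g x 1‖ₑ ^ 2 + ‖g x 2‖ₑ ^ 2 := by
      simp only [← ofReal_norm, ← ENNReal.ofReal_pow (norm_nonneg _)]
      rw [normSq_eq, ENNReal.ofReal_add (by positivity) (by positivity),
        ENNReal.ofReal_add (by positivity) (by positivity)]
      simp [Real.norm_eq_abs, sq_abs]
    simp only [enorm_mul, mul_pow, h1, mul_add]
  simp only [eLpNorm_two_sq, e, enorm_mul, enorm_norm]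
  have m : ∀ i : Fin 3, Measurable fun x => (‖ψ x‖ₑ * ‖g x i‖ₑ) ^ 2 := fun i =>
    (ψm.enorm.mul (gm i).enorm).pow_const 2
  have m01 : Measurable fun x => (‖ψ x‖ₑ * ‖g x 0‖ₑ) ^ 2 + (‖ψ x‖ₑ * ‖g x 1‖ₑ) ^ 2 :=
    (m 0).add (m 1)
  rw [lintegral_add_left m01, lintegral_add_left (m 0)]
  simp only [mul_pow]
  ring

end SliceH1

/-! ### The drift term on a time slice -/

/-- Hölder's inequality for the exponents occurring in the drift term:
`3/5 + 9/5 · 1/6 + 1/5 · 1/2 = 1`. -/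
lemma lintegral_drift_le {α : Type*} [MeasurableSpace α] {μ : Measure α} {f F U : α → ℝ≥0∞}
    (hf : AEMeasurable f μ) (hF : AEMeasurable F μ) (hU : AEMeasurable U μ) :
    ∫⁻ x, f x * F x ^ (9 / 5 : ℝ) * U x ^ (1 / 5 : ℝ) ∂μ ≤
      (∫⁻ x, f x ^ (5 / 3 : ℝ) ∂μ) ^ (3 / 5 : ℝ) * (∫⁻ x, F x ^ 6 ∂μ) ^ (3 / 10 : ℝ)
        * (∫⁻ x, U x ^ 2 ∂μ) ^ (1 / 10 : ℝ) := by
  have h := ENNReal.lintegral_prod_norm_pow_le (μ := μ) Finset.univ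
    (f := ![fun x => f x ^ (5 / 3 : ℝ), fun x => F x ^ 6, fun x => U x ^ 2])
    (p := ![3 / 5, 3 / 10, 1 / 10]) (by
      intro i _; fin_cases i
      · exact hf.pow_const _
      · exact hF.pow_const _
      · exact hU.pow_const _)
    (by simp [Fin.sum_univ_three]; norm_num)
    (by intro i _; fin_cases i <;> simp <;> norm_num)
  simp only [Fin.prod_univ_three] at h
  refine le_trans (le_of_eq (lintegral_congr fun x => ?_)) h
  have e1 : (f x ^ (5 / 3 : ℝ)) ^ (3 / 5 : ℝ) = f x := by
    rw [← ENNReal.rpow_mul]; norm_num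
  have e2 : (F x ^ 6) ^ (3 / 10 : ℝ) = F x ^ (9 / 5 : ℝ) := by
    rw [← ENNReal.rpow_natCast, ← ENNReal.rpow_mul]; norm_num
  have e3 : (U x ^ 2) ^ (1 / 10 : ℝ) = U x ^ (1 / 5 : ℝ) := by
    rw [← ENNReal.rpow_natCast, ← ENNReal.rpow_mul]; norm_num
  change _ = (f x ^ (5 / 3 : ℝ)) ^ (3 / 5 : ℝ) * (F x ^ 6) ^ (3 / 10 : ℝ) * (U x ^ 2) ^ (1 / 10 : ℝ)
  rw [e1, e2, e3]

/-- Young's inequality in the form used to absorb the drift term into the diffusion. -/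
lemma young_drift {X A M δ : ℝ≥0∞} (δ0 : δ ≠ 0) (δt : δ ≠ ⊤) :
    X * A ^ (9 / 10 : ℝ) * M ^ (1 / 10 : ℝ) ≤ δ * A + (δ ^ 9)⁻¹ * X ^ 10 * M := by
  have hpq : (10 / 9 : ℝ).HolderConjugate 10 := by
    rw [Real.holderConjugate_iff]; norm_num
  have h := ENNReal.young_inequality ((δ * A) ^ (9 / 10 : ℝ))
    (((δ ^ 9)⁻¹ * X ^ 10 * M) ^ (1 / 10 : ℝ)) hpq
  rw [← ENNReal.rpow_mul, ← ENNReal.rpow_mul] at h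
  norm_num at h
  have e : (δ * A) ^ (9 / 10 : ℝ) * (((δ ^ 9)⁻¹ * X ^ 10 * M) ^ (1 / 10 : ℝ))
      = X * A ^ (9 / 10 : ℝ) * M ^ (1 / 10 : ℝ) := by
    rw [ENNReal.mul_rpow_of_nonneg _ _ (by norm_num), ENNReal.mul_rpow_of_nonneg _ _ (by norm_num),
      ENNReal.mul_rpow_of_nonneg _ _ (by norm_num), ENNReal.inv_rpow,
      ← ENNReal.rpow_natCast, ← ENNReal.rpow_natCast, ← ENNReal.rpow_mul, ← ENNReal.rpow_mul]
    norm_num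
    have h1 : δ ^ (9 / 10 : ℝ) * (δ ^ (9 / 10 : ℝ))⁻¹ = 1 :=
      ENNReal.mul_inv_cancel (by simp [δ0, δt]) (by simp [δ0, δt])
    calc δ ^ (9 / 10 : ℝ) * A ^ (9 / 10 : ℝ) * ((δ ^ (9 / 10 : ℝ))⁻¹ * X * M ^ (1 / 10 : ℝ))
        = (δ ^ (9 / 10 : ℝ) * (δ ^ (9 / 10 : ℝ))⁻¹) * (X * A ^ (9 / 10 : ℝ) * M ^ (1 / 10 : ℝ)) := by
          ring
      _ = _ := by rw [h1, one_mul]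
  norm_num at e
  rw [e] at h
  norm_num
  refine h.trans (add_le_add ?_ ?_)
  · refine ENNReal.div_le_of_le_mul ?_
    refine le_mul_of_one_le_right zero_le ?_
    rw [ENNReal.one_le_ofReal]; norm_num
  · refine ENNReal.div_le_of_le_mul ?_
    refine le_mul_of_one_le_right zero_le ?_
    norm_num

lemma lintegral_pow_six (F : E → ℝ) :
    (∫⁻ x, ‖F x‖ₑ ^ 6) ^ (3 / 10 : ℝ) = (eLpNorm F 6 volume ^ 2) ^ (9 / 10 : ℝ) := by
  rw [eLpNorm_eq_lintegral_rpow_enorm_toReal (by norm_num) (by norm_num)]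
  rw [← ENNReal.rpow_natCast, ← ENNReal.rpow_mul, ← ENNReal.rpow_mul]
  norm_num

/-- The drift is bounded in time with values in `L^{5/3}(B₁)`. -/
def DriftBdd (b : ST → E) (β : ℝ≥0) : Prop :=
  ∀ᵐ t : ℝ, t ∈ Ioo (-1 : ℝ) 0 → ∫⁻ x in ball (0 : E) 1, ‖b (x, t)‖ₑ ^ (5 / 3 : ℝ) ≤ β

namespace Sol
variable {b : ST → E} {Γ : ST → ℝ} {G : ST → E} {k : ℝ → ℝ} {B : ℝ}

lemma sq_b_integrable (S : Sol b Γ G) {β : ℝ≥0} (hβ : DriftBdd b β) {a : ℝ} (ha : a < 1) :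
    IntegrableOn (fun z => Γ z ^ 2 * ‖b z‖) {z | ‖z.1‖ ^ 2 < a} := by
  have hsa : √a < 1 := by
    rw [Real.sqrt_lt' one_pos]; simpa using ha
  set r₁ := (1 + √a) / 2 with hr₁
  have h0 := Real.sqrt_nonneg a
  let φ : ContDiffBump (0 : E) := ⟨r₁, (1 + r₁) / 2, by linarith, by linarith⟩
  have φ1 : ∀ x : E, ‖x‖ ^ 2 < a → φ x = 1 := by
    intro x hx
    refine φ.one_of_mem_closedBall ?_
    rw [mem_closedBall_zero_iff]
    have : ‖x‖ ≤ √a := Real.le_sqrt_of_sq_le hx.le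
    change ‖x‖ ≤ r₁
    linarith
  have φz : ∀ x : E, (1 + r₁) / 2 ≤ ‖x‖ → φ x = 0 := fun x hx =>
    φ.zero_of_le_dist (by rw [dist_zero_right]; exact hx)
  have φc : ContDiff ℝ 1 φ := φ.contDiff
  obtain ⟨C, hC⟩ := (φ.hasCompactSupport.fderiv (𝕜 := ℝ)).exists_bound_of_continuous
    (φc.continuous_fderiv (by simp))
  have hm : MeasurableSet {z : ST | ‖z.1‖ ^ 2 < a} :=
    measurableSet_lt (measurable_fst.norm.pow_const 2) measurable_const
  have mF : Measurable fun z => Γ z ^ 2 * ‖b z‖ := (S.mΓ.pow_const 2).mul S.mb.norm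
  refine ⟨mF.aestronglyMeasurable, ?_⟩
  have mI : Measurable ({z : ST | ‖z.1‖ ^ 2 < a}.indicator fun z => ‖Γ z ^ 2 * ‖b z‖‖ₑ) :=
    mF.enorm.indicator hm
  rw [HasFiniteIntegral, ← lintegral_indicator hm, lintegral_slice mI]
  -- the bound on one slice
  set K : ℝ≥0∞ := 4 * sobolevConst ^ 2
  set Y : ℝ → ℝ≥0∞ := fun t => (∫⁻ x : E, ‖G (x, t)‖ₑ ^ 2)
  set Z : ℝ → ℝ≥0∞ := fun t => (∫⁻ x : E, ‖Γ (x, t)‖ₑ ^ 2)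
  have slice : ∀ᵐ t : ℝ, ∫⁻ x, {z : ST | ‖z.1‖ ^ 2 < a}.indicator (fun z => ‖Γ z ^ 2 * ‖b z‖‖ₑ) (x, t)
      ≤ K * (Y t + ofReal C ^ 2 * Z t) + ((β : ℝ≥0∞) ^ (3 / 5 : ℝ)) ^ 10 * Z t := by
    have hne : ∀ᵐ t : ℝ, t ≠ 0 := by simp [ae_iff]
    filter_upwards [hβ, S.sliceH1, hne] with t h1 h2 h3
    by_cases ht : t ∈ Ioo (-1 : ℝ) 0
    · have H := h2 ht
      set F : E → ℝ := fun x => φ x * Γ (x, t) with hF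
      have mFm : Measurable F := φc.continuous.measurable.mul H.mu
      have mbs : Measurable fun x : E => b (x, t) := S.mb.comp measurable_prodMk_right
      have Fz : ∀ x, x ∉ ball (0 : E) 1 → F x = 0 := by
        intro x hx
        rw [mem_ball_zero_iff, not_lt] at hx
        simp only [hF]
        rw [φz x (by linarith), zero_mul]
      have sob := H.sobolev_sq φc (r := (1 + r₁) / 2) (by linarith) φz
      have hold := lintegral_drift_le (μ := volume)
        (f := (ball (0 : E) 1).indicator fun x => ‖b (x, t)‖ₑ) (F := fun x => ‖F x‖ₑ)
        (U := fun x => ‖F x‖ₑ) (mbs.enorm.indicator measurableSet_ball).aemeasurable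
        mFm.enorm.aemeasurable mFm.enorm.aemeasurable
      rw [lintegral_pow_six] at hold
      have hA : eLpNorm F 6 volume ^ 2 ≤ K * (Y t + ofReal C ^ 2 * Z t) := by
        refine sob.trans ?_
        refine mul_le_mul_right (add_le_add ?_ ?_) _
        · refine lintegral_mono fun x => ?_
          refine mul_le_of_le_one_left zero_le (pow_le_one₀ zero_le ?_)
          rw [Real.enorm_eq_ofReal φ.nonneg]
          exact ENNReal.ofReal_le_one.2 φ.le_one
        · rw [← lintegral_const_mul _ (H.mu.enorm.pow_const 2)]
          refine lintegral_mono fun x => ?_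
          refine mul_le_mul_left (pow_le_pow_left' ?_ 2) _
          rw [← ofReal_norm]
          exact ENNReal.ofReal_le_ofReal (hC x)
      have hM : ∫⁻ x, ‖F x‖ₑ ^ 2 ≤ Z t := by
        refine lintegral_mono fun x => ?_
        gcongr
        simp only [hF, enorm_mul]
        refine mul_le_of_le_one_left zero_le ?_
        rw [Real.enorm_eq_ofReal φ.nonneg]
        exact ENNReal.ofReal_le_one.2 φ.le_one
      have hb : ∫⁻ x, ((ball (0 : E) 1).indicator (fun x => ‖b (x, t)‖ₑ) x) ^ (5 / 3 : ℝ) ≤ β := by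
        refine le_trans (le_of_eq ?_) (h1 ht)
        rw [← lintegral_indicator measurableSet_ball]
        refine lintegral_congr fun x => ?_
        by_cases hx : x ∈ ball (0 : E) 1
        · simp [indicator_of_mem hx]
        · simp [indicator_of_notMem hx]
      calc ∫⁻ x, {z : ST | ‖z.1‖ ^ 2 < a}.indicator (fun z => ‖Γ z ^ 2 * ‖b z‖‖ₑ) (x, t)
          ≤ ∫⁻ x, (ball (0 : E) 1).indicator (fun x => ‖b (x, t)‖ₑ) x
              * ‖F x‖ₑ ^ (9 / 5 : ℝ) * ‖F x‖ₑ ^ (1 / 5 : ℝ) := by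
            refine lintegral_mono fun x => ?_
            by_cases hx : ‖x‖ ^ 2 < a
            · rw [indicator_of_mem (by exact hx)]
              have hx1 : x ∈ ball (0 : E) 1 := by
                rw [mem_ball_zero_iff]
                have : ‖x‖ ≤ √a := Real.le_sqrt_of_sq_le hx.le
                linarith
              rw [indicator_of_mem hx1, mul_assoc, ← ENNReal.rpow_add_of_nonneg _ _ (by norm_num)
                (by norm_num)]
              simp only [hF, φ1 x hx, one_mul]
              rw [enorm_mul, enorm_pow, enorm_norm, mul_comm]
              norm_num
            · rw [indicator_of_notMem (by exact hx)]
              exact zero_le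
        _ ≤ _ := hold
        _ ≤ (β : ℝ≥0∞) ^ (3 / 5 : ℝ) * (K * (Y t + ofReal C ^ 2 * Z t)) ^ (9 / 10 : ℝ)
              * Z t ^ (1 / 10 : ℝ) := by gcongr
        _ ≤ _ := by
            refine (young_drift (δ := 1) (by simp) (by simp)).trans ?_
            simp
    · have hz : ∀ x : E, Γ (x, t) = 0 := by
        intro x
        refine S.Γz _ (zero_time fun h => ht ⟨h.1, lt_of_le_of_ne h.2 h3⟩)
      simp [indicator, hz]
  refine (lintegral_mono_ae slice).trans_lt ?_
  have mY : Measurable Y := (S.mG.enorm.pow_const 2).lintegral_prod_left'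
  have mZ : Measurable Z := (S.mΓ.enorm.pow_const 2).lintegral_prod_left'
  have fY : ∫⁻ t, Y t ≠ ⊤ := by
    have : ∫⁻ t, Y t = ∫⁻ z, ‖G z‖ₑ ^ 2 := (lintegral_slice (S.mG.enorm.pow_const 2)).symm
    rw [this]
    have h := S.normSq_integrable.2
    rw [HasFiniteIntegral] at h
    simpa using h.ne
  have fZ : ∫⁻ t, Z t ≠ ⊤ := by
    have : ∫⁻ t, Z t = ∫⁻ z, ‖Γ z‖ₑ ^ 2 := (lintegral_slice (S.mΓ.enorm.pow_const 2)).symm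
    rw [this, ← eLpNorm_two_sq]
    exact ENNReal.pow_ne_top S.Γ2.2.ne
  have mYZ : Measurable fun t => Y t + ofReal C ^ 2 * Z t := mY.add (mZ.const_mul _)
  rw [lintegral_add_left (mYZ.const_mul _), lintegral_const_mul _ mYZ, lintegral_add_left mY, lintegral_const_mul _ mZ, lintegral_const_mul _ mZ]
  refine ENNReal.add_lt_top.2 ⟨ENNReal.mul_lt_top ?_ (ENNReal.add_lt_top.2 ⟨fY.lt_top,
    ENNReal.mul_lt_top (by simp) fZ.lt_top⟩), ENNReal.mul_lt_top ?_ fZ.lt_top⟩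
  · exact ENNReal.mul_lt_top (by simp) (by simp)
  · exact ENNReal.pow_lt_top (ENNReal.rpow_lt_top_of_nonneg (by norm_num) (by simp))

end Sol

/-! ### The energy identity for functions with bounded second derivative -/

lemma C2B.of_compact {k : ℝ → ℝ} {B A : ℝ} (kc : Continuous k) (kb : ∀ s, |k s| ≤ B) (A0 : 0 ≤ A)
    (kz : ∀ s, A ≤ |s| → k s = 0) : C2B (prim (prim k)) (prim k) k (B * (A + 1)) := by
  have hk := bddLim_of_continuous kc kb
  have B0 := hk.nonneg
  refine ⟨hasDerivAt_prim hk.prim_continuous, hasDerivAt_prim kc, kc, prim_zero _, prim_zero _, ?_, ?_⟩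
  · -- outside `[-A, A]` the first derivative is constant
    have far : ∀ s, A ≤ |s| → ∃ s', |s'| = A ∧ prim k s = prim k s' := by
      intro s hs
      have key : ∀ s', |s'| = A → (∀ x ∈ uIcc s' s, A ≤ |x|) → prim k s = prim k s' := by
        intro s' _ hx
        rw [← sub_eq_zero, prim, prim, intervalIntegral.integral_interval_sub_left
          (hk.intervalIntegrable _ _) (hk.intervalIntegrable _ _),
          intervalIntegral.integral_congr (g := fun _ => 0) fun x hx' => kz x (hx x hx')]
        simp
      rcases le_abs'.1 hs with h | h
      · refine ⟨-A, by rw [abs_neg, abs_of_nonneg A0], key _ (by rw [abs_neg, abs_of_nonneg A0]) ?_⟩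
        intro x hx
        rw [uIcc_of_ge h] at hx
        exact le_abs.2 (Or.inr (by linarith [hx.2]))
      · refine ⟨A, abs_of_nonneg A0, key _ (abs_of_nonneg A0) ?_⟩
        intro x hx
        rw [uIcc_of_le h] at hx
        exact le_abs.2 (Or.inl hx.1)
    intro s
    have main : |prim k s| ≤ B * A := by
      rcases le_total A |s| with h | h
      · obtain ⟨s', h1, h2⟩ := far s h
        rw [h2, ← h1]
        exact hk.abs_prim_le s'
      · exact (hk.abs_prim_le s).trans (mul_le_mul_of_nonneg_left h B0)
    nlinarith
  · intro s
    have := kb s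
    nlinarith

lemma BddLim.abs_prim_prim_le {k : ℝ → ℝ} {B : ℝ} (h : BddLim B k) (s : ℝ) :
    |prim (prim k) s| ≤ B * s ^ 2 := by
  have := intervalIntegral.norm_integral_le_of_norm_le_const (f := prim k) (a := 0) (b := s)
    (C := B * |s|) fun x hx => by
      refine (h.abs_prim_le x).trans (mul_le_mul_of_nonneg_left ?_ h.nonneg)
      have := abs_sub_left_of_mem_uIcc (uIoc_subset_uIcc hx)
      simpa using this
  rw [sub_zero, mul_assoc, ← sq, sq_abs] at this
  exact this

lemma BddLim.compact_approx {k : ℝ → ℝ} {B : ℝ} (h : BddLim B k) : ∃ kn : ℕ → ℝ → ℝ,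
    (∀ n, Continuous (kn n)) ∧ (∀ n s, |kn n s| ≤ B) ∧
    (∀ s, Tendsto (fun n => kn n s) atTop (𝓝 (k s))) ∧
    ∀ (n : ℕ) (s : ℝ), (n : ℝ) + 1 ≤ |s| → kn n s = 0 := by
  obtain ⟨kn, hc, hb, ht⟩ := h
  refine ⟨fun (n : ℕ) s => kn n s * max 0 (min 1 ((n : ℝ) + 1 - |s|)), fun n => ?_, fun n s => ?_, fun s => ?_,
    fun n s hs => ?_⟩
  · exact (hc n).mul (continuous_const.max (continuous_const.min (continuous_const.sub
      continuous_abs)))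
  · beta_reduce
    rw [abs_mul, abs_of_nonneg (le_max_left (0 : ℝ) _)]
    refine (mul_le_of_le_one_right (abs_nonneg _) ?_).trans (hb n s)
    exact max_le zero_le_one (min_le_left _ _)
  · refine (ht s).congr' ?_
    filter_upwards [eventually_ge_atTop ⌈|s|⌉₊] with n hn
    have : |s| ≤ n := (Nat.le_ceil _).trans (by exact_mod_cast hn)
    rw [min_eq_left (by linarith), max_eq_right zero_le_one, mul_one]
  · beta_reduce
    rw [max_eq_left ((min_le_right _ _).trans (by linarith)), mul_zero]

namespace Sol
variable {b : ST → E} {Γ : ST → ℝ} {G : ST → E} {k : ℝ → ℝ} {B : ℝ} {σ : ℝ → ℝ} {a C : ℝ}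

lemma abs_dotx_le (F : ST → E) (z : ST) : |dotx F z| ≤ ‖z.1‖ * ‖F z‖ := by
  have h := abs_real_inner_le_norm z.1 (F z)
  have e : inner ℝ z.1 (F z) = dotx F z := by
    simp only [PiLp.inner_apply, dotx, RCLike.inner_apply, conj_trivial]
    exact Finset.sum_congr rfl fun i _ => mul_comm _ _
  rwa [e] at h

lemma measurable_dotx {F : ST → E} (hF : Measurable F) : Measurable fun z => dotx F z :=
  Finset.measurable_sum _ fun i _ => (contDiff_coord i).continuous.measurable.mul (measurable_coord hF i)

/-- The function that dominates the flux for `|h''| ≤ B`. -/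
noncomputable def fluxBound (b : ST → E) (Γ : ST → ℝ) (G : ST → E) (B a C : ℝ) (z : ST) : ℝ :=
  C * (B * ‖G z‖ ^ 2) + 2 * (C * (B * (Γ z ^ 2 + ‖G z‖ ^ 2)))
    + 2 * (C * (B * {z : ST | ‖z.1‖ ^ 2 < a}.indicator (fun z => Γ z ^ 2 * ‖b z‖) z))
    + 4 * (C * (B * Γ z ^ 2))

lemma sq_integrable (S : Sol b Γ G) : Integrable fun z => Γ z ^ 2 := S.Γ2.integrable_sq

lemma fluxBound_integrable (S : Sol b Γ G) {β : ℝ≥0} (hβ : DriftBdd b β) (ha : a < 1) :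
    Integrable (fluxBound b Γ G B a C) := by
  have hm : MeasurableSet {z : ST | ‖z.1‖ ^ 2 < a} :=
    measurableSet_lt (measurable_fst.norm.pow_const 2) measurable_const
  have i1 := S.normSq_integrable
  have i2 := S.sq_integrable
  have i3 := (integrable_indicator_iff hm).2 (S.sq_b_integrable hβ ha)
  exact ((((i1.const_mul B).const_mul C).add ((((i2.add i1).const_mul B).const_mul C).const_mul 2)).add
    (((i3.const_mul B).const_mul C).const_mul 2)).add (((i2.const_mul B).const_mul C).const_mul 4)

lemma abs_flux_le (hk : BddLim B k) (P : Profile σ a C) (z : ST) :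
    |flux b Γ G (prim (prim k)) (prim k) k σ z| ≤ fluxBound b Γ G B a C z := by
  have B0 := hk.nonneg
  have C0 : 0 ≤ C := (abs_nonneg _).trans (P.bd 0)
  have hσ := P.bd (‖z.1‖ ^ 2)
  have hσ' := P.bd' (‖z.1‖ ^ 2)
  have hx : ∀ F : ST → E, |deriv σ (‖z.1‖ ^ 2) * dotx F z| ≤ C * ‖F z‖ := by
    intro F
    by_cases h : a ≤ ‖z.1‖ ^ 2
    · rw [P.deriv_zero _ h, zero_mul, abs_zero]; positivity
    · have hx : ‖z.1‖ ≤ 1 := by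
        have := P.a1
        have h0 := norm_nonneg z.1
        nlinarith
      rw [abs_mul]
      refine mul_le_mul hσ' ((abs_dotx_le F z).trans ?_) (abs_nonneg _) C0
      exact mul_le_of_le_one_left (norm_nonneg _) hx
  have t1 : |σ (‖z.1‖ ^ 2) * (k (Γ z) * ‖G z‖ ^ 2)| ≤ C * (B * ‖G z‖ ^ 2) := by
    rw [abs_mul, abs_mul, abs_of_nonneg (sq_nonneg ‖G z‖)]
    gcongr
    exact hk.abs_le _
  have t2 : |prim k (Γ z) * (deriv σ (‖z.1‖ ^ 2) * dotx G z)| ≤ C * (B * (Γ z ^ 2 + ‖G z‖ ^ 2)) := by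
    rw [abs_mul]
    calc |prim k (Γ z)| * |deriv σ (‖z.1‖ ^ 2) * dotx G z| ≤ (B * |Γ z|) * (C * ‖G z‖) :=
          mul_le_mul (hk.abs_prim_le _) (hx G) (abs_nonneg _) (by positivity)
      _ = C * (B * (|Γ z| * ‖G z‖)) := by ring
      _ ≤ C * (B * (Γ z ^ 2 + ‖G z‖ ^ 2)) := by
          gcongr
          rw [← sq_abs (Γ z)]
          nlinarith [sq_nonneg (|Γ z| - ‖G z‖), sq_nonneg (|Γ z|), sq_nonneg ‖G z‖]
  have t3 : |prim (prim k) (Γ z) * (deriv σ (‖z.1‖ ^ 2) * dotx b z)|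
      ≤ C * (B * {z : ST | ‖z.1‖ ^ 2 < a}.indicator (fun z => Γ z ^ 2 * ‖b z‖) z) := by
    by_cases h : ‖z.1‖ ^ 2 < a
    · rw [indicator_of_mem (by exact h), abs_mul]
      calc _ ≤ (B * Γ z ^ 2) * (C * ‖b z‖) :=
            mul_le_mul (hk.abs_prim_prim_le _) (hx b) (abs_nonneg _) (by positivity)
        _ = _ := by ring
    · rw [indicator_of_notMem (by exact h), P.deriv_zero _ (not_lt.1 h)]; simp
  have t4 : |deriv σ (‖z.1‖ ^ 2) * prim (prim k) (Γ z)| ≤ C * (B * Γ z ^ 2) := by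
    rw [abs_mul]
    exact mul_le_mul hσ' (hk.abs_prim_prim_le _) (abs_nonneg _) C0
  rw [flux, fluxBound, abs_le]
  rw [abs_le] at t1 t2 t3 t4
  constructor <;> linarith [t1.1, t1.2, t2.1, t2.2, t3.1, t3.2, t4.1, t4.2]

lemma measurable_flux (S : Sol b Γ G) (hk : BddLim B k) (P : Profile σ a C) :
    Measurable (flux b Γ G (prim (prim k)) (prim k) k σ) := by
  have hp : Continuous (prim (prim k)) :=
    continuous_iff_continuousAt.2 fun s => (hasDerivAt_prim hk.prim_continuous s).continuousAt
  have mσ := measurable_prof P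
  have mσ' := measurable_prof' P
  exact (((mσ.mul ((hk.measurable.comp S.mΓ).mul (S.mG.norm.pow_const 2))).add
    (((hk.prim_continuous.measurable.comp S.mΓ).mul (mσ'.mul (measurable_dotx S.mG))).const_mul 2)).sub
    (((hp.measurable.comp S.mΓ).mul (mσ'.mul (measurable_dotx S.mb))).const_mul 2)).sub
    ((mσ'.mul (hp.measurable.comp S.mΓ)).const_mul 4)

lemma flux_integrable_lim (S : Sol b Γ G) {β : ℝ≥0} (hβ : DriftBdd b β) (hk : BddLim B k)
    (P : Profile σ a C) : Integrable (flux b Γ G (prim (prim k)) (prim k) k σ) :=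
  (S.fluxBound_integrable hβ P.a1).mono' (S.measurable_flux hk P).aestronglyMeasurable
    (ae_of_all _ fun z => abs_flux_le hk P z)

lemma energy_bound (hk : BddLim B k) (P : Profile σ a C) (x : E) (s : ℝ) :
    |σ (‖x‖ ^ 2) * prim (prim k) s| ≤ C * (B * s ^ 2) := by
  rw [abs_mul]
  exact mul_le_mul (P.bd _) (hk.abs_prim_prim_le _) (abs_nonneg _) ((abs_nonneg _).trans (P.bd 0))

lemma measurable_energy (S : Sol b Γ G) (hk : BddLim B k) (P : Profile σ a C) :
    Measurable fun z : ST => σ (‖z.1‖ ^ 2) * prim (prim k) (Γ z) := by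
  have hp : Continuous (prim (prim k)) :=
    continuous_iff_continuousAt.2 fun s => (hasDerivAt_prim hk.prim_continuous s).continuousAt
  exact (measurable_prof P).mul (hp.measurable.comp S.mΓ)

lemma energy_integrable_lim (S : Sol b Γ G) (hk : BddLim B k) (P : Profile σ a C) :
    Integrable fun z : ST => σ (‖z.1‖ ^ 2) * prim (prim k) (Γ z) :=
  ((S.sq_integrable.const_mul B).const_mul C).mono' (S.measurable_energy hk P).aestronglyMeasurable
    (ae_of_all _ fun z => energy_bound hk P z.1 (Γ z))

/-- The energy identity for `h = ∬ k`, with `k` a bounded limit of continuous functions, in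
terms of the time slices. -/
lemma energy_identity_lim (S : Sol b Γ G) {β : ℝ≥0} (hβ : DriftBdd b β) (hk : BddLim B k)
    (P : Profile σ a C) {η : ℝ → ℝ} {t₀ : ℝ} (hη : ContDiff ℝ ∞ η) (ht₀ : -1 < t₀)
    (ηz : ∀ t ≤ t₀, η t = 0) :
    ∀ᵐ t, t ∈ Ioo (-1 : ℝ) 0 →
      η t * ∫ x, σ (‖x‖ ^ 2) * prim (prim k) (Γ (x, t)) =
        ∫ s in Iic t, (deriv η s * (∫ x, σ (‖x‖ ^ 2) * prim (prim k) (Γ (x, s)))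
          - η s * ∫ x, flux b Γ G (prim (prim k)) (prim k) k σ (x, s)) := by
  obtain ⟨kn, hc, hb, ht, hz⟩ := hk.compact_approx
  have hn : ∀ n, BddLim B (kn n) := fun n => bddLim_of_continuous (hc n) (hb n)
  have CB : ∀ n, C2B (prim (prim (kn n))) (prim (kn n)) (kn n) (B * ((n + 1) + 1)) := fun n =>
    C2B.of_compact (hc n) (hb n) (by positivity) (hz n)
  have l1 : ∀ s, Tendsto (fun n => prim (kn n) s) atTop (𝓝 (prim k s)) :=
    prim_tendsto (fun n => (hc n).measurable) hb ht
  have l0 : ∀ s, Tendsto (fun n => prim (prim (kn n)) s) atTop (𝓝 (prim (prim k) s)) := by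
    intro s
    refine intervalIntegral.tendsto_integral_filter_of_dominated_convergence (fun _ => B * |s|)
      (Eventually.of_forall fun n => (hn n).prim_continuous.aestronglyMeasurable)
      (Eventually.of_forall fun n => Eventually.of_forall fun x hx => ?_) (by simp)
      (ae_of_all _ fun x _ => l1 x)
    refine ((hn n).abs_prim_le x).trans (mul_le_mul_of_nonneg_left ?_ hk.nonneg)
    have := abs_sub_left_of_mem_uIcc (uIoc_subset_uIcc hx)
    simpa using this
  have lflux : ∀ z, Tendsto (fun n => flux b Γ G (prim (prim (kn n))) (prim (kn n)) (kn n) σ z) atTop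
      (𝓝 (flux b Γ G (prim (prim k)) (prim k) k σ z)) := by
    intro z
    exact (((((ht _).mul_const _).const_mul _).add (((l1 _).mul_const _).const_mul 2)).sub
      (((l0 _).mul_const _).const_mul 2)).sub (((l0 _).const_mul _).const_mul 4)
  have lE : ∀ z : ST, Tendsto (fun n => σ (‖z.1‖ ^ 2) * prim (prim (kn n)) (Γ z)) atTop
      (𝓝 (σ (‖z.1‖ ^ 2) * prim (prim k) (Γ z))) := fun z => (l0 _).const_mul _
  have η'c : Continuous (deriv η) := hη.continuous_deriv (by simp)
  have domF := S.fluxBound_integrable (B := B) (C := C) hβ P.a1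
  have domE := (S.sq_integrable.const_mul B).const_mul C
  have dz : ∀ z ∉ cyl 1, C * (B * Γ z ^ 2) = 0 := fun z hz => by simp [S.Γz z hz]
  have fz : ∀ z ∉ cyl 1, fluxBound b Γ G B a C z = 0 := fun z hz => by
    simp [fluxBound, S.Γz z hz, S.Gz z hz, indicator]
  have Ez : ∀ {k : ℝ → ℝ}, ∀ z ∉ cyl 1, σ (‖z.1‖ ^ 2) * prim (prim k) (Γ z) = 0 := fun z hz => by
    rw [S.Γz z hz, prim_zero, mul_zero]
  have Qz : ∀ {k : ℝ → ℝ}, ∀ z ∉ cyl 1, flux b Γ G (prim (prim k)) (prim k) k σ z = 0 :=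
    fun z hz => S.flux_zero (prim_zero _) (prim_zero _) hz
  have dom1 := (bdd_mul_time η'c domE dz).norm
  have dom2 := (bdd_mul_time hη.continuous domF fz).norm
  have all := ae_all_iff.2 fun n => S.energy_identity (CB n) P hη ht₀ ηz
  have i1 := bdd_mul_time η'c (S.energy_integrable_lim hk P) Ez
  have mono : ∀ (c : ℝ) {x y : ℝ}, |x| ≤ y → ‖c * x‖ ≤ ‖c * y‖ := by
    intro c x y h
    rw [norm_mul, norm_mul]
    exact mul_le_mul_of_nonneg_left (h.trans (le_abs_self _)) (norm_nonneg _)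
  have i2 := bdd_mul_time hη.continuous (S.flux_integrable_lim hβ hk P) Qz
  filter_upwards [all, integrable_slice S.sq_integrable] with t hall hΓ htI
  have lim1 : Tendsto (fun n => η t * ∫ x, σ (‖x‖ ^ 2) * prim (prim (kn n)) (Γ (x, t))) atTop
      (𝓝 (η t * ∫ x, σ (‖x‖ ^ 2) * prim (prim k) (Γ (x, t)))) := by
    refine Tendsto.const_mul _ (tendsto_integral_of_dominated_convergence
      (fun x => C * (B * Γ (x, t) ^ 2)) (fun n => ?_) ((hΓ.const_mul _).const_mul _)
      (fun n => ae_of_all _ fun x => energy_bound (hn n) P x _)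
      (ae_of_all _ fun x => lE (x, t)))
    exact ((S.measurable_energy (hn n) P).comp measurable_prodMk_right).aestronglyMeasurable
  have lim2 : Tendsto (fun n => ∫ z in {z : ST | z.2 ≤ t},
      (deriv η z.2 * (σ (‖z.1‖ ^ 2) * prim (prim (kn n)) (Γ z))
        - η z.2 * flux b Γ G (prim (prim (kn n))) (prim (kn n)) (kn n) σ z)) atTop
      (𝓝 (∫ z in {z : ST | z.2 ≤ t}, (deriv η z.2 * (σ (‖z.1‖ ^ 2) * prim (prim k) (Γ z))
        - η z.2 * flux b Γ G (prim (prim k)) (prim k) k σ z))) := by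
    refine tendsto_integral_of_dominated_convergence
      (fun z => ‖deriv η z.2 * (C * (B * Γ z ^ 2))‖ + ‖η z.2 * fluxBound b Γ G B a C z‖) (fun n => ?_)
      ((dom1.add dom2).integrableOn (s := {z : ST | z.2 ≤ t})) (fun n => ae_of_all _ fun z => ?_)
      (ae_of_all _ fun z => ((lE z).const_mul _).sub ((lflux z).const_mul _))
    · exact ((((η'c.comp continuous_snd).measurable.mul (S.measurable_energy (hn n) P)).sub
        ((hη.continuous.comp continuous_snd).measurable.mul
          (S.measurable_flux (hn n) P)))).aestronglyMeasurable
    · refine le_trans (norm_sub_le (E := ℝ) _ _) (add_le_add ?_ ?_)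
      · exact mono _ (energy_bound (hn n) P _ _)
      · exact mono _ (abs_flux_le (hn n) P _)
  have e := tendsto_nhds_unique (lim1.congr fun n => hall n htI) lim2
  have i12 : Integrable (fun z : ST => deriv η z.2 * (σ (‖z.1‖ ^ 2) * prim (prim k) (Γ z))
    - η z.2 * flux b Γ G (prim (prim k)) (prim k) k σ z) := i1.sub i2
  rw [e, integral_slice_Iic i12]
  refine integral_congr_ae (ae_restrict_of_ae ?_)
  filter_upwards [integrable_slice i1, integrable_slice i2] with s hs1 hs2
  rw [integral_sub hs1 hs2, integral_const_mul, integral_const_mul]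

end Sol

/-! ### Truncation -/

/-- The indicator of `{|s| > k}`. -/
noncomputable def above (k s : ℝ) : ℝ := if k < |s| then 1 else 0

/-- The truncation `sign(s) (|s| - k)₊`. -/
noncomputable def trunc (k : ℝ) : ℝ → ℝ := prim (above k)

lemma above_nonneg (k s : ℝ) : 0 ≤ above k s := by unfold above; split_ifs <;> norm_num
lemma above_le_one (k s : ℝ) : above k s ≤ 1 := by unfold above; split_ifs <;> norm_num

lemma above_sq (k s : ℝ) : above k s ^ 2 = above k s := by unfold above; split_ifs <;> norm_num

lemma above_bddLim (k : ℝ) : BddLim 1 (above k) := by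
  refine ⟨fun n s => max 0 (min 1 ((n : ℝ) * (|s| - k))), fun n => ?_, fun n s => ?_, fun s => ?_⟩
  · exact continuous_const.max (continuous_const.min (continuous_const.mul
      (continuous_abs.sub continuous_const)))
  · rw [abs_of_nonneg (le_max_left _ _)]
    exact max_le zero_le_one (min_le_left _ _)
  · by_cases h : k < |s|
    · rw [above, if_pos h]
      refine tendsto_const_nhds.congr' ?_
      have := tendsto_natCast_atTop_atTop (R := ℝ) |>.atTop_mul_const (sub_pos.2 h)
      filter_upwards [this.eventually_ge_atTop 1] with n hn
      rw [min_eq_left hn, max_eq_right zero_le_one]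
    · rw [above, if_neg h]
      refine tendsto_const_nhds.congr fun n => ?_
      have : (n : ℝ) * (|s| - k) ≤ 0 := mul_nonpos_of_nonneg_of_nonpos n.cast_nonneg (by linarith)
      beta_reduce
      rw [max_eq_left ((min_le_right _ _).trans this)]

lemma trunc_continuous (k : ℝ) : Continuous (trunc k) := (above_bddLim k).prim_continuous

lemma trunc_of_le {k s : ℝ} (hs : |s| ≤ k) : trunc k s = 0 := by
  rw [trunc, prim, intervalIntegral.integral_congr (g := fun _ => 0)]
  · simp
  · intro x hx
    have := abs_sub_left_of_mem_uIcc hx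
    simp only [sub_zero] at this
    exact if_neg (not_lt.2 (this.trans hs))

lemma abs_trunc {k : ℝ} (hk : 0 ≤ k) (s : ℝ) : |trunc k s| = max (|s| - k) 0 := by
  rcases le_or_gt |s| k with h | h
  · rw [trunc_of_le h, max_eq_right (by linarith), abs_zero]
  rw [max_eq_left (by linarith)]
  have split : ∀ c : ℝ, |c| = k → (∀ x ∈ uIoc c s, x ≠ c → above k x = 1) → trunc k s = s - c := by
    intro c hc hx
    have hne : ∀ᵐ x : ℝ, x ≠ c := by simp [ae_iff]
    have h1 : trunc k s - trunc k c = s - c := by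
      rw [trunc, prim, prim, intervalIntegral.integral_interval_sub_left
        ((above_bddLim k).intervalIntegrable _ _) ((above_bddLim k).intervalIntegrable _ _),
        intervalIntegral.integral_congr_ae (g := fun _ => 1) (hne.mono fun x h1 h2 => hx x h2 h1)]
      simp
    rwa [trunc_of_le hc.le, sub_zero] at h1
  rcases le_total 0 s with h0 | h0
  · rw [abs_of_nonneg h0] at h ⊢
    rw [split k (abs_of_nonneg hk), abs_of_pos (by linarith)]
    intro x hx _
    rw [uIoc_of_le h.le] at hx
    exact if_pos (hx.1.trans_le (le_abs_self _))
  · rw [abs_of_nonpos h0] at h ⊢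
    rw [split (-k) (by rw [abs_neg, abs_of_nonneg hk]), abs_of_neg (by linarith)]
    · ring
    intro x hx hxk
    rw [uIoc_of_ge (by linarith)] at hx
    have := lt_of_le_of_ne hx.2 hxk
    exact if_pos (lt_abs.2 (Or.inr (by linarith)))

lemma trunc_mul_above (k s : ℝ) : trunc k s * above k s = trunc k s := by
  by_cases h : k < |s|
  · rw [above, if_pos h, mul_one]
  · rw [trunc_of_le (not_lt.1 h), zero_mul]

lemma prim_const_mul (c : ℝ) (k : ℝ → ℝ) : prim (fun s => c * k s) = fun s => c * prim k s := by
  ext s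
  exact intervalIntegral.integral_const_mul _ _

/-- `(F²)' = 2 F F'` for the primitive `F` of a bounded limit of continuous functions. -/
lemma prim_sq {k : ℝ → ℝ} {B : ℝ} (hk : BddLim B k) (s : ℝ) :
    prim (fun x => 2 * (prim k x * k x)) s = prim k s ^ 2 := by
  obtain ⟨kn, hc, hb, ht⟩ := hk
  have hn : ∀ n, BddLim B (kn n) := fun n => bddLim_of_continuous (hc n) (hb n)
  have l := prim_tendsto (fun n => (hc n).measurable) hb ht
  have e : ∀ n, prim (fun x => 2 * (prim (kn n) x * kn n x)) s = prim (kn n) s ^ 2 := by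
    intro n
    have hd : ∀ x ∈ uIcc 0 s, HasDerivAt (fun x => prim (kn n) x ^ 2)
        (2 * (prim (kn n) x * kn n x)) x := by
      intro x _
      refine ((hasDerivAt_prim (hc n) x).pow 2).congr_deriv ?_
      simp; ring
    rw [prim, intervalIntegral.integral_eq_sub_of_hasDerivAt hd
      ((((hn n).prim_continuous.mul (hc n)).const_mul 2).intervalIntegrable _ _), prim_zero]
    ring
  refine tendsto_nhds_unique ?_ ((l s).pow 2)
  refine Tendsto.congr e ?_
  refine intervalIntegral.tendsto_integral_filter_of_dominated_convergence
    (fun _ => 2 * (B * |s| * B))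
    (Eventually.of_forall fun n =>
      (((hn n).prim_continuous.mul (hc n)).const_mul 2).aestronglyMeasurable)
    (Eventually.of_forall fun n => Eventually.of_forall fun x hx => ?_) (by simp)
    (ae_of_all _ fun x _ => ((l x).mul (ht x)).const_mul 2)
  rw [norm_mul, norm_mul, Real.norm_two]
  have hx' : |x| ≤ |s| := by simpa using abs_sub_left_of_mem_uIcc (uIoc_subset_uIcc hx)
  have B0 := (hn 0).nonneg
  gcongr
  · exact ((hn n).abs_prim_le x).trans (mul_le_mul_of_nonneg_left hx' B0)
  · exact hb n x

lemma two_above_bddLim (k : ℝ) : BddLim 2 fun s => 2 * above k s := by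
  obtain ⟨kn, hc, hb, ht⟩ := above_bddLim k
  refine ⟨fun n s => 2 * kn n s, fun n => (hc n).const_mul 2, fun n s => ?_,
    fun s => (ht s).const_mul 2⟩
  rw [abs_mul, abs_two]
  linarith [hb n s]

lemma prim_two_above (k : ℝ) : prim (fun s => 2 * above k s) = fun s => 2 * trunc k s :=
  prim_const_mul 2 _

lemma prim_prim_two_above (k s : ℝ) : prim (prim fun s => 2 * above k s) s = trunc k s ^ 2 := by
  rw [prim_two_above]
  simpa only [trunc_mul_above, ← trunc.eq_1] using prim_sq (above_bddLim k) s

/-! ### Radial cutoff functions -/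

lemma exists_stBound : ∃ D : ℝ, 1 ≤ D ∧ ∀ s, |deriv Real.smoothTransition s| ≤ D := by
  obtain ⟨D, -, hD⟩ := exists_smoothTransition_deriv_bound
  exact ⟨max 1 D, le_max_left _ _, fun s => (hD s).trans (le_max_right _ _)⟩

/-- A bound for the derivative of the smooth transition function. -/
noncomputable def stBound : ℝ := exists_stBound.choose

lemma one_le_stBound : 1 ≤ stBound := exists_stBound.choose_spec.1
lemma abs_deriv_st_le (s : ℝ) : |deriv Real.smoothTransition s| ≤ stBound :=
  exists_stBound.choose_spec.2 s

/-- The decreasing transition from `1` on `(-∞, a - w]` to `0` on `[a, ∞)`. -/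
noncomputable def cut (a w s : ℝ) : ℝ := Real.smoothTransition ((a - s) / w)

section cut
variable {a w : ℝ}

lemma cut_smooth : ContDiff ℝ ∞ (cut a w) :=
  smoothTransition_smooth.comp ((contDiff_const.sub contDiff_id).div_const w)

lemma cut_nonneg (s : ℝ) : 0 ≤ cut a w s := Real.smoothTransition.nonneg _
lemma cut_le_one (s : ℝ) : cut a w s ≤ 1 := Real.smoothTransition.le_one _

lemma cut_zero (hw : 0 < w) {s : ℝ} (hs : a ≤ s) : cut a w s = 0 :=
  Real.smoothTransition.zero_of_nonpos (div_nonpos_of_nonpos_of_nonneg (by linarith) hw.le)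

lemma cut_one (hw : 0 < w) {s : ℝ} (hs : s ≤ a - w) : cut a w s = 1 :=
  Real.smoothTransition.one_of_one_le ((one_le_div hw).2 (by linarith))

lemma hasDerivAt_cut (s : ℝ) : HasDerivAt (cut a w)
    (deriv Real.smoothTransition ((a - s) / w) * (-1 / w)) s := by
  have h1 : HasDerivAt Real.smoothTransition _ ((a - s) / w) :=
    ((smoothTransition_smooth.differentiable (by simp)) _).hasDerivAt
  have h2 : HasDerivAt (fun s => (a - s) / w) (-1 / w) s :=
    ((hasDerivAt_id s).const_sub a).div_const w
  exact h1.comp s h2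

lemma abs_deriv_cut_le (hw : 0 < w) (s : ℝ) : |deriv (cut a w) s| ≤ stBound / w := by
  rw [(hasDerivAt_cut s).deriv, abs_mul, abs_div, abs_neg, abs_one, abs_of_pos hw, mul_one_div]
  gcongr
  exact abs_deriv_st_le _

lemma deriv_cut_pow (n : ℕ) (s : ℝ) :
    deriv (fun s => cut a w s ^ n) s = n * cut a w s ^ (n - 1) * deriv (cut a w) s := by
  have h := (cut_smooth (a := a) (w := w)).differentiable (by simp) s
  simpa [Pi.pow_def] using (h.hasDerivAt.pow n).deriv

lemma abs_deriv_cut_pow_le (hw : 0 < w) (n : ℕ) (s : ℝ) :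
    |deriv (fun s => cut a w s ^ n) s| ≤ n * (stBound / w) * cut a w s ^ (n - 1) := by
  rw [deriv_cut_pow, abs_mul, abs_of_nonneg (by have := cut_nonneg (a := a) (w := w) s; positivity)]
  have := mul_le_mul_of_nonneg_left (abs_deriv_cut_le (a := a) hw s)
    (show 0 ≤ (n : ℝ) * cut a w s ^ (n - 1) by have := cut_nonneg (a := a) (w := w) s; positivity)
  linarith

lemma cut_profile (ha : 0 < a) (ha1 : a < 1) (hw : 0 < w) {n : ℕ} (hn : n ≠ 0) :
    Profile (fun s => cut a w s ^ n) a (1 + n * (stBound / w)) where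
  smooth := cut_smooth.pow n
  apos := ha
  a1 := ha1
  zero s hs := by rw [cut_zero hw hs, zero_pow hn]
  bd s := by
    have := one_le_stBound
    rw [abs_of_nonneg (pow_nonneg (cut_nonneg s) n)]
    have h1 := pow_le_one₀ (n := n) (cut_nonneg (a := a) (w := w) s) (cut_le_one s)
    have : (0 : ℝ) ≤ n * (stBound / w) := by positivity
    linarith
  bd' s := by
    have := one_le_stBound
    refine (abs_deriv_cut_pow_le hw n s).trans ?_
    have h1 := pow_le_one₀ (n := n - 1) (cut_nonneg (a := a) (w := w) s) (cut_le_one s)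
    have h2 : (0 : ℝ) ≤ n * (stBound / w) := by positivity
    nlinarith

end cut

lemma hasFDerivAt_radial {σ : ℝ → ℝ} (hσ : ContDiff ℝ 1 σ) (x : E) :
    HasFDerivAt (fun x : E => σ (‖x‖ ^ 2)) (deriv σ (‖x‖ ^ 2) • (2 • innerSL ℝ x)) x :=
  ((hσ.differentiable (by simp)) _).hasDerivAt.comp_hasFDerivAt x
    (hasStrictFDerivAt_norm_sq x).hasFDerivAt

lemma contDiff_radial {σ : ℝ → ℝ} (hσ : ContDiff ℝ 1 σ) : ContDiff ℝ 1 fun x : E => σ (‖x‖ ^ 2) :=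
  hσ.comp (contDiff_id.norm_sq ℝ)

lemma norm_fderiv_radial_le {σ : ℝ → ℝ} (hσ : ContDiff ℝ 1 σ) (x : E) :
    ‖fderiv ℝ (fun x : E => σ (‖x‖ ^ 2)) x‖ ≤ |deriv σ (‖x‖ ^ 2)| * (2 * ‖x‖) := by
  rw [(hasFDerivAt_radial hσ x).fderiv, norm_smul, Real.norm_eq_abs]
  gcongr
  refine norm_nsmul_le.trans ?_
  rw [innerSL_apply_norm]
  simp

/-! ### Truncations on time slices -/

/-- The square of the constant in the Sobolev inequality for products with cutoff functions. -/
noncomputable def sobSq : ℝ := 4 * (sobolevConst : ℝ) ^ 2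

lemma sobSq_nonneg : 0 ≤ sobSq := by unfold sobSq; positivity

lemma ofReal_sobSq : ofReal sobSq = 4 * (sobolevConst : ℝ≥0∞) ^ 2 := by
  rw [sobSq, ENNReal.ofReal_mul (by norm_num), ENNReal.ofReal_pow NNReal.zero_le_coe,
    ENNReal.ofReal_coe_nnreal]
  norm_num

/-- The constant that Young's inequality produces for the drift term. -/
noncomputable def youngConst : ℝ := (2 * (sobSq + 1)) ^ 9

lemma youngConst_nonneg : 0 ≤ youngConst := by
  have := sobSq_nonneg
  unfold youngConst; positivity

/-- The gradient bound of the cutoff function `cut a w (|x|²)` on the ball of radius `s`. -/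
noncomputable def cutGrad (w s : ℝ) : ℝ := 20 * stBound * s / w

lemma cut_eq_zero {a w s : ℝ} (hw : 0 < w) (hs : 0 ≤ s) (has : a ≤ s ^ 2) {x : E} (hx : s ≤ ‖x‖) :
    cut a w (‖x‖ ^ 2) = 0 :=
  cut_zero hw (has.trans (pow_le_pow_left₀ hs hx 2))

/-- `|σ'| |x| ≤ (n / 20) D c^(n-1)` for `σ = cⁿ`, where `c` is the cutoff and `D` its gradient bound. -/
lemma abs_deriv_cut_mul_le {a w s : ℝ} (hw : 0 < w) (hs : 0 ≤ s) (has : a ≤ s ^ 2) {n : ℕ}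
    (hn : 1 < n) (x : E) : |deriv (fun r => cut a w r ^ n) (‖x‖ ^ 2)| * ‖x‖ ≤
      n / 20 * cutGrad w s * cut a w (‖x‖ ^ 2) ^ (n - 1) := by
  have h := abs_deriv_cut_pow_le (a := a) hw n (‖x‖ ^ 2)
  have h0 := one_le_stBound
  have c0 : 0 ≤ cut a w (‖x‖ ^ 2) := cut_nonneg _
  rcases le_or_gt s ‖x‖ with hx | hx
  · rw [cut_eq_zero hw hs has hx, zero_pow (by omega), mul_zero] at h
    have : |deriv (fun r => cut a w r ^ n) (‖x‖ ^ 2)| = 0 := le_antisymm h (abs_nonneg _)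
    rw [this, zero_mul]
    unfold cutGrad
    positivity
  · calc _ ≤ (n * (stBound / w) * cut a w (‖x‖ ^ 2) ^ (n - 1)) * s :=
          mul_le_mul h hx.le (norm_nonneg _) (by positivity)
      _ = _ := by unfold cutGrad; ring

lemma sq_indicator_integrable {u : E → ℝ} (hu : MemLp u 2 volume) (s : ℝ) :
    Integrable ((ball (0 : E) s).indicator fun x => u x ^ 2) :=
  hu.integrable_sq.indicator measurableSet_ball

namespace SliceH1
variable {u : E → ℝ} {g : E → E} {f : E → E} {k a w s β : ℝ}

lemma trunc_memLp (H : SliceH1 u g) (k : ℝ) : MemLp (fun x => trunc k (u x)) 2 volume :=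
  H.memLp_prim (above_bddLim k)

/-- The localized Dirichlet energy of the truncation. -/
noncomputable def energy (u : E → ℝ) (g : E → E) (k a w : ℝ) : ℝ :=
  ∫ x, cut a w (‖x‖ ^ 2) ^ 10 * (above k (u x) * ‖g x‖ ^ 2)

/-- The localized square norm of the truncation. -/
noncomputable def mass (u : E → ℝ) (k s : ℝ) : ℝ := ∫ x in ball (0 : E) s, trunc k (u x) ^ 2

lemma energy_nonneg : 0 ≤ energy u g k a w :=
  integral_nonneg fun _ => mul_nonneg (pow_nonneg (cut_nonneg _) _)
    (mul_nonneg (above_nonneg _ _) (sq_nonneg _))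

lemma mass_nonneg : 0 ≤ mass u k s := integral_nonneg fun _ => sq_nonneg _

lemma measurable_cut : Measurable fun x : E => cut a w (‖x‖ ^ 2) :=
  ((cut_smooth (a := a) (w := w)).continuous.comp (continuous_norm.pow 2)).measurable

lemma energy_integrable (H : SliceH1 u g) :
    Integrable fun x => cut a w (‖x‖ ^ 2) ^ 10 * (above k (u x) * ‖g x‖ ^ 2) := by
  have hi : Integrable fun x => ‖g x‖ ^ 2 := H.g2.integrable_norm_pow (p := 2) (by norm_num)
  refine hi.mono' ((measurable_cut.pow_const 10).mul
    (((above_bddLim k).measurable.comp H.mu).mul (H.mg.norm.pow_const 2))).aestronglyMeasurable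
    (ae_of_all _ fun x => ?_)
  have c1 := pow_le_one₀ (n := 10) (cut_nonneg (a := a) (w := w) (‖x‖ ^ 2)) (cut_le_one _)
  have c0 := pow_nonneg (cut_nonneg (a := a) (w := w) (‖x‖ ^ 2)) 10
  rw [Real.norm_of_nonneg (mul_nonneg c0 (mul_nonneg (above_nonneg _ _) (sq_nonneg _)))]
  have := mul_le_of_le_one_left (sq_nonneg ‖g x‖) (above_le_one k (u x))
  exact (mul_le_of_le_one_left (mul_nonneg (above_nonneg _ _) (sq_nonneg _)) c1).trans this

lemma ofReal_mass (H : SliceH1 u g) (k s : ℝ) : ofReal (mass u k s)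
    = ∫⁻ x in ball (0 : E) s, ‖trunc k (u x)‖ₑ ^ 2 := by
  rw [mass, ofReal_integral_eq_lintegral_ofReal (H.trunc_memLp k).integrable_sq.integrableOn
    (ae_of_all _ fun x => sq_nonneg _)]
  refine lintegral_congr fun x => ?_
  rw [← sq_abs, ENNReal.ofReal_pow (abs_nonneg _), Real.enorm_eq_ofReal_abs]

/-- The Sobolev inequality for the truncation with the cutoff `c⁵`. -/
lemma sobolev_trunc (H : SliceH1 u g) (ha0 : 0 < a) (ha : a < 1) (hw : 0 < w) (hs : 0 ≤ s)
    (has : a ≤ s ^ 2) :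
    eLpNorm (fun x => cut a w (‖x‖ ^ 2) ^ 5 * trunc k (u x)) 6 volume ^ 2 ≤
      ofReal (sobSq * (energy u g k a w + cutGrad w s ^ 2 / 4 * mass u k s)) := by
  have h0 := one_le_stBound
  have D0 : 0 ≤ cutGrad w s := by unfold cutGrad; positivity
  have hK := H.comp (above_bddLim k)
  have hc : ContDiff ℝ 1 fun r => cut a w r ^ 5 :=
    (cut_smooth.pow 5).of_le (by simp)
  have sob := hK.sobolev_sq (contDiff_radial hc) (r := √a)
    (by rw [Real.sqrt_lt' one_pos]; simpa using ha)
    (fun x hx => by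
      rw [cut_zero hw ((Real.sqrt_le_left (norm_nonneg x)).1 hx), zero_pow (by norm_num)])
  refine sob.trans ?_
  rw [ENNReal.ofReal_mul sobSq_nonneg, ofReal_sobSq]
  refine mul_le_mul_right ?_ _
  rw [ENNReal.ofReal_add energy_nonneg (mul_nonneg (by positivity) mass_nonneg)]
  refine add_le_add ?_ ?_
  · rw [energy, ofReal_integral_eq_lintegral_ofReal H.energy_integrable
      (ae_of_all _ fun x => mul_nonneg (pow_nonneg (cut_nonneg _) _)
        (mul_nonneg (above_nonneg _ _) (sq_nonneg _)))]
    refine lintegral_mono fun x => le_of_eq ?_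
    rw [Real.enorm_eq_ofReal (pow_nonneg (cut_nonneg _) _), ← ofReal_norm (above k (u x) • g x),
      ← ENNReal.ofReal_pow (pow_nonneg (cut_nonneg _) _), ← ENNReal.ofReal_pow (norm_nonneg _),
      ← ENNReal.ofReal_mul (by positivity), norm_smul, Real.norm_of_nonneg (above_nonneg _ _),
      mul_pow, above_sq]
    congr 1
    ring
  · have mI : Measurable ((ball (0 : E) s).indicator fun x => ‖trunc k (u x)‖ₑ ^ 2) :=
      (((trunc_continuous k).measurable.comp H.mu).enorm.pow_const 2).indicator measurableSet_ball
    rw [ENNReal.ofReal_mul (by positivity), H.ofReal_mass, ← lintegral_indicator measurableSet_ball,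
      ← lintegral_const_mul _ mI]
    refine lintegral_mono fun x => ?_
    have hd := norm_fderiv_radial_le hc x
    have hd2 := abs_deriv_cut_mul_le (a := a) hw hs has (n := 5) (by norm_num) x
    have c1 := pow_le_one₀ (n := 4) (cut_nonneg (a := a) (w := w) (‖x‖ ^ 2)) (cut_le_one _)
    have c0 := pow_nonneg (cut_nonneg (a := a) (w := w) (‖x‖ ^ 2)) 4
    norm_num at hd2
    by_cases hx : x ∈ ball (0 : E) s
    · rw [indicator_of_mem hx]
      refine mul_le_mul_left ?_ _
      rw [← ofReal_norm, ← ENNReal.ofReal_pow (norm_nonneg _)]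
      refine ENNReal.ofReal_le_ofReal ?_
      have : ‖fderiv ℝ (fun x : E => cut a w (‖x‖ ^ 2) ^ 5) x‖ ≤ cutGrad w s / 2 := by
        nlinarith
      calc _ ≤ (cutGrad w s / 2) ^ 2 := pow_le_pow_left₀ (norm_nonneg _) this 2
        _ = _ := by ring
    · rw [mem_ball_zero_iff, not_lt] at hx
      rw [cut_eq_zero hw hs has hx] at hd2
      have : ‖fderiv ℝ (fun x : E => cut a w (‖x‖ ^ 2) ^ 5) x‖ ≤ 0 := by
        simp at hd2
        nlinarith
      rw [← ofReal_norm, le_antisymm this (norm_nonneg _)]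
      simp

lemma lintegral_indicator_rpow {μ : Measure E} {A : Set E} (hA : MeasurableSet A) (F : E → ℝ≥0∞)
    {p : ℝ} (hp : 0 < p) : ∫⁻ x, A.indicator F x ^ p ∂μ = ∫⁻ x in A, F x ^ p ∂μ := by
  rw [← lintegral_indicator hA]
  refine lintegral_congr fun x => ?_
  by_cases hx : x ∈ A
  · simp [indicator_of_mem hx]
  · simp [indicator_of_notMem hx, hp]

lemma ofReal_split {y q c : ℝ} (c0 : 0 ≤ c) (y0 : 0 ≤ y) :
    ofReal (y * (q ^ 2 * c ^ 9))
      = ofReal y * ‖c ^ 5 * q‖ₑ ^ (9 / 5 : ℝ) * ‖q‖ₑ ^ (1 / 5 : ℝ) := by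
  have h1 : ‖c ^ 5‖ₑ ^ (9 / 5 : ℝ) = ofReal c ^ 9 := by
    rw [Real.enorm_eq_ofReal (pow_nonneg c0 5), ENNReal.ofReal_pow c0, ← ENNReal.rpow_natCast,
      ← ENNReal.rpow_mul, ← ENNReal.rpow_natCast]
    norm_num
  have h2 : ‖q‖ₑ ^ (9 / 5 : ℝ) * ‖q‖ₑ ^ (1 / 5 : ℝ) = ofReal (q ^ 2) := by
    rw [← ENNReal.rpow_add_of_nonneg _ _ (by norm_num) (by norm_num), ← sq_abs,
      ENNReal.ofReal_pow (abs_nonneg _), ← Real.enorm_eq_ofReal_abs, ← ENNReal.rpow_natCast]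
    norm_num
  rw [enorm_mul, ENNReal.mul_rpow_of_nonneg _ _ (by norm_num), h1, ENNReal.ofReal_mul y0,
    ENNReal.ofReal_mul (sq_nonneg q), ENNReal.ofReal_pow c0, ← h2]
  ring

/-- Hölder's inequality for the drift term of the truncation. -/
lemma drift_hoelder (H : SliceH1 u g) (mf : Measurable f) (hw : 0 < w)
    (hs : 0 < s) (has : a ≤ s ^ 2) :
    ∫⁻ x, ofReal (‖f x‖ * (trunc k (u x) ^ 2 * cut a w (‖x‖ ^ 2) ^ 9)) ≤
      (∫⁻ x in ball (0 : E) s, ‖f x‖ₑ ^ (5 / 3 : ℝ)) ^ (3 / 5 : ℝ)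
        * (eLpNorm (fun x => cut a w (‖x‖ ^ 2) ^ 5 * trunc k (u x)) 6 volume ^ 2) ^ (9 / 10 : ℝ)
        * ofReal (mass u k s) ^ (1 / 10 : ℝ) := by
  have cz : ∀ x, x ∉ ball (0 : E) s → cut a w (‖x‖ ^ 2) = 0 := fun x hx => by
    rw [mem_ball_zero_iff, not_lt] at hx
    exact cut_eq_zero hw hs.le has hx
  have mq : Measurable fun x => trunc k (u x) := (trunc_continuous k).measurable.comp H.mu
  have mF : Measurable fun x : E => cut a w (‖x‖ ^ 2) ^ 5 * trunc k (u x) :=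
    (measurable_cut.pow_const 5).mul mq
  have m1 : Measurable ((ball (0 : E) s).indicator fun x => ‖f x‖ₑ) :=
    mf.enorm.indicator measurableSet_ball
  have m2 : Measurable ((ball (0 : E) s).indicator fun x => ‖trunc k (u x)‖ₑ) :=
    mq.enorm.indicator measurableSet_ball
  have hold := lintegral_drift_le (μ := volume)
    (f := (ball (0 : E) s).indicator fun x => ‖f x‖ₑ)
    (F := fun x => ‖cut a w (‖x‖ ^ 2) ^ 5 * trunc k (u x)‖ₑ)
    (U := (ball (0 : E) s).indicator fun x => ‖trunc k (u x)‖ₑ)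
    m1.aemeasurable mF.enorm.aemeasurable m2.aemeasurable
  have eU : ∫⁻ x, (ball (0 : E) s).indicator (fun x => ‖trunc k (u x)‖ₑ) x ^ 2
      = ofReal (mass u k s) := by
    rw [H.ofReal_mass]
    have := lintegral_indicator_rpow (μ := volume) (measurableSet_ball (x := (0 : E)) (ε := s))
      (fun x => ‖trunc k (u x)‖ₑ) (p := 2) (by norm_num)
    simp only [ENNReal.rpow_two] at this
    exact this
  rw [lintegral_pow_six, lintegral_indicator_rpow measurableSet_ball _ (by norm_num), eU] at hold
  refine le_trans (lintegral_mono fun x => le_of_eq ?_) hold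
  by_cases hx : x ∈ ball (0 : E) s
  · rw [indicator_of_mem hx, indicator_of_mem hx, ofReal_split (cut_nonneg _) (norm_nonneg _),
      ofReal_norm]
  · rw [indicator_of_notMem hx, cz x hx]
    simp

/-- The drift term on a time slice is controlled by the Dirichlet energy and the mass. -/
lemma drift_le (H : SliceH1 u g) (mf : Measurable f) (ha0 : 0 < a) (ha : a < 1) (hw : 0 < w)
    (hs : 0 < s) (has : a ≤ s ^ 2) (hβ0 : 0 ≤ β)
    (hβ : (∫⁻ x in ball (0 : E) s, ‖f x‖ₑ ^ (5 / 3 : ℝ)) ^ (3 / 5 : ℝ) ≤ ofReal β) :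
    ofReal (cutGrad w s)
        * ∫⁻ x, ofReal (‖f x‖ * (trunc k (u x) ^ 2 * cut a w (‖x‖ ^ 2) ^ 9)) ≤
      ofReal (energy u g k a w / 2
        + (cutGrad w s ^ 2 / 8 + youngConst * (cutGrad w s * β) ^ 10) * mass u k s) := by
  have h0 := one_le_stBound
  have D0 : 0 ≤ cutGrad w s := by unfold cutGrad; positivity
  have K0 := sobSq_nonneg
  have hold := H.drift_hoelder (k := k) mf hw hs has
  have sob := H.sobolev_trunc (k := k) ha0 ha hw hs.le has
  have m0 := mass_nonneg (u := u) (k := k) (s := s)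
  have n0 := energy_nonneg (u := u) (g := g) (k := k) (a := a) (w := w)
  generalize cutGrad w s = D at *
  generalize mass u k s = m at *
  generalize energy u g k a w = N at *
  obtain ⟨A, hA⟩ : ∃ A, A = sobSq * (N + D ^ 2 / 4 * m) := ⟨_, rfl⟩
  rw [← hA] at sob
  have A0 : 0 ≤ A := by rw [hA]; positivity
  calc ofReal D * _ ≤ ofReal D * (ofReal β
        * ofReal A ^ (9 / 10 : ℝ) * ofReal m ^ (1 / 10 : ℝ)) := by
        refine mul_le_mul_right (hold.trans ?_) _
        gcongr
    _ = ofReal (D * β) * ofReal A ^ (9 / 10 : ℝ)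
          * ofReal m ^ (1 / 10 : ℝ) := by
        rw [ENNReal.ofReal_mul D0]; ring
    _ ≤ ofReal ((2 * (sobSq + 1))⁻¹) * ofReal A
          + (ofReal ((2 * (sobSq + 1))⁻¹) ^ 9)⁻¹ * ofReal (D * β) ^ 10
            * ofReal m := by
        refine young_drift ?_ ENNReal.ofReal_ne_top
        rw [Ne, ENNReal.ofReal_eq_zero, not_le]
        positivity
    _ = ofReal ((2 * (sobSq + 1))⁻¹ * A + youngConst * (D * β) ^ 10 * m) := by
        have p : 0 < (2 * (sobSq + 1))⁻¹ := by positivity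
        have y0 := youngConst_nonneg
        have e : (ofReal ((2 * (sobSq + 1))⁻¹) ^ 9)⁻¹ = ofReal youngConst := by
          rw [← ENNReal.ofReal_pow p.le, ← ENNReal.ofReal_inv_of_pos (pow_pos p 9), youngConst,
            inv_pow, inv_inv]
        rw [e, ← ENNReal.ofReal_pow (by positivity), ← ENNReal.ofReal_mul y0,
          ← ENNReal.ofReal_mul (show 0 ≤ youngConst * (D * β) ^ 10 by positivity),
          ← ENNReal.ofReal_mul p.le,
          ← ENNReal.ofReal_add (by positivity) (by positivity)]
    _ ≤ _ := by
        refine ENNReal.ofReal_le_ofReal ?_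
        have : (2 * (sobSq + 1))⁻¹ * A ≤ (N + D ^ 2 / 4 * m) / 2 := by
          rw [inv_mul_le_iff₀ (by positivity), hA]
          have : 0 ≤ N + D ^ 2 / 4 * m := by positivity
          nlinarith
        linarith

end SliceH1

/-! ### The Caccioppoli inequality for truncations -/

namespace SliceH1
variable {u : E → ℝ} {g : E → E} {k k' κ a w s s' V : ℝ}

lemma pow_le_of_trunc {F Q : ℝ≥0∞} {c : ℝ≥0∞} (hF : c ≤ Q) (hQ : Q = F) :
    c ^ (4 / 3 : ℝ) * Q ^ 2 ≤ F ^ (10 / 3 : ℝ) := by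
  subst hQ
  calc c ^ (4 / 3 : ℝ) * Q ^ 2 ≤ Q ^ (4 / 3 : ℝ) * Q ^ 2 := by gcongr
    _ = Q ^ (10 / 3 : ℝ) := by
      rw [← ENNReal.rpow_natCast, ← ENNReal.rpow_add_of_nonneg _ _ (by norm_num) (by norm_num)]
      norm_num

lemma trunc_dichotomy (hk : 0 ≤ k) (hκ : 0 < κ) (r : ℝ) :
    trunc (k + κ) r = 0 ∨ (κ ≤ |trunc k r| ∧ |trunc (k + κ) r| ≤ |trunc k r|) := by
  rcases le_or_gt |r| (k + κ) with h | h
  · exact Or.inl (trunc_of_le h)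
  · refine Or.inr ?_
    rw [abs_trunc hk, abs_trunc (by linarith), max_eq_left (by linarith), max_eq_left (by linarith)]
    constructor <;> linarith

/-- Passing to a higher truncation level gains integrability. -/
lemma mass_le (H : SliceH1 u g) (ha0 : 0 < a) (ha : a < 1) (hw : 0 < w) (hs : 0 ≤ s)
    (has : a ≤ s ^ 2) (hs'a : s' ^ 2 ≤ a - w) (hk : 0 ≤ k) (hκ : 0 < κ)
    (hV : ∫ x, cut a w (‖x‖ ^ 2) ^ 10 * trunc k (u x) ^ 2 ≤ V) :
    mass u (k + κ) s' ≤ (V ^ 2 / κ ^ 4) ^ (1 / 3 : ℝ)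
      * (sobSq * (energy u g k a w + cutGrad w s ^ 2 / 4 * mass u k s)) := by
  have sob := H.sobolev_trunc (k := k) ha0 ha hw hs has
  have m0 := mass_nonneg (u := u) (k := k) (s := s)
  have n0 := energy_nonneg (u := u) (g := g) (k := k) (a := a) (w := w)
  have mq : Measurable fun x => trunc k (u x) := (trunc_continuous k).measurable.comp H.mu
  have mq' : Measurable fun x => trunc (k + κ) (u x) :=
    (trunc_continuous _).measurable.comp H.mu
  have mF : Measurable fun x : E => cut a w (‖x‖ ^ 2) ^ 5 * trunc k (u x) :=
    (measurable_cut.pow_const 5).mul mq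
  set A := sobSq * (energy u g k a w + cutGrad w s ^ 2 / 4 * mass u k s) with hA
  have A0 : 0 ≤ A := mul_nonneg sobSq_nonneg (by positivity)
  have nn : ∀ x : E, 0 ≤ cut a w (‖x‖ ^ 2) ^ 10 * trunc k (u x) ^ 2 := fun x =>
    mul_nonneg (pow_nonneg (cut_nonneg _) _) (sq_nonneg _)
  have V0 : 0 ≤ V := (integral_nonneg nn).trans hV
  have hF2 : ∫⁻ x, ‖cut a w (‖x‖ ^ 2) ^ 5 * trunc k (u x)‖ₑ ^ 2 ≤ ofReal V := by
    refine le_trans (le_of_eq ?_) (ENNReal.ofReal_le_ofReal hV)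
    rw [ofReal_integral_eq_lintegral_ofReal _ (ae_of_all _ nn)]
    · refine lintegral_congr fun x => ?_
      rw [Real.enorm_eq_ofReal_abs, ← ENNReal.ofReal_pow (abs_nonneg _), sq_abs]
      congr 1; ring
    · refine (H.trunc_memLp k).integrable_sq.mono' ((measurable_cut.pow_const 10).mul
        (mq.pow_const 2)).aestronglyMeasurable (ae_of_all _ fun x => ?_)
      rw [Real.norm_of_nonneg (nn x)]
      exact mul_le_of_le_one_left (sq_nonneg _) (pow_le_one₀ (cut_nonneg _) (cut_le_one _))
  have h6 : (∫⁻ x, ‖cut a w (‖x‖ ^ 2) ^ 5 * trunc k (u x)‖ₑ ^ 6) ^ (1 / 3 : ℝ)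
      ≤ ofReal A := by
    refine le_trans (le_of_eq ?_) sob
    rw [eLpNorm_eq_lintegral_rpow_enorm_toReal (by norm_num) (by norm_num)]
    rw [← ENNReal.rpow_natCast, ← ENNReal.rpow_mul]
    norm_num
  have hold : ∫⁻ x, ‖cut a w (‖x‖ ^ 2) ^ 5 * trunc k (u x)‖ₑ ^ (10 / 3 : ℝ)
      ≤ ofReal A * ofReal V ^ (2 / 3 : ℝ) := by
    have := ENNReal.lintegral_mul_norm_pow_le (μ := (volume : Measure E))
      (mF.enorm.pow_const 6).aemeasurable (mF.enorm.pow_const 2).aemeasurable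
      (p := 1 / 3) (q := 2 / 3) (by norm_num) (by norm_num) (by norm_num)
    refine le_trans (le_trans (lintegral_mono fun x => le_of_eq ?_) this) ?_
    · rw [← ENNReal.rpow_natCast, ← ENNReal.rpow_natCast, ← ENNReal.rpow_mul, ← ENNReal.rpow_mul,
        ← ENNReal.rpow_add_of_nonneg _ _ (by norm_num) (by norm_num)]
      norm_num
    · gcongr
  have cheb : ofReal κ ^ (4 / 3 : ℝ) * ofReal (mass u (k + κ) s')
      ≤ ∫⁻ x, ‖cut a w (‖x‖ ^ 2) ^ 5 * trunc k (u x)‖ₑ ^ (10 / 3 : ℝ) := by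
    rw [H.ofReal_mass, ← lintegral_indicator measurableSet_ball,
      ← lintegral_const_mul _ ((mq'.enorm.pow_const 2).indicator measurableSet_ball)]
    refine lintegral_mono fun x => ?_
    by_cases hx : x ∈ ball (0 : E) s'
    · have hx' : ‖x‖ ^ 2 ≤ a - w := by
        rw [mem_ball_zero_iff] at hx
        exact (pow_le_pow_left₀ (norm_nonneg _) hx.le 2).trans hs'a
      rw [indicator_of_mem hx, cut_one hw hx', one_pow, one_mul]
      rcases trunc_dichotomy hk hκ (u x) with h | ⟨h1, h2⟩
      · rw [h]; simp
      · have h1' : ofReal κ ≤ ‖trunc k (u x)‖ₑ := by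
          rw [Real.enorm_eq_ofReal_abs]; exact ENNReal.ofReal_le_ofReal h1
        have h2' : ‖trunc (k + κ) (u x)‖ₑ ≤ ‖trunc k (u x)‖ₑ := by
          rw [Real.enorm_eq_ofReal_abs, Real.enorm_eq_ofReal_abs]
          exact ENNReal.ofReal_le_ofReal h2
        exact (mul_le_mul_right (pow_le_pow_left' h2' 2) _).trans (pow_le_of_trunc h1' rfl)
    · rw [indicator_of_notMem hx]; simp
  have hfin := cheb.trans hold
  rw [ENNReal.ofReal_rpow_of_nonneg hκ.le (by norm_num), ENNReal.ofReal_rpow_of_nonneg V0 (by norm_num),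
    ← ENNReal.ofReal_mul (by positivity), ← ENNReal.ofReal_mul A0,
    ENNReal.ofReal_le_ofReal_iff (by positivity)] at hfin
  have e : (V ^ 2 / κ ^ 4) ^ (1 / 3 : ℝ) = V ^ (2 / 3 : ℝ) / κ ^ (4 / 3 : ℝ) := by
    rw [Real.div_rpow (by positivity) (by positivity), ← Real.rpow_natCast, ← Real.rpow_natCast,
      ← Real.rpow_mul V0, ← Real.rpow_mul hκ.le]
    norm_num
  rw [e, div_mul_eq_mul_div, le_div_iff₀ (by positivity)]
  linarith

end SliceH1

namespace Sol
variable {b : ST → E} {Γ : ST → ℝ} {G : ST → E} {k a w s β : ℝ}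

/-- The growth constant in the Caccioppoli inequality. -/
noncomputable def cacc (w s β : ℝ) : ℝ :=
  cutGrad w s ^ 2 + 2 * cutGrad w s / s
    + (cutGrad w s ^ 2 / 8 + youngConst * (cutGrad w s * β) ^ 10)

/-- The flux for the squared truncation. -/
noncomputable def truncFlux (b : ST → E) (Γ : ST → ℝ) (G : ST → E) (k a w : ℝ) : ST → ℝ :=
  flux b Γ G (prim (prim fun r => 2 * above k r)) (prim fun r => 2 * above k r)
    (fun r => 2 * above k r) (fun r => cut a w r ^ 10)

lemma neg_truncFlux_le (hw : 0 < w) (hs : 0 < s) (has : a ≤ s ^ 2) (z : ST) :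
    -truncFlux b Γ G k a w z ≤
      -(cut a w (‖z.1‖ ^ 2) ^ 10 * (above k (Γ z) * ‖G z‖ ^ 2))
        + (cutGrad w s ^ 2 + 2 * cutGrad w s / s)
          * (ball (0 : E) s).indicator (fun x => trunc k (Γ (x, z.2)) ^ 2) z.1
        + cutGrad w s * (‖b z‖ * (trunc k (Γ z) ^ 2 * cut a w (‖z.1‖ ^ 2) ^ 9)) := by
  have h0 := one_le_stBound
  have D0 : 0 ≤ cutGrad w s := by unfold cutGrad; positivity
  have hd := abs_deriv_cut_mul_le (a := a) hw hs.le has (n := 10) (by norm_num) z.1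
  have hd' := abs_deriv_cut_pow_le (a := a) hw 10 (‖z.1‖ ^ 2)
  rw [truncFlux, flux, prim_prim_two_above, prim_two_above]
  have c0 : 0 ≤ cut a w (‖z.1‖ ^ 2) := cut_nonneg _
  have c1 : cut a w (‖z.1‖ ^ 2) ≤ 1 := cut_le_one _
  have cz : s ≤ ‖z.1‖ → cut a w (‖z.1‖ ^ 2) = 0 := cut_eq_zero hw hs.le has
  have qe := trunc_mul_above k (Γ z)
  have e0 := above_nonneg k (Γ z)
  have e2 := above_sq k (Γ z)
  have hG := abs_dotx_le G z
  have hb := abs_dotx_le b z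
  have eD : 10 * (stBound / w) = cutGrad w s / (2 * s) := by unfold cutGrad; field_simp; norm_num
  norm_num at hd hd'
  rw [eD] at hd'
  beta_reduce
  generalize cut a w (‖z.1‖ ^ 2) = c at *
  generalize deriv (fun r => cut a w r ^ 10) (‖z.1‖ ^ 2) = d at *
  generalize cutGrad w s = D at *
  have xz : (ball (0 : E) s).indicator (fun x => trunc k (Γ (x, z.2)) ^ 2) z.1
      = if ‖z.1‖ < s then trunc k (Γ z) ^ 2 else 0 := by
    simp [indicator]
  rw [xz]
  generalize trunc k (Γ z) = q at *
  generalize above k (Γ z) = e at *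
  generalize dotx G z = xG at *
  generalize dotx b z = xb at *
  have nG := norm_nonneg (G z)
  have nb := norm_nonneg (b z)
  have nX := norm_nonneg z.1
  generalize ‖G z‖ = γ at *
  generalize ‖b z‖ = f at *
  generalize ‖z.1‖ = X at *
  -- the three error terms
  have t1 : -(2 * (2 * q * (d * xG))) ≤ D ^ 2 * (if X < s then q ^ 2 else 0)
      + c ^ 10 * (e * γ ^ 2) := by
    have h1 : -(2 * (2 * q * (d * xG))) ≤ 2 * D * |q| * c ^ 9 * γ := by
      have : |2 * (2 * q * (d * xG))| ≤ 2 * D * |q| * c ^ 9 * γ := by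
        rw [abs_mul, abs_mul, abs_mul, abs_mul, abs_two]
        have : |d| * |xG| ≤ (1 / 2 * D * c ^ 9) * γ := by
          calc |d| * |xG| ≤ |d| * (X * γ) := by gcongr
            _ = (|d| * X) * γ := by ring
            _ ≤ _ := by gcongr
        calc 2 * (2 * |q| * (|d| * |xG|)) ≤ 2 * (2 * |q| * ((1 / 2 * D * c ^ 9) * γ)) := by gcongr
          _ = _ := by ring
      exact (neg_le_abs _).trans this
    refine h1.trans ?_
    by_cases hX : X < s
    · rw [if_pos hX]
      have hq : |q| = |q| * e := by
        rw [← abs_of_nonneg e0, ← abs_mul, qe]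
      have h8 : c ^ 8 ≤ 1 := pow_le_one₀ c0 c1
      calc 2 * D * |q| * c ^ 9 * γ = 2 * (D * |q| * c ^ 4) * (e * c ^ 5 * γ) := by
            rw [hq]; nth_rw 1 [← e2]; ring
        _ ≤ (D * |q| * c ^ 4) ^ 2 + (e * c ^ 5 * γ) ^ 2 := two_mul_le_add_sq _ _
        _ = D ^ 2 * q ^ 2 * c ^ 8 + c ^ 10 * (e ^ 2 * γ ^ 2) := by
            rw [mul_pow, mul_pow, sq_abs]; ring
        _ ≤ _ := by
            rw [e2]
            have : D ^ 2 * q ^ 2 * c ^ 8 ≤ D ^ 2 * q ^ 2 :=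
              mul_le_of_le_one_right (by positivity) h8
            linarith
    · rw [if_neg hX, cz (not_lt.1 hX)]
      simp
  have t2 : 2 * (q ^ 2 * (d * xb)) ≤ D * (f * (q ^ 2 * c ^ 9)) := by
    have : d * xb ≤ (1 / 2 * D * c ^ 9) * f := by
      calc d * xb ≤ |d| * |xb| := by rw [← abs_mul]; exact le_abs_self _
        _ ≤ |d| * (X * f) := by gcongr
        _ = (|d| * X) * f := by ring
        _ ≤ _ := by gcongr
    calc 2 * (q ^ 2 * (d * xb)) ≤ 2 * (q ^ 2 * ((1 / 2 * D * c ^ 9) * f)) := by gcongr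
      _ = _ := by ring
  have t3 : 4 * (d * q ^ 2) ≤ 2 * D / s * (if X < s then q ^ 2 else 0) := by
    by_cases hX : X < s
    · rw [if_pos hX]
      have h9 : c ^ 9 ≤ 1 := pow_le_one₀ c0 c1
      have : d ≤ D / (2 * s) := (le_abs_self d).trans (hd'.trans
        (mul_le_of_le_one_right (by positivity) h9))
      calc 4 * (d * q ^ 2) ≤ 4 * (D / (2 * s) * q ^ 2) := by gcongr
        _ = _ := by field_simp; ring
    · rw [cz (not_lt.1 hX)] at hd'
      have : d = 0 := by
        have h := hd'
        norm_num at h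
        exact h
      rw [if_neg hX, this]; simp
  linarith [t1, t2, t3]

end Sol

namespace Sol
variable {b : ST → E} {Γ : ST → ℝ} {G : ST → E} {k κ a w s s' β T : ℝ}

open SliceH1 (mass energy)

/-- The square norm of the truncation over the parabolic cylinder `P(s)`. -/
noncomputable def totalMass (Γ : ST → ℝ) (k s : ℝ) : ℝ :=
  ∫ t in Ioc (-s ^ 2) 0, mass (fun x => Γ (x, t)) k s

lemma neg_integral_truncFlux_le (S : Sol b Γ G) {t : ℝ}
    (H : SliceH1 (fun x => Γ (x, t)) (fun x => G (x, t)))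
    (hQ : Integrable fun x => truncFlux b Γ G k a w (x, t))
    (ha0 : 0 < a) (ha : a < 1) (hw : 0 < w) (hs : 0 < s) (has : a ≤ s ^ 2) (hβ0 : 0 ≤ β)
    (hβ : (∫⁻ x in ball (0 : E) s, ‖b (x, t)‖ₑ ^ (5 / 3 : ℝ)) ^ (3 / 5 : ℝ) ≤ ofReal β) :
    -∫ x, truncFlux b Γ G k a w (x, t) ≤
      -(energy (fun x => Γ (x, t)) (fun x => G (x, t)) k a w / 2)
        + cacc w s β * mass (fun x => Γ (x, t)) k s := by
  have h0 := one_le_stBound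
  have D0 : 0 < cutGrad w s := by unfold cutGrad; positivity
  have mb : Measurable fun x : E => b (x, t) := S.mb.comp measurable_prodMk_right
  have hd := H.drift_le (k := k) mb ha0 ha hw hs has hβ0 hβ
  set N := energy (fun x => Γ (x, t)) (fun x => G (x, t)) k a w
  set m := mass (fun x => Γ (x, t)) k s
  have N0 : 0 ≤ N := SliceH1.energy_nonneg
  have m0 : 0 ≤ m := SliceH1.mass_nonneg
  have mq : Measurable fun x : E => trunc k (Γ (x, t)) := (trunc_continuous k).measurable.comp H.mu
  have nn : ∀ x : E, 0 ≤ ‖b (x, t)‖ * (trunc k (Γ (x, t)) ^ 2 * cut a w (‖x‖ ^ 2) ^ 9) := fun x =>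
    mul_nonneg (norm_nonneg _) (mul_nonneg (sq_nonneg _) (pow_nonneg (cut_nonneg _) _))
  have mR : Measurable fun x : E =>
      ‖b (x, t)‖ * (trunc k (Γ (x, t)) ^ 2 * cut a w (‖x‖ ^ 2) ^ 9) :=
    mb.norm.mul ((mq.pow_const 2).mul (SliceH1.measurable_cut.pow_const 9))
  have iR : Integrable fun x : E =>
      ‖b (x, t)‖ * (trunc k (Γ (x, t)) ^ 2 * cut a w (‖x‖ ^ 2) ^ 9) := by
    refine ⟨mR.aestronglyMeasurable, ?_⟩
    rw [hasFiniteIntegral_iff_ofReal (ae_of_all _ nn)]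
    by_contra h
    rw [not_lt, top_le_iff] at h
    rw [h, ENNReal.mul_top (by simpa using D0)] at hd
    exact absurd (top_le_iff.1 hd) ENNReal.ofReal_ne_top
  have Y0 := youngConst_nonneg
  have hR : cutGrad w s * ∫ x : E, ‖b (x, t)‖ * (trunc k (Γ (x, t)) ^ 2 * cut a w (‖x‖ ^ 2) ^ 9)
      ≤ N / 2 + (cutGrad w s ^ 2 / 8 + youngConst * (cutGrad w s * β) ^ 10) * m := by
    rw [← ofReal_integral_eq_lintegral_ofReal iR (ae_of_all _ nn),
      ← ENNReal.ofReal_mul D0.le, ENNReal.ofReal_le_ofReal_iff (by positivity)] at hd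
    exact hd
  have iN := H.energy_integrable (k := k) (a := a) (w := w)
  have im := sq_indicator_integrable (H.trunc_memLp k) s
  have iRHS : Integrable fun x : E => -(cut a w (‖x‖ ^ 2) ^ 10 * (above k (Γ (x, t)) * ‖G (x, t)‖ ^ 2))
      + (cutGrad w s ^ 2 + 2 * cutGrad w s / s)
        * (ball (0 : E) s).indicator (fun x => trunc k (Γ (x, t)) ^ 2) x := iN.neg.add (im.const_mul _)
  have iD := iR.const_mul (cutGrad w s)
  have main := integral_mono hQ.neg (iRHS.add iD) fun x => neg_truncFlux_le hw hs has (x, t)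
  have e1 := integral_add' iRHS iD
  have e2 := integral_add' iN.neg (im.const_mul (cutGrad w s ^ 2 + 2 * cutGrad w s / s))
  have e3 : ∫ x, (ball (0 : E) s).indicator (fun x => trunc k (Γ (x, t)) ^ 2) x = m :=
    integral_indicator measurableSet_ball
  rw [integral_neg', integral_const_mul, e3] at e2
  rw [integral_const_mul] at e1
  rw [integral_neg'] at main
  have e4 : ∫ x : E, cut a w (‖x‖ ^ 2) ^ 10 * (above k (Γ (x, t)) * ‖G (x, t)‖ ^ 2) = N := rfl
  rw [e4] at e2
  have main' := main.trans (le_of_eq (e1.trans (congrArg (· + _) e2)))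
  beta_reduce at main'
  unfold cacc
  linarith

/-- The time cutoff, equal to `0` for `t ≤ -s²` and to `1` for `t ≥ -s² + w`. -/
noncomputable def timeCut (w s t : ℝ) : ℝ := Real.smoothTransition ((t + s ^ 2) / w)

lemma timeCut_smooth : ContDiff ℝ ∞ (timeCut w s) :=
  smoothTransition_smooth.comp ((contDiff_id.add contDiff_const).div_const w)

lemma timeCut_zero (hw : 0 < w) {t : ℝ} (ht : t ≤ -s ^ 2) : timeCut w s t = 0 :=
  Real.smoothTransition.zero_of_nonpos (div_nonpos_of_nonpos_of_nonneg (by linarith) hw.le)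

lemma timeCut_one (hw : 0 < w) {t : ℝ} (ht : -s ^ 2 + w ≤ t) : timeCut w s t = 1 :=
  Real.smoothTransition.one_of_one_le ((one_le_div hw).2 (by linarith))

lemma abs_deriv_timeCut_le (hw : 0 < w) (t : ℝ) : |deriv (timeCut w s) t| ≤ stBound / w := by
  have h1 : HasDerivAt Real.smoothTransition _ ((t + s ^ 2) / w) :=
    ((smoothTransition_smooth.differentiable (by simp)) _).hasDerivAt
  have h2 : HasDerivAt (fun t => (t + s ^ 2) / w) (1 / w) t :=
    ((hasDerivAt_id t).add_const _).div_const w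
  have h3 : HasDerivAt (timeCut w s) _ t := h1.comp t h2
  rw [h3.deriv, abs_mul, abs_div, abs_one, abs_of_pos hw, mul_one_div]
  gcongr
  exact abs_deriv_st_le _

lemma deriv_timeCut_zero (hw : 0 < w) {t : ℝ} (ht : t < -s ^ 2) : deriv (timeCut w s) t = 0 := by
  have : timeCut w s =ᶠ[𝓝 t] fun _ => 0 := by
    filter_upwards [gt_mem_nhds ht] with r hr using timeCut_zero hw hr.le
  rw [this.deriv_eq]; simp

lemma trunc_sq_integrable (S : Sol b Γ G) (k : ℝ) : Integrable fun z => trunc k (Γ z) ^ 2 := by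
  refine S.sq_integrable.mono' (((trunc_continuous k).measurable.comp S.mΓ).pow_const
    2).aestronglyMeasurable (ae_of_all _ fun z => ?_)
  rw [Real.norm_of_nonneg (sq_nonneg _), ← sq_abs, ← sq_abs (Γ z)]
  have := (above_bddLim k).abs_prim_le (Γ z)
  rw [one_mul] at this
  exact pow_le_pow_left₀ (abs_nonneg _) this 2

lemma mass_integrable (S : Sol b Γ G) (k s : ℝ) :
    Integrable fun t => mass (fun x => Γ (x, t)) k s := by
  have hm : MeasurableSet {z : ST | z.1 ∈ ball (0 : E) s} := measurable_fst measurableSet_ball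
  refine ((S.trunc_sq_integrable k).indicator hm).integral_prod_right.congr
    (ae_of_all _ fun t => ?_)
  simp only [mass]
  rw [← integral_indicator measurableSet_ball]
  rfl

lemma energyDensity_integrable (S : Sol b Γ G) (k a w : ℝ) : Integrable fun z : ST =>
    cut a w (‖z.1‖ ^ 2) ^ 10 * (above k (Γ z) * ‖G z‖ ^ 2) := by
  refine S.normSq_integrable.mono' (((SliceH1.measurable_cut.comp measurable_fst).pow_const 10).mul
    (((above_bddLim k).measurable.comp S.mΓ).mul (S.mG.norm.pow_const 2))).aestronglyMeasurable
    (ae_of_all _ fun z => ?_)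
  have c1 := pow_le_one₀ (n := 10) (cut_nonneg (a := a) (w := w) (‖z.1‖ ^ 2)) (cut_le_one _)
  have c0 := pow_nonneg (cut_nonneg (a := a) (w := w) (‖z.1‖ ^ 2)) 10
  rw [Real.norm_of_nonneg (mul_nonneg c0 (mul_nonneg (above_nonneg _ _) (sq_nonneg _)))]
  have := mul_le_of_le_one_left (sq_nonneg ‖G z‖) (above_le_one k (Γ z))
  exact (mul_le_of_le_one_left (mul_nonneg (above_nonneg _ _) (sq_nonneg _)) c1).trans this

lemma energy_slice_integrable (S : Sol b Γ G) (k a w : ℝ) :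
    Integrable fun t => energy (fun x => Γ (x, t)) (fun x => G (x, t)) k a w :=
  (S.energyDensity_integrable k a w).integral_prod_right

lemma energy_slice_zero (S : Sol b Γ G) {t : ℝ} (ht : t ∉ Ioc (-1 : ℝ) 0) :
    energy (fun x => Γ (x, t)) (fun x => G (x, t)) k a w = 0 := by
  refine integral_eq_zero_of_ae (ae_of_all _ fun x => ?_)
  simp [S.Gz (x, t) (zero_time ht)]

/-- The Caccioppoli inequality: the truncation at the level `k` in a smaller cylinder is controlled
by its square norm in a larger one. -/
lemma caccioppoli (S : Sol b Γ G) {β₁ : ℝ≥0} (hβ₁ : DriftBdd b β₁) (hw : 0 < w) (hs : 0 < s)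
    (hs1 : s < 1) (hβ0 : 0 ≤ β)
    (hβ : ∀ᵐ t : ℝ, t ∈ Ioo (-s ^ 2) 0 →
      (∫⁻ x in ball (0 : E) s, ‖b (x, t)‖ₑ ^ (5 / 3 : ℝ)) ^ (3 / 5 : ℝ) ≤ ofReal β)
    (hT : T = cacc w s β + stBound / w) :
    (∀ᵐ t : ℝ, t ∈ Ioo (-s ^ 2 + w) 0 →
      ∫ x, cut (s ^ 2) w (‖x‖ ^ 2) ^ 10 * trunc k (Γ (x, t)) ^ 2 ≤ T * totalMass Γ k s) ∧
    ∫ t in Ioc (-s ^ 2 + w) 0, energy (fun x => Γ (x, t)) (fun x => G (x, t)) k (s ^ 2) w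
      ≤ 2 * (T * totalMass Γ k s) := by
  have h0 := one_le_stBound
  have ha0 : 0 < s ^ 2 := by positivity
  have ha : s ^ 2 < 1 := by nlinarith
  have P := cut_profile ha0 ha hw (n := 10) (by norm_num)
  have hk := two_above_bddLim k
  have Qi := S.flux_integrable_lim hβ₁ hk P
  have ident := S.energy_identity_lim hβ₁ hk P (timeCut_smooth (w := w) (s := s)) (t₀ := -s ^ 2)
    (by linarith) (fun t ht => timeCut_zero hw ht)
  simp only [prim_prim_two_above] at ident
  set W : ℝ → ℝ := fun t => ∫ x, cut (s ^ 2) w (‖x‖ ^ 2) ^ 10 * trunc k (Γ (x, t)) ^ 2 with hW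
  set m : ℝ → ℝ := fun t => mass (fun x => Γ (x, t)) k s with hm
  set N : ℝ → ℝ := fun t => energy (fun x => Γ (x, t)) (fun x => G (x, t)) k (s ^ 2) w with hN
  have m0 : ∀ t, 0 ≤ m t := fun t => SliceH1.mass_nonneg
  have N0 : ∀ t, 0 ≤ N t := fun t => SliceH1.energy_nonneg
  have W0 : ∀ t, 0 ≤ W t := fun t => integral_nonneg fun x =>
    mul_nonneg (pow_nonneg (cut_nonneg _) _) (sq_nonneg _)
  have D0 : 0 ≤ cutGrad w s := by unfold cutGrad; positivity
  have Y0 := youngConst_nonneg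
  have K0 : 0 ≤ cacc w s β := by unfold cacc; positivity
  have T0 : 0 ≤ T := by rw [hT]; positivity
  have Z0 : 0 ≤ totalMass Γ k s := integral_nonneg m0
  have η0 : ∀ t, 0 ≤ timeCut w s t := fun t => Real.smoothTransition.nonneg _
  have η1 : ∀ t, timeCut w s t ≤ 1 := fun t => Real.smoothTransition.le_one _
  have mint : Integrable m := S.mass_integrable k s
  have Nint : Integrable N := S.energy_slice_integrable k _ w
  have Nz : ∀ t ∉ Ioc (-1 : ℝ) 0, N t = 0 := fun t ht => S.energy_slice_zero ht
  have ηN : Integrable fun t => timeCut w s t * N t :=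
    integrable_cont_mul timeCut_smooth.continuous Nint Nz
  have W_le : ∀ᵐ t : ℝ, W t ≤ m t := by
    filter_upwards [integrable_slice (S.trunc_sq_integrable k)] with t ht
    simp only [hW, hm, mass]
    rw [← integral_indicator measurableSet_ball]
    refine integral_mono_of_nonneg (ae_of_all _ fun x =>
      mul_nonneg (pow_nonneg (cut_nonneg _) _) (sq_nonneg _)) (ht.indicator measurableSet_ball)
      (ae_of_all _ fun x => ?_)
    by_cases hx : x ∈ ball (0 : E) s
    · rw [indicator_of_mem hx]
      exact mul_le_of_le_one_left (sq_nonneg _) (pow_le_one₀ (cut_nonneg _) (cut_le_one _))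
    · rw [indicator_of_notMem hx]
      rw [mem_ball_zero_iff, not_lt] at hx
      simp [cut_eq_zero hw hs.le le_rfl hx]
  -- the differential inequality for almost every time
  have point : ∀ᵐ τ : ℝ, τ ∈ Iio (0 : ℝ) →
      deriv (timeCut w s) τ * W τ - timeCut w s τ * ∫ x, truncFlux b Γ G k (s ^ 2) w (x, τ)
        ≤ (Ioc (-s ^ 2) 0).indicator (fun τ => T * m τ) τ - (timeCut w s τ * N τ) / 2 := by
    have hne : ∀ᵐ τ : ℝ, τ ≠ -s ^ 2 := by simp [ae_iff]
    filter_upwards [W_le, S.sliceH1, hβ, integrable_slice Qi, hne] with τ h1 h2 h3 h4 h5 hτ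
    rcases lt_or_gt_of_ne h5 with hlt | hgt
    · rw [timeCut_zero hw hlt.le, deriv_timeCut_zero hw hlt, indicator_of_notMem (by simp [hlt.le])]
      simp
    · rw [indicator_of_mem (show τ ∈ Ioc (-s ^ 2) 0 from ⟨hgt, le_of_lt hτ⟩)]
      have key := S.neg_integral_truncFlux_le (k := k)
        (h2 ⟨lt_trans (by linarith) hgt, hτ⟩) h4 ha0 ha hw hs le_rfl
        hβ0 (h3 ⟨hgt, hτ⟩)
      have b1 : deriv (timeCut w s) τ * W τ ≤ stBound / w * m τ :=
        mul_le_mul ((le_abs_self _).trans (abs_deriv_timeCut_le hw τ)) h1 (W0 τ) (by positivity)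
      have b2 := mul_le_mul_of_nonneg_left key (η0 τ)
      have b3 : timeCut w s τ * (cacc w s β * m τ) ≤ cacc w s β * m τ :=
        mul_le_of_le_one_left (mul_nonneg K0 (m0 τ)) (η1 τ)
      have b4 : T * m τ = cacc w s β * m τ + stBound / w * m τ := by rw [hT]; ring
      change timeCut w s τ * _ ≤ timeCut w s τ * (-(N τ / 2) + cacc w s β * m τ) at b2
      linarith
  have intInd : Integrable ((Ioc (-s ^ 2) 0).indicator fun τ => T * m τ) :=
    (mint.const_mul T).indicator measurableSet_Ioc
  have main : ∀ᵐ t : ℝ, t ∈ Ioo (-1 : ℝ) 0 → timeCut w s t * W t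
      + (∫ τ in Iic t, timeCut w s τ * N τ) / 2 ≤ T * totalMass Γ k s := by
    have Wint : Integrable W := by
      have := S.energy_integrable_lim hk P
      simp only [prim_prim_two_above] at this
      exact this.integral_prod_right
    have Wz : ∀ t ∉ Ioc (-1 : ℝ) 0, W t = 0 := fun t ht =>
      integral_eq_zero_of_ae (ae_of_all _ fun x => by
        simp [S.Γz (x, t) (zero_time ht), trunc, prim_zero])
    have Qz : ∀ t ∉ Ioc (-1 : ℝ) 0, ∫ x, truncFlux b Γ G k (s ^ 2) w (x, t) = 0 := fun t ht =>
      integral_eq_zero_of_ae (ae_of_all _ fun x =>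
        S.flux_zero (prim_zero _) (prim_zero _) (zero_time ht))
    have i1 := integrable_cont_mul
      ((timeCut_smooth (w := w) (s := s)).continuous_deriv (by simp)) Wint Wz
    have i2 := integrable_cont_mul (timeCut_smooth (w := w) (s := s)).continuous
      (show Integrable (fun t : ℝ => ∫ x, truncFlux b Γ G k (s ^ 2) w (x, t)) volume from
        Qi.integral_prod_right) Qz
    filter_upwards [ident] with t ht htI
    rw [ht htI]
    have hle := setIntegral_mono_on_ae (μ := volume) (s := Iic t) (i1.sub i2).integrableOn
      (intInd.sub (ηN.div_const 2)).integrableOn measurableSet_Iic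
      (point.mono fun τ h hτ => h (lt_of_le_of_lt hτ htI.2))
    have e : ∫ τ in Iic t, ((Ioc (-s ^ 2) 0).indicator (fun τ => T * m τ) τ
        - (timeCut w s τ * N τ) / 2) = (∫ τ in Iic t, (Ioc (-s ^ 2) 0).indicator (fun τ => T * m τ) τ)
          - (∫ τ in Iic t, timeCut w s τ * N τ) / 2 := by
      rw [integral_sub intInd.integrableOn (ηN.div_const 2).integrableOn, integral_div]
    have e2 : ∫ τ in Iic t, (Ioc (-s ^ 2) 0).indicator (fun τ => T * m τ) τ
        ≤ T * totalMass Γ k s := by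
      refine (setIntegral_le_integral intInd (ae_of_all _ fun τ =>
        indicator_nonneg (fun τ _ => mul_nonneg T0 (m0 τ)) τ)).trans (le_of_eq ?_)
      rw [integral_indicator measurableSet_Ioc, integral_const_mul]
      rfl
    have hle' := hle.trans (le_of_eq e)
    change ∫ τ in Iic t, (deriv (timeCut w s) τ * W τ - timeCut w s τ *
        ∫ x, truncFlux b Γ G k (s ^ 2) w (x, τ)) ≤ _ at hle'
    have e3 : ∫ τ in Iic t, (deriv (timeCut w s) τ * W τ - timeCut w s τ *
        ∫ x, flux b Γ G (prim (prim fun r => 2 * above k r)) (prim fun r => 2 * above k r)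
          (fun r => 2 * above k r) (fun r => cut (s ^ 2) w r ^ 10) (x, τ))
        = ∫ τ in Iic t, (deriv (timeCut w s) τ * W τ - timeCut w s τ *
          ∫ x, truncFlux b Γ G k (s ^ 2) w (x, τ)) := rfl
    rw [e3]
    linarith
  set Φ : ℝ → ℝ := fun t => ∫ τ in Iic t, timeCut w s τ * N τ with hΦ
  have Φ0 : ∀ t, 0 ≤ Φ t := fun t => integral_nonneg fun τ => mul_nonneg (η0 τ) (N0 τ)
  refine ⟨?_, ?_⟩
  · filter_upwards [main] with t ht htI
    have := ht ⟨by linarith [htI.1], htI.2⟩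
    rw [timeCut_one hw htI.1.le, one_mul] at this
    linarith [Φ0 t]
  · have Φc : Continuous Φ := by
      have : Φ = fun t => (∫ τ in (0 : ℝ)..t, timeCut w s τ * N τ)
          + ∫ τ in Iic 0, timeCut w s τ * N τ := by
        ext t
        rw [← intervalIntegral.integral_Iic_sub_Iic ηN.integrableOn ηN.integrableOn]
        ring
      rw [this]
      exact (intervalIntegral.continuous_primitive (fun _ _ => ηN.intervalIntegrable) 0).add
        continuous_const
    have Φle : Φ 0 ≤ 2 * (T * totalMass Γ k s) := by
      by_contra hcon
      rw [not_le] at hcon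
      obtain ⟨ε, ε0, hε⟩ := Metric.eventually_nhds_iff.1 (Φc.continuousAt.eventually_const_lt hcon)
      have hne : (ae (volume.restrict (Ioo (max (-1) (-ε)) 0))).NeBot := by
        rw [ae_neBot, Ne, Measure.restrict_eq_zero, Real.volume_Ioo, ENNReal.ofReal_eq_zero, not_le,
          sub_pos]
        exact max_lt (by norm_num) (by linarith)
      obtain ⟨t, h1, h2⟩ := ((ae_restrict_of_ae main).and
        (ae_restrict_mem (μ := volume) (s := Ioo (max (-1) (-ε)) 0) measurableSet_Ioo)).exists
      have h3 := h1 ⟨(le_max_left _ _).trans_lt h2.1, h2.2⟩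
      have h4 := hε (y := t) (by
        rw [dist_zero_right, Real.norm_eq_abs, abs_lt]
        exact ⟨(le_max_right _ _).trans_lt h2.1, h2.2.trans ε0⟩)
      have h5 := mul_nonneg (η0 t) (W0 t)
      change timeCut w s t * W t + Φ t / 2 ≤ _ at h3
      linarith
    refine le_trans ?_ Φle
    calc ∫ t in Ioc (-s ^ 2 + w) 0, N t = ∫ t in Ioc (-s ^ 2 + w) 0, timeCut w s t * N t := by
          refine setIntegral_congr_fun measurableSet_Ioc fun t ht => ?_
          rw [timeCut_one hw ht.1.le, one_mul]
      _ ≤ Φ 0 := setIntegral_mono_set ηN.integrableOn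
          (ae_of_all _ fun τ => mul_nonneg (η0 τ) (N0 τ))
          (ae_of_all _ fun τ hτ => hτ.2)

end Sol

/-! ### De Giorgi iteration -/

/-- A nonlinear recursion with small initial value decays geometrically. -/
lemma geometric_decay {Z : ℕ → ℝ} {A B q : ℝ} (Z0 : ∀ n, 0 ≤ Z n) (A0 : 0 ≤ A) (B0 : 0 ≤ B)
    (q0 : 0 ≤ q) (hq : B * q ^ 2 ≤ 1) (hA : A * Z 0 ^ 2 ≤ q ^ 3)
    (h : ∀ n, Z (n + 1) ^ 3 ≤ A * B ^ n * Z n ^ 5) (n : ℕ) : Z n ≤ Z 0 * q ^ n := by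
  induction n with
  | zero => simp
  | succ n ih =>
    have z := Z0 0
    refine le_of_pow_le_pow_left₀ (n := 3) (by norm_num) (by positivity) ?_
    calc Z (n + 1) ^ 3 ≤ A * B ^ n * Z n ^ 5 := h n
      _ ≤ A * B ^ n * (Z 0 * q ^ n) ^ 5 := by
          have := Z0 n
          gcongr
      _ = (A * Z 0 ^ 2) * (B * q ^ 2) ^ n * (Z 0 * q ^ n) ^ 3 := by ring
      _ ≤ q ^ 3 * 1 * (Z 0 * q ^ n) ^ 3 := by
          have : (B * q ^ 2) ^ n ≤ 1 := pow_le_one₀ (by positivity) hq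
          gcongr
      _ = (Z 0 * q ^ (n + 1)) ^ 3 := by ring

/-- The scale invariant bound of the drift in `P(R)` used in the interior estimates. -/
def DriftScale (b : ST → E) (R e : ℝ) : Prop :=
  ∀ᵐ t : ℝ, t ∈ Ioo (-R ^ 2) 0 →
    (∫⁻ x in ball (0 : E) R, ‖b (x, t)‖ₑ ^ (5 / 3 : ℝ)) ^ (3 / 5 : ℝ)
      ≤ ofReal (e * R ^ (4 / 5 : ℝ))

namespace Sol
variable {b : ST → E} {Γ : ST → ℝ} {G : ST → E} {k κ w s s' β R e : ℝ}

open SliceH1 (mass energy)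

lemma totalMass_nonneg : 0 ≤ totalMass Γ k s := integral_nonneg fun _ => SliceH1.mass_nonneg

/-- One step of the De Giorgi iteration. -/
lemma totalMass_step (S : Sol b Γ G) {β₁ : ℝ≥0} (hβ₁ : DriftBdd b β₁) (hs : 0 < s)
    (hs1 : s < 1) (hs' : 0 < s') (hss' : s' < s) (hw : w = s ^ 2 - s' ^ 2) (hβ0 : 0 ≤ β)
    (hβ : ∀ᵐ t : ℝ, t ∈ Ioo (-s ^ 2) 0 →
      (∫⁻ x in ball (0 : E) s, ‖b (x, t)‖ₑ ^ (5 / 3 : ℝ)) ^ (3 / 5 : ℝ) ≤ ofReal β)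
    (hk : 0 ≤ k) (hκ : 0 < κ) :
    totalMass Γ (k + κ) s' ^ 3 ≤ (3 * sobSq) ^ 3 *
      ((cacc w s β + stBound / w) * totalMass Γ k s) ^ 5 / κ ^ 4 := by
  have hw0 : 0 < w := by rw [hw]; nlinarith
  obtain ⟨h1, h2⟩ := S.caccioppoli hβ₁ hw0 hs hs1 hβ0 hβ rfl (k := k)
  have h0 := one_le_stBound
  have D0 : 0 ≤ cutGrad w s := by unfold cutGrad; positivity
  have Y0 := youngConst_nonneg
  have S0 := sobSq_nonneg
  have hT : cutGrad w s ^ 2 ≤ cacc w s β + stBound / w := by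
    have a1 : 0 ≤ 2 * cutGrad w s / s := by positivity
    have a2 : 0 ≤ youngConst * (cutGrad w s * β) ^ 10 := by positivity
    have a3 : 0 ≤ stBound / w := by positivity
    have a4 : 0 ≤ cutGrad w s ^ 2 := sq_nonneg _
    unfold cacc
    linarith
  have es : -s ^ 2 + w = -s' ^ 2 := by rw [hw]; ring
  rw [es] at h1 h2
  set T := cacc w s β + stBound / w
  set Z := totalMass Γ k s with hZ
  have Z0 : 0 ≤ Z := totalMass_nonneg
  have V0 : 0 ≤ T * Z := mul_nonneg ((sq_nonneg _).trans hT) Z0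
  set X := ((T * Z) ^ 2 / κ ^ 4) ^ (1 / 3 : ℝ) with hX
  have X0 : 0 ≤ X := by positivity
  have X3 : X ^ 3 = (T * Z) ^ 2 / κ ^ 4 := by
    rw [hX, ← Real.rpow_natCast, ← Real.rpow_mul (by positivity)]
    norm_num
  have im := S.mass_integrable k s
  have iN := S.energy_slice_integrable k (s ^ 2) w
  have iR : Integrable fun t => X * (sobSq * (energy (fun x => Γ (x, t)) (fun x => G (x, t)) k (s ^ 2) w
      + cutGrad w s ^ 2 / 4 * mass (fun x => Γ (x, t)) k s)) :=
    ((iN.add (im.const_mul _)).const_mul _).const_mul _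
  have step : totalMass Γ (k + κ) s' ≤ X * (sobSq * (2 * (T * Z) + cutGrad w s ^ 2 / 4 * Z)) := by
    calc totalMass Γ (k + κ) s' ≤ ∫ t in Ioc (-s' ^ 2) 0,
          X * (sobSq * (energy (fun x => Γ (x, t)) (fun x => G (x, t)) k (s ^ 2) w
            + cutGrad w s ^ 2 / 4 * mass (fun x => Γ (x, t)) k s)) := by
          refine setIntegral_mono_on_ae (S.mass_integrable _ _).integrableOn iR.integrableOn
            measurableSet_Ioc ?_
          have hne : ∀ᵐ t : ℝ, t ≠ 0 := by simp [ae_iff]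
          filter_upwards [h1, S.sliceH1, hne] with t ht1 ht2 ht3 htI
          have ht0 : t < 0 := lt_of_le_of_ne htI.2 ht3
          exact SliceH1.mass_le (ht2 ⟨by nlinarith [htI.1], ht0⟩) (by positivity) (by nlinarith) hw0
            hs.le le_rfl (by rw [hw]; linarith) hk hκ (ht1 ⟨htI.1, ht0⟩)
      _ = X * (sobSq * ((∫ t in Ioc (-s' ^ 2) 0,
            energy (fun x => Γ (x, t)) (fun x => G (x, t)) k (s ^ 2) w)
            + cutGrad w s ^ 2 / 4 * ∫ t in Ioc (-s' ^ 2) 0, mass (fun x => Γ (x, t)) k s)) := by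
          rw [integral_const_mul, integral_const_mul, integral_add iN.integrableOn
            (im.const_mul _).integrableOn, integral_const_mul]
      _ ≤ _ := by
          have : ∫ t in Ioc (-s' ^ 2) 0, mass (fun x => Γ (x, t)) k s ≤ Z :=
            setIntegral_mono_set im.integrableOn (ae_of_all _ fun _ => SliceH1.mass_nonneg)
              (Ioc_subset_Ioc_left (by nlinarith)).eventuallyLE
          gcongr
  have step2 : totalMass Γ (k + κ) s' ≤ X * (3 * sobSq * (T * Z)) := by
    refine step.trans (mul_le_mul_of_nonneg_left ?_ X0)
    have : cutGrad w s ^ 2 / 4 * Z ≤ T * Z := by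
      refine mul_le_mul_of_nonneg_right ?_ Z0
      linarith [sq_nonneg (cutGrad w s)]
    nlinarith
  calc totalMass Γ (k + κ) s' ^ 3 ≤ (X * (3 * sobSq * (T * Z))) ^ 3 :=
        pow_le_pow_left₀ totalMass_nonneg step2 3
    _ = X ^ 3 * ((3 * sobSq) ^ 3 * (T * Z) ^ 3) := by ring
    _ = _ := by rw [X3]; ring

/-- The constant in the growth bound of the Caccioppoli constants. -/
noncomputable def growthConst : ℝ := (8 + youngConst) * (160 * stBound) ^ 10

lemma cacc_growth (hR : 0 < R) (he : 1 ≤ e) (n : ℕ) (hsR : s ≤ R) (hs : R / 2 ≤ s)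
    (hw : R ^ 2 / 2 ^ (n + 3) ≤ w) :
    cacc w s (e * R ^ (4 / 5 : ℝ)) + stBound / w
      ≤ growthConst * (e ^ 10 / R ^ 2) * (2 ^ 10) ^ n := by
  have h0 := one_le_stBound
  have Y0 := youngConst_nonneg
  have w0 : 0 < w := lt_of_lt_of_le (by positivity) hw
  have s0 : 0 < s := by linarith
  set L := 160 * stBound with hL
  have L1 : 1 ≤ L := by rw [hL]; linarith
  have p1 : (1 : ℝ) ≤ 2 ^ n := one_le_pow₀ (by norm_num)
  have winv : 1 / w ≤ 8 * 2 ^ n / R ^ 2 := by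
    rw [div_le_div_iff₀ w0 (by positivity)]
    have := hw
    rw [div_le_iff₀ (by positivity), pow_add] at this
    linarith
  have D0 : 0 ≤ cutGrad w s := by unfold cutGrad; positivity
  have hD : cutGrad w s ≤ L * 2 ^ n / R := by
    calc cutGrad w s = 20 * stBound * s * (1 / w) := by unfold cutGrad; ring
      _ ≤ 20 * stBound * R * (8 * 2 ^ n / R ^ 2) := by gcongr
      _ = L * 2 ^ n / R := by rw [hL]; field_simp; ring
  -- every term is bounded by a multiple of `P = L ^ 10 * 2 ^ (10 n) * e ^ 10 / R ^ 2`
  set P := L ^ 10 * (2 ^ 10) ^ n * (e ^ 10 / R ^ 2) with hP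
  have e1 : 1 ≤ e ^ 10 := one_le_pow₀ he
  have le1 : ∀ {x : ℝ}, x ≤ L ^ 10 * (2 ^ 10) ^ n → x / R ^ 2 ≤ P := by
    intro x hx
    rw [hP, ← mul_div_assoc]
    refine div_le_div_of_nonneg_right (hx.trans ?_) (by positivity)
    exact le_mul_of_one_le_right (by positivity) e1
  have pw : ((2 : ℝ) ^ 10) ^ n = (2 ^ n) ^ 10 := by rw [← pow_mul, ← pow_mul, mul_comm]
  have y1 : 1 ≤ L * 2 ^ n := one_le_mul_of_one_le_of_one_le L1 p1
  have c2 : (L * 2 ^ n) ^ 2 ≤ L ^ 10 * (2 ^ 10) ^ n := by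
    rw [pw, ← mul_pow]
    exact pow_le_pow_right₀ y1 (by norm_num)
  have c1 : L * 2 ^ n ≤ L ^ 10 * (2 ^ 10) ^ n := by
    rw [pw, ← mul_pow]
    exact le_self_pow₀ y1 (by norm_num)
  have t1 : cutGrad w s ^ 2 ≤ P := by
    calc cutGrad w s ^ 2 ≤ (L * 2 ^ n / R) ^ 2 := by gcongr
      _ = (L * 2 ^ n) ^ 2 / R ^ 2 := by ring
      _ ≤ P := le1 c2
  have t2 : 2 * cutGrad w s / s ≤ 4 * P := by
    calc 2 * cutGrad w s / s ≤ 2 * (L * 2 ^ n / R) / (R / 2) := by gcongr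
      _ = 4 * (L * 2 ^ n / R ^ 2) := by field_simp; ring
      _ ≤ 4 * P := by linarith [le1 c1]
  have t3 : stBound / w ≤ P := by
    calc stBound / w = stBound * (1 / w) := by ring
      _ ≤ stBound * (8 * 2 ^ n / R ^ 2) := by gcongr
      _ = (8 * stBound * 2 ^ n) / R ^ 2 := by ring
      _ ≤ P := le1 (le_trans (by rw [hL]; gcongr; norm_num) c1)
  have t4 : (cutGrad w s * (e * R ^ (4 / 5 : ℝ))) ^ 10 ≤ P := by
    have r8 : (R ^ (4 / 5 : ℝ)) ^ 10 = R ^ 8 := by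
      rw [← Real.rpow_natCast, ← Real.rpow_mul hR.le, ← Real.rpow_natCast]
      norm_num
    calc (cutGrad w s * (e * R ^ (4 / 5 : ℝ))) ^ 10
        ≤ (L * 2 ^ n / R * (e * R ^ (4 / 5 : ℝ))) ^ 10 := by gcongr
      _ = (L * 2 ^ n) ^ 10 / R ^ 10 * (e ^ 10 * (R ^ (4 / 5 : ℝ)) ^ 10) := by ring
      _ = P := by rw [r8, hP, pw]; field_simp
  have P0 : 0 ≤ P := by positivity
  have t5 := mul_le_mul_of_nonneg_left t4 Y0
  have : growthConst * (e ^ 10 / R ^ 2) * (2 ^ 10) ^ n = (8 + youngConst) * P := by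
    rw [hP, growthConst]; ring
  rw [this]
  unfold cacc
  linarith

lemma abs_trunc_mono {k k' : ℝ} (hk : 0 ≤ k) (hkk : k ≤ k') (r : ℝ) :
    |trunc k' r| ≤ |trunc k r| := by
  rw [abs_trunc hk, abs_trunc (hk.trans hkk)]
  exact max_le_max (by linarith) le_rfl

lemma totalMass_mono (S : Sol b Γ G) {k k' : ℝ} (hk : 0 ≤ k) (hkk : k ≤ k') (hs' : 0 ≤ s')
    (hss : s' ≤ s) : totalMass Γ k' s' ≤ totalMass Γ k s := by
  calc totalMass Γ k' s' ≤ ∫ t in Ioc (-s' ^ 2) 0, mass (fun x => Γ (x, t)) k s := by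
        refine setIntegral_mono_on_ae (S.mass_integrable _ _).integrableOn
          (S.mass_integrable _ _).integrableOn measurableSet_Ioc ?_
        filter_upwards [integrable_slice (S.trunc_sq_integrable k),
          integrable_slice (S.trunc_sq_integrable k')] with t h1 h2 _
        calc mass (fun x => Γ (x, t)) k' s' ≤ ∫ x in ball (0 : E) s', trunc k (Γ (x, t)) ^ 2 := by
              refine integral_mono h2.integrableOn h1.integrableOn fun x => ?_
              exact sq_le_sq.2 (abs_trunc_mono hk hkk _)
          _ ≤ _ := setIntegral_mono_set h1.integrableOn
              (ae_of_all _ fun x => sq_nonneg _) (ball_subset_ball hss).eventuallyLE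
    _ ≤ _ := setIntegral_mono_set (S.mass_integrable _ _).integrableOn
        (ae_of_all _ fun _ => SliceH1.mass_nonneg)
        (Ioc_subset_Ioc_left (by nlinarith)).eventuallyLE

lemma totalMass_eq (S : Sol b Γ G) (k s : ℝ) :
    totalMass Γ k s = ∫ z in cyl s, trunc k (Γ z) ^ 2 := by
  have hm : MeasurableSet (cyl s) := measurableSet_cyl s
  rw [← integral_indicator hm, integral_slice ((S.trunc_sq_integrable k).indicator hm), totalMass,
    ← integral_indicator measurableSet_Ioc]
  refine integral_congr_ae (ae_of_all _ fun t => ?_)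
  by_cases ht : t ∈ Ioc (-s ^ 2) 0
  · simp only [indicator_of_mem ht, mass]
    rw [← integral_indicator measurableSet_ball]
    refine integral_congr_ae (ae_of_all _ fun x => ?_)
    by_cases hx : x ∈ ball (0 : E) s
    · beta_reduce
      rw [indicator_of_mem hx, indicator_of_mem (show (x, t) ∈ cyl s from ⟨hx, ht⟩)]
    · beta_reduce
      rw [indicator_of_notMem hx, indicator_of_notMem (show (x, t) ∉ cyl s from fun h => hx h.1)]
  · simp only [indicator_of_notMem ht]
    refine (integral_eq_zero_of_ae (ae_of_all _ fun x => ?_)).symm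
    exact indicator_of_notMem (fun h => ht h.2) _

/-- The smallness constant of the De Giorgi lemma. -/
noncomputable def giorgiConst : ℝ :=
  (1 / 2 : ℝ) ^ 41 / ((3 * sobSq) ^ 3 * growthConst ^ 5 * 16 + 1)

lemma growthConst_nonneg : 0 ≤ growthConst := by
  have := youngConst_nonneg
  unfold growthConst
  positivity

lemma giorgiConst_pos : 0 < giorgiConst := by
  have := sobSq_nonneg
  have := growthConst_nonneg
  unfold giorgiConst
  positivity

/-- The De Giorgi lemma: if `(|Γ| - k)₊` is small in `L²(P(R))`, then `|Γ| ≤ k + κ` in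
`P(R / 2)`. The required smallness depends polynomially on the size of the drift. -/
theorem deGiorgi (S : Sol b Γ G) {β₁ : ℝ≥0} (hβ₁ : DriftBdd b β₁) (hR : 0 < R) (hR1 : R ≤ 1)
    (he : 1 ≤ e) (hb : DriftScale b R e) (hk : 0 ≤ k) (hκ : 0 < κ)
    (hsmall : totalMass Γ k R ≤ giorgiConst * κ ^ 2 * R ^ 5 / e ^ 25) :
    ∀ᵐ z ∂(cylVol (R / 2)), |Γ z| ≤ k + κ := by
  have S0 := sobSq_nonneg
  have C0 := growthConst_nonneg
  set s : ℕ → ℝ := fun n => R * (1 / 2 + (1 / 2) ^ (n + 2)) with hs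
  set kn : ℕ → ℝ := fun n => k + κ * (1 - (1 / 2) ^ n) with hkn
  have hn0 : ∀ n : ℕ, 0 < ((1 : ℝ) / 2) ^ n := fun n => by positivity
  have hn1 : ∀ n : ℕ, ((1 : ℝ) / 2) ^ n ≤ 1 := fun n => pow_le_one₀ (by norm_num) (by norm_num)
  have s_lo : ∀ n, R / 2 ≤ s n := fun n => by
    simp only [hs]; nlinarith [mul_pos hR (hn0 (n + 2))]
  have s_hi : ∀ n, s n ≤ R * (3 / 4) := fun n => by
    simp only [hs, pow_add]; nlinarith [hn1 n]
  have s_diff : ∀ n, s n - s (n + 1) = R * (1 / 2) ^ (n + 3) := fun n => by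
    simp only [hs, pow_add]; ring
  have kn0 : ∀ n, 0 ≤ kn n := fun n => by
    simp only [hkn]
    have := mul_nonneg hκ.le (sub_nonneg.2 (hn1 n))
    linarith
  set Z : ℕ → ℝ := fun n => totalMass Γ (kn n) (s n) with hZ
  set A := (3 * sobSq) ^ 3 * growthConst ^ 5 * 16 * (e ^ 50 / (R ^ 10 * κ ^ 4)) with hA
  have e0 : 0 < e := by linarith
  have step_le : ∀ n, Z (n + 1) ^ 3 ≤ A * (2 ^ 54) ^ n * Z n ^ 5 := by
    intro n
    have lt : s (n + 1) < s n := by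
      have := s_diff n
      have := mul_pos hR (hn0 (n + 3))
      linarith
    have sn : 0 < s n := by linarith [s_lo n]
    have sn' : 0 < s (n + 1) := by linarith [s_lo (n + 1)]
    have hw : R ^ 2 / 2 ^ (n + 3) ≤ s n ^ 2 - s (n + 1) ^ 2 := by
      have e1 : s n ^ 2 - s (n + 1) ^ 2 = (R * (1 / 2) ^ (n + 3)) * (s n + s (n + 1)) := by
        rw [← s_diff n]; ring
      have e2 : R ^ 2 / 2 ^ (n + 3) = (R * (1 / 2) ^ (n + 3)) * R := by
        rw [one_div, inv_pow]; ring
      rw [e1, e2]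
      refine mul_le_mul_of_nonneg_left ?_ (mul_pos hR (hn0 _)).le
      linarith [s_lo n, s_lo (n + 1)]
    have hβ : ∀ᵐ t : ℝ, t ∈ Ioo (-s n ^ 2) 0 →
        (∫⁻ x in ball (0 : E) (s n), ‖b (x, t)‖ₑ ^ (5 / 3 : ℝ)) ^ (3 / 5 : ℝ)
          ≤ ofReal (e * R ^ (4 / 5 : ℝ)) := by
      filter_upwards [hb] with t ht htI
      have hsR : s n ≤ R := by linarith [s_hi n]
      refine le_trans ?_ (ht ⟨by nlinarith [htI.1], htI.2⟩)
      gcongr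
    have step := S.totalMass_step hβ₁ sn (by linarith [s_hi n]) sn' lt rfl
      (by positivity) hβ (kn0 n) (κ := κ * (1 / 2) ^ (n + 1)) (mul_pos hκ (hn0 _))
    have ek : kn n + κ * (1 / 2) ^ (n + 1) = kn (n + 1) := by simp only [hkn, pow_succ]; ring
    rw [ek] at step
    refine step.trans ?_
    have Zn : 0 ≤ Z n := totalMass_nonneg
    have hT := cacc_growth hR he n (by linarith [s_hi n]) (s_lo n) hw
    calc _ ≤ (3 * sobSq) ^ 3 * ((growthConst * (e ^ 10 / R ^ 2) * (2 ^ 10) ^ n) * Z n) ^ 5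
          / (κ * (1 / 2) ^ (n + 1)) ^ 4 := by
          have T0 : 0 ≤ cacc (s n ^ 2 - s (n + 1) ^ 2) (s n) (e * R ^ (4 / 5 : ℝ))
              + stBound / (s n ^ 2 - s (n + 1) ^ 2) := by
            have h0 := one_le_stBound
            have Y0 := youngConst_nonneg
            have w0 : 0 < s n ^ 2 - s (n + 1) ^ 2 := lt_of_lt_of_le (by positivity) hw
            unfold cacc cutGrad
            positivity
          gcongr
      _ = _ := by
          rw [hA, one_div, inv_pow]
          have : ((2 : ℝ) ^ 54) ^ n = ((2 ^ 10) ^ n) ^ 5 * (2 ^ n) ^ 4 := by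
            rw [← pow_mul, ← pow_mul, ← pow_mul, ← pow_mul, ← pow_add]
            congr 1; ring
          rw [this, pow_succ]
          field_simp
          ring
  have A0 : 0 ≤ A := by positivity
  have Z00 : Z 0 ≤ giorgiConst * κ ^ 2 * R ^ 5 / e ^ 25 :=
    (S.totalMass_mono hk (by simp [hkn]) (by linarith [s_lo 0]) (by linarith [s_hi 0])).trans hsmall
  have hsm : A * Z 0 ^ 2 ≤ ((1 / 2 : ℝ) ^ 27) ^ 3 := by
    have g0 := giorgiConst_pos
    set M := (3 * sobSq) ^ 3 * growthConst ^ 5 * 16 with hM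
    have M0 : 0 ≤ M := by positivity
    calc A * Z 0 ^ 2 ≤ A * (giorgiConst * κ ^ 2 * R ^ 5 / e ^ 25) ^ 2 := by
          have : 0 ≤ Z 0 := totalMass_nonneg
          gcongr
      _ = M * giorgiConst ^ 2 := by
          rw [hA]
          field_simp
      _ = (1 / 2) ^ 82 * (M / (M + 1) ^ 2) := by
          rw [giorgiConst, ← hM, div_pow]
          ring
      _ ≤ (1 / 2) ^ 82 * 1 := by
          gcongr
          rw [div_le_one (by positivity)]
          nlinarith
      _ ≤ _ := by norm_num
  have decay := geometric_decay (fun n => totalMass_nonneg) A0 (by positivity) (q := (1 / 2) ^ 27)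
    (by positivity) (by norm_num) hsm step_le
  have lim : totalMass Γ (k + κ) (R / 2) ≤ 0 := by
    have h1 : ∀ n, totalMass Γ (k + κ) (R / 2) ≤ Z 0 * ((1 / 2 : ℝ) ^ 27) ^ n := fun n =>
      (S.totalMass_mono (kn0 n) (by
        simp only [hkn]
        have := mul_pos hκ (hn0 n)
        linarith) (by linarith) (s_lo n)).trans (decay n)
    have h2 : Tendsto (fun n => Z 0 * ((1 / 2 : ℝ) ^ 27) ^ n) atTop (𝓝 (Z 0 * 0)) :=
      (tendsto_pow_atTop_nhds_zero_of_lt_one (by positivity) (by norm_num)).const_mul _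
    rw [mul_zero] at h2
    exact ge_of_tendsto' h2 h1
  rw [S.totalMass_eq] at lim
  have hz := (setIntegral_eq_zero_iff_of_nonneg_ae (ae_of_all _ fun z => sq_nonneg _)
    (S.trunc_sq_integrable (k + κ)).integrableOn).1
    (le_antisymm lim (integral_nonneg fun z => sq_nonneg _))
  filter_upwards [hz] with z hz
  have h0 : trunc (k + κ) (Γ z) = 0 := by simpa using hz
  have := abs_trunc (show 0 ≤ k + κ by linarith) (Γ z)
  rw [h0, abs_zero] at this
  have := le_max_left (|Γ z| - (k + κ)) 0
  linarith

end Sol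

/-! ### A weighted Poincaré inequality -/

section poincare
variable {φ f : E → ℝ≥0∞} {ρ : ℝ}

/-- The point `(1 - s) x + s y` of the segment from `x` to `y`. -/
def seg (s : ℝ) (x y : E) : E := (1 - s) • x + s • y

lemma seg_symm (s : ℝ) (x y : E) : seg s x y = seg (1 - s) y x := by
  unfold seg; rw [sub_sub_cancel, add_comm]

lemma lintegral_seg_le (hf : Measurable f) {s : ℝ} (hs : s ≤ 1 / 2) (y : E) :
    ∫⁻ x, f (seg s x y) ≤ 8 * ∫⁻ x, f x := by
  have h0 : (1 - s) ≠ 0 := by linarith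
  have hg : Measurable fun z => f (z + s • y) := hf.comp (measurable_add_const _)
  calc ∫⁻ x, f (seg s x y) = ∫⁻ z, f (z + s • y) ∂(Measure.map ((1 - s) • ·) volume) := by
        rw [lintegral_map hg (measurable_const_smul _)]; rfl
    _ = ofReal |((1 - s) ^ 3)⁻¹| * ∫⁻ z, f z := by
        rw [Measure.map_addHaar_smul volume h0, lintegral_smul_measure,
          lintegral_add_right_eq_self]
        simp
    _ ≤ 8 * ∫⁻ z, f z := by
        gcongr
        rw [show (8 : ℝ≥0∞) = ofReal 8 by norm_num]
        refine ENNReal.ofReal_le_ofReal ?_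
        have : (1 / 2 : ℝ) ^ 3 ≤ (1 - s) ^ 3 := pow_le_pow_left₀ (by norm_num) (by linarith) 3
        rw [abs_of_pos (inv_pos.2 (lt_of_lt_of_le (by norm_num) this))]
        exact (inv_anti₀ (by norm_num) this).trans (by norm_num)

/-- A quasiconcave weight with values in `[0, 1]` that vanishes outside the ball of radius `ρ`. -/
structure QuasiWeight (φ : E → ℝ≥0∞) (ρ : ℝ) : Prop where
  meas : Measurable φ
  le_one : ∀ x, φ x ≤ 1
  zero : ∀ x ∉ ball (0 : E) ρ, φ x = 0
  quasi : ∀ x y, ∀ s ∈ Icc (0 : ℝ) 1, min (φ x) (φ y) ≤ φ (seg s x y)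

lemma continuous_seg : Continuous fun q : (E × E) × ℝ => seg q.2 q.1.1 q.1.2 := by
  unfold seg; fun_prop

namespace QuasiWeight

lemma mul_le (W : QuasiWeight φ ρ) {s : ℝ} (hs : s ∈ Icc (0 : ℝ) 1) (x y : E) :
    φ x * φ y ≤ (ball (0 : E) ρ).indicator 1 y * φ (seg s x y) := by
  by_cases hy : y ∈ ball (0 : E) ρ
  · rw [indicator_of_mem hy, Pi.one_apply, one_mul]
    refine le_trans (le_min ?_ ?_) (W.quasi x y s hs)
    · exact mul_le_of_le_one_right' (W.le_one y)
    · exact mul_le_of_le_one_left' (W.le_one x)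
  · rw [W.zero y hy, mul_zero]; exact zero_le

lemma lintegral_seg_aux (W : QuasiWeight φ ρ) (hf : Measurable f) {s : ℝ} (hs0 : 0 ≤ s)
    (hs : s ≤ 1 / 2) : ∫⁻ y, ∫⁻ x, φ x * φ y * f (seg s x y) ≤
      8 * volume (ball (0 : E) ρ) * ∫⁻ x, φ x * f x := by
  have hm : Measurable fun x => φ x * f x := W.meas.mul hf
  calc ∫⁻ y, ∫⁻ x, φ x * φ y * f (seg s x y)
      ≤ ∫⁻ y, (ball (0 : E) ρ).indicator 1 y * (8 * ∫⁻ x, φ x * f x) := by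
        refine lintegral_mono fun y => ?_
        calc ∫⁻ x, φ x * φ y * f (seg s x y)
            ≤ ∫⁻ x, (ball (0 : E) ρ).indicator 1 y * (φ (seg s x y) * f (seg s x y)) := by
              refine lintegral_mono fun x => ?_
              rw [← mul_assoc]
              exact mul_le_mul_left (W.mul_le ⟨hs0, by linarith⟩ x y) _
          _ = (ball (0 : E) ρ).indicator 1 y * ∫⁻ x, φ (seg s x y) * f (seg s x y) := by
              refine lintegral_const_mul' _ _ ?_
              by_cases hy : y ∈ ball (0 : E) ρ
              · simp [indicator_of_mem hy]
              · simp [indicator_of_notMem hy]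
          _ ≤ _ := by
              gcongr
              exact lintegral_seg_le hm hs y
    _ = (∫⁻ y, (ball (0 : E) ρ).indicator 1 y) * (8 * ∫⁻ x, φ x * f x) :=
        lintegral_mul_const _ (measurable_one.indicator measurableSet_ball)
    _ = _ := by
        rw [lintegral_indicator measurableSet_ball]
        simp only [Pi.one_apply, lintegral_const, MeasurableSet.univ, Measure.restrict_apply,
          univ_inter, one_mul]
        ring

lemma measurable_kernel (W : QuasiWeight φ ρ) (hf : Measurable f) :
    Measurable fun q : (E × E) × ℝ => φ q.1.1 * φ q.1.2 * f (seg q.2 q.1.1 q.1.2) :=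
  ((W.meas.comp measurable_fst.fst).mul (W.meas.comp measurable_fst.snd)).mul
    (hf.comp continuous_seg.measurable)

lemma lintegral_seg (W : QuasiWeight φ ρ) (hf : Measurable f) {s : ℝ} (hs : s ∈ Icc (0 : ℝ) 1) :
    ∫⁻ x, ∫⁻ y, φ x * φ y * f (seg s x y) ≤
      8 * volume (ball (0 : E) ρ) * ∫⁻ x, φ x * f x := by
  rcases le_total s (1 / 2) with h | h
  · have m : Measurable fun q : E × E => φ q.1 * φ q.2 * f (seg s q.1 q.2) :=
      (W.measurable_kernel hf).comp (measurable_id.prodMk measurable_const)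
    rw [lintegral_lintegral_swap (f := fun x y => φ x * φ y * f (seg s x y)) m.aemeasurable]
    exact W.lintegral_seg_aux hf hs.1 h
  · have := W.lintegral_seg_aux hf (s := 1 - s) (by linarith [hs.2]) (by linarith)
    refine le_trans (le_of_eq ?_) this
    refine lintegral_congr fun x => lintegral_congr fun y => ?_
    rw [seg_symm, mul_comm (φ x)]

end QuasiWeight

lemma enorm_sub_sq_le {v : E → ℝ} (hv : ContDiff ℝ 1 v) (x y : E) :
    ‖v x - v y‖ₑ ^ 2 ≤ ‖x - y‖ₑ ^ 2 * ∫⁻ s in Icc (0 : ℝ) 1, ‖fderiv ℝ v (seg s x y)‖ₑ ^ 2 := by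
  have hc : Continuous fun s : ℝ => seg s x y := by unfold seg; fun_prop
  have hv' := hv.continuous_fderiv (by simp)
  have hd : ∀ s : ℝ, HasDerivAt (fun s => v (seg s x y)) (fderiv ℝ v (seg s x y) (y - x)) s := by
    intro s
    have h1 : HasDerivAt (fun s => seg s x y) (y - x) s := by
      have h := (((hasDerivAt_id s).const_sub 1).smul_const x).add ((hasDerivAt_id s).smul_const y)
      have e : (-1 : ℝ) • x + (1 : ℝ) • y = y - x := by simp [sub_eq_neg_add]
      rw [e] at h
      exact h
    exact ((hv.differentiable (by simp)) _).hasFDerivAt.comp_hasDerivAt s h1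
  have hi := intervalIntegral.integral_eq_sub_of_hasDerivAt (a := 0) (b := 1)
    (fun s _ => hd s) (((hv'.comp hc).clm_apply continuous_const).intervalIntegrable _ _)
  have e0 : seg 0 x y = x := by simp [seg]
  have e1 : seg 1 x y = y := by simp [seg]
  rw [e0, e1, intervalIntegral.integral_of_le zero_le_one] at hi
  have m : Measurable fun s : ℝ => ‖fderiv ℝ v (seg s x y)‖ₑ := (hv'.comp hc).enorm.measurable
  have b1 : ‖v x - v y‖ₑ ≤ ‖x - y‖ₑ * ∫⁻ s in Icc (0 : ℝ) 1, ‖fderiv ℝ v (seg s x y)‖ₑ := by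
    rw [← enorm_neg, neg_sub, ← hi, ← lintegral_const_mul _ m]
    refine (enorm_integral_le_lintegral_enorm _).trans ?_
    refine (lintegral_mono_set Ioc_subset_Icc_self).trans (lintegral_mono fun s => ?_)
    rw [mul_comm, ← enorm_neg (x - y), neg_sub]
    exact ContinuousLinearMap.le_opENorm _ _
  refine (pow_le_pow_left' b1 2).trans ?_
  rw [mul_pow]
  gcongr
  have := lintegral_mul_sq_le (μ := volume.restrict (Icc (0 : ℝ) 1)) (f := fun _ => 1)
    aemeasurable_const m.aemeasurable
  simpa using this

/-- The weighted Poincaré inequality in symmetric form, for continuously differentiable functions. -/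
lemma QuasiWeight.poincare_c1 (W : QuasiWeight φ ρ) {v : E → ℝ} (hv : ContDiff ℝ 1 v) :
    ∫⁻ x, ∫⁻ y, φ x * φ y * ‖v x - v y‖ₑ ^ 2 ≤
      ofReal (2 * ρ) ^ 2 * (8 * volume (ball (0 : E) ρ)) *
        ∫⁻ x, φ x * ‖fderiv ℝ v x‖ₑ ^ 2 := by
  set f : E → ℝ≥0∞ := fun x => ‖fderiv ℝ v x‖ₑ ^ 2 with hf
  have mf : Measurable f := ((hv.continuous_fderiv (by simp)).enorm.measurable).pow_const 2
  have mk := W.measurable_kernel mf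
  set c := ofReal (2 * ρ) ^ 2 with hc
  have ct : c ≠ ⊤ := ENNReal.pow_ne_top ENNReal.ofReal_ne_top
  have pt : ∀ x y, φ x * φ y * ‖v x - v y‖ₑ ^ 2 ≤
      c * ∫⁻ s in Icc (0 : ℝ) 1, φ x * φ y * f (seg s x y) := by
    intro x y
    by_cases hx : x ∈ ball (0 : E) ρ
    swap
    · rw [W.zero x hx]; simp
    by_cases hy : y ∈ ball (0 : E) ρ
    swap
    · rw [W.zero y hy]; simp
    have fin : φ x * φ y ≠ ⊤ := ENNReal.mul_ne_top
      (ne_top_of_le_ne_top ENNReal.one_ne_top (W.le_one x))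
      (ne_top_of_le_ne_top ENNReal.one_ne_top (W.le_one y))
    rw [lintegral_const_mul' _ _ fin, mul_left_comm]
    gcongr
    refine (enorm_sub_sq_le hv x y).trans ?_
    gcongr
    rw [← ofReal_norm]
    refine pow_le_pow_left' (ENNReal.ofReal_le_ofReal ?_) 2
    rw [mem_ball_zero_iff] at hx hy
    linarith [norm_sub_le x y]
  have mkx : ∀ x, Measurable fun q : E × ℝ => φ x * φ q.1 * f (seg q.2 x q.1) := fun x =>
    mk.comp ((measurable_const.prodMk measurable_fst).prodMk measurable_snd)
  have mxs : Measurable fun q : E × ℝ => ∫⁻ y, φ q.1 * φ y * f (seg q.2 q.1 y) :=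
    Measurable.lintegral_prod_right' (f := fun r : (E × ℝ) × E =>
      φ r.1.1 * φ r.2 * f (seg r.1.2 r.1.1 r.2))
      (mk.comp ((measurable_fst.fst.prodMk measurable_snd).prodMk measurable_fst.snd))
  calc ∫⁻ x, ∫⁻ y, φ x * φ y * ‖v x - v y‖ₑ ^ 2
      ≤ ∫⁻ x, ∫⁻ y, c * ∫⁻ s in Icc (0 : ℝ) 1, φ x * φ y * f (seg s x y) :=
        lintegral_mono fun x => lintegral_mono fun y => pt x y
    _ = c * ∫⁻ x, ∫⁻ y, ∫⁻ s in Icc (0 : ℝ) 1, φ x * φ y * f (seg s x y) := by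
        rw [← lintegral_const_mul' _ _ ct]
        exact lintegral_congr fun x => lintegral_const_mul' _ _ ct
    _ = c * ∫⁻ x, ∫⁻ s in Icc (0 : ℝ) 1, ∫⁻ y, φ x * φ y * f (seg s x y) := by
        congr 1
        refine lintegral_congr fun x => ?_
        exact lintegral_lintegral_swap (f := fun y s => φ x * φ y * f (seg s x y))
          (mkx x).aemeasurable
    _ = c * ∫⁻ s in Icc (0 : ℝ) 1, ∫⁻ x, ∫⁻ y, φ x * φ y * f (seg s x y) := by
        congr 1
        exact lintegral_lintegral_swap (f := fun x s => ∫⁻ y, φ x * φ y * f (seg s x y))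
          mxs.aemeasurable
    _ ≤ c * ∫⁻ s in Icc (0 : ℝ) 1, 8 * volume (ball (0 : E) ρ) * ∫⁻ x, φ x * f x := by
        refine mul_le_mul_right ?_ _
        exact setLIntegral_mono measurable_const fun s hs => W.lintegral_seg mf hs
    _ = _ := by simp [mul_assoc, hf]

end poincare

namespace SliceH1
variable {u : E → ℝ} {g : E → E} {φ : E → ℝ≥0∞} {ρ : ℝ}

/-- The weighted Poincaré inequality in symmetric form. -/
lemma poincare_symm (H : SliceH1 u g) (W : QuasiWeight φ ρ) (hρ : ρ < 1) :
    ∫⁻ x, φ x * ∫⁻ y, φ y * ‖u x - u y‖ₑ ^ 2 ≤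
      ofReal (2 * ρ) ^ 2 * (8 * volume (ball (0 : E) ρ)) *
        (3 * ∫⁻ x, φ x * ‖g x‖ₑ ^ 2) := by
  obtain ⟨v, hv, t1, t2, hae⟩ := H.exists_seq hρ
  set K := ofReal (2 * ρ) ^ 2 * (8 * volume (ball (0 : E) ρ)) with hK
  have Kt : K ≠ ⊤ := by
    rw [hK]
    exact ENNReal.mul_ne_top (ENNReal.pow_ne_top ENNReal.ofReal_ne_top)
      (ENNReal.mul_ne_top (by simp) measure_ball_lt_top.ne)
  set ν : Measure E := volume.withDensity φ with hν
  have φt : ∀ x, φ x < ⊤ := fun x => (W.le_one x).trans_lt ENNReal.one_lt_top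
  have wd : ∀ f : E → ℝ≥0∞, ∫⁻ x, f x ∂ν = ∫⁻ x, φ x * f x := fun f =>
    lintegral_withDensity_eq_lintegral_mul_non_measurable _ W.meas (ae_of_all _ φt) f
  have le : ν ≤ volume.restrict (ball (0 : E) ρ) := by
    intro s
    rw [hν, ← withDensity_indicator_one measurableSet_ball]
    refine withDensity_mono (ae_of_all _ fun x => ?_) s
    by_cases hx : x ∈ ball (0 : E) ρ
    · simpa [indicator_of_mem hx] using W.le_one x
    · rw [W.zero x hx]; exact zero_le
  have haeν : ∀ᵐ x ∂ν, Tendsto (fun n => v n x) atTop (𝓝 (u x)) := ae_mono le hae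
  have T : ∀ i : Fin 3, TendstoL2 ν
      (fun n x => fderiv ℝ (v n) x (EuclideanSpace.single i 1)) fun x => g x i := fun i =>
    tendsto_of_tendsto_of_tendsto_of_le_of_le tendsto_const_nhds (t2 i) (fun _ => zero_le)
      fun n => eLpNorm_mono_measure _ le
  have mg : ∀ i : Fin 3, AEStronglyMeasurable (fun x => g x i) ν := fun i =>
    ((EuclideanSpace.proj (𝕜 := ℝ) i).continuous.measurable.comp H.mg).aestronglyMeasurable
  have mv : ∀ (i : Fin 3) n, AEStronglyMeasurable
      (fun x => fderiv ℝ (v n) x (EuclideanSpace.single i 1)) ν := fun i n =>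
    (continuous_partial (hv n) _).aestronglyMeasurable
  set X : ℕ → Fin 3 → ℝ≥0∞ := fun n i =>
    eLpNorm ((fun x => fderiv ℝ (v n) x (EuclideanSpace.single i 1)) - fun x => g x i) 2 ν
      + eLpNorm (fun x => g x i) 2 ν with hX
  have bound : ∀ n, ∫⁻ x, φ x * ∫⁻ y, φ y * ‖v n x - v n y‖ₑ ^ 2 ≤
      K * (3 * ∑ i : Fin 3, X n i ^ 2) := by
    intro n
    have h := W.poincare_c1 (hv n)
    calc ∫⁻ x, φ x * ∫⁻ y, φ y * ‖v n x - v n y‖ₑ ^ 2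
        = ∫⁻ x, ∫⁻ y, φ x * φ y * ‖v n x - v n y‖ₑ ^ 2 := by
          refine lintegral_congr fun x => ?_
          rw [← lintegral_const_mul' _ _ (φt x).ne]
          simp only [mul_assoc]
      _ ≤ K * ∫⁻ x, φ x * ‖fderiv ℝ (v n) x‖ₑ ^ 2 := h
      _ = K * ∫⁻ x, ‖fderiv ℝ (v n) x‖ₑ ^ 2 ∂ν := by rw [wd]
      _ ≤ K * ∫⁻ x, 3 * ∑ i : Fin 3, ‖fderiv ℝ (v n) x (EuclideanSpace.single i 1)‖ₑ ^ 2 ∂ν := by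
          gcongr with x
          have h1 := norm_le_sum_coord (fderiv ℝ (v n) x)
          rw [Fin.sum_univ_three] at h1
          simp only [← ofReal_norm, Real.norm_eq_abs, ← ENNReal.ofReal_pow (norm_nonneg _),
            ← ENNReal.ofReal_pow (abs_nonneg _), Fin.sum_univ_three]
          rw [← ENNReal.ofReal_add (by positivity) (by positivity),
            ← ENNReal.ofReal_add (by positivity) (by positivity),
            show (3 : ℝ≥0∞) = ofReal 3 by norm_num, ← ENNReal.ofReal_mul (by norm_num)]
          refine ENNReal.ofReal_le_ofReal ((pow_le_pow_left₀ (norm_nonneg _) h1 2).trans ?_)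
          set p := |fderiv ℝ (v n) x (EuclideanSpace.single 0 1)|
          set q := |fderiv ℝ (v n) x (EuclideanSpace.single 1 1)|
          set r := |fderiv ℝ (v n) x (EuclideanSpace.single 2 1)|
          nlinarith [sq_nonneg (p - q), sq_nonneg (q - r), sq_nonneg (p - r)]
      _ = K * (3 * ∑ i : Fin 3,
            eLpNorm (fun x => fderiv ℝ (v n) x (EuclideanSpace.single i 1)) 2 ν ^ 2) := by
          rw [lintegral_const_mul' _ _ (by simp), lintegral_finsetSum']
          · simp only [eLpNorm_two_sq]
          · exact fun i _ => (mv i n).enorm.pow_const 2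
      _ ≤ _ := by
          gcongr with i
          have e : (fun x => fderiv ℝ (v n) x (EuclideanSpace.single i 1))
              = ((fun x => fderiv ℝ (v n) x (EuclideanSpace.single i 1)) - fun x => g x i)
                + fun x => g x i := by ring
          conv_lhs => rw [e]
          exact eLpNorm_add_le ((mv i n).sub (mg i)) (mg i) (by norm_num)
  have lim : Tendsto (fun n => K * (3 * ∑ i : Fin 3, X n i ^ 2)) atTop
      (𝓝 (K * (3 * ∑ i : Fin 3, (0 + eLpNorm (fun x => g x i) 2 ν) ^ 2))) := by
    refine ENNReal.Tendsto.const_mul (ENNReal.Tendsto.const_mul ?_ (Or.inr (by simp))) (Or.inr Kt)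
    exact tendsto_finsetSum _ fun i _ => ENNReal.Tendsto.pow
      (Filter.Tendsto.add (T i) tendsto_const_nhds)
  have m2 : ∀ n, Measurable fun q : E × E => ‖v n q.1 - v n q.2‖ₑ ^ 2 := fun n =>
    ((((hv n).continuous.comp continuous_fst).sub
      ((hv n).continuous.comp continuous_snd)).enorm.measurable).pow_const 2
  have : SFinite ν := by rw [hν]; infer_instance
  -- Fatou's lemma in both variables
  have fatou : ∫⁻ x, ∫⁻ y, ‖u x - u y‖ₑ ^ 2 ∂ν ∂ν ≤
      liminf (fun n => ∫⁻ x, ∫⁻ y, ‖v n x - v n y‖ₑ ^ 2 ∂ν ∂ν) atTop := by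
    refine le_trans ?_ (lintegral_liminf_le fun n => (m2 n).lintegral_prod_right')
    refine lintegral_mono_ae ?_
    filter_upwards [haeν] with x hx
    refine le_trans ?_ (lintegral_liminf_le fun n => (m2 n).comp measurable_prodMk_left)
    refine lintegral_mono_ae ?_
    filter_upwards [haeν] with y hy
    exact (ENNReal.Tendsto.pow (n := 2) (hx.sub hy).enorm).liminf_eq.ge
  have e1 : ∀ w : E → ℝ, ∫⁻ x, ∫⁻ y, ‖w x - w y‖ₑ ^ 2 ∂ν ∂ν
      = ∫⁻ x, φ x * ∫⁻ y, φ y * ‖w x - w y‖ₑ ^ 2 := fun w => by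
    rw [wd]; simp only [wd]
  rw [e1] at fatou
  simp only [e1] at fatou
  refine (fatou.trans (liminf_le_liminf (Eventually.of_forall bound))).trans ?_
  rw [lim.liminf_eq]
  simp only [zero_add, eLpNorm_two_sq]
  rw [← lintegral_finsetSum' _ fun i _ => (mg i).enorm.pow_const 2, ← wd]
  gcongr with x
  refine le_of_eq ?_
  simp only [← ofReal_norm, ← ENNReal.ofReal_pow (norm_nonneg _)]
  rw [normSq_eq, Fin.sum_univ_three, ENNReal.ofReal_add (by positivity) (by positivity),
    ENNReal.ofReal_add (by positivity) (by positivity)]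
  simp [Real.norm_eq_abs, sq_abs]

/-- The weighted Poincaré inequality: some constant approximates `u`. -/
lemma poincare (H : SliceH1 u g) (W : QuasiWeight φ ρ) (hρ : ρ < 1)
    (h0 : ∫⁻ x, φ x ≠ 0) : ∃ c : ℝ,
    (∫⁻ x, φ x) * ∫⁻ x, φ x * ‖u x - c‖ₑ ^ 2 ≤
      ofReal (2 * ρ) ^ 2 * (8 * volume (ball (0 : E) ρ)) *
        (3 * ∫⁻ x, φ x * ‖g x‖ₑ ^ 2) := by
  set ν : Measure E := volume.withDensity φ with hν
  have φt : ∀ x, φ x < ⊤ := fun x => (W.le_one x).trans_lt ENNReal.one_lt_top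
  have wd : ∀ f : E → ℝ≥0∞, ∫⁻ x, f x ∂ν = ∫⁻ x, φ x * f x := fun f =>
    lintegral_withDensity_eq_lintegral_mul_non_measurable _ W.meas (ae_of_all _ φt) f
  have nu : ν univ = ∫⁻ x, φ x := by rw [hν, withDensity_apply _ .univ, setLIntegral_univ]
  have ν0 : ν ≠ 0 := fun h => h0 (by rw [← nu, h]; rfl)
  have νt : ∫⁻ x, φ x ≠ ⊤ := by
    have : ∫⁻ x, φ x ≤ ∫⁻ x, (ball (0 : E) ρ).indicator 1 x := lintegral_mono fun x => by
      by_cases hx : x ∈ ball (0 : E) ρ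
      · simpa [indicator_of_mem hx] using W.le_one x
      · rw [W.zero x hx]; exact zero_le
    refine ne_top_of_le_ne_top ?_ this
    rw [lintegral_indicator measurableSet_ball]
    simpa using (measure_ball_lt_top (μ := (volume : Measure E)) (x := 0) (r := ρ)).ne
  have m : Measurable fun q : E × E => φ q.2 * ‖u q.1 - u q.2‖ₑ ^ 2 :=
    (W.meas.comp measurable_snd).mul
      ((((H.mu.comp measurable_fst).sub (H.mu.comp measurable_snd)).enorm).pow_const 2)
  have : IsFiniteMeasure ν := ⟨by rw [nu]; exact νt.lt_top⟩
  obtain ⟨x, hx⟩ := exists_le_laverage (μ := ν) ν0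
    (f := fun x => ∫⁻ y, φ y * ‖u x - u y‖ₑ ^ 2) m.lintegral_prod_right'.aemeasurable
  refine ⟨u x, ?_⟩
  rw [laverage_eq, wd, nu] at hx
  calc (∫⁻ y, φ y) * ∫⁻ y, φ y * ‖u y - u x‖ₑ ^ 2
      = (∫⁻ y, φ y) * ∫⁻ y, φ y * ‖u x - u y‖ₑ ^ 2 := by
        congr 1
        refine lintegral_congr fun y => ?_
        rw [← enorm_neg, neg_sub]
    _ ≤ (∫⁻ y, φ y) * ((∫⁻ x, φ x * ∫⁻ y, φ y * ‖u x - u y‖ₑ ^ 2) / ∫⁻ y, φ y) := by gcongr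
    _ ≤ ∫⁻ x, φ x * ∫⁻ y, φ y * ‖u x - u y‖ₑ ^ 2 := ENNReal.mul_div_le
    _ ≤ _ := H.poincare_symm W hρ

end SliceH1

/-! ### The weight and the drift term -/

lemma hasDerivAt_expNegInvGlue (y : ℝ) :
    HasDerivAt expNegInvGlue ((y⁻¹) ^ 2 * expNegInvGlue y) y := by
  simpa using expNegInvGlue.hasDerivAt_polynomial_eval_inv_mul 1 y

lemma expNegInvGlue_smooth : ContDiff ℝ ∞ expNegInvGlue := expNegInvGlue.contDiff (n := ⊤)

lemma expNegInvGlue_le_one (y : ℝ) : expNegInvGlue y ≤ 1 := by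
  unfold expNegInvGlue
  split_ifs with h
  · exact zero_le_one
  · exact Real.exp_le_one_iff.2 (neg_nonpos.2 (inv_nonneg.2 (not_le.1 h).le))

lemma inv_sq_mul_expNegInvGlue_le (y : ℝ) : (y⁻¹) ^ 2 * expNegInvGlue y ≤ 2 := by
  rcases le_or_gt y 0 with h | h
  · rw [expNegInvGlue.zero_of_nonpos h, mul_zero]; norm_num
  · have hu : 0 < y⁻¹ := inv_pos.2 h
    have h1 := Real.quadratic_le_exp_of_nonneg hu.le
    rw [expNegInvGlue, if_neg (not_le.2 h), Real.exp_neg, ← div_eq_mul_inv,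
      div_le_iff₀ (Real.exp_pos _)]
    linarith

lemma expNegInvGlue_le_inv_sq_mul {y : ℝ} (hy : y ≤ 1) :
    expNegInvGlue y ≤ (y⁻¹) ^ 2 * expNegInvGlue y := by
  rcases le_or_gt y 0 with h | h
  · simp [expNegInvGlue.zero_of_nonpos h]
  · exact le_mul_of_one_le_left (expNegInvGlue.nonneg y)
      (one_le_pow₀ ((one_le_inv₀ h).2 hy))

/-- The radial profile `r ↦ exp (-1 / (1 - r / ρ²))`, extended by zero to `r ≥ ρ²`; it is
evaluated at `r = |x|²`. -/
noncomputable def hat (ρ r : ℝ) : ℝ := expNegInvGlue (1 - r / ρ ^ 2)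

section hat
variable {ρ : ℝ}

lemma hat_smooth : ContDiff ℝ ∞ (hat ρ) :=
  expNegInvGlue_smooth.comp (contDiff_const.sub (contDiff_id.div_const _))

lemma hat_nonneg (r : ℝ) : 0 ≤ hat ρ r := expNegInvGlue.nonneg _
lemma hat_le_one (r : ℝ) : hat ρ r ≤ 1 := expNegInvGlue_le_one _

lemma hat_zero (hρ : 0 < ρ) {r : ℝ} (hr : ρ ^ 2 ≤ r) : hat ρ r = 0 :=
  expNegInvGlue.zero_of_nonpos (sub_nonpos.2 ((one_le_div (pow_pos hρ 2)).2 hr))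

lemma hat_anti (hρ : 0 < ρ) {r r' : ℝ} (h : r ≤ r') : hat ρ r' ≤ hat ρ r := by
  refine expNegInvGlue.monotone ?_
  have : r / ρ ^ 2 ≤ r' / ρ ^ 2 := by gcongr
  linarith

/-- The factor `q'(1 - r / ρ²)` in the derivative of `r ↦ q(1 - r / ρ²)`. -/
noncomputable def hatSlope (ρ r : ℝ) : ℝ := ((1 - r / ρ ^ 2)⁻¹) ^ 2 * hat ρ r

lemma hatSlope_nonneg (r : ℝ) : 0 ≤ hatSlope ρ r := mul_nonneg (sq_nonneg _) (hat_nonneg r)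

lemma hatSlope_le_two (r : ℝ) : hatSlope ρ r ≤ 2 := inv_sq_mul_expNegInvGlue_le _

lemma hat_le_hatSlope {r : ℝ} (hr : 0 ≤ r) : hat ρ r ≤ hatSlope ρ r :=
  expNegInvGlue_le_inv_sq_mul (sub_le_self _ (by positivity))

lemma deriv_hat_pow (n : ℕ) (r : ℝ) :
    deriv (fun r => hat ρ r ^ n) r = -(n / ρ ^ 2 * hat ρ r ^ (n - 1) * hatSlope ρ r) := by
  have h1 : HasDerivAt (fun r : ℝ => 1 - r / ρ ^ 2) (-(1 / ρ ^ 2)) r :=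
    ((hasDerivAt_id r).div_const _).const_sub 1
  have h2 : HasDerivAt (hat ρ) _ r := (hasDerivAt_expNegInvGlue _).comp r h1
  have h3 := (h2.pow n).deriv
  simp only [Pi.pow_def] at h3
  rw [h3, hatSlope]
  unfold hat
  ring

lemma abs_deriv_hat_pow_mul_le (hρ : 0 < ρ) {n : ℕ} (hn : 1 < n) (x : E) :
    |deriv (fun r => hat ρ r ^ n) (‖x‖ ^ 2)| * ‖x‖ ≤ 2 * n / ρ * hat ρ (‖x‖ ^ 2) ^ (n - 1) := by
  have b0 := hat_nonneg (ρ := ρ) (‖x‖ ^ 2)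
  have s0 := hatSlope_nonneg (ρ := ρ) (‖x‖ ^ 2)
  rw [deriv_hat_pow, abs_neg, abs_of_nonneg (by positivity)]
  rcases le_or_gt ρ ‖x‖ with h | h
  · rw [hat_zero hρ (pow_le_pow_left₀ hρ.le h 2), zero_pow (by omega)]; simp
  · calc n / ρ ^ 2 * hat ρ (‖x‖ ^ 2) ^ (n - 1) * hatSlope ρ (‖x‖ ^ 2) * ‖x‖
        ≤ n / ρ ^ 2 * hat ρ (‖x‖ ^ 2) ^ (n - 1) * 2 * ρ := by
          gcongr
          exact hatSlope_le_two _
      _ = _ := by field_simp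

lemma hat_profile (hρ : 0 < ρ) (hρ1 : ρ < 1) :
    Profile (fun r => hat ρ r ^ 4) (ρ ^ 2) (1 + 8 / ρ ^ 2) where
  smooth := hat_smooth.pow 4
  apos := by positivity
  a1 := by nlinarith
  zero s hs := by rw [hat_zero hρ hs]; norm_num
  bd s := by
    rw [abs_of_nonneg (pow_nonneg (hat_nonneg s) 4)]
    have := pow_le_one₀ (n := 4) (hat_nonneg s) (hat_le_one (ρ := ρ) s)
    have : 0 ≤ 8 / ρ ^ 2 := by positivity
    linarith
  bd' s := by
    have b0 := hat_nonneg (ρ := ρ) s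
    have s0 := hatSlope_nonneg (ρ := ρ) s
    rw [deriv_hat_pow, abs_neg, abs_of_nonneg (by positivity)]
    have h1 := pow_le_one₀ (n := 3) (hat_nonneg s) (hat_le_one (ρ := ρ) s)
    calc ((4 : ℕ) : ℝ) / ρ ^ 2 * hat ρ s ^ (4 - 1) * hatSlope ρ s
        ≤ ((4 : ℕ) : ℝ) / ρ ^ 2 * 1 * 2 := by
          gcongr
          exact hatSlope_le_two s
      _ = 8 / ρ ^ 2 := by push_cast; ring
      _ ≤ _ := by linarith

lemma measurable_hat : Measurable fun x : E => hat ρ (‖x‖ ^ 2) :=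
  ((hat_smooth (ρ := ρ)).continuous.comp (continuous_norm.pow 2)).measurable

lemma hat_notMem_ball (hρ : 0 < ρ) {x : E} (hx : x ∉ ball (0 : E) ρ) : hat ρ (‖x‖ ^ 2) = 0 := by
  rw [mem_ball_zero_iff, not_lt] at hx
  exact hat_zero hρ (pow_le_pow_left₀ hρ.le hx 2)

lemma hat_quasiWeight (hρ : 0 < ρ) :
    QuasiWeight (fun x : E => ofReal (hat ρ (‖x‖ ^ 2) ^ 4)) ρ where
  meas := (measurable_hat.pow_const 4).ennreal_ofReal
  le_one x := by
    rw [ENNReal.ofReal_le_one]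
    exact pow_le_one₀ (hat_nonneg _) (hat_le_one _)
  zero x hx := by rw [hat_notMem_ball hρ hx]; norm_num
  quasi x y s hs := by
    have hseg : ‖seg s x y‖ ≤ max ‖x‖ ‖y‖ := by
      calc ‖seg s x y‖ ≤ (1 - s) * ‖x‖ + s * ‖y‖ := by
            refine (norm_add_le _ _).trans (le_of_eq ?_)
            rw [norm_smul, norm_smul, Real.norm_of_nonneg (by linarith [hs.2]),
              Real.norm_of_nonneg hs.1]
        _ ≤ (1 - s) * max ‖x‖ ‖y‖ + s * max ‖x‖ ‖y‖ := by
            have := hs.1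
            have : 0 ≤ 1 - s := by linarith [hs.2]
            gcongr
            · exact le_max_left _ _
            · exact le_max_right _ _
        _ = _ := by ring
    have mono : ∀ {z : E}, ‖seg s x y‖ ≤ ‖z‖ → ofReal (hat ρ (‖z‖ ^ 2) ^ 4) ≤
        ofReal (hat ρ (‖seg s x y‖ ^ 2) ^ 4) := by
      intro z hz
      refine ENNReal.ofReal_le_ofReal (pow_le_pow_left₀ (hat_nonneg _) ?_ 4)
      exact hat_anti hρ (pow_le_pow_left₀ (norm_nonneg _) hz 2)
    rcases le_total ‖x‖ ‖y‖ with h | h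
    · exact (min_le_right _ _).trans (mono (by rwa [max_eq_right h] at hseg))
    · exact (min_le_left _ _).trans (mono (by rwa [max_eq_left h] at hseg))

/-- The value of the weight `hat ^ 4` at distance `ρ / 2`. -/
noncomputable def hatLow : ℝ := expNegInvGlue (3 / 4) ^ 4

lemma hatLow_pos : 0 < hatLow := pow_pos (expNegInvGlue.pos_of_pos (by norm_num)) 4

lemma hatLow_le (hρ : 0 < ρ) {x : E} (hx : x ∈ ball (0 : E) (ρ / 2)) :
    hatLow ≤ hat ρ (‖x‖ ^ 2) ^ 4 := by
  refine pow_le_pow_left₀ (expNegInvGlue.nonneg _) (expNegInvGlue.monotone ?_) 4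
  rw [mem_ball_zero_iff] at hx
  have : ‖x‖ ^ 2 / ρ ^ 2 ≤ 1 / 4 := by
    rw [div_le_iff₀ (by positivity)]
    nlinarith [norm_nonneg x]
  linarith

end hat

lemma lintegral_drift_low_le {α : Type*} [MeasurableSpace α] {μ : Measure α} {f W : α → ℝ≥0∞}
    (hf : AEMeasurable f μ) (hW : AEMeasurable W μ) :
    ∫⁻ x, f x * W x ∂μ ≤
      (∫⁻ x, f x ^ (5 / 3 : ℝ) ∂μ) ^ (3 / 5 : ℝ) * (∫⁻ x, W x ^ 6 ∂μ) ^ (1 / 20 : ℝ)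
        * (∫⁻ x, W x ^ 2 ∂μ) ^ (7 / 20 : ℝ) := by
  have h := ENNReal.lintegral_prod_norm_pow_le (μ := μ) Finset.univ
    (f := ![fun x => f x ^ (5 / 3 : ℝ), fun x => W x ^ 6, fun x => W x ^ 2])
    (p := ![3 / 5, 1 / 20, 7 / 20]) (by
      intro i _; fin_cases i
      · exact hf.pow_const _
      · exact hW.pow_const _
      · exact hW.pow_const _)
    (by simp [Fin.sum_univ_three]; norm_num)
    (by intro i _; fin_cases i <;> simp <;> norm_num)
  simp only [Fin.prod_univ_three] at h
  refine le_trans (le_of_eq (lintegral_congr fun x => ?_)) h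
  have e1 : (f x ^ (5 / 3 : ℝ)) ^ (3 / 5 : ℝ) = f x := by
    rw [← ENNReal.rpow_mul]; norm_num
  have e2 : (W x ^ 6) ^ (1 / 20 : ℝ) * (W x ^ 2) ^ (7 / 20 : ℝ) = W x := by
    rw [← ENNReal.rpow_natCast, ← ENNReal.rpow_mul, ← ENNReal.rpow_natCast, ← ENNReal.rpow_mul,
      ← ENNReal.rpow_add_of_nonneg _ _ (by norm_num) (by norm_num)]
    norm_num
  change _ = (f x ^ (5 / 3 : ℝ)) ^ (3 / 5 : ℝ) * (W x ^ 6) ^ (1 / 20 : ℝ) * (W x ^ 2) ^ (7 / 20 : ℝ)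
  rw [mul_assoc, e1, e2]

/-- The constant of the Poincaré inequality for the weight `hat ^ 4`. -/
noncomputable def poinConst : ℝ := 768 / hatLow

lemma poinConst_pos : 0 < poinConst := div_pos (by norm_num) hatLow_pos

namespace SliceH1
variable {u : E → ℝ} {g f : E → E} {ρ e : ℝ}

/-- The weighted Dirichlet energy. -/
noncomputable def dirichlet (ρ : ℝ) (g : E → E) : ℝ := ∫ x, hat ρ (‖x‖ ^ 2) ^ 4 * ‖g x‖ ^ 2

lemma dirichlet_nonneg : 0 ≤ dirichlet ρ g :=
  integral_nonneg fun _ => mul_nonneg (pow_nonneg (hat_nonneg _) _) (sq_nonneg _)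

lemma dirichlet_integrable (H : SliceH1 u g) :
    Integrable fun x => hat ρ (‖x‖ ^ 2) ^ 4 * ‖g x‖ ^ 2 := by
  have hi : Integrable fun x => ‖g x‖ ^ 2 := H.g2.integrable_norm_pow (p := 2) (by norm_num)
  refine hi.mono' ((measurable_hat.pow_const 4).mul (H.mg.norm.pow_const 2)).aestronglyMeasurable
    (ae_of_all _ fun x => ?_)
  rw [Real.norm_of_nonneg (mul_nonneg (pow_nonneg (hat_nonneg _) 4) (sq_nonneg _))]
  exact mul_le_of_le_one_left (sq_nonneg _) (pow_le_one₀ (hat_nonneg _) (hat_le_one _))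

lemma ofReal_dirichlet (H : SliceH1 u g) : ofReal (dirichlet ρ g)
    = ∫⁻ x, ofReal (hat ρ (‖x‖ ^ 2) ^ 4) * ‖g x‖ₑ ^ 2 := by
  rw [dirichlet, ofReal_integral_eq_lintegral_ofReal H.dirichlet_integrable
    (ae_of_all _ fun x => mul_nonneg (pow_nonneg (hat_nonneg _) _) (sq_nonneg _))]
  refine lintegral_congr fun x => ?_
  rw [ENNReal.ofReal_mul (pow_nonneg (hat_nonneg _) _), ← ofReal_norm (g x),
    ENNReal.ofReal_pow (norm_nonneg _)]

/-- The Poincaré inequality with the weight `hat ^ 4`. -/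
lemma poincare_hat (H : SliceH1 u g) (hρ : 0 < ρ) (hρ1 : ρ < 1) : ∃ c : ℝ,
    ∫⁻ x, ofReal (hat ρ (‖x‖ ^ 2) ^ 4) * ‖u x - c‖ₑ ^ 2 ≤
      ofReal (poinConst * ρ ^ 2 * dirichlet ρ g) := by
  set φ : E → ℝ≥0∞ := fun x => ofReal (hat ρ (‖x‖ ^ 2) ^ 4) with hφ
  set V := volume (ball (0 : E) (ρ / 2)) with hV
  have V0 : V ≠ 0 := (measure_ball_pos _ _ (by positivity)).ne'
  have Vt : V ≠ ⊤ := measure_ball_lt_top.ne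
  have V8 : volume (ball (0 : E) ρ) = 8 * V := by
    rw [hV, EuclideanSpace.volume_ball_fin_three, EuclideanSpace.volume_ball_fin_three, ← mul_assoc,
      ← ENNReal.ofReal_pow hρ.le, ← ENNReal.ofReal_pow (by positivity),
      show (8 : ℝ≥0∞) = ofReal 8 by norm_num, ← ENNReal.ofReal_mul (by norm_num : (0:ℝ) ≤ 8)]
    congr 2
    ring
  have low : ofReal hatLow * V ≤ ∫⁻ x, φ x := by
    calc ofReal hatLow * V = ∫⁻ x in ball (0 : E) (ρ / 2), ofReal hatLow := by
          simp [hV]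
      _ ≤ ∫⁻ x in ball (0 : E) (ρ / 2), φ x :=
          setLIntegral_mono ((measurable_hat.pow_const 4).ennreal_ofReal) fun x hx =>
            ENNReal.ofReal_le_ofReal (hatLow_le hρ hx)
      _ ≤ _ := setLIntegral_le_lintegral _ _
  have l0 : ofReal hatLow ≠ 0 := (ENNReal.ofReal_pos.2 hatLow_pos).ne'
  have h0 : ∫⁻ x, φ x ≠ 0 := fun h => by
    rw [h, nonpos_iff_eq_zero, mul_eq_zero] at low
    exact low.elim l0 V0
  obtain ⟨c, hc⟩ := H.poincare (hat_quasiWeight hρ) hρ1 h0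
  refine ⟨c, ?_⟩
  rw [← H.ofReal_dirichlet, V8] at hc
  set I := ∫⁻ x, φ x * ‖u x - c‖ₑ ^ 2
  have h1 : (ofReal hatLow * V) * I ≤ (ofReal hatLow * V) *
      ofReal (poinConst * ρ ^ 2 * dirichlet ρ g) := by
    refine ((mul_le_mul_left low _).trans hc).trans (le_of_eq ?_)
    have e1 : ofReal hatLow * ofReal (poinConst * ρ ^ 2 * dirichlet ρ g)
        = 768 * ofReal (ρ ^ 2) * ofReal (dirichlet ρ g) := by
      rw [← ENNReal.ofReal_mul hatLow_pos.le, poinConst,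
        show (768 : ℝ≥0∞) = ofReal 768 by norm_num, ← ENNReal.ofReal_mul (by norm_num),
        ← ENNReal.ofReal_mul (by positivity)]
      congr 1
      have := hatLow_pos
      field_simp
    rw [mul_right_comm (ofReal hatLow), e1, ENNReal.ofReal_mul (by norm_num : (0:ℝ) ≤ 2), mul_pow,
      ENNReal.ofReal_pow hρ.le]
    norm_num
    ring
  rwa [ENNReal.mul_le_mul_iff_right (mul_ne_zero l0 V0)
    (ENNReal.mul_ne_top ENNReal.ofReal_ne_top Vt)] at h1

lemma indicator_sub_const (H : SliceH1 u g) (c : ℝ) :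
    SliceH1 ((ball (0 : E) 1).indicator fun x => u x - c) g := by
  have m : Measurable ((ball (0 : E) 1).indicator fun x => u x - c) :=
    (H.mu.sub_const c).indicator measurableSet_ball
  refine ⟨m, H.mg, ?_, H.g2, fun r hr δ hδ => ?_⟩
  · rw [memLp_indicator_iff_restrict measurableSet_ball]
    exact (H.u2.restrict _).sub (memLp_of_continuous continuous_const 1)
  · obtain ⟨v, hv, h1, h2⟩ := H.approx r hr δ hδ
    refine ⟨fun x => v x - c, hv.sub contDiff_const, ?_, fun i => ?_⟩
    · refine le_trans (le_of_eq (eLpNorm_congr_ae ?_)) h1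
      filter_upwards [ae_restrict_mem measurableSet_ball] with x hx
      rw [Pi.sub_apply, Pi.sub_apply, indicator_of_mem (ball_subset_ball hr.le hx)]
      ring
    · simpa only [fderiv_sub_const] using h2 i

/-- The constant in the Sobolev inequality for the oscillation. -/
noncomputable def oscConst : ℝ := sobSq * (1 + 144 * poinConst)

lemma oscConst_nonneg : 0 ≤ oscConst := by
  have := sobSq_nonneg
  have := poinConst_pos
  unfold oscConst; positivity

/-- The constant in the bound of the drift term by the weighted Dirichlet energy. -/
noncomputable def driftConst : ℝ := oscConst ^ (3 / 20 : ℝ) * poinConst ^ (7 / 20 : ℝ)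

lemma driftConst_nonneg : 0 ≤ driftConst := by
  have := oscConst_nonneg
  have := poinConst_pos
  unfold driftConst; positivity

/-- The drift term is controlled by the weighted Dirichlet energy after subtraction of a
suitable constant from `u`; the power of `ρ` is the scale invariant one. -/
lemma drift_osc_le (H : SliceH1 u g) (mf : Measurable f) (hρ : 0 < ρ) (hρ1 : ρ < 1) (he : 0 ≤ e)
    (hf : (∫⁻ x in ball (0 : E) ρ, ‖f x‖ₑ ^ (5 / 3 : ℝ)) ^ (3 / 5 : ℝ)
      ≤ ofReal (e * ρ ^ (4 / 5 : ℝ))) : ∃ c : ℝ,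
    ∫⁻ x, ‖f x‖ₑ * ‖hat ρ (‖x‖ ^ 2) ^ 3 * (u x - c)‖ₑ ≤
      ofReal (driftConst * e * ρ ^ (3 / 2 : ℝ) * √(dirichlet ρ g)) := by
  obtain ⟨c, hc⟩ := H.poincare_hat hρ hρ1
  refine ⟨c, ?_⟩
  have N0 := dirichlet_nonneg (ρ := ρ) (g := g)
  have p0 := poinConst_pos
  have o0 := oscConst_nonneg
  set N := dirichlet ρ g with hN
  set W : E → ℝ := fun x => hat ρ (‖x‖ ^ 2) ^ 3 * (u x - c) with hW
  have mW : Measurable W := (measurable_hat.pow_const 3).mul (H.mu.sub_const c)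
  have b3 : ContDiff ℝ 1 fun r => hat ρ r ^ 3 :=
    (hat_smooth.pow 3).of_le (by simp)
  -- the square norm of `W`
  have w2 : ∫⁻ x, ‖W x‖ₑ ^ 2 ≤ ofReal (poinConst * ρ ^ 2 * N) := by
    refine (lintegral_mono fun x => ?_).trans hc
    simp only [hW]
    rw [enorm_mul, mul_pow, Real.enorm_eq_ofReal (pow_nonneg (hat_nonneg _) 3),
      ← ENNReal.ofReal_pow (pow_nonneg (hat_nonneg _) 3)]
    gcongr
    rw [← pow_mul]
    exact pow_le_pow_of_le_one (hat_nonneg _) (hat_le_one _) (by norm_num)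
  -- the Sobolev norm of `W`
  have w6 : eLpNorm W 6 volume ^ 2 ≤ ofReal (oscConst * N) := by
    have sob := (H.indicator_sub_const c).sobolev_sq (contDiff_radial b3) hρ1
      (fun x hx => by rw [hat_zero hρ (pow_le_pow_left₀ hρ.le hx 2)]; norm_num)
    have eW : (fun x => hat ρ (‖x‖ ^ 2) ^ 3 * (ball (0 : E) 1).indicator (fun x => u x - c) x)
        = W := by
      ext x
      by_cases hx : x ∈ ball (0 : E) 1
      · rw [indicator_of_mem hx]
      · have : x ∉ ball (0 : E) ρ := fun h => hx (ball_subset_ball hρ1.le h)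
        simp only [hW]
        rw [hat_notMem_ball hρ this]; simp
    rw [eW] at sob
    refine sob.trans ?_
    rw [oscConst, mul_assoc sobSq, ENNReal.ofReal_mul sobSq_nonneg, ofReal_sobSq]
    refine mul_le_mul_right ?_ _
    rw [add_mul, one_mul, ENNReal.ofReal_add N0 (by positivity)]
    refine add_le_add ?_ ?_
    · rw [hN, H.ofReal_dirichlet]
      refine lintegral_mono fun x => ?_
      rw [Real.enorm_eq_ofReal (pow_nonneg (hat_nonneg _) 3),
        ← ENNReal.ofReal_pow (pow_nonneg (hat_nonneg _) 3)]
      gcongr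
      rw [← pow_mul]
      exact pow_le_pow_of_le_one (hat_nonneg _) (hat_le_one _) (by norm_num)
    · have grad : ∀ x : E, ‖fderiv ℝ (fun x : E => hat ρ (‖x‖ ^ 2) ^ 3) x‖ ^ 2 ≤
          144 / ρ ^ 2 * hat ρ (‖x‖ ^ 2) ^ 4 := by
        intro x
        have h1 := norm_fderiv_radial_le b3 x
        have h2 := abs_deriv_hat_pow_mul_le hρ (n := 3) (by norm_num) x
        have h3 : ‖fderiv ℝ (fun x : E => hat ρ (‖x‖ ^ 2) ^ 3) x‖ ≤
            12 / ρ * hat ρ (‖x‖ ^ 2) ^ 2 := by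
          refine h1.trans ?_
          calc _ = 2 * (|deriv (fun r => hat ρ r ^ 3) (‖x‖ ^ 2)| * ‖x‖) := by ring
            _ ≤ 2 * (2 * (3 : ℕ) / ρ * hat ρ (‖x‖ ^ 2) ^ (3 - 1)) := by gcongr
            _ = _ := by push_cast; ring
        calc _ ≤ (12 / ρ * hat ρ (‖x‖ ^ 2) ^ 2) ^ 2 := pow_le_pow_left₀ (norm_nonneg _) h3 2
          _ = _ := by ring
      calc ∫⁻ x, ‖fderiv ℝ (fun x : E => hat ρ (‖x‖ ^ 2) ^ 3) x‖ₑ ^ 2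
            * ‖(ball (0 : E) 1).indicator (fun x => u x - c) x‖ₑ ^ 2
          ≤ ∫⁻ x, ofReal (144 / ρ ^ 2) *
              (ofReal (hat ρ (‖x‖ ^ 2) ^ 4) * ‖u x - c‖ₑ ^ 2) := by
            refine lintegral_mono fun x => ?_
            rw [← mul_assoc, ← ENNReal.ofReal_mul (by positivity), ← ofReal_norm,
              ← ENNReal.ofReal_pow (norm_nonneg _)]
            have hi : ‖(ball (0 : E) 1).indicator (fun x => u x - c) x‖ₑ ≤ ‖u x - c‖ₑ :=
              enorm_indicator_le_enorm_self _ _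
            gcongr
            exact grad x
        _ ≤ ofReal (144 / ρ ^ 2) * ofReal (poinConst * ρ ^ 2 * N) := by
            rw [lintegral_const_mul' _ _ ENNReal.ofReal_ne_top]
            gcongr
        _ = ofReal (144 * poinConst * N) := by
            rw [← ENNReal.ofReal_mul (by positivity)]
            congr 1
            field_simp
  have w6' : (∫⁻ x, ‖W x‖ₑ ^ 6) ^ (1 / 20 : ℝ) = (eLpNorm W 6 volume ^ 2) ^ (3 / 20 : ℝ) := by
    rw [eLpNorm_eq_lintegral_rpow_enorm_toReal (by norm_num) (by norm_num),
      ← ENNReal.rpow_natCast, ← ENNReal.rpow_mul, ← ENNReal.rpow_mul]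
    norm_num
  have mF : Measurable ((ball (0 : E) ρ).indicator fun x => ‖f x‖ₑ) :=
    mf.enorm.indicator measurableSet_ball
  have hol := lintegral_drift_low_le (μ := (volume : Measure E)) mF.aemeasurable
    mW.enorm.aemeasurable
  have eF : ∀ x, ‖f x‖ₑ * ‖W x‖ₑ = (ball (0 : E) ρ).indicator (fun x => ‖f x‖ₑ) x * ‖W x‖ₑ := by
    intro x
    by_cases hx : x ∈ ball (0 : E) ρ
    · rw [indicator_of_mem hx]
    · simp only [hW]
      rw [hat_notMem_ball hρ hx]; simp
  rw [lintegral_congr eF]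
  refine hol.trans ?_
  rw [lintegral_indicator_rpow measurableSet_ball _ (by norm_num), w6']
  have n2 : 0 ≤ poinConst * ρ ^ 2 * N := by positivity
  have n6 : 0 ≤ oscConst * N := by positivity
  calc _ ≤ ofReal (e * ρ ^ (4 / 5 : ℝ)) * ofReal (oscConst * N) ^ (3 / 20 : ℝ)
        * ofReal (poinConst * ρ ^ 2 * N) ^ (7 / 20 : ℝ) := by gcongr
    _ = ofReal (e * ρ ^ (4 / 5 : ℝ) * (oscConst * N) ^ (3 / 20 : ℝ)
        * (poinConst * ρ ^ 2 * N) ^ (7 / 20 : ℝ)) := by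
        rw [ENNReal.ofReal_rpow_of_nonneg n6 (by norm_num),
          ENNReal.ofReal_rpow_of_nonneg n2 (by norm_num), ← ENNReal.ofReal_mul (by positivity),
          ← ENNReal.ofReal_mul (by positivity)]
    _ = _ := by
        congr 1
        rw [Real.mul_rpow o0 N0, Real.mul_rpow (by positivity) N0, Real.mul_rpow p0.le (by positivity),
          driftConst, Real.sqrt_eq_rpow, ← Real.rpow_natCast ρ 2, ← Real.rpow_mul hρ.le]
        have e1 : ρ ^ (3 / 2 : ℝ) = ρ ^ (4 / 5 : ℝ) * ρ ^ (((2 : ℕ) : ℝ) * (7 / 20)) := by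
          rw [← Real.rpow_add hρ]; norm_num
        have e2 : N ^ (1 / 2 : ℝ) = N ^ (3 / 20 : ℝ) * N ^ (7 / 20 : ℝ) := by
          rw [← Real.rpow_add_of_nonneg N0 (by norm_num) (by norm_num)]; norm_num
        rw [e1, e2]
        ring

end SliceH1

/-! ### The logarithm of the distance to the maximum -/

/-- The projection of `ℝ` onto `[-1, 1]`. -/
noncomputable def clamp (s : ℝ) : ℝ := max (-1) (min 1 s)

lemma clamp_mem (s : ℝ) : clamp s ∈ Icc (-1 : ℝ) 1 :=
  ⟨le_max_left _ _, max_le (by norm_num) (min_le_left _ _)⟩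

lemma clamp_of_abs_le {s : ℝ} (hs : |s| ≤ 1) : clamp s = s := by
  rw [abs_le] at hs
  rw [clamp, min_eq_right hs.2, max_eq_right hs.1]

lemma clamp_continuous : Continuous clamp :=
  continuous_const.max (continuous_const.min continuous_id)

lemma prim_comp_clamp {f P : ℝ → ℝ} (hf : Continuous fun s => f (clamp s))
    (hP : ∀ s ∈ Icc (-1 : ℝ) 1, HasDerivAt P (f s) s) (P0 : P 0 = 0) {s : ℝ} (hs : |s| ≤ 1) :
    prim (fun s => f (clamp s)) s = P s := by
  have hsub : ∀ x ∈ uIcc 0 s, |x| ≤ 1 := fun x hx => by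
    have := abs_sub_left_of_mem_uIcc hx
    simp only [sub_zero] at this
    exact this.trans hs
  rw [prim, intervalIntegral.integral_eq_sub_of_hasDerivAt (f := P) _ (hf.intervalIntegrable _ _),
    P0, sub_zero]
  intro x hx
  rw [clamp_of_abs_le (hsub x hx)]
  exact hP x (abs_le.1 (hsub x hx))

/-- `F(s) = -log (1 - (1 - ε) s²)`, which satisfies `F'' ≥ (F')²`. -/
noncomputable def logF (ε s : ℝ) : ℝ := -Real.log (1 - (1 - ε) * s ^ 2)

/-- The first derivative of `logF`. -/
noncomputable def logF1 (ε s : ℝ) : ℝ := 2 * (1 - ε) * s / (1 - (1 - ε) * s ^ 2)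

/-- The second derivative of `logF`. -/
noncomputable def logF2 (ε s : ℝ) : ℝ := 2 * (1 - ε) / (1 - (1 - ε) * s ^ 2) + logF1 ε s ^ 2

section logF
variable {ε s : ℝ}

lemma le_logF_arg (hε1 : ε < 1) (hs : |s| ≤ 1) : ε ≤ 1 - (1 - ε) * s ^ 2 := by
  have : s ^ 2 ≤ 1 := (sq_le_one_iff_abs_le_one s).2 hs
  nlinarith

lemma hasDerivAt_logF_arg : HasDerivAt (fun s : ℝ => 1 - (1 - ε) * s ^ 2) (-(2 * (1 - ε) * s)) s := by
  have := ((hasDerivAt_pow 2 s).const_mul (1 - ε)).const_sub 1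
  refine this.congr_deriv ?_
  push_cast
  ring

lemma hasDerivAt_logF (hε : 0 < ε) (hε1 : ε < 1) (hs : |s| ≤ 1) :
    HasDerivAt (logF ε) (logF1 ε s) s := by
  have h0 := hε.trans_le (le_logF_arg hε1 hs)
  refine (hasDerivAt_logF_arg.log h0.ne').neg.congr_deriv ?_
  rw [logF1]
  ring

lemma hasDerivAt_logF1 (hε : 0 < ε) (hε1 : ε < 1) (hs : |s| ≤ 1) :
    HasDerivAt (logF1 ε) (logF2 ε s) s := by
  have h0 := hε.trans_le (le_logF_arg hε1 hs)
  refine (((hasDerivAt_id s).const_mul (2 * (1 - ε))).div hasDerivAt_logF_arg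
    h0.ne').congr_deriv ?_
  rw [logF2, logF1]
  simp only [id]
  field_simp
  ring

lemma continuous_logF1_clamp (hε : 0 < ε) (hε1 : ε < 1) :
    Continuous fun s => logF1 ε (clamp s) := by
  refine ((continuous_const.mul clamp_continuous).div
    (continuous_const.sub (continuous_const.mul (clamp_continuous.pow 2))) fun s => ?_)
  exact (hε.trans_le (le_logF_arg hε1 (abs_le.2 (clamp_mem s)))).ne'

lemma continuous_logF2_clamp (hε : 0 < ε) (hε1 : ε < 1) :
    Continuous fun s => logF2 ε (clamp s) := by
  refine Continuous.add (continuous_const.div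
    (continuous_const.sub (continuous_const.mul (clamp_continuous.pow 2))) fun s => ?_)
    ((continuous_logF1_clamp hε hε1).pow 2)
  exact (hε.trans_le (le_logF_arg hε1 (abs_le.2 (clamp_mem s)))).ne'

lemma exists_bddLim_clamp {f : ℝ → ℝ} (hf : Continuous fun s => f (clamp s)) :
    ∃ B, BddLim B fun s => f (clamp s) := by
  obtain ⟨B, hB⟩ := (isCompact_Icc (a := (-1 : ℝ)) (b := 1)).exists_bound_of_continuousOn
    hf.continuousOn
  refine ⟨B, bddLim_of_continuous hf fun s => ?_⟩
  have h := hB (clamp s) (clamp_mem s)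
  rwa [clamp_of_abs_le (abs_le.2 (clamp_mem s))] at h

lemma prim_logF1 (hε : 0 < ε) (hε1 : ε < 1) (hs : |s| ≤ 1) :
    prim (fun s => logF1 ε (clamp s)) s = logF ε s :=
  prim_comp_clamp (continuous_logF1_clamp hε hε1)
    (fun _ hs => hasDerivAt_logF hε hε1 (abs_le.2 hs)) (by simp [logF]) hs

lemma prim_logF2 (hε : 0 < ε) (hε1 : ε < 1) (hs : |s| ≤ 1) :
    prim (fun s => logF2 ε (clamp s)) s = logF1 ε s :=
  prim_comp_clamp (continuous_logF2_clamp hε hε1)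
    (fun _ hs => hasDerivAt_logF1 hε hε1 (abs_le.2 hs)) (by simp [logF1]) hs

lemma prim_prim_logF2 (hε : 0 < ε) (hε1 : ε < 1) (hs : |s| ≤ 1) :
    prim (prim fun s => logF2 ε (clamp s)) s = logF ε s := by
  rw [← prim_logF1 hε hε1 hs]
  refine intervalIntegral.integral_congr fun x hx => ?_
  have := abs_sub_left_of_mem_uIcc hx
  simp only [sub_zero] at this
  rw [prim_logF2 hε hε1 (this.trans hs), clamp_of_abs_le (this.trans hs)]

lemma logF_nonneg (hε : 0 < ε) (hε1 : ε < 1) (hs : |s| ≤ 1) : 0 ≤ logF ε s :=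
  neg_nonneg.2 (Real.log_nonpos (hε.le.trans (le_logF_arg hε1 hs)) (by nlinarith [sq_nonneg s]))

lemma logF_le (hε : 0 < ε) (hε1 : ε < 1) (hs : |s| ≤ 1) : logF ε s ≤ -Real.log ε :=
  neg_le_neg (Real.log_le_log hε (le_logF_arg hε1 hs))

lemma logF1_sq_le (hε : 0 < ε) (hε1 : ε < 1) (hs : |s| ≤ 1) : logF1 ε s ^ 2 ≤ logF2 ε s := by
  have h0 := hε.trans_le (le_logF_arg hε1 hs)
  rw [logF2]
  have : 0 ≤ 2 * (1 - ε) / (1 - (1 - ε) * s ^ 2) := div_nonneg (by linarith) h0.le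
  linarith

lemma logF_mono (hε : 0 < ε) (hε1 : ε < 1) {s' : ℝ} (hs : |s| ≤ 1) (h : |s'| ≤ |s|) :
    logF ε s' ≤ logF ε s := by
  refine neg_le_neg (Real.log_le_log (hε.trans_le (le_logF_arg hε1 hs)) ?_)
  have := sq_le_sq.2 h
  nlinarith

end logF

/-! ### The differential inequality for the logarithm -/

namespace Sol
variable {b : ST → E} {Γ : ST → ℝ} {G : ST → E} {ρ e ε : ℝ}

open SliceH1 (driftConst driftConst_nonneg)

lemma b_integrable (S : Sol b Γ G) (i : Fin 3) : Integrable fun z => b z i := by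
  have h := (locInt_of_L2 (memLp_apply S.b2 i)).integrableOn_isCompact
    ((isCompact_closedBall (0 : E) 1).prod (isCompact_Icc (a := (-1 : ℝ)) (b := 0)))
  refine h.integrable_of_forall_notMem_eq_zero fun z hz => ?_
  rw [S.bz z fun hc => hz ⟨ball_subset_closedBall hc.1, Ioc_subset_Icc_self (by simpa using hc.2)⟩]
  rfl

/-- On almost every time slice the drift is orthogonal to the gradient of a radial weight. -/
lemma integral_dotx_slice (S : Sol b Γ G) {σ : ℝ → ℝ} {a C : ℝ} (P : Profile σ a C) :
    ∀ᵐ t : ℝ, t ∈ Ioo (-1 : ℝ) 0 → (Integrable fun x : E => deriv σ (‖x‖ ^ 2) * dotx b (x, t)) ∧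
      ∫ x : E, deriv σ (‖x‖ ^ 2) * dotx b (x, t) = 0 := by
  have hi : Integrable fun z : ST => deriv σ (‖z.1‖ ^ 2) * dotx b z := by
    have : ∀ i : Fin 3, Integrable fun z : ST => (z.1 i * deriv σ (‖z.1‖ ^ 2)) * b z i := fun i =>
      (S.b_integrable i).bdd_mul (c := C) (measurable_xprof' P i).aestronglyMeasurable
        (ae_of_all _ fun _ => P.coord_bd _ _)
    refine (integrable_finsetSum Finset.univ fun i _ => this i).congr
      (ae_of_all _ fun z => ?_)
    simp only [dotx, Fin.sum_univ_three]
    ring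
  have hz : ∀ᵐ t : ℝ, t ∈ Ioo (-1 : ℝ) 0 → ∫ x : E, deriv σ (‖x‖ ^ 2) * dotx b (x, t) = 0 := by
    refine isOpen_Ioo.ae_eq_zero_of_integral_contDiff_smul_eq_zero
      (hi.integral_prod_right.locallyIntegrable.locallyIntegrableOn _) ?_
    intro θ θs θc θsupp
    obtain ⟨s₀, s₁, hs₀, hs₁, hθ⟩ : ∃ s₀ s₁ : ℝ, -1 < s₀ ∧ s₁ < 0 ∧ ∀ t ∉ Icc s₀ s₁, θ t = 0 := by
      by_cases hne : (tsupport θ).Nonempty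
      · obtain ⟨m, hm, hmin⟩ := θc.isCompact.exists_isLeast hne
        obtain ⟨m', hm', hmax⟩ := θc.isCompact.exists_isGreatest hne
        refine ⟨m, m', (θsupp hm).1, (θsupp hm').2, fun t ht => ?_⟩
        by_contra h
        exact ht ⟨hmin (subset_tsupport _ h), hmax (subset_tsupport _ h)⟩
      · refine ⟨-(1 / 2), -(1 / 2), by norm_num, by norm_num, fun t _ => ?_⟩
        by_contra h
        exact hne ⟨t, subset_tsupport _ h⟩
    have T := S.div _ (isTest_tens_openCyl (χ := fun _ => 1) P θs contDiff_const hs₀ hs₁ hθ)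
    have e1 : ∀ z : ST, ∑ i : Fin 3, b z i * dx i (tens σ θ fun _ => 1) z
        = 2 * (θ z.2 * (deriv σ (‖z.1‖ ^ 2) * dotx b z)) := by
      intro z
      simp only [dx_tens P.smooth θs contDiff_const, dotx, Fin.sum_univ_three, deriv_const]
      ring
    simp only [e1] at T
    obtain ⟨D, hD⟩ := θc.exists_bound_of_continuous θs.continuous
    have hθi : Integrable fun z : ST => θ z.2 * (deriv σ (‖z.1‖ ^ 2) * dotx b z) :=
      hi.bdd_mul (c := D) (θs.continuous.comp continuous_snd).aestronglyMeasurable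
        (ae_of_all _ fun z => hD _)
    rw [integral_const_mul, integral_slice hθi, mul_eq_zero] at T
    have T' := T.resolve_left (by norm_num)
    simp only [smul_eq_mul]
    rw [← T']
    refine integral_congr_ae (ae_of_all _ fun t => ?_)
    exact (integral_const_mul _ _).symm
  filter_upwards [hz, integrable_slice hi] with t h1 h2 ht using ⟨h2, h1 ht⟩

/-- The constant in the differential inequality for the logarithm. -/
noncomputable def logConst : ℝ := 640 + 128 * driftConst ^ 2

lemma logConst_nonneg : 0 ≤ logConst := by unfold logConst; positivity

/-- The flux for `logF` with the weight `hat ^ 4`. -/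
noncomputable def logFlux (b : ST → E) (Γ : ST → ℝ) (G : ST → E) (ε ρ : ℝ) : ST → ℝ :=
  flux b Γ G (prim (prim fun s => logF2 ε (clamp s))) (prim fun s => logF2 ε (clamp s))
    (fun s => logF2 ε (clamp s)) (fun r => hat ρ r ^ 4)

/-- Pointwise bound of the flux apart from the drift term, where `F'' ≥ (F')²` is used. -/
lemma neg_logFlux_le (hρ : 0 < ρ) (hε : 0 < ε) (hε1 : ε < 1) (z : ST)
    (hz : z.1 ∈ ball (0 : E) ρ → |Γ z| ≤ 1) :
    -logFlux b Γ G ε ρ z ≤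
      -(1 / 2) * (hat ρ (‖z.1‖ ^ 2) ^ 4 * ‖logF1 ε (clamp (Γ z)) • G z‖ ^ 2)
      - 16 / ρ ^ 2 * (hat ρ (‖z.1‖ ^ 2) ^ 4 * prim (prim fun s => logF2 ε (clamp s)) (Γ z))
      + 128 / ρ ^ 2 * (ball (0 : E) ρ).indicator 1 z.1
      + 2 * (prim (prim fun s => logF2 ε (clamp s)) (Γ z)
          * (deriv (fun r => hat ρ r ^ 4) (‖z.1‖ ^ 2) * dotx b z)) := by
  by_cases hx : z.1 ∈ ball (0 : E) ρ
  swap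
  · have h0 := hat_notMem_ball hρ hx
    have h1 : deriv (fun r => hat ρ r ^ 4) (‖z.1‖ ^ 2) = 0 := by
      rw [deriv_hat_pow, h0]; simp
    rw [logFlux, flux, h0, h1, indicator_of_notMem hx]
    simp
  have hs := hz hx
  have q0 := hat_nonneg (ρ := ρ) (‖z.1‖ ^ 2)
  have q1 := hat_le_one (ρ := ρ) (‖z.1‖ ^ 2)
  have hd := abs_deriv_hat_pow_mul_le hρ (n := 4) (by norm_num) z.1
  have hdot := abs_dotx_le G z
  have F0 := logF_nonneg hε hε1 hs
  have F2 := logF1_sq_le hε hε1 hs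
  have damp : deriv (fun r => hat ρ r ^ 4) (‖z.1‖ ^ 2) ≤ -(4 / ρ ^ 2 * hat ρ (‖z.1‖ ^ 2) ^ 4) := by
    rw [deriv_hat_pow, neg_le_neg_iff]
    have := hat_le_hatSlope (ρ := ρ) (sq_nonneg ‖z.1‖)
    calc 4 / ρ ^ 2 * hat ρ (‖z.1‖ ^ 2) ^ 4
        = ((4 : ℕ) : ℝ) / ρ ^ 2 * hat ρ (‖z.1‖ ^ 2) ^ (4 - 1) * hat ρ (‖z.1‖ ^ 2) := by
          push_cast; ring
      _ ≤ _ := by gcongr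
  rw [logFlux, flux, indicator_of_mem hx, Pi.one_apply, prim_logF2 hε hε1 hs,
    prim_prim_logF2 hε hε1 hs, clamp_of_abs_le hs, norm_smul, Real.norm_eq_abs, mul_pow, sq_abs]
  simp only [Nat.reduceSub] at hd
  set q := hat ρ (‖z.1‖ ^ 2)
  set d := deriv (fun r => hat ρ r ^ 4) (‖z.1‖ ^ 2)
  set F := logF ε (Γ z)
  set f := logF1 ε (Γ z)
  set f2 := logF2 ε (Γ z)
  set γ := ‖G z‖
  have γ0 : 0 ≤ γ := norm_nonneg _
  -- the cross term
  have cross : -(2 * (f * (d * dotx G z))) ≤ 1 / 2 * (q ^ 4 * (f ^ 2 * γ ^ 2)) + 128 / ρ ^ 2 := by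
    have h1 : |f * (d * dotx G z)| ≤ |f| * (8 / ρ * q ^ 3 * γ) := by
      rw [abs_mul, abs_mul]
      refine mul_le_mul_of_nonneg_left ?_ (abs_nonneg _)
      calc |d| * |dotx G z| ≤ |d| * (‖z.1‖ * γ) := by gcongr
        _ = (|d| * ‖z.1‖) * γ := by ring
        _ ≤ (2 * ((4 : ℕ) : ℝ) / ρ * q ^ 3) * γ := by gcongr
        _ = _ := by push_cast; ring
    have h2 : |f| * (8 / ρ * q ^ 3 * γ) = (q ^ 2 * (|f| * γ)) * (8 / ρ * q) := by ring
    have h3 : (8 / ρ * q) ^ 2 ≤ 64 / ρ ^ 2 := by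
      calc (8 / ρ * q) ^ 2 = 64 / ρ ^ 2 * q ^ 2 := by ring
        _ ≤ 64 / ρ ^ 2 * 1 := by
          gcongr
          exact pow_le_one₀ q0 q1
        _ = _ := mul_one _
    have h4 : (q ^ 2 * (|f| * γ)) ^ 2 = q ^ 4 * (f ^ 2 * γ ^ 2) := by
      rw [mul_pow, mul_pow, sq_abs]; ring
    have h5 := neg_abs_le (f * (d * dotx G z))
    have h6 := sq_nonneg (q ^ 2 * (|f| * γ) - 2 * (8 / ρ * q))
    have h7 : 128 / ρ ^ 2 = 2 * (64 / ρ ^ 2) := by ring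
    nlinarith
  have t1 : q ^ 4 * (f ^ 2 * γ ^ 2) ≤ q ^ 4 * (f2 * γ ^ 2) := by gcongr
  have t2 := mul_le_mul_of_nonneg_right damp F0
  have t3 : 16 / ρ ^ 2 * (q ^ 4 * F) = 4 * (4 / ρ ^ 2 * q ^ 4 * F) := by ring
  linarith

/-- The differential inequality for the weighted integral of `logF` on a time slice. -/
lemma neg_integral_logFlux_le (S : Sol b Γ G) {t : ℝ}
    (H : SliceH1 (fun x => Γ (x, t)) (fun x => G (x, t))) (hε : 0 < ε) (hε1 : ε < 1) (hρ : 0 < ρ)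
    (hρ1 : ρ < 1) (he : 1 ≤ e) (hu : ∀ᵐ x : E, x ∈ ball (0 : E) ρ → |Γ (x, t)| ≤ 1)
    (hb : (∫⁻ x in ball (0 : E) ρ, ‖b (x, t)‖ₑ ^ (5 / 3 : ℝ)) ^ (3 / 5 : ℝ)
      ≤ ofReal (e * ρ ^ (4 / 5 : ℝ)))
    (hQ : Integrable fun x => logFlux b Γ G ε ρ (x, t))
    (hE : Integrable fun x => hat ρ (‖x‖ ^ 2) ^ 4
      * prim (prim fun s => logF2 ε (clamp s)) (Γ (x, t)))
    (hq : Integrable fun x : E => deriv (fun r => hat ρ r ^ 4) (‖x‖ ^ 2) * dotx b (x, t))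
    (hq0 : ∫ x : E, deriv (fun r => hat ρ r ^ 4) (‖x‖ ^ 2) * dotx b (x, t) = 0) :
    -∫ x, logFlux b Γ G ε ρ (x, t) ≤
      -(16 / ρ ^ 2 * ∫ x, hat ρ (‖x‖ ^ 2) ^ 4 * prim (prim fun s => logF2 ε (clamp s)) (Γ (x, t)))
        + logConst * e ^ 2 * ρ := by
  obtain ⟨B1, hB1⟩ := exists_bddLim_clamp (continuous_logF1_clamp hε hε1)
  have H1 := H.comp hB1
  set h : E → ℝ := fun x => prim (prim fun s => logF2 ε (clamp s)) (Γ (x, t)) with hh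
  set q : E → ℝ := fun x => deriv (fun r => hat ρ r ^ 4) (‖x‖ ^ 2) * dotx b (x, t) with hqd
  set g1 : E → E := fun x => logF1 ε (clamp (Γ (x, t))) • G (x, t) with hg1
  have mb : Measurable fun x => b (x, t) := S.mb.comp measurable_prodMk_right
  have he0 : 0 ≤ e := by linarith
  obtain ⟨c, hc⟩ := H1.drift_osc_le mb hρ hρ1 he0 hb
  set N := SliceH1.dirichlet ρ g1 with hN
  have N0 : 0 ≤ N := SliceH1.dirichlet_nonneg
  have q_zero : ∀ x ∉ ball (0 : E) ρ, q x = 0 := fun x hx => by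
    simp only [hqd]
    rw [deriv_hat_pow, hat_notMem_ball hρ hx]; simp
  have q_le : ∀ x, |q x| ≤ 8 / ρ * (hat ρ (‖x‖ ^ 2) ^ 3 * ‖b (x, t)‖) := by
    intro x
    have hd := abs_deriv_hat_pow_mul_le hρ (n := 4) (by norm_num) x
    simp only [hqd]
    rw [abs_mul]
    calc _ ≤ |deriv (fun r => hat ρ r ^ 4) (‖x‖ ^ 2)| * (‖x‖ * ‖b (x, t)‖) := by
          gcongr
          exact abs_dotx_le b (x, t)
      _ = (|deriv (fun r => hat ρ r ^ 4) (‖x‖ ^ 2)| * ‖x‖) * ‖b (x, t)‖ := by ring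
      _ ≤ (2 * ((4 : ℕ) : ℝ) / ρ * hat ρ (‖x‖ ^ 2) ^ (4 - 1)) * ‖b (x, t)‖ := by gcongr
      _ = _ := by push_cast; ring
  have mh : Measurable h := by
    obtain ⟨B2, hB2⟩ := exists_bddLim_clamp (continuous_logF2_clamp hε hε1)
    have hp : Continuous (prim (prim fun s => logF2 ε (clamp s))) :=
      continuous_iff_continuousAt.2 fun s => (hasDerivAt_prim hB2.prim_continuous s).continuousAt
    exact hp.measurable.comp H.mu
  have hF : ∀ᵐ x, x ∈ ball (0 : E) ρ → h x = prim (fun s => logF1 ε (clamp s)) (Γ (x, t)) := by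
    filter_upwards [hu] with x hx hxb
    simp only [hh]
    rw [prim_prim_logF2 hε hε1 (hx hxb), prim_logF1 hε hε1 (hx hxb)]
  -- the oscillating part of the drift term
  have hosc : Integrable fun x => 2 * ((h x - c) * q x) := by
    refine ((hq.norm.const_mul (2 * (-Real.log ε + |c|)))).mono'
      (((mh.sub_const c).aestronglyMeasurable.mul hq.1).const_mul 2) ?_
    filter_upwards [hu] with x hx
    by_cases hxb : x ∈ ball (0 : E) ρ
    · have h1 : |h x - c| ≤ -Real.log ε + |c| := by
        refine (abs_sub _ _).trans (add_le_add_left ?_ _)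
        simp only [hh]
        rw [prim_prim_logF2 hε hε1 (hx hxb), abs_of_nonneg (logF_nonneg hε hε1 (hx hxb))]
        exact logF_le hε hε1 (hx hxb)
      rw [norm_mul, norm_mul, Real.norm_of_nonneg zero_le_two, mul_assoc]
      exact mul_le_mul_of_nonneg_left (mul_le_mul_of_nonneg_right h1 (norm_nonneg _)) zero_le_two
    · rw [q_zero x hxb]; simp
  have osc_le : ∫ x, 2 * ((h x - c) * q x) ≤ 1 / 2 * N + 128 * driftConst ^ 2 * e ^ 2 * ρ := by
    have D0 := driftConst_nonneg
    have hsq : ρ ^ (3 / 2 : ℝ) = ρ * √ρ := by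
      rw [Real.sqrt_eq_rpow, ← Real.rpow_one_add' hρ.le (by norm_num)]; norm_num
    have h1 : ‖∫ x, 2 * ((h x - c) * q x)‖ₑ ≤
        ofReal (16 / ρ * (driftConst * e * ρ ^ (3 / 2 : ℝ) * √N)) := by
      refine (enorm_integral_le_lintegral_enorm _).trans ?_
      rw [ENNReal.ofReal_mul (by positivity)]
      refine le_trans ?_ (mul_le_mul_right hc _)
      rw [← lintegral_const_mul' _ _ ENNReal.ofReal_ne_top]
      refine lintegral_mono_ae ?_
      filter_upwards [hF] with x hx
      by_cases hxb : x ∈ ball (0 : E) ρ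
      · rw [← hx hxb, ← ofReal_norm (b (x, t)), Real.enorm_eq_ofReal_abs, Real.enorm_eq_ofReal_abs,
          ← ENNReal.ofReal_mul (norm_nonneg _), ← ENNReal.ofReal_mul (by positivity)]
        refine ENNReal.ofReal_le_ofReal ?_
        rw [abs_mul 2, abs_mul (h x - c), abs_mul (hat ρ (‖x‖ ^ 2) ^ 3),
          abs_of_nonneg (pow_nonneg (hat_nonneg _) 3), abs_two]
        calc 2 * (|h x - c| * |q x|)
            ≤ 2 * (|h x - c| * (8 / ρ * (hat ρ (‖x‖ ^ 2) ^ 3 * ‖b (x, t)‖))) := by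
              gcongr
              exact q_le x
          _ = _ := by ring
      · rw [q_zero x hxb]; simp
    rw [Real.enorm_eq_ofReal_abs, ENNReal.ofReal_le_ofReal_iff (by positivity)] at h1
    have h2 := (le_abs_self _).trans h1
    have e1 : 16 / ρ * (driftConst * e * ρ ^ (3 / 2 : ℝ) * √N) = √N * (16 * driftConst * e * √ρ) := by
      rw [hsq]
      field_simp
    have h3 := sq_nonneg (√N - 16 * driftConst * e * √ρ)
    have s1 := Real.sq_sqrt N0
    have s2 := Real.sq_sqrt hρ.le
    have e2 : (16 * driftConst * e * √ρ) ^ 2 = 256 * driftConst ^ 2 * e ^ 2 * ρ := by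
      rw [mul_pow, s2]; ring
    rw [e1] at h2
    nlinarith
  have iN : Integrable fun x => hat ρ (‖x‖ ^ 2) ^ 4 * ‖g1 x‖ ^ 2 := H1.dirichlet_integrable
  have iB : Integrable ((ball (0 : E) ρ).indicator (1 : E → ℝ)) :=
    (integrable_indicator_iff measurableSet_ball).2
      (integrableOn_const (measure_ball_lt_top (μ := (volume : Measure E))).ne)
  have vB : ∫ x, (ball (0 : E) ρ).indicator (1 : E → ℝ) x ≤ 5 * ρ ^ 3 := by
    rw [integral_indicator_one measurableSet_ball, Measure.real,
      EuclideanSpace.volume_ball_fin_three, ← ENNReal.ofReal_pow hρ.le,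
      ← ENNReal.ofReal_mul (by positivity), ENNReal.toReal_ofReal (by positivity), mul_comm]
    refine mul_le_mul_of_nonneg_right ?_ (by positivity)
    linarith [Real.pi_lt_d2]
  have i1 : Integrable fun x => -(1 / 2) * (hat ρ (‖x‖ ^ 2) ^ 4 * ‖g1 x‖ ^ 2) := iN.const_mul _
  have i2 : Integrable fun x => 16 / ρ ^ 2 * (hat ρ (‖x‖ ^ 2) ^ 4 * h x) := hE.const_mul _
  have i3 : Integrable fun x => 128 / ρ ^ 2 * (ball (0 : E) ρ).indicator (1 : E → ℝ) x :=
    iB.const_mul _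
  have i5 : Integrable fun x => 2 * c * q x := hq.const_mul _
  have i12 : Integrable fun x => -(1 / 2) * (hat ρ (‖x‖ ^ 2) ^ 4 * ‖g1 x‖ ^ 2)
      - 16 / ρ ^ 2 * (hat ρ (‖x‖ ^ 2) ^ 4 * h x) := i1.sub i2
  have i123 : Integrable fun x => -(1 / 2) * (hat ρ (‖x‖ ^ 2) ^ 4 * ‖g1 x‖ ^ 2)
      - 16 / ρ ^ 2 * (hat ρ (‖x‖ ^ 2) ^ 4 * h x)
      + 128 / ρ ^ 2 * (ball (0 : E) ρ).indicator (1 : E → ℝ) x := i12.add i3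
  have i1234 : Integrable fun x => -(1 / 2) * (hat ρ (‖x‖ ^ 2) ^ 4 * ‖g1 x‖ ^ 2)
      - 16 / ρ ^ 2 * (hat ρ (‖x‖ ^ 2) ^ 4 * h x)
      + 128 / ρ ^ 2 * (ball (0 : E) ρ).indicator (1 : E → ℝ) x + 2 * ((h x - c) * q x) :=
    i123.add hosc
  calc -∫ x, logFlux b Γ G ε ρ (x, t) = ∫ x, -logFlux b Γ G ε ρ (x, t) := (integral_neg _).symm
    _ ≤ ∫ x, (-(1 / 2) * (hat ρ (‖x‖ ^ 2) ^ 4 * ‖g1 x‖ ^ 2)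
      - 16 / ρ ^ 2 * (hat ρ (‖x‖ ^ 2) ^ 4 * h x)
      + 128 / ρ ^ 2 * (ball (0 : E) ρ).indicator (1 : E → ℝ) x + 2 * ((h x - c) * q x)
      + 2 * c * q x) := by
        refine integral_mono_ae hQ.neg (i1234.add i5) ?_
        filter_upwards [hu] with x hx
        refine (neg_logFlux_le hρ hε hε1 (x, t) hx).trans (le_of_eq ?_)
        simp only [hh, hqd, hg1]
        ring
    _ = -(1 / 2) * N - 16 / ρ ^ 2 * (∫ x, hat ρ (‖x‖ ^ 2) ^ 4 * h x)
        + 128 / ρ ^ 2 * (∫ x, (ball (0 : E) ρ).indicator (1 : E → ℝ) x)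
        + (∫ x, 2 * ((h x - c) * q x)) + 2 * c * ∫ x, q x := by
        rw [integral_add i1234 i5, integral_add i123 hosc, integral_add i12 i3, integral_sub i1 i2,
          integral_const_mul, integral_const_mul, integral_const_mul, integral_const_mul (2 * c)]
        rfl
    _ ≤ _ := by
        rw [hq0, mul_zero, add_zero]
        have h1 : 128 / ρ ^ 2 * (∫ x, (ball (0 : E) ρ).indicator (1 : E → ℝ) x) ≤ 640 * ρ := by
          calc _ ≤ 128 / ρ ^ 2 * (5 * ρ ^ 3) := by gcongr
            _ = _ := by field_simp; ring
        have h2 : 640 * ρ ≤ 640 * e ^ 2 * ρ := by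
          have := one_le_pow₀ (n := 2) he
          nlinarith
        rw [logConst]
        linarith

end Sol

/-! ### Decrease of the maximum -/

namespace Sol
variable {b : ST → E} {Γ : ST → ℝ} {G : ST → E} {R ρ e ε k κ w s : ℝ}

lemma deriv_timeCut_zero_of_gt (hw : 0 < w) {t : ℝ} (ht : -s ^ 2 + w < t) :
    deriv (timeCut w s) t = 0 := by
  have : timeCut w s =ᶠ[𝓝 t] fun _ => 1 := by
    filter_upwards [lt_mem_nhds ht] with r hr using timeCut_one hw hr.le
  rw [this.deriv_eq]; simp

/-- The weighted integral of `logF` on a time slice. -/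
noncomputable def logMass (Γ : ST → ℝ) (ε ρ t : ℝ) : ℝ :=
  ∫ x, hat ρ (‖x‖ ^ 2) ^ 4 * prim (prim fun s => logF2 ε (clamp s)) (Γ (x, t))

/-- The constant that multiplies the initial value in the bound of `logMass`. -/
noncomputable def startConst : ℝ := 10 * Real.exp 4 * stBound

lemma startConst_pos : 0 < startConst := by
  have := one_le_stBound
  have := Real.exp_pos 4
  unfold startConst; positivity

set_option maxHeartbeats 800000 in
/-- If `|Γ| ≤ 1` in `P(R)`, then the mean of `logF(Γ)` at the scale `ρ` is bounded at times close
to `0`: the damping forgets the initial value, which is at most `log (1 / ε)`. -/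
lemma logMass_le (S : Sol b Γ G) {β₁ : ℝ≥0} (hβ₁ : DriftBdd b β₁) (hε : 0 < ε) (hε1 : ε < 1)
    (hR1 : R ≤ 1) (hρ : 0 < ρ) (hρR : ρ ≤ R / 2) (he : 1 ≤ e)
    (hΓ : ∀ᵐ z ∂(cylVol R), |Γ z| ≤ 1)
    (hb : ∀ᵐ t : ℝ, t ∈ Ioo (-R ^ 2) 0 →
      (∫⁻ x in ball (0 : E) ρ, ‖b (x, t)‖ₑ ^ (5 / 3 : ℝ)) ^ (3 / 5 : ℝ)
        ≤ ofReal (e * ρ ^ (4 / 5 : ℝ))) :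
    ∀ᵐ t : ℝ, t ∈ Ioo (-(ρ / 2) ^ 2) 0 → 0 ≤ logMass Γ ε ρ t ∧ logMass Γ ε ρ t ≤
      ρ ^ 3 * (startConst * -Real.log ε * Real.exp (-(2 * R ^ 2 / ρ ^ 2)) + logConst * e ^ 2) := by
  have hR : 0 < R := by linarith
  have hρ1 : ρ < 1 := by linarith
  have h0 := one_le_stBound
  have L0 := logConst_nonneg
  have Λ0 : 0 ≤ -Real.log ε := neg_nonneg.2 (Real.log_nonpos hε.le hε1.le)
  set Λ := -Real.log ε with hΛ
  have P := hat_profile hρ hρ1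
  obtain ⟨B, hk⟩ := exists_bddLim_clamp (continuous_logF2_clamp hε hε1)
  set s := R / 2 with hs
  set w := R ^ 2 / 8 with hw
  have w0 : 0 < w := by positivity
  set α := 16 / ρ ^ 2 with hα
  have α0 : 0 < α := by positivity
  set ζ := timeCut w s with hζ
  have ζs : ContDiff ℝ ∞ ζ := timeCut_smooth
  have es : ContDiff ℝ ∞ fun t : ℝ => Real.exp (α * t) := (contDiff_const.mul contDiff_id).exp
  set η : ℝ → ℝ := fun t => Real.exp (α * t) * ζ t with hη
  have ηs : ContDiff ℝ ∞ η := es.mul ζs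
  have η' : ∀ t, deriv η t = α * η t + Real.exp (α * t) * deriv ζ t := by
    intro t
    have h1 : HasDerivAt (fun t : ℝ => Real.exp (α * t)) (Real.exp (α * t) * (α * 1)) t :=
      ((hasDerivAt_id t).const_mul α).exp
    have h2 := (ζs.differentiable (by simp) t).hasDerivAt
    have h3 : HasDerivAt η _ t := h1.mul h2
    rw [h3.deriv]
    simp only [hη]
    ring
  have ident := S.energy_identity_lim hβ₁ hk P ηs (t₀ := -s ^ 2) (by rw [hs]; nlinarith)
    (fun t ht => by simp only [hη, hζ]; rw [timeCut_zero w0 ht, mul_zero])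
  have Qi := S.flux_integrable_lim hβ₁ hk P
  have Ei := S.energy_integrable_lim hk P
  set W : ℝ → ℝ := fun t => logMass Γ ε ρ t with hW
  set Q : ℝ → ℝ := fun t => ∫ x, logFlux b Γ G ε ρ (x, t) with hQ
  have Wi : Integrable W := Ei.integral_prod_right
  have Qii : Integrable Q := Qi.integral_prod_right
  have Wz : ∀ t ∉ Ioc (-1 : ℝ) 0, W t = 0 := fun t ht =>
    integral_eq_zero_of_ae (ae_of_all _ fun x => by
      simp [S.Γz (x, t) (zero_time ht), prim_zero])
  have Qz : ∀ t ∉ Ioc (-1 : ℝ) 0, Q t = 0 := fun t ht =>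
    integral_eq_zero_of_ae (ae_of_all _ fun x =>
      S.flux_zero (prim_zero _) (prim_zero _) (zero_time ht))
  have Γ1 : ∀ᵐ t : ℝ, ∀ᵐ x : E, (x, t) ∈ cyl R → |Γ (x, t)| ≤ 1 :=
    ae_slice ((ae_restrict_iff' (measurableSet_cyl R)).1 hΓ)
  have iB : Integrable ((ball (0 : E) ρ).indicator fun _ => Λ) :=
    (integrable_indicator_iff measurableSet_ball).2
      (integrableOn_const (measure_ball_lt_top (μ := (volume : Measure E))).ne)
  have W_bd : ∀ᵐ t : ℝ, t ∈ Ioo (-R ^ 2) 0 → 0 ≤ W t ∧ W t ≤ 5 * ρ ^ 3 * Λ := by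
    filter_upwards [Γ1, integrable_slice Ei] with t h1 h2 ht
    have hx : ∀ᵐ x : E, 0 ≤ hat ρ (‖x‖ ^ 2) ^ 4
          * prim (prim fun s => logF2 ε (clamp s)) (Γ (x, t)) ∧
        hat ρ (‖x‖ ^ 2) ^ 4 * prim (prim fun s => logF2 ε (clamp s)) (Γ (x, t))
          ≤ (ball (0 : E) ρ).indicator (fun _ => Λ) x := by
      filter_upwards [h1] with x hx
      by_cases hxb : x ∈ ball (0 : E) ρ
      · have hΓx := hx ⟨ball_subset_ball (by linarith) hxb, ht.1, ht.2.le⟩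
        have F0 := logF_nonneg hε hε1 hΓx
        rw [prim_prim_logF2 hε hε1 hΓx, indicator_of_mem hxb]
        refine ⟨mul_nonneg (pow_nonneg (hat_nonneg _) 4) F0, ?_⟩
        exact (mul_le_of_le_one_left F0 (pow_le_one₀ (hat_nonneg _) (hat_le_one _))).trans
          (logF_le hε hε1 hΓx)
      · rw [hat_notMem_ball hρ hxb, indicator_of_notMem hxb]
        simp
    refine ⟨integral_nonneg_of_ae (hx.mono fun x h => h.1), ?_⟩
    refine (integral_mono_ae h2 iB (hx.mono fun x h => h.2)).trans ?_
    rw [integral_indicator measurableSet_ball, setIntegral_const, smul_eq_mul, Measure.real,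
      EuclideanSpace.volume_ball_fin_three, ← ENNReal.ofReal_pow hρ.le,
      ← ENNReal.ofReal_mul (by positivity), ENNReal.toReal_ofReal (by positivity)]
    refine mul_le_mul_of_nonneg_right ?_ Λ0
    nlinarith [Real.pi_lt_d2, pow_pos hρ 3]
  -- the bounds of the two sources
  set K1 := Real.exp (-(2 * R ^ 2 / ρ ^ 2)) * (stBound / w * (5 * ρ ^ 3 * Λ)) with hK1
  set K2 := logConst * e ^ 2 * ρ with hK2
  have K10 : 0 ≤ K1 := by positivity
  have K20 : 0 ≤ K2 := by positivity
  have point : ∀ᵐ τ : ℝ, τ ∈ Iio (0 : ℝ) → deriv η τ * W τ - η τ * Q τ ≤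
      (Ioc (-s ^ 2) 0).indicator (fun _ => K1) τ + K2 * Real.exp (α * τ) := by
    have hne : ∀ᵐ τ : ℝ, τ ≠ -s ^ 2 := by simp [ae_iff]
    have hne' : ∀ᵐ τ : ℝ, τ ≠ -s ^ 2 + w := by simp [ae_iff]
    filter_upwards [W_bd, S.sliceH1, hb, integrable_slice Qi, integrable_slice Ei, hne, hne', Γ1,
      S.integral_dotx_slice P] with τ h1 h2 h3 h4 h5 h6 h7 h8 h9 hτ
    have hexp := Real.exp_pos (α * τ)
    have K2τ := mul_nonneg K20 hexp.le
    rcases lt_or_gt_of_ne h6 with hlt | hgt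
    · have z1 : ζ τ = 0 := timeCut_zero w0 hlt.le
      have z2 : deriv ζ τ = 0 := deriv_timeCut_zero w0 hlt
      rw [indicator_of_notMem (by simp [hlt.le]), η']
      simp only [hη, z1, z2]
      linarith
    have hτR : τ ∈ Ioo (-R ^ 2) 0 := ⟨by rw [hs] at hgt; nlinarith, hτ⟩
    have hτ1 : τ ∈ Ioo (-1 : ℝ) 0 := ⟨by nlinarith [hτR.1], hτ⟩
    obtain ⟨q1, q2⟩ := h9 hτ1
    have key : -Q τ ≤ -(α * W τ) + K2 :=
      S.neg_integral_logFlux_le (h2 hτ1) hε hε1 hρ hρ1 he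
        (h8.mono fun x hx hxb => hx ⟨ball_subset_ball (by linarith) hxb, hτR.1, hτ.le⟩)
        (h3 hτR) h4 h5 q1 q2
    obtain ⟨W0, Wle⟩ := h1 hτR
    rw [indicator_of_mem (show τ ∈ Ioc (-s ^ 2) 0 from ⟨hgt, le_of_lt hτ⟩), η']
    have ζ0 : 0 ≤ ζ τ := Real.smoothTransition.nonneg _
    have ζ1 : ζ τ ≤ 1 := Real.smoothTransition.le_one _
    have η0 : 0 ≤ η τ := mul_nonneg hexp.le ζ0
    have η1 : η τ ≤ Real.exp (α * τ) := mul_le_of_le_one_right hexp.le ζ1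
    have b2 : -(η τ * Q τ) ≤ -(α * η τ * W τ) + K2 * Real.exp (α * τ) := by
      have := mul_le_mul_of_nonneg_left key η0
      nlinarith
    have b1 : Real.exp (α * τ) * deriv ζ τ * W τ ≤ K1 := by
      rcases lt_or_gt_of_ne h7 with hl | hg
      · have e1 : Real.exp (α * τ) ≤ Real.exp (-(2 * R ^ 2 / ρ ^ 2)) := by
          rw [Real.exp_le_exp]
          have e2 : -s ^ 2 + w = -(R ^ 2 / 8) := by rw [hs, hw]; ring
          rw [e2] at hl
          have := mul_le_mul_of_nonneg_left hl.le α0.le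
          calc α * τ ≤ α * -(R ^ 2 / 8) := this
            _ = _ := by rw [hα]; ring
        have e3 : deriv ζ τ ≤ stBound / w := (le_abs_self _).trans (abs_deriv_timeCut_le w0 τ)
        calc Real.exp (α * τ) * deriv ζ τ * W τ = Real.exp (α * τ) * (deriv ζ τ * W τ) := by ring
          _ ≤ Real.exp (α * τ) * (stBound / w * (5 * ρ ^ 3 * Λ)) := by gcongr
          _ ≤ K1 := by
            rw [hK1]
            gcongr
      · have z2 : deriv ζ τ = 0 := deriv_timeCut_zero_of_gt w0 hg
        rw [z2]; simpa using K10
    nlinarith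
  have i1 : Integrable fun t => deriv η t * W t :=
    integrable_cont_mul (ηs.continuous_deriv (by simp)) Wi Wz
  have i2 : Integrable fun t => η t * Q t := integrable_cont_mul ηs.continuous Qii Qz
  have i3 : Integrable ((Ioc (-s ^ 2) 0).indicator fun _ => K1) :=
    (integrable_indicator_iff measurableSet_Ioc).2 (integrableOn_const (by simp))
  filter_upwards [ident, W_bd] with t ht hWb htI
  have htR : t ∈ Ioo (-R ^ 2) 0 := ⟨by nlinarith [htI.1], htI.2⟩
  refine ⟨(hWb htR).1, ?_⟩
  have id1 := ht ⟨by nlinarith [htI.1], htI.2⟩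
  have ζt : ζ t = 1 := timeCut_one w0 (by rw [hs, hw]; nlinarith [htI.1])
  have i4 : IntegrableOn (fun τ => K2 * Real.exp (α * τ)) (Iic t) :=
    (integrableOn_exp_mul_Iic α0 t).const_mul K2
  have i12 : Integrable fun τ => deriv η τ * W τ - η τ * Q τ := i1.sub i2
  have i34 : IntegrableOn (fun τ => (Ioc (-s ^ 2) 0).indicator (fun _ => K1) τ
      + K2 * Real.exp (α * τ)) (Iic t) := i3.integrableOn.add i4
  have hle : ∫ τ in Iic t, (deriv η τ * W τ - η τ * Q τ) ≤ ∫ τ in Iic t,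
      ((Ioc (-s ^ 2) 0).indicator (fun _ => K1) τ + K2 * Real.exp (α * τ)) :=
    setIntegral_mono_on_ae i12.integrableOn i34 measurableSet_Iic
      (point.mono fun τ h hτ => h (lt_of_le_of_lt hτ htI.2))
  have e1 : ∫ τ in Iic t, ((Ioc (-s ^ 2) 0).indicator (fun _ => K1) τ + K2 * Real.exp (α * τ))
      = (∫ τ in Iic t, (Ioc (-s ^ 2) 0).indicator (fun _ => K1) τ)
        + K2 * (Real.exp (α * t) / α) := by
    rw [integral_add i3.integrableOn i4, integral_const_mul, integral_exp_mul_Iic α0]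
  have e2 : ∫ τ in Iic t, (Ioc (-s ^ 2) 0).indicator (fun _ => K1) τ ≤ K1 * (R ^ 2 / 4) := by
    refine (setIntegral_le_integral i3 (ae_of_all _ fun τ =>
      indicator_nonneg (fun _ _ => K10) τ)).trans (le_of_eq ?_)
    rw [integral_indicator measurableSet_Ioc, setIntegral_const, smul_eq_mul, Measure.real,
      Real.volume_Ioc, ENNReal.toReal_ofReal (by rw [hs]; nlinarith), hs]
    ring
  have hle' : η t * W t ≤ K1 * (R ^ 2 / 4) + K2 * (Real.exp (α * t) / α) := by
    have h1 : η t * W t = ∫ τ in Iic t, (deriv η τ * W τ - η τ * Q τ) := id1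
    rw [h1]
    refine (hle.trans (le_of_eq e1)).trans ?_
    linarith
  simp only [hη, ζt, mul_one] at hle'
  have hexp := Real.exp_pos (α * t)
  have hα4 : 1 ≤ Real.exp 4 * Real.exp (α * t) := by
    rw [← Real.exp_add]
    refine Real.one_le_exp ?_
    have := mul_le_mul_of_nonneg_left htI.1.le α0.le
    have e3 : α * -(ρ / 2) ^ 2 = -4 := by rw [hα]; field_simp; norm_num
    linarith
  have hE4 := Real.exp_pos 4
  have f1 : W t ≤ Real.exp 4 * K1 * (R ^ 2 / 4) + K2 / α := by
    have h2 : Real.exp (α * t) * W t ≤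
        Real.exp (α * t) * (Real.exp 4 * K1 * (R ^ 2 / 4) + K2 / α) := by
      have h3 : K1 * (R ^ 2 / 4) ≤ (Real.exp 4 * Real.exp (α * t)) * (K1 * (R ^ 2 / 4)) :=
        le_mul_of_one_le_left (by positivity) hα4
      calc _ ≤ _ := hle'
        _ ≤ (Real.exp 4 * Real.exp (α * t)) * (K1 * (R ^ 2 / 4))
            + K2 * (Real.exp (α * t) / α) := by linarith
        _ = _ := by ring
    exact le_of_mul_le_mul_left h2 hexp
  have f2 : Real.exp 4 * K1 * (R ^ 2 / 4)
      = ρ ^ 3 * (startConst * Λ * Real.exp (-(2 * R ^ 2 / ρ ^ 2))) := by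
    rw [hK1, hw, startConst]
    field_simp
    ring
  have f3 : K2 / α ≤ ρ ^ 3 * (logConst * e ^ 2) := by
    have : K2 / α = ρ ^ 3 * (logConst * e ^ 2) / 16 := by
      rw [hK2, hα]
      field_simp
    rw [this]
    have : 0 ≤ ρ ^ 3 * (logConst * e ^ 2) := by positivity
    linarith
  calc logMass Γ ε ρ t ≤ _ := f1
    _ ≤ _ := by rw [f2, mul_add]; linarith

/-- A bound of `logMass` controls the truncations at high levels. -/
lemma totalMass_le_of_logMass (S : Sol b Γ G) (hε : 0 < ε)
    (hε1 : ε < 1) (hR1 : R ≤ 1) (hρ : 0 < ρ) (hρR : ρ ≤ R / 2) (hk : 0 ≤ k)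
    {F₀ Y : ℝ} (hF₀ : 0 < F₀) (hF : F₀ ≤ logF ε k) (hΓ : ∀ᵐ z ∂(cylVol R), |Γ z| ≤ 1)
    (hY : ∀ᵐ t : ℝ, t ∈ Ioo (-(ρ / 2) ^ 2) 0 → logMass Γ ε ρ t ≤ Y) :
    totalMass Γ k (ρ / 2) ≤ (ρ / 2) ^ 2 * ((1 - k) ^ 2 / (F₀ * hatLow) * Y) := by
  have hl := hatLow_pos
  obtain ⟨B, hB⟩ := exists_bddLim_clamp (continuous_logF2_clamp hε hε1)
  have P := hat_profile hρ (by linarith)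
  have Ei := S.energy_integrable_lim hB P
  have Γ1 : ∀ᵐ t : ℝ, ∀ᵐ x : E, (x, t) ∈ cyl R → |Γ (x, t)| ≤ 1 :=
    ae_slice ((ae_restrict_iff' (measurableSet_cyl R)).1 hΓ)
  have hne : ∀ᵐ t : ℝ, t ≠ 0 := by simp [ae_iff]
  set D := (1 - k) ^ 2 / (F₀ * hatLow) with hD
  have D0 : 0 ≤ D := by positivity
  have iD : Integrable ((Ioc (-(ρ / 2) ^ 2) 0).indicator fun _ => D * Y) :=
    (integrable_indicator_iff measurableSet_Ioc).2 (integrableOn_const (by simp))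
  calc totalMass Γ k (ρ / 2) ≤ ∫ t in Ioc (-(ρ / 2) ^ 2) 0, D * Y := by
        refine setIntegral_mono_on_ae (S.mass_integrable _ _).integrableOn
          (integrableOn_const (by simp)) measurableSet_Ioc ?_
        filter_upwards [hY, Γ1, integrable_slice Ei, integrable_slice (S.trunc_sq_integrable k),
          hne] with t h1 h2 h3 h4 h5 ht
        have ht' : t ∈ Ioo (-(ρ / 2) ^ 2) 0 := ⟨ht.1, lt_of_le_of_ne ht.2 h5⟩
        refine le_trans ?_ (mul_le_mul_of_nonneg_left (h1 ht') D0)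
        rw [SliceH1.mass, ← integral_indicator measurableSet_ball, logMass, ← integral_const_mul]
        refine integral_mono_ae (h4.indicator measurableSet_ball) (h3.const_mul D) ?_
        filter_upwards [h2] with x hx
        have sub : ∀ {y : E}, y ∈ ball (0 : E) ρ → (y, t) ∈ cyl R := fun hy =>
          ⟨ball_subset_ball (by linarith) hy, by nlinarith [ht.1], ht.2⟩
        have rhs : 0 ≤ D * (hat ρ (‖x‖ ^ 2) ^ 4
            * prim (prim fun s => logF2 ε (clamp s)) (Γ (x, t))) := by
          by_cases hxρ : x ∈ ball (0 : E) ρ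
          · have := hx (sub hxρ)
            rw [prim_prim_logF2 hε hε1 this]
            exact mul_nonneg D0 (mul_nonneg (pow_nonneg (hat_nonneg _) 4) (logF_nonneg hε hε1 this))
          · rw [hat_notMem_ball hρ hxρ]; simp
        by_cases hxb : x ∈ ball (0 : E) (ρ / 2)
        swap
        · rw [indicator_of_notMem hxb]; exact rhs
        rw [indicator_of_mem hxb]
        rcases le_or_gt |Γ (x, t)| k with hΓk | hΓk
        · rw [trunc_of_le hΓk]; simpa using rhs
        have hΓ1 := hx (sub (ball_subset_ball (by linarith) hxb))
        rw [prim_prim_logF2 hε hε1 hΓ1]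
        have t1 : trunc k (Γ (x, t)) ^ 2 ≤ (1 - k) ^ 2 := by
          rw [← sq_abs, abs_trunc hk, max_eq_left (by linarith)]
          exact pow_le_pow_left₀ (by linarith) (by linarith) 2
        have t2 : F₀ ≤ logF ε (Γ (x, t)) :=
          hF.trans (logF_mono hε hε1 hΓ1 (by rw [abs_of_nonneg hk]; exact hΓk.le))
        have t3 := hatLow_le hρ hxb
        calc trunc k (Γ (x, t)) ^ 2 ≤ (1 - k) ^ 2 := t1
          _ = D * (hatLow * F₀) := by rw [hD]; field_simp
          _ ≤ _ := by
            have : 0 ≤ hat ρ (‖x‖ ^ 2) ^ 4 := pow_nonneg (hat_nonneg _) 4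
            gcongr
    _ = _ := by
        rw [setIntegral_const, smul_eq_mul, Measure.real, Real.volume_Ioc,
          ENNReal.toReal_ofReal (by nlinarith [sq_nonneg (ρ / 2)])]
        ring

/-- A constant in the choice of parameters for the decrease of the maximum. -/
noncomputable def gapConst : ℝ := giorgiConst * hatLow / 64

lemma gapConst_pos : 0 < gapConst := div_pos (mul_pos giorgiConst_pos hatLow_pos) (by norm_num)

/-- The ratio of the scales in the decrease of the maximum, divided by the size of the drift. -/
noncomputable def scaleConst : ℝ := 2 + 2 * startConst * (Nat.factorial 13) / gapConst

lemma two_le_scaleConst : 2 ≤ scaleConst := by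
  have := startConst_pos
  have := gapConst_pos
  unfold scaleConst
  have : 0 ≤ 2 * startConst * (Nat.factorial 13) / gapConst := by positivity
  linarith

/-- The constant in the exponent of the gain `exp (-c e²⁹)`. -/
noncomputable def gainConst : ℝ := 2 + 2 * logConst * scaleConst ^ 2 / gapConst

lemma two_le_gainConst : 2 ≤ gainConst := by
  have := logConst_nonneg
  have := gapConst_pos
  unfold gainConst
  have : 0 ≤ 2 * logConst * scaleConst ^ 2 / gapConst := by positivity
  linarith

lemma exp_scale_le (he : 1 ≤ e) :
    startConst * Real.exp (-(2 * (scaleConst * e) ^ 2)) ≤ gapConst / 2 / e ^ 25 := by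
  have A2 := two_le_scaleConst
  have c0 := startConst_pos
  have g0 := gapConst_pos
  set A := scaleConst with hA
  have hAe : 1 ≤ A * e := by nlinarith
  have h1 : (A * e) ^ 26 / (Nat.factorial 13) ≤ Real.exp (2 * (A * e) ^ 2) := by
    refine le_trans ?_ (Real.pow_div_factorial_le_exp (x := 2 * (A * e) ^ 2) (by positivity) 13)
    have : (A * e) ^ 26 ≤ (2 * (A * e) ^ 2) ^ 13 := by
      calc (A * e) ^ 26 = ((A * e) ^ 2) ^ 13 := by ring
        _ ≤ _ := by
          gcongr
          linarith [sq_nonneg (A * e)]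
    gcongr
  have f0 : (0 : ℝ) < (Nat.factorial 13 : ℝ) := by positivity
  have h2 : A * e ^ 25 ≤ (A * e) ^ 26 := by
    calc A * e ^ 25 ≤ A ^ 26 * e ^ 26 := by
          have a1 : A ≤ A ^ 26 := le_self_pow₀ (by linarith) (by norm_num)
          have a2 : e ^ 25 ≤ e ^ 26 := pow_le_pow_right₀ he (by norm_num)
          gcongr
      _ = _ := by ring
  have h3 : 2 * startConst * (Nat.factorial 13) / gapConst ≤ A := by
    rw [hA, scaleConst]; linarith
  rw [div_le_iff₀ g0] at h3
  rw [Real.exp_neg, ← div_eq_mul_inv, div_le_div_iff₀ (Real.exp_pos _) (by positivity)]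
  rw [div_le_iff₀ f0] at h1
  have h4 : (2 * startConst * (Nat.factorial 13)) * e ^ 25 ≤
      (gapConst * Real.exp (2 * (A * e) ^ 2)) * (Nat.factorial 13) := by
    calc _ ≤ (A * gapConst) * e ^ 25 := by gcongr
      _ = gapConst * (A * e ^ 25) := by ring
      _ ≤ gapConst * (Real.exp (2 * (A * e) ^ 2) * (Nat.factorial 13)) := by
          exact mul_le_mul_of_nonneg_left (h2.trans h1) g0.le
      _ = _ := by ring
  have h5 : (2 * (startConst * e ^ 25)) * (Nat.factorial 13) ≤
      (gapConst * Real.exp (2 * (A * e) ^ 2)) * (Nat.factorial 13) := by linarith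
  have := le_of_mul_le_mul_right h5 f0
  linarith

/-- If `|Γ| ≤ 1` in `P(R)`, then `|Γ| ≤ 1 - δ / 8` in a smaller cylinder, where the ratio of the
radii is a multiple of the size `e` of the drift and `δ = exp (-c e²⁹)`. -/
theorem decrease_of_le_one (S : Sol b Γ G) {β₁ : ℝ≥0} (hβ₁ : DriftBdd b β₁) (hR : 0 < R)
    (hR1 : R ≤ 1) (he : 1 ≤ e) (hb : DriftScale b R e)
    (hb' : DriftScale b (R / (scaleConst * e) / 2) e) (hΓ : ∀ᵐ z ∂(cylVol R), |Γ z| ≤ 1) :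
    ∀ᵐ z ∂(cylVol (R / (scaleConst * e) / 2 / 2)),
      |Γ z| ≤ 1 - Real.exp (-(gainConst / 2 * e ^ 29)) / 8 := by
  have A2 := two_le_scaleConst
  have B2 := two_le_gainConst
  have g0 := gapConst_pos
  have L0 := logConst_nonneg
  have c0 := startConst_pos
  have hl := hatLow_pos
  have e0 : 0 < e := by linarith
  set A := scaleConst with hA
  have hAe : 2 ≤ A * e := by nlinarith
  set ρ := R / (A * e) with hρd
  have hρ : 0 < ρ := by positivity
  have hRρ : R = A * e * ρ := by rw [hρd]; field_simp
  have hρR : ρ ≤ R / 2 := by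
    rw [hRρ]; nlinarith
  set δ := Real.exp (-(gainConst / 2 * e ^ 29)) with hδ
  have e29 : 1 ≤ e ^ 29 := one_le_pow₀ he
  have δ0 : 0 < δ := Real.exp_pos _
  have δ1 : δ ≤ 1 / 2 := by
    rw [hδ, Real.exp_neg, one_div]
    refine inv_anti₀ two_pos ?_
    have : 1 ≤ gainConst / 2 * e ^ 29 := by nlinarith
    linarith [Real.add_one_le_exp (gainConst / 2 * e ^ 29)]
  have hε : 0 < δ ^ 2 := by positivity
  have hε1 : δ ^ 2 < 1 := by nlinarith
  have logε : -Real.log (δ ^ 2) = gainConst * e ^ 29 := by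
    rw [Real.log_pow, hδ, Real.log_exp]; push_cast; ring
  set k := 1 - δ / 4 with hk
  have k0 : 0 ≤ k := by rw [hk]; linarith
  have k1 : k ≤ 1 := by rw [hk]; linarith
  -- the level `k` is close enough to `1` for `logF` to be comparable to `log (1 / ε)`
  have hF : gainConst / 2 * e ^ 29 ≤ logF (δ ^ 2) k := by
    rw [logF, le_neg, ← Real.log_exp (-(gainConst / 2 * e ^ 29)), ← hδ]
    refine Real.log_le_log (hε.trans_le (le_logF_arg hε1 (abs_le.2 ⟨by linarith, k1⟩))) ?_
    rw [hk]
    nlinarith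
  -- the drift in the ball of radius `ρ`
  have hdr : ∀ᵐ t : ℝ, t ∈ Ioo (-R ^ 2) 0 →
      (∫⁻ x in ball (0 : E) ρ, ‖b (x, t)‖ₑ ^ (5 / 3 : ℝ)) ^ (3 / 5 : ℝ)
        ≤ ofReal (A * e ^ 2 * ρ ^ (4 / 5 : ℝ)) := by
    filter_upwards [hb] with t ht htI
    have hsub : ball (0 : E) ρ ⊆ ball (0 : E) R := ball_subset_ball (by linarith)
    have mono : (∫⁻ x in ball (0 : E) ρ, ‖b (x, t)‖ₑ ^ (5 / 3 : ℝ)) ^ (3 / 5 : ℝ) ≤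
        (∫⁻ x in ball (0 : E) R, ‖b (x, t)‖ₑ ^ (5 / 3 : ℝ)) ^ (3 / 5 : ℝ) := by gcongr
    refine (mono.trans (ht htI)).trans (ENNReal.ofReal_le_ofReal ?_)
    rw [hRρ, Real.mul_rpow (by positivity) hρ.le]
    have : (A * e) ^ (4 / 5 : ℝ) ≤ A * e := by
      calc (A * e) ^ (4 / 5 : ℝ) ≤ (A * e) ^ (1 : ℝ) :=
            Real.rpow_le_rpow_of_exponent_le (by linarith) (by norm_num)
        _ = _ := Real.rpow_one _
    calc e * ((A * e) ^ (4 / 5 : ℝ) * ρ ^ (4 / 5 : ℝ)) ≤ e * ((A * e) * ρ ^ (4 / 5 : ℝ)) := by gcongr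
      _ = _ := by ring
  have he' : 1 ≤ A * e ^ 2 := by nlinarith
  have mass := S.logMass_le hβ₁ hε hε1 hR1 hρ hρR he' hΓ hdr
  have tm := S.totalMass_le_of_logMass hε hε1 hR1 hρ hρR k0
    (show 0 < gainConst / 2 * e ^ 29 by positivity) hF hΓ (mass.mono fun t h ht => (h ht).2)
  have hκ : 0 < δ / 8 := by positivity
  have small : totalMass Γ k (ρ / 2) ≤ giorgiConst * (δ / 8) ^ 2 * (ρ / 2) ^ 5 / e ^ 25 := by
    refine tm.trans ?_
    rw [logε]
    have eR : 2 * R ^ 2 / ρ ^ 2 = 2 * (A * e) ^ 2 := by rw [hRρ]; field_simp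
    rw [eR]
    have b1 := exp_scale_le he
    have b2 : logConst * (A * e ^ 2) ^ 2 / (gainConst * e ^ 29) ≤ gapConst / 2 / e ^ 25 := by
      have h3 : 2 * logConst * A ^ 2 / gapConst ≤ gainConst := by rw [gainConst]; linarith
      rw [div_le_iff₀ g0] at h3
      rw [div_le_div_iff₀ (by positivity) (by positivity)]
      calc logConst * (A * e ^ 2) ^ 2 * e ^ 25 = (2 * logConst * A ^ 2) * e ^ 29 / 2 := by ring
        _ ≤ (gainConst * gapConst) * e ^ 29 / 2 := by gcongr
        _ = _ := by ring
    set X := Real.exp (-(2 * (A * e) ^ 2))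
    calc (ρ / 2) ^ 2 * ((1 - k) ^ 2 / (gainConst / 2 * e ^ 29 * hatLow) *
          (ρ ^ 3 * (startConst * (gainConst * e ^ 29) * X + logConst * (A * e ^ 2) ^ 2)))
        = ρ ^ 5 * δ ^ 2 / (32 * hatLow)
            * (startConst * X + logConst * (A * e ^ 2) ^ 2 / (gainConst * e ^ 29)) := by
          rw [hk]
          field_simp
          ring
      _ ≤ ρ ^ 5 * δ ^ 2 / (32 * hatLow) * (gapConst / 2 / e ^ 25 + gapConst / 2 / e ^ 25) := by
          gcongr
      _ = _ := by
          rw [gapConst]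
          field_simp
          ring
  have fin := S.deGiorgi hβ₁ (show 0 < ρ / 2 by positivity) (by linarith) he hb' k0 hκ small
  filter_upwards [fin] with z hz
  rw [hk] at hz
  linarith

end Sol

/-! ### Iteration over scales -/

lemma cyl_mono {r R : ℝ} (hr : 0 ≤ r) (h : r ≤ R) : cyl r ⊆ cyl R := fun _ hz =>
  ⟨ball_subset_ball h hz.1, by nlinarith [hz.2.1], hz.2.2⟩

lemma DriftScale.mono {b : ST → E} {R e e' : ℝ} (h : DriftScale b R e) (hR : 0 ≤ R)
    (he : e ≤ e') : DriftScale b R e' := by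
  filter_upwards [h] with t ht htI
  exact (ht htI).trans (ENNReal.ofReal_le_ofReal (by gcongr))

namespace Sol
variable {b : ST → E} {Γ : ST → ℝ} {G : ST → E} {R e : ℝ}

lemma const_mul (S : Sol b Γ G) (c : ℝ) : Sol b (fun z => c * Γ z) (fun z => c • G z) where
  mb := S.mb
  mΓ := S.mΓ.const_mul c
  mG := S.mG.const_smul c
  b2 := S.b2
  Γ2 := S.Γ2.const_mul c
  G2 := S.G2.const_smul c
  bz := S.bz
  Γz z hz := by rw [S.Γz z hz, mul_zero]
  Gz z hz := by rw [S.Gz z hz, smul_zero]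
  div := S.div
  grad ψ hψ i := by
    have := S.grad ψ hψ i
    simp only [PiLp.smul_apply, smul_eq_mul, mul_assoc]
    rw [integral_const_mul, integral_const_mul, this, mul_neg]
  axis r h0 h1 := by
    have := (S.axis r h0 h1).const_mul |c|
    rw [mul_zero] at this
    refine this.congr fun ρ => ?_
    simp only [abs_mul]
    rw [integral_const_mul]
    ring
  eqn ψ hψ := by
    have := congrArg (c * ·) (S.eqn ψ hψ)
    beta_reduce at this
    rw [mul_zero, ← integral_const_mul] at this
    rw [← this]
    refine integral_congr_ae (ae_of_all _ fun z => ?_)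
    simp only [PiLp.smul_apply, smul_eq_mul, Fin.sum_univ_three]
    ring

/-- The ratio of two consecutive scales, for a drift of size `e`. -/
noncomputable def ratio (e : ℝ) : ℝ := (4 * scaleConst * e)⁻¹

/-- The factor by which the maximum decreases from one scale to the next. -/
noncomputable def decayFactor (e : ℝ) : ℝ := 1 - Real.exp (-(gainConst / 2 * e ^ 29)) / 8

lemma decayFactor_pos (he : 1 ≤ e) : 0 < decayFactor e := by
  have := two_le_gainConst
  have h : Real.exp (-(gainConst / 2 * e ^ 29)) ≤ 1 :=
    Real.exp_le_one_iff.2 (neg_nonpos.2 (by positivity))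
  unfold decayFactor; linarith

lemma ratio_pos (he : 1 ≤ e) : 0 < ratio e := by
  have := two_le_scaleConst
  unfold ratio; positivity

lemma ratio_le (he : 1 ≤ e) : ratio e ≤ 1 / 2 := by
  have := two_le_scaleConst
  rw [ratio, ← one_div]
  exact one_div_le_one_div_of_le two_pos (by nlinarith)

lemma decrease (S : Sol b Γ G) {β₁ : ℝ≥0} (hβ₁ : DriftBdd b β₁) (hR : 0 < R)
    (hR1 : R ≤ 1) (he : 1 ≤ e) (hb : DriftScale b R e) (hb' : DriftScale b (2 * (ratio e * R)) e)
    {M : ℝ} (hM : 0 < M) (hΓ : ∀ᵐ z ∂(cylVol R), |Γ z| ≤ M) :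
    ∀ᵐ z ∂(cylVol (ratio e * R)), |Γ z| ≤ decayFactor e * M := by
  have A2 := two_le_scaleConst
  have r1 : R / (scaleConst * e) / 2 = 2 * (ratio e * R) := by
    rw [ratio]; field_simp; norm_num
  have r2 : R / (scaleConst * e) / 2 / 2 = ratio e * R := by rw [r1]; ring
  have key := (S.const_mul M⁻¹).decrease_of_le_one hβ₁ hR hR1 he hb (by rwa [r1]) (by
    filter_upwards [hΓ] with z hz
    rw [abs_mul, abs_of_pos (inv_pos.2 hM), inv_mul_le_iff₀ hM]
    linarith)
  rw [r2] at key
  filter_upwards [key] with z hz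
  rw [abs_mul, abs_of_pos (inv_pos.2 hM), inv_mul_le_iff₀ hM] at hz
  rw [decayFactor]
  linarith

lemma iterate (S : Sol b Γ G) {β₁ : ℝ≥0} (hβ₁ : DriftBdd b β₁) (hR : 0 < R)
    (hR1 : R ≤ 1) (he : 1 ≤ e) {r₁ : ℝ} (hb : ∀ r, r₁ ≤ r → r ≤ R → DriftScale b r e)
    {M : ℝ} (hM : 0 < M) (hΓ : ∀ᵐ z ∂(cylVol R), |Γ z| ≤ M) (N : ℕ)
    (hN : r₁ ≤ ratio e ^ N * R) :
    ∀ᵐ z ∂(cylVol (ratio e ^ N * R)), |Γ z| ≤ decayFactor e ^ N * M := by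
  have θ0 := ratio_pos he
  have θ1 := ratio_le he
  induction N with
  | zero => simpa using hΓ
  | succ N ih =>
    have p0 : 0 < ratio e ^ N * R := by positivity
    have e1 : ratio e ^ (N + 1) * R = ratio e * (ratio e ^ N * R) := by ring
    rw [e1] at hN ⊢
    have le1 : ratio e ^ N * R ≤ R := mul_le_of_le_one_left hR.le
      (pow_le_one₀ θ0.le (by linarith))
    have le2 : r₁ ≤ ratio e ^ N * R := by nlinarith
    have := S.decrease hβ₁ p0 (le1.trans hR1) he (hb _ le2 le1)
      (hb _ (by nlinarith) (by nlinarith)) (mul_pos (pow_pos (decayFactor_pos he) N) hM) (ih le2)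
    rwa [pow_succ', mul_assoc]

end Sol

/-- The size of the drift that is admitted at the scale `r`. -/
noncomputable def sizeAt (A r : ℝ) : ℝ := A * (1 + Real.log (Real.log (3 / r))) ^ (1 / 34 : ℝ)

lemma one_lt_log_three_div {r : ℝ} (hr : 0 < r) (hr1 : r ≤ 1) : 1 < Real.log (3 / r) := by
  rw [Real.lt_log_iff_exp_lt (by positivity)]
  have : (3 : ℝ) ≤ 3 / r := (le_div_iff₀ hr).2 (by linarith)
  linarith [Real.exp_one_lt_three]

lemma one_le_sizeAt {A r : ℝ} (hA : 1 ≤ A) (hr : 0 < r) (hr1 : r ≤ 1) : 1 ≤ sizeAt A r := by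
  have := Real.log_pos (one_lt_log_three_div hr hr1)
  have := Real.one_le_rpow (x := 1 + Real.log (Real.log (3 / r))) (by linarith)
    (show (0 : ℝ) ≤ 1 / 34 by norm_num)
  rw [sizeAt]
  nlinarith

lemma sizeAt_anti {A r r' : ℝ} (hA : 1 ≤ A) (hr : 0 < r) (h : r ≤ r') (hr1 : r' ≤ 1) :
    sizeAt A r' ≤ sizeAt A r := by
  have h1 := one_lt_log_three_div (hr.trans_le h) hr1
  have h0 := Real.log_pos h1
  have h2 : Real.log (3 / r') ≤ Real.log (3 / r) :=
    Real.log_le_log (div_pos (by norm_num) (hr.trans_le h)) (by gcongr)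
  have h3 := Real.log_le_log (by linarith) h2
  unfold sizeAt
  gcongr

/-- A power less than one is absorbed by a small multiple. -/
lemma exists_mul_rpow_le {D : ℝ} (hD : 0 < D) :
    ∃ C : ℝ, ∀ y : ℝ, 1 ≤ y → D * y ^ (29 / 34 : ℝ) ≤ y / 4 + C := by
  refine ⟨D * (4 * D) ^ (34 / 5 : ℝ), fun y hy => ?_⟩
  have y0 : 0 < y := by linarith
  rcases le_total ((4 * D) ^ (34 / 5 : ℝ)) y with h | h
  · have h1 : 4 * D ≤ y ^ (5 / 34 : ℝ) := by
      calc 4 * D = ((4 * D) ^ (34 / 5 : ℝ)) ^ (5 / 34 : ℝ) := by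
            rw [← Real.rpow_mul (by positivity)]; norm_num
        _ ≤ _ := by gcongr
    have h2 : y ^ (5 / 34 : ℝ) * y ^ (29 / 34 : ℝ) = y := by
      rw [← Real.rpow_add y0]; norm_num
    have h3 : 0 < y ^ (29 / 34 : ℝ) := by positivity
    have h4 : 0 ≤ D * (4 * D) ^ (34 / 5 : ℝ) := by positivity
    nlinarith
  · have h1 : y ^ (29 / 34 : ℝ) ≤ y := by
      simpa using Real.rpow_le_rpow_of_exponent_le hy (show (29 / 34 : ℝ) ≤ 1 by norm_num)
    have h2 : D * y ^ (29 / 34 : ℝ) ≤ D * (4 * D) ^ (34 / 5 : ℝ) := by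
      gcongr
      exact h1.trans h
    linarith

/-- The gain of one step is at least a multiple of `L ^ (-1/4)`, where `L = log (3 / r)`. -/
lemma exists_le_gain {A : ℝ} (hA : 1 ≤ A) : ∃ c : ℝ, 0 < c ∧ ∀ r : ℝ, 0 < r → r ≤ 1 →
    c * Real.log (3 / r) ^ (-(1 / 4) : ℝ) ≤
      Real.exp (-(Sol.gainConst / 2 * sizeAt A r ^ 29)) / 8 := by
  have g2 := Sol.two_le_gainConst
  obtain ⟨C, hC⟩ := exists_mul_rpow_le (show 0 < Sol.gainConst / 2 * A ^ 29 by positivity)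
  refine ⟨Real.exp (-(1 / 4) - C) / 8, by positivity, fun r hr hr1 => ?_⟩
  have hL := one_lt_log_three_div hr hr1
  set L := Real.log (3 / r) with hLd
  have hy := Real.log_pos hL
  have h1 := hC (1 + Real.log L) (by linarith)
  have h2 : sizeAt A r ^ 29 = A ^ 29 * (1 + Real.log L) ^ (29 / 34 : ℝ) := by
    rw [sizeAt, mul_pow, ← Real.rpow_natCast ((1 + Real.log L) ^ (1 / 34 : ℝ)),
      ← Real.rpow_mul (by linarith)]
    norm_num
  rw [h2, Real.rpow_def_of_pos (by linarith), div_mul_eq_mul_div, ← Real.exp_add]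
  gcongr
  linarith

/-- The number of steps from the radius `R` to the radius `r` is at least a multiple of
`L ^ (3/4)`, up to a constant, where `L = log (3 / r)`. -/
lemma exists_le_steps {A : ℝ} (hA : 1 ≤ A) : ∃ c : ℝ, 0 < c ∧ ∀ R r : ℝ, 1 / 2 ≤ R → R ≤ 1 →
    0 < r → r ≤ R → ∃ N : ℕ, r ≤ Sol.ratio (sizeAt A r) ^ N * R ∧
      c * Real.log (3 / r) ^ (3 / 4 : ℝ) - 2 ≤ N := by
  have s2 := Sol.two_le_scaleConst
  set B := 4 * Sol.scaleConst * A * 4 with hB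
  have B0 : 2 ≤ B := by
    have : 1 * 1 ≤ Sol.scaleConst * A := by gcongr; linarith
    rw [hB]; linarith
  refine ⟨B⁻¹, by positivity, fun R r hR hR1 hr hrR => ?_⟩
  have hr1 := hrR.trans hR1
  have hL := one_lt_log_three_div hr hr1
  set L := Real.log (3 / r) with hLd
  have hy := Real.log_pos hL
  have he := one_le_sizeAt hA hr hr1
  set e := sizeAt A r with hed
  have hq : 1 < 4 * Sol.scaleConst * e := by nlinarith
  set q := Real.log (4 * Sol.scaleConst * e) with hqd
  have q0 : 0 < q := Real.log_pos hq
  have L4 : 0 < L ^ (1 / 4 : ℝ) := by positivity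
  have L4' : 1 ≤ L ^ (1 / 4 : ℝ) := Real.one_le_rpow hL.le (by norm_num)
  have hqB : q ≤ B * L ^ (1 / 4 : ℝ) := by
    have h1 : q ≤ 4 * Sol.scaleConst * e := (Real.log_le_sub_one_of_pos (by linarith)).trans
      (by linarith)
    have h2 : (1 + Real.log L) ^ (1 / 34 : ℝ) ≤ 1 + Real.log L := by
      simpa using Real.rpow_le_rpow_of_exponent_le (show 1 ≤ 1 + Real.log L by linarith)
        (show (1 / 34 : ℝ) ≤ 1 by norm_num)
    have h3 : 1 + Real.log L ≤ 4 * L ^ (1 / 4 : ℝ) := by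
      have := Real.log_le_sub_one_of_pos L4
      rw [Real.log_rpow (by linarith)] at this
      linarith
    calc q ≤ 4 * Sol.scaleConst * e := h1
      _ ≤ 4 * Sol.scaleConst * (A * (4 * L ^ (1 / 4 : ℝ))) := by
          rw [hed, sizeAt]
          gcongr
          exact h2.trans h3
      _ = _ := by rw [hB]; ring
  have hRr : 0 ≤ Real.log (R / r) := Real.log_nonneg ((one_le_div hr).2 hrR)
  refine ⟨⌊Real.log (R / r) / q⌋₊, ?_, ?_⟩
  · set N := ⌊Real.log (R / r) / q⌋₊
    have h1 : (N : ℝ) ≤ Real.log (R / r) / q := Nat.floor_le (by positivity)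
    rw [le_div_iff₀ q0] at h1
    have h2 : (4 * Sol.scaleConst * e) ^ N ≤ R / r := by
      rw [← Real.log_le_log_iff (by positivity) (by positivity), Real.log_pow]
      exact h1
    rw [Sol.ratio, inv_pow, inv_mul_eq_div, le_div_iff₀ (by positivity)]
    rw [le_div_iff₀ hr] at h2
    linarith
  · have h1 := Nat.lt_floor_add_one (Real.log (R / r) / q)
    have h2 : L - 2 ≤ Real.log (R / r) := by
      have e1 : L = Real.log (R / r) + Real.log (3 / R) := by
        rw [hLd, ← Real.log_mul (by positivity) (by positivity)]
        congr 1
        field_simp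
      have e2 : Real.log (3 / R) ≤ 2 := by
        rw [Real.log_le_iff_le_exp (by positivity)]
        have : 3 / R ≤ 6 := by rw [div_le_iff₀ (by linarith)]; linarith
        have h7 := Real.exp_one_gt_d9
        have : Real.exp 2 = Real.exp 1 * Real.exp 1 := by rw [← Real.exp_add]; norm_num
        nlinarith
      linarith
    have h3 : B⁻¹ * L ^ (3 / 4 : ℝ) - 1 ≤ Real.log (R / r) / q := by
      have h4 : L ^ (3 / 4 : ℝ) * L ^ (1 / 4 : ℝ) = L := by
        rw [← Real.rpow_add (by linarith)]; norm_num
      have h5 : Real.log (R / r) / (B * L ^ (1 / 4 : ℝ)) ≤ Real.log (R / r) / q := by gcongr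
      refine le_trans ?_ h5
      rw [le_div_iff₀ (by positivity)]
      have : (B⁻¹ * L ^ (3 / 4 : ℝ) - 1) * (B * L ^ (1 / 4 : ℝ)) =
          L ^ (3 / 4 : ℝ) * L ^ (1 / 4 : ℝ) - B * L ^ (1 / 4 : ℝ) := by field_simp
      rw [this, h4]
      nlinarith
    linarith

/-- The decay of the maximum in the concentric cylinders, with constants that only depend on the
size `A` of the drift. -/
lemma exists_decay_at_scale {A : ℝ} (hA : 1 ≤ A) : ∃ c C : ℝ, 0 < c ∧ 0 < C ∧
    ∀ {b : ST → E} {Γ : ST → ℝ} {G : ST → E}, Sol b Γ G → ∀ {β₁ : ℝ≥0}, DriftBdd b β₁ →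
      (∀ r, 0 < r → r ≤ 1 → DriftScale b r (sizeAt A r)) → ∀ R r M : ℝ, 1 / 2 ≤ R → R ≤ 1 →
      0 < r → r ≤ R → 0 < M → (∀ᵐ z ∂(cylVol R), |Γ z| ≤ M) →
      ∀ᵐ z ∂(cylVol r), |Γ z| ≤ C * M * Real.log (3 / r) ^ (-c) := by
  obtain ⟨c₁, c₁0, hc₁⟩ := exists_le_gain hA
  obtain ⟨c₂, c₂0, hc₂⟩ := exists_le_steps hA
  refine ⟨c₁ * c₂ / 2, Real.exp (2 * c₁), by positivity, by positivity, ?_⟩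
  intro b Γ G S β₁ hβ₁ hb R r M hR hR1 hr hrR hM hΓ
  obtain ⟨N, hN, hN'⟩ := hc₂ R r hR hR1 hr hrR
  have hr1 := hrR.trans hR1
  have hg := hc₁ r hr hr1
  have hL := one_lt_log_three_div hr hr1
  have he := one_le_sizeAt hA hr hr1
  set L := Real.log (3 / r) with hLd
  set e := sizeAt A r with hed
  have it := S.iterate hβ₁ (by linarith) hR1 he (r₁ := r) (fun s h1 h2 =>
    (hb s (hr.trans_le h1) (h2.trans hR1)).mono (hr.le.trans h1)
      (sizeAt_anti hA hr h1 (h2.trans hR1))) hM hΓ N hN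
  have sub : cyl r ⊆ cyl (Sol.ratio e ^ N * R) := cyl_mono hr.le hN
  have it' : ∀ᵐ z ∂(cylVol r), |Γ z| ≤ Sol.decayFactor e ^ N * M :=
    ae_mono (Measure.restrict_mono sub le_rfl) it
  have fac : Sol.decayFactor e ^ N ≤ Real.exp (2 * c₁) * L ^ (-(c₁ * c₂ / 2)) := by
    set g := Real.exp (-(Sol.gainConst / 2 * e ^ 29)) / 8
    have h1 : Sol.decayFactor e ≤ Real.exp (-g) := Real.one_sub_le_exp_neg g
    have h2 : Sol.decayFactor e ^ N ≤ Real.exp (N * -g) := by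
      rw [Real.exp_nat_mul]
      exact pow_le_pow_left₀ (Sol.decayFactor_pos he).le h1 N
    refine h2.trans ?_
    rw [Real.rpow_def_of_pos (by linarith), ← Real.exp_add]
    refine Real.exp_le_exp.2 ?_
    have L4 : 0 < L ^ (-(1 / 4) : ℝ) := by positivity
    have L4' : L ^ (-(1 / 4) : ℝ) ≤ 1 :=
      Real.rpow_le_one_of_one_le_of_nonpos hL.le (by norm_num)
    have h3 : L ^ (3 / 4 : ℝ) * L ^ (-(1 / 4) : ℝ) = L ^ (1 / 2 : ℝ) := by
      rw [← Real.rpow_add (by linarith)]; norm_num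
    have h4 : Real.log L ≤ 2 * L ^ (1 / 2 : ℝ) := by
      have := Real.log_le_sub_one_of_pos (show 0 < L ^ (1 / 2 : ℝ) by positivity)
      rw [Real.log_rpow (by linarith)] at this
      linarith
    have h5 : N * (c₁ * L ^ (-(1 / 4) : ℝ)) ≤ N * g := by gcongr
    have h6 : (c₂ * L ^ (3 / 4 : ℝ) - 2) * (c₁ * L ^ (-(1 / 4) : ℝ)) ≤
        N * (c₁ * L ^ (-(1 / 4) : ℝ)) := by gcongr
    have h7 : (c₂ * L ^ (3 / 4 : ℝ) - 2) * (c₁ * L ^ (-(1 / 4) : ℝ)) =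
        c₁ * c₂ * L ^ (1 / 2 : ℝ) - 2 * c₁ * L ^ (-(1 / 4) : ℝ) := by rw [← h3]; ring
    have h8 : c₁ * c₂ * Real.log L ≤ c₁ * c₂ * (2 * L ^ (1 / 2 : ℝ)) := by gcongr
    have h9 : c₁ * L ^ (-(1 / 4) : ℝ) ≤ c₁ * 1 := by gcongr
    linarith
  filter_upwards [it'] with z hz
  calc |Γ z| ≤ Sol.decayFactor e ^ N * M := hz
    _ ≤ (Real.exp (2 * c₁) * L ^ (-(c₁ * c₂ / 2))) * M := by gcongr
    _ = _ := by ring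

lemma parDist_lt {R : ℝ} {z : ST} (hR : 0 < R) (hz : z ∈ cyl R) : parDist z < R := by
  refine max_lt (by simpa using hz.1) ?_
  rw [Real.sqrt_lt' hR]
  linarith [hz.2.1]

lemma mem_cyl_of_parDist_lt {R : ℝ} {z : ST} (h : parDist z < R) (ht : z.2 ≤ 0) : z ∈ cyl R := by
  have h1 := (le_max_left _ _).trans_lt h
  have h2 := (le_max_right _ _).trans_lt h
  refine ⟨by simpa using h1, ?_, ht⟩
  rw [Real.sqrt_lt' ((norm_nonneg _).trans_lt h1)] at h2
  linarith

lemma parDist_pos {z : ST} (ht : z.2 < 0) : 0 < parDist z :=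
  lt_max_of_lt_right (Real.sqrt_pos.2 (by linarith))

/-- A bound in `P(R)` implies logarithmic decay in `P(R)`. -/
lemma exists_decay {A : ℝ} (hA : 1 ≤ A) : ∃ c C : ℝ, 0 < c ∧ 0 < C ∧
    ∀ {b : ST → E} {Γ : ST → ℝ} {G : ST → E}, Sol b Γ G → ∀ {β₁ : ℝ≥0}, DriftBdd b β₁ →
      (∀ r, 0 < r → r ≤ 1 → DriftScale b r (sizeAt A r)) → ∀ R M : ℝ, 1 / 2 ≤ R → R ≤ 1 →
      0 ≤ M → (∀ᵐ z ∂(cylVol R), |Γ z| ≤ M) →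
      ∀ᵐ z ∂(cylVol R), |Γ z| ≤ C * M * |Real.log (parDist z / 3)| ^ (-c) := by
  obtain ⟨c, C, hc, hC, H⟩ := exists_decay_at_scale hA
  refine ⟨c, C * 3 ^ c, hc, by positivity, ?_⟩
  intro b Γ G S β₁ hβ₁ hb R M hR hR1 hM hΓ
  have R0 : 0 < R := by linarith
  rcases hM.eq_or_lt with rfl | hM
  · filter_upwards [hΓ] with z hz
    simpa using hz
  have all : ∀ᵐ z : ST, ∀ j : ℕ, z ∈ cyl (R * (1 / 2) ^ j) →
      |Γ z| ≤ C * M * Real.log (3 / (R * (1 / 2) ^ j)) ^ (-c) := by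
    rw [ae_all_iff]
    intro j
    have h1 : (1 / 2 : ℝ) ^ j ≤ 1 := pow_le_one₀ (by norm_num) (by norm_num)
    exact (ae_restrict_iff' (measurableSet_cyl _)).1
      (H S hβ₁ hb R _ M hR hR1 (by positivity) (mul_le_of_le_one_right R0.le h1) hM hΓ)
  have neg : ∀ᵐ z : ST, z.2 ≠ 0 := by
    have : ∀ᵐ t : ℝ, t ≠ 0 := by simp [ae_iff]
    exact Measure.quasiMeasurePreserving_snd.ae this
  refine (ae_restrict_iff' (measurableSet_cyl R)).2 ?_
  filter_upwards [all, neg] with z hz hne hzR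
  have ht : z.2 < 0 := lt_of_le_of_ne hzR.2.2 hne
  have p0 := parDist_pos ht
  have pR := parDist_lt R0 hzR
  obtain ⟨j, hj1, hj2⟩ := exists_nat_pow_near_of_lt_one (div_pos p0 R0)
    ((div_le_one R0).2 pR.le) (show (0 : ℝ) < 1 / 2 by norm_num) (by norm_num)
  -- the scale of `z`, up to a factor four
  obtain ⟨i, hi1, hi2⟩ : ∃ i : ℕ, R * (1 / 2) ^ (i + 2) ≤ parDist z ∧
      parDist z < R * (1 / 2) ^ i := by
    rcases j with _ | j
    · refine ⟨0, ?_, by simpa using pR⟩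
      rw [lt_div_iff₀ R0] at hj1
      nlinarith
    · refine ⟨j, ?_, ?_⟩
      · rw [lt_div_iff₀ R0] at hj1
        linarith
      · rw [div_le_iff₀ R0] at hj2
        have : (1 / 2 : ℝ) ^ (j + 1) < (1 / 2) ^ j := by
          rw [pow_succ]
          have : (0 : ℝ) < (1 / 2) ^ j := by positivity
          linarith
        nlinarith
  refine (hz i (mem_cyl_of_parDist_lt hi2 ht.le)).trans ?_
  have q0 : 0 < R * (1 / 2 : ℝ) ^ i := by positivity
  have q1 : R * (1 / 2 : ℝ) ^ i ≤ 1 :=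
    (mul_le_of_le_one_right R0.le (pow_le_one₀ (by norm_num) (by norm_num))).trans hR1
  set q := R * (1 / 2 : ℝ) ^ i with hq
  have hL := one_lt_log_three_div q0 q1
  have hL' := one_lt_log_three_div p0 (pR.le.trans hR1)
  have abs_log : |Real.log (parDist z / 3)| = Real.log (3 / parDist z) := by
    rw [← inv_div, Real.log_inv, abs_neg, abs_of_pos (by linarith)]
  have le3 : Real.log (3 / parDist z) ≤ 3 * Real.log (3 / q) := by
    have h1 : Real.log (3 / parDist z) ≤ Real.log (4 * (3 / q)) := by
      refine Real.log_le_log (by positivity) ?_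
      rw [div_le_iff₀ p0]
      have : 4 * (3 / q) * (q / 4) = 3 := by field_simp
      have hi1' : q / 4 ≤ parDist z := by
        rw [hq]
        rw [pow_add] at hi1
        linarith
      calc 3 = 4 * (3 / q) * (q / 4) := this.symm
        _ ≤ _ := by gcongr
    rw [Real.log_mul (by norm_num) (by positivity)] at h1
    have h2 : Real.log 4 ≤ 2 := by
      have : Real.log 4 = 2 * Real.log 2 := by
        rw [show (4 : ℝ) = 2 ^ 2 by norm_num, Real.log_pow]; norm_num
      linarith [Real.log_two_lt_d9]
    linarith
  rw [abs_log]
  have fin : Real.log (3 / q) ^ (-c) ≤ 3 ^ c * Real.log (3 / parDist z) ^ (-c) := by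
    have h1 : (3 * Real.log (3 / q)) ^ (-c) ≤ Real.log (3 / parDist z) ^ (-c) :=
      Real.rpow_le_rpow_of_nonpos (by linarith) le3 (by linarith)
    rw [Real.mul_rpow (by norm_num) (by linarith), Real.rpow_neg (by norm_num),
      inv_mul_le_iff₀ (by positivity)] at h1
    exact h1
  calc C * M * Real.log (3 / q) ^ (-c)
      ≤ C * M * (3 ^ c * Real.log (3 / parDist z) ^ (-c)) := by gcongr
    _ = _ := by ring

/-! ### The hypotheses of the theorem -/

lemma setIntegral_eq_integral_of_ae_eq {f g : ST → ℝ} (hg : ∀ z ∉ cyl 1, g z = 0)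
    (h : f =ᵐ[cylVol 1] g) : ∫ z in cyl 1, f z = ∫ z, g z := by
  rw [← setIntegral_eq_integral_of_forall_compl_eq_zero hg]
  exact integral_congr_ae h

/-- A weak solution has measurable representatives, extended by zero. -/
lemma IsWeakSolution.exists_sol {b : ST → E} {Γ : ST → ℝ} (hb : IsDivFreeDrift b)
    (hΓ : IsWeakSolution b Γ) : ∃ b' Γ' G', Sol b' Γ' G' ∧ b' =ᵐ[cylVol 1] b ∧
      Γ' =ᵐ[cylVol 1] Γ := by
  obtain ⟨hΓ2, -, hax, G, hG2, hgrad, heqn⟩ := hΓ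
  have mc := measurableSet_cyl 1
  have rep : ∀ {F : Type} [NormedAddCommGroup F] (f : ST → F) (hf : AEStronglyMeasurable f (cylVol 1)),
      (cyl 1).indicator (hf.mk f) =ᵐ[cylVol 1] f := fun f hf =>
    (indicator_ae_eq_restrict mc).trans hf.ae_eq_mk.symm
  set b' := (cyl 1).indicator (hb.memLp.1.mk b) with hb'
  set Γ' := (cyl 1).indicator (hΓ2.1.mk Γ) with hΓ'
  set G' := (cyl 1).indicator (hG2.1.mk G) with hG'
  have eb : b' =ᵐ[cylVol 1] b := rep b hb.memLp.1
  have eΓ : Γ' =ᵐ[cylVol 1] Γ := rep Γ hΓ2.1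
  have eG : G' =ᵐ[cylVol 1] G := rep G hG2.1
  have bz : ∀ z ∉ cyl 1, b' z = 0 := fun z hz => indicator_of_notMem hz _
  have Γz : ∀ z ∉ cyl 1, Γ' z = 0 := fun z hz => indicator_of_notMem hz _
  have Gz : ∀ z ∉ cyl 1, G' z = 0 := fun z hz => indicator_of_notMem hz _
  refine ⟨b', Γ', G', ⟨?_, ?_, ?_, ?_, ?_, ?_, bz, Γz, Gz, ?_, ?_, ?_, ?_⟩, eb, eΓ⟩
  · exact hb.memLp.1.stronglyMeasurable_mk.measurable.indicator mc
  · exact hΓ2.1.stronglyMeasurable_mk.measurable.indicator mc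
  · exact hG2.1.stronglyMeasurable_mk.measurable.indicator mc
  · exact (memLp_indicator_iff_restrict mc).2 (hb.memLp.ae_eq hb.memLp.1.ae_eq_mk)
  · exact (memLp_indicator_iff_restrict mc).2 (hΓ2.ae_eq hΓ2.1.ae_eq_mk)
  · exact (memLp_indicator_iff_restrict mc).2 (hG2.ae_eq hG2.1.ae_eq_mk)
  · intro ψ hψ
    rw [← hb.div_free ψ hψ]
    refine (setIntegral_eq_integral_of_ae_eq (fun z hz => by simp [bz z hz]) ?_).symm
    filter_upwards [eb] with z hz
    rw [hz]
  · intro ψ hψ i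
    have h := hgrad ψ hψ i
    rw [setIntegral_eq_integral_of_ae_eq (g := fun z => Γ' z * dx i ψ z)
      (fun z hz => by simp [Γz z hz]) (eΓ.mono fun z hz => by simp only [hz]),
      setIntegral_eq_integral_of_ae_eq (g := fun z => G' z i * ψ z)
      (fun z hz => by simp [Gz z hz]) (eG.mono fun z hz => by simp only [hz])] at h
    exact h
  · intro R h0 h1
    refine (hax R h0 h1).congr fun ρ => ?_
    congr 1
    refine integral_congr_ae ?_
    have sub : cyl R ∩ {z | axisDist z.1 < ρ} ⊆ cyl 1 :=
      inter_subset_left.trans (cyl_mono h0.le h1.le)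
    filter_upwards [ae_mono (Measure.restrict_mono sub le_rfl) eΓ] with z hz
    rw [hz]
  · intro ψ hψ
    rw [← heqn ψ hψ]
    refine (setIntegral_eq_integral_of_ae_eq (fun z hz => by simp [bz z hz, Γz z hz, Gz z hz])
      ?_).symm
    filter_upwards [eb, eΓ, eG] with z h1 h2 h3
    rw [h1, h2, h3]

/-- The scaled `L^p` norm of the drift controls the scaled `L^{5/3}` norm. -/
lemma driftScale_of_scaledNorm_le {p : ℝ} (hp : 5 / 3 < p) {b b' : ST → E}
    (hm : Measurable b') (hbb : b' =ᵐ[cylVol 1] b) {R q : ℝ} (hR : 0 < R) (hR1 : R ≤ 1)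
    (hq : 0 ≤ q) (h : scaledNorm p b R ≤ ofReal q) : DriftScale b' R (5 * q) := by
  have p0 : 0 < p := by linarith
  have h1 : ∀ᵐ t ∂(volume.restrict (Icc (-R ^ 2) 0)),
      (ofReal (1 / R ^ (3 - p)) * ∫⁻ x in ball (0 : E) R, ‖b (x, t)‖ₑ ^ p) ^ (1 / p)
        ≤ ofReal q := by
    filter_upwards [ENNReal.ae_le_essSup (μ := volume.restrict (Icc (-R ^ 2) 0)) fun t : ℝ =>
      (ofReal (1 / R ^ (3 - p)) * ∫⁻ x in ball (0 : E) R, ‖b (x, t)‖ₑ ^ p) ^ (1 / p)]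
      with t ht using ht.trans h
  have h2 : ∀ᵐ t : ℝ, ∀ᵐ x : E, (x, t) ∈ cyl 1 → b' (x, t) = b (x, t) :=
    ae_slice ((ae_restrict_iff' (measurableSet_cyl 1)).1 hbb)
  filter_upwards [(ae_restrict_iff' measurableSet_Icc).1 h1, h2] with t ht1 ht2 ht
  have hsl : ∫⁻ x in ball (0 : E) R, ‖b' (x, t)‖ₑ ^ p = ∫⁻ x in ball (0 : E) R, ‖b (x, t)‖ₑ ^ p := by
    refine setLIntegral_congr_fun_ae measurableSet_ball ?_
    filter_upwards [ht2] with x hx hxR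
    rw [hx ⟨ball_subset_ball hR1 hxR, by nlinarith [ht.1], ht.2.le⟩]
  have ht3 := ht1 ⟨ht.1.le, ht.2.le⟩
  rw [← hsl] at ht3
  have hol := eLpNorm'_le_eLpNorm'_mul_rpow_measure_univ (μ := volume.restrict (ball (0 : E) R))
    (show (0 : ℝ) < 5 / 3 by norm_num) hp.le
    ((hm.comp measurable_prodMk_right).aestronglyMeasurable (f := fun x => b' (x, t)))
  simp only [eLpNorm'_eq_lintegral_enorm, Measure.restrict_apply_univ] at hol
  have e1 : (1 : ℝ) / (5 / 3) = 3 / 5 := by norm_num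
  rw [e1] at hol
  refine hol.trans ?_
  set I := ∫⁻ x in ball (0 : E) R, ‖b' (x, t)‖ₑ ^ p
  have pw : 0 < R ^ (3 - p) := Real.rpow_pos_of_pos hR _
  have hI : I ^ (1 / p) ≤ ofReal ((R ^ (3 - p)) ^ (1 / p) * q) := by
    have e2 : I = ofReal (R ^ (3 - p)) * (ofReal (1 / R ^ (3 - p)) * I) := by
      rw [← mul_assoc, ← ENNReal.ofReal_mul pw.le, mul_one_div_cancel pw.ne', ENNReal.ofReal_one,
        one_mul]
    rw [e2, ENNReal.mul_rpow_of_nonneg _ _ (by positivity),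
      ENNReal.ofReal_rpow_of_pos pw, ENNReal.ofReal_mul (by positivity)]
    gcongr
  have x0 : 0 ≤ 3 / 5 - 1 / p := by
    rw [sub_nonneg, div_le_div_iff₀ p0 (by norm_num)]; linarith
  have x1 : 3 / 5 - 1 / p ≤ 1 := by
    have : 0 < 1 / p := by positivity
    linarith
  have hV : volume (ball (0 : E) R) ^ (3 / 5 - 1 / p) ≤
      ofReal ((5 * R ^ 3) ^ (3 / 5 - 1 / p)) := by
    rw [← ENNReal.ofReal_rpow_of_pos (by positivity), EuclideanSpace.volume_ball_fin_three,
      ← ENNReal.ofReal_pow hR.le, ← ENNReal.ofReal_mul (by positivity)]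
    rw [mul_comm 5]
    gcongr
    linarith [Real.pi_lt_d2]
  calc I ^ (1 / p) * volume (ball (0 : E) R) ^ (3 / 5 - 1 / p)
      ≤ ofReal ((R ^ (3 - p)) ^ (1 / p) * q)
        * ofReal ((5 * R ^ 3) ^ (3 / 5 - 1 / p)) := by gcongr
    _ = ofReal ((R ^ (3 - p)) ^ (1 / p) * q * (5 * R ^ 3) ^ (3 / 5 - 1 / p)) :=
        (ENNReal.ofReal_mul (by positivity)).symm
    _ ≤ _ := by
        refine ENNReal.ofReal_le_ofReal ?_
        have e3 : (R ^ (3 - p)) ^ (1 / p) * (R ^ 3) ^ (3 / 5 - 1 / p) = R ^ (4 / 5 : ℝ) := by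
          rw [← Real.rpow_natCast R 3, ← Real.rpow_mul hR.le, ← Real.rpow_mul hR.le,
            ← Real.rpow_add hR]
          congr 1
          field_simp
          push_cast
          ring
        have e4 : (5 : ℝ) ^ (3 / 5 - 1 / p) ≤ 5 := by
          simpa using Real.rpow_le_rpow_of_exponent_le (show (1 : ℝ) ≤ 5 by norm_num) x1
        rw [Real.mul_rpow (by norm_num) (by positivity)]
        calc _ = 5 ^ (3 / 5 - 1 / p) * q * ((R ^ (3 - p)) ^ (1 / p)
              * (R ^ 3) ^ (3 / 5 - 1 / p)) := by ring
          _ ≤ 5 * q * R ^ (4 / 5 : ℝ) := by rw [e3]; gcongr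

lemma exponent_le {p β : ℝ} (hp : 5 / 3 < p) (hp2 : p ≤ 2) (hβ : 0 < β) :
    (3 * p - 5) / (77 * p - 120) * (1 - β) ≤ 1 / 34 := by
  have h1 : (3 * p - 5) / (77 * p - 120) ≤ 1 / 34 := by
    rw [div_le_div_iff₀ (by linarith) (by norm_num)]; linarith
  have h0 : 0 ≤ (3 * p - 5) / (77 * p - 120) := div_nonneg (by linarith) (by linarith)
  nlinarith

/-- The constant `A` for which the growth `K (log (log (3 / R))) ^ γ` is at most `sizeAt A R`. -/
noncomputable def sizeConst (K γ : ℝ) : ℝ := 1 + 5 * (|K| * (1 + Real.log (Real.log 3) ^ γ))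

lemma loglog_three_pos : 0 < Real.log (Real.log 3) := by
  have := one_lt_log_three_div one_pos le_rfl
  rw [div_one] at this
  exact Real.log_pos this

lemma one_le_sizeConst (K γ : ℝ) : 1 ≤ sizeConst K γ := by
  have := loglog_three_pos
  have : 0 ≤ 5 * (|K| * (1 + Real.log (Real.log 3) ^ γ)) := by positivity
  rw [sizeConst]; linarith

lemma abs_log_div_three {s : ℝ} (hs : 0 < s) (hs1 : s ≤ 1) :
    |Real.log (s / 3)| = Real.log (3 / s) := by
  rw [← inv_div, Real.log_inv, abs_neg, abs_of_pos (by linarith [one_lt_log_three_div hs hs1])]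

lemma growth_le_sizeAt {K γ R : ℝ} (hγ : γ ≤ 1 / 34) (hR : 0 < R) (hR1 : R ≤ 1) :
    5 * (|K| * Real.log |Real.log (R / 3)| ^ γ) ≤ sizeAt (sizeConst K γ) R := by
  rw [abs_log_div_three hR hR1]
  have l0 := loglog_three_pos
  have hL := one_lt_log_three_div hR hR1
  have h3 : Real.log (Real.log 3) ≤ Real.log (Real.log (3 / R)) := by
    refine Real.log_le_log (by simpa using (one_pos.trans (one_lt_log_three_div one_pos le_rfl))) ?_
    exact Real.log_le_log (by norm_num) ((le_div_iff₀ hR).2 (by linarith))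
  set l := Real.log (Real.log (3 / R)) with hl
  have ll : 0 < l := l0.trans_le h3
  have y1 : 1 ≤ (1 + l) ^ (1 / 34 : ℝ) := Real.one_le_rpow (by linarith) (by norm_num)
  have c0 : 0 < Real.log (Real.log 3) ^ γ := Real.rpow_pos_of_pos l0 _
  have key : l ^ γ ≤ (1 + Real.log (Real.log 3) ^ γ) * (1 + l) ^ (1 / 34 : ℝ) := by
    rcases le_total γ 0 with h | h
    · have h1 : l ^ γ ≤ Real.log (Real.log 3) ^ γ := Real.rpow_le_rpow_of_nonpos l0 h3 h
      nlinarith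
    · have h1 : l ^ γ ≤ (1 + l) ^ (1 / 34 : ℝ) :=
        (Real.rpow_le_rpow ll.le (by linarith) h).trans
          (Real.rpow_le_rpow_of_exponent_le (by linarith) hγ)
      nlinarith
  have hK := abs_nonneg K
  calc 5 * (|K| * l ^ γ)
      ≤ 5 * (|K| * ((1 + Real.log (Real.log 3) ^ γ) * (1 + l) ^ (1 / 34 : ℝ))) := by gcongr
    _ ≤ _ := by
      rw [sizeAt, sizeConst, ← hl, add_mul, one_mul]
      have : 5 * (|K| * ((1 + Real.log (Real.log 3) ^ γ) * (1 + l) ^ (1 / 34 : ℝ))) =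
        5 * (|K| * (1 + Real.log (Real.log 3) ^ γ)) * (1 + l) ^ (1 / 34 : ℝ) := by ring
      linarith

lemma DriftScale.driftBdd {b : ST → E} {e : ℝ} (h : DriftScale b 1 e) :
    DriftBdd b (Real.toNNReal e ^ (5 / 3 : ℝ)) := by
  filter_upwards [h] with t ht htI
  have h1 := ht (by simpa using htI)
  rw [Real.one_rpow, mul_one] at h1
  have h2 := ENNReal.rpow_le_rpow h1 (show (0 : ℝ) ≤ 5 / 3 by norm_num)
  rw [← ENNReal.rpow_mul] at h2
  norm_num at h2
  rw [ENNReal.coe_rpow_of_nonneg _ (by norm_num)]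
  exact h2

namespace Sol
variable {b : ST → E} {Γ : ST → ℝ} {G : ST → E} {e : ℝ}

/-- The `L²` norm controls the maximum in `P(1/2)`. -/
lemma abs_le_sqrt_integral (S : Sol b Γ G) {β₁ : ℝ≥0} (hβ₁ : DriftBdd b β₁) (he : 1 ≤ e)
    (hb : DriftScale b 1 e) : ∀ᵐ z ∂(cylVol (1 / 2)),
      |Γ z| ≤ √(e ^ 25 / giorgiConst) * √(∫ z in cyl 1, Γ z ^ 2) := by
  have g0 := giorgiConst_pos
  have i0 : 0 ≤ ∫ z in cyl 1, Γ z ^ 2 := integral_nonneg fun _ => sq_nonneg _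
  rcases i0.eq_or_lt with h | h
  · have hz := (setIntegral_eq_zero_iff_of_nonneg_ae (ae_of_all _ fun z => sq_nonneg _)
      S.sq_integrable.integrableOn).1 h.symm
    have sub : cyl (1 / 2) ⊆ cyl 1 := cyl_mono (by norm_num) (by norm_num)
    filter_upwards [ae_mono (Measure.restrict_mono sub le_rfl) hz] with z hz
    have : Γ z = 0 := by simpa using hz
    rw [this, abs_zero]
    positivity
  · have key := S.deGiorgi hβ₁ one_pos le_rfl he hb le_rfl
      (κ := √(e ^ 25 / giorgiConst) * √(∫ z in cyl 1, Γ z ^ 2)) (by positivity) (by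
        have e1 : giorgiConst * (√(e ^ 25 / giorgiConst) * √(∫ z in cyl 1, Γ z ^ 2)) ^ 2 * 1 ^ 5
            / e ^ 25 = ∫ z in cyl 1, Γ z ^ 2 := by
          rw [mul_pow, Real.sq_sqrt (by positivity), Real.sq_sqrt i0]
          field_simp
        rw [e1, S.totalMass_eq]
        refine setIntegral_mono (S.trunc_sq_integrable 0).integrableOn
          S.sq_integrable.integrableOn fun z => ?_
        rw [← sq_abs, abs_trunc le_rfl, sub_zero, max_eq_left (abs_nonneg _), sq_abs])
    filter_upwards [key] with z hz
    linarith

end Sol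

lemma parDist_continuous : Continuous parDist :=
  (continuous_fst.norm).max (Real.continuous_sqrt.comp continuous_snd.neg)

/-- A function that decays logarithmically has a representative that is continuous at the
origin, where it vanishes. -/
lemma exists_continuousWithinAt {Γ : ST → ℝ} {c D : ℝ} (hc : 0 < c)
    (h : ∀ᵐ z ∂(cylVol (1 / 2)), |Γ z| ≤ D * |Real.log (parDist z / 3)| ^ (-c)) :
    ∃ g : ST → ℝ, g =ᵐ[cylVol 1] Γ ∧ ContinuousWithinAt g (cyl 1) 0 ∧ g 0 = 0 := by
  classical
  set φ : ℝ → ℝ := fun s => |Real.log (s / 3)| ^ (-c) with hφ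
  have φ0 : φ 0 = 0 := by
    simp only [hφ]
    rw [zero_div, Real.log_zero, abs_zero, Real.zero_rpow (by linarith)]
  have p0 : parDist 0 = 0 := by simp [parDist]
  have hlim : Tendsto φ (𝓝 0) (𝓝 0) := by
    suffices h0 : Tendsto φ (𝓝[≠] 0 ⊔ pure 0) (𝓝 0) by rwa [nhdsNE_sup_pure] at h0
    rw [tendsto_sup]
    constructor
    · have h1 : Tendsto (fun s : ℝ => s / 3) (𝓝[≠] 0) (𝓝[≠] 0) := by
        refine tendsto_nhdsWithin_iff.2 ⟨?_, ?_⟩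
        · have : Tendsto (fun s : ℝ => s / 3) (𝓝 0) (𝓝 (0 / 3)) :=
            (continuous_id.div_const 3).tendsto 0
          rw [zero_div] at this
          exact this.mono_left nhdsWithin_le_nhds
        · filter_upwards [self_mem_nhdsWithin] with s hs
          simpa using hs
      exact (tendsto_rpow_neg_atTop hc).comp
        (tendsto_abs_atBot_atTop.comp (Real.tendsto_log_nhdsNE_zero.comp h1))
    · rw [tendsto_pure_left]
      intro s hs
      rw [φ0]
      exact mem_of_mem_nhds hs
  set g : ST → ℝ := fun z => if z ∈ cyl (1 / 2) ∧ ¬ |Γ z| ≤ D * φ (parDist z) then 0 else Γ z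
    with hg
  have bd : ∀ z ∈ cyl (1 / 2), |g z| ≤ |D| * φ (parDist z) := by
    intro z hz
    have φn : 0 ≤ φ (parDist z) := Real.rpow_nonneg (abs_nonneg _) _
    simp only [hg]
    split_ifs with hif
    · rw [abs_zero]; positivity
    · have h1 : |Γ z| ≤ D * φ (parDist z) := by
        by_contra hcon
        exact hif ⟨hz, hcon⟩
      exact h1.trans (mul_le_mul_of_nonneg_right (le_abs_self D) φn)
  have g0 : g 0 = 0 := by
    have := bd 0 ⟨by simp, by simp, le_rfl⟩
    rw [p0, φ0, mul_zero] at this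
    exact abs_nonpos_iff.1 this
  refine ⟨g, ?_, ?_, g0⟩
  · have h1 := (ae_restrict_iff' (measurableSet_cyl (1 / 2))).1 h
    refine ae_restrict_of_ae ?_
    filter_upwards [h1] with z hz
    simp only [hg]
    rw [if_neg]
    rintro ⟨h2, h3⟩
    exact h3 (hz h2)
  · rw [ContinuousWithinAt, g0]
    have near : ∀ᶠ z in 𝓝[cyl 1] (0 : ST), z ∈ cyl (1 / 2) := by
      have h1 : ∀ᶠ z in 𝓝 (0 : ST), parDist z < 1 / 2 :=
        parDist_continuous.continuousAt.eventually_lt continuousAt_const (by rw [p0]; norm_num)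
      filter_upwards [nhdsWithin_le_nhds h1, self_mem_nhdsWithin] with z hz hz1
      exact mem_cyl_of_parDist_lt hz hz1.2.2
    have h2 : Tendsto (fun z => |D| * φ (parDist z)) (𝓝[cyl 1] (0 : ST)) (𝓝 0) := by
      have h3 : Tendsto parDist (𝓝 (0 : ST)) (𝓝 0) := by
        have := parDist_continuous.tendsto (0 : ST)
        rwa [p0] at this
      have h4 := (hlim.comp (h3.mono_left (nhdsWithin_le_nhds (s := cyl 1)))).const_mul |D|
      rwa [mul_zero] at h4
    exact squeeze_zero_norm' (near.mono fun z hz => bd z hz) h2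

end AxisDrift

theorem theorem1p2 (p β K : ℝ) (hp : 5 / 3 < p) (hp2 : p ≤ 2) (hβ : 0 < β) :
    ∃ c₀ C : ℝ, 0 < c₀ ∧ 0 < C ∧
      ∀ (b : AxisDrift.ST → AxisDrift.E) (Γ : AxisDrift.ST → ℝ),
        AxisDrift.IsDivFreeDrift b →
        AxisDrift.IsWeakSolution b Γ →
        (∀ R : ℝ, 0 < R → R ≤ 1 →
          AxisDrift.scaledNorm p b R ≤ ENNReal.ofReal
            (K * Real.log |Real.log (R / 3)| ^ ((3 * p - 5) / (77 * p - 120) * (1 - β)))) →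
        -- `Γ` is continuous at the origin (after modification on a null set), with value `0`
        (∃ g : AxisDrift.ST → ℝ, g =ᵐ[AxisDrift.cylVol 1] Γ ∧
          ContinuousWithinAt g (AxisDrift.cyl 1) 0 ∧ g 0 = 0) ∧
        -- logarithmic decay in `P(1/2)`, controlled by the `L²` norm of `Γ`
        (∀ᵐ z ∂(AxisDrift.cylVol (1 / 2)),
          |Γ z| ≤ C * Real.sqrt (∫ w in AxisDrift.cyl 1, Γ w ^ 2)
            * |Real.log (AxisDrift.parDist z / 3)| ^ (-c₀)) ∧
        -- logarithmic decay in all of `P(1)`, for bounded `Γ`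
        (∀ M : ℝ, (∀ᵐ z ∂(AxisDrift.cylVol 1), |Γ z| ≤ M) →
          ∀ᵐ z ∂(AxisDrift.cylVol 1),
            |Γ z| ≤ C * M * |Real.log (AxisDrift.parDist z / 3)| ^ (-c₀)) := by
  set γ := (3 * p - 5) / (77 * p - 120) * (1 - β) with hγ
  set A := AxisDrift.sizeConst K γ with hA
  have A1 : 1 ≤ A := AxisDrift.one_le_sizeConst K γ
  obtain ⟨c, C, hc, hC, H⟩ := AxisDrift.exists_decay A1
  set D := √(AxisDrift.sizeAt A 1 ^ 25 / AxisDrift.Sol.giorgiConst) with hD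
  have D0 : 0 ≤ D := Real.sqrt_nonneg _
  refine ⟨c, C * (1 + D), hc, by positivity, fun b Γ hb hΓ hE => ?_⟩
  obtain ⟨b', Γ', G', S, eb, eΓ⟩ := hΓ.exists_sol hb
  have hscale : ∀ r, 0 < r → r ≤ 1 → AxisDrift.DriftScale b' r (AxisDrift.sizeAt A r) := by
    intro r hr hr1
    have h1 : 0 ≤ Real.log |Real.log (r / 3)| ^ γ := by
      rw [AxisDrift.abs_log_div_three hr hr1]
      exact Real.rpow_nonneg (Real.log_nonneg (AxisDrift.one_lt_log_three_div hr hr1).le) _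
    refine (AxisDrift.driftScale_of_scaledNorm_le hp S.mb eb hr hr1
      (mul_nonneg (abs_nonneg K) h1) ((hE r hr hr1).trans (ENNReal.ofReal_le_ofReal
        (mul_le_mul_of_nonneg_right (le_abs_self K) h1)))).mono hr.le ?_
    exact AxisDrift.growth_le_sizeAt (AxisDrift.exponent_le hp hp2 hβ) hr hr1
  have hbdd := (hscale 1 one_pos le_rfl).driftBdd
  have sub : AxisDrift.cyl (1 / 2) ⊆ AxisDrift.cyl 1 :=
    AxisDrift.cyl_mono (by norm_num) (by norm_num)
  have eΓ' : Γ' =ᵐ[AxisDrift.cylVol (1 / 2)] Γ := ae_mono (Measure.restrict_mono sub le_rfl) eΓ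
  have eI : ∫ z in AxisDrift.cyl 1, Γ' z ^ 2 = ∫ z in AxisDrift.cyl 1, Γ z ^ 2 :=
    integral_congr_ae (eΓ.mono fun z hz => by simp only [hz])
  have sup := S.abs_le_sqrt_integral hbdd (AxisDrift.one_le_sizeAt A1 one_pos le_rfl)
    (hscale 1 one_pos le_rfl)
  rw [eI] at sup
  set Λ := √(∫ z in AxisDrift.cyl 1, Γ z ^ 2) with hΛ
  have Λ0 : 0 ≤ Λ := Real.sqrt_nonneg _
  have half : ∀ᵐ z ∂(AxisDrift.cylVol (1 / 2)), |Γ z| ≤ C * (1 + D) * Λ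
      * |Real.log (AxisDrift.parDist z / 3)| ^ (-c) := by
    filter_upwards [H S hbdd hscale (1 / 2) (D * Λ) le_rfl (by norm_num) (by positivity) sup, eΓ']
      with z h1 h2
    rw [← h2]
    refine h1.trans (mul_le_mul_of_nonneg_right ?_ (Real.rpow_nonneg (abs_nonneg _) _))
    nlinarith [mul_nonneg hC.le Λ0]
  refine ⟨AxisDrift.exists_continuousWithinAt hc half, half, fun M hM => ?_⟩
  rcases lt_or_ge M 0 with hneg | hM0
  · filter_upwards [hM] with z hz
    linarith [abs_nonneg (Γ z)]
  · filter_upwards [H S hbdd hscale 1 M (by norm_num) le_rfl hM0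
      (by filter_upwards [hM, eΓ] with z h1 h2; rwa [h2]), eΓ] with z h1 h2
    rw [← h2]
    refine h1.trans (mul_le_mul_of_nonneg_right ?_ (Real.rpow_nonneg (abs_nonneg _) _))
    nlinarith [mul_nonneg hC.le hM0, mul_nonneg (mul_nonneg hC.le hM0) D0]
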